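/- Let $k$ be a field and let $\mathrm{Ch}$ be the symmetric monoidal category of ($\mathbb Z$-graded) chain complexes over $k$, with the Koszul sign rule. **Trees.** Trees are finite rooted trees all of whose vertices have at least two inputs (open, reduced trees); $\eta$ is the tree with one edge and no vertices. $\mathbb A$ is the category of such trees with the compositions of isomorphisms and inner faces as morphisms; $\mathbb R\supset\mathbb A$ is the category with the same objects and with all root preserving morphisms (compositions of isomorphisms, inner faces and prunings). $Psh(\mathbb R)$ is the category of functors $\mathbb R^{op}\to \mathrm{Ch}$. For $\alpha:S\to T$ in $\mathbb R$ and a leaf $\ell$ of $S$, let $T_\ell=T(\alpha)_\ell$ be the subtree of $T$ above the edge $\alpha(\ell)$. **Preoperads.** A preoperad is a functor $X:\mathbb A^{op}\to \mathrm{Ch}$ with $X(\eta)\cong k$ and with maps $X(S\circ_eT)\to X(S)\otimes X(T)$ for each grafting $S\circ_e T$ of a tree $T$ onto a leaf $e$ of a tree $S$, natural in $S$ and $T$, associative (for nested and for parallel graftings), and equal to the canonical isomorphism if $S$ or $T$ is $\eta$. Iterating these gives maps $X(R)\to X(S)\otimes\bigotimes_\ell X(R_\ell)$ for all $\alpha:S\to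 R$ in $\mathbb R$, with $\ell$ ranging over the leaves of $S$. Morphisms of preoperads are natural transformations compatible with these maps and with $X(\eta)\cong k$. **Prealgebras.** A prealgebra over $X$ is a presheaf $M\in Psh(\mathbb R)$ with maps $\tau^\alpha:M(T)\to X(S)\otimes\bigotimes_\ell M(T_\ell)$ for all $\alpha:S\to T$ in $\mathbb R$, which are natural in $T\in\mathbb R$ and $S\in\mathbb A$, unital (for $S=\eta$) and associative (for $S\to R\to T$). These form a category $Prealg(X)$, and a morphism of preoperads $f:X\to X'$ induces a functor $f_!:Prealg(X)\to Prealg(X')$, which keeps the presheaf $M$ and composes $\tau^\alpha$ with $f\otimes \mathrm{id}$. **The functor $H_X$.** For $V\in Psh(\mathbb R)$ let $$H_X(V)(T)=\Big(\prod_{\alpha:S\to T}X(S)\otimes\bigotimes_\ell V(T_\ell)\Big)^{inv}$$ be the subcomplex of the families $\omega$, indexed by all morphisms $\alpha: S\to T$ of $\mathbb R$ with target $T$, such that $\omega_{\alpha\gamma}=(\gamma^*\otimes \mathrm{id})(\omega_\alpha)$ for all composable $\gamma$ in $\mathbb A$. This defines a functor $H_X:Psh(\mathbb R)\to Psh(\mathbb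 R)$, with a natural map $\varepsilon:H_X(V)\to V$ given by the projection onto the factor of the root inclusion $\eta\to T$. The $\tau^\alpha$ of a prealgebra $M$ over $X$ define a map $\theta_M:M\to H_X(M)$ in $Psh(\mathbb R)$, and $f:X\to X'$ induces a natural transformation $H_f:H_X\to H_{X'}$. **Proposition.** Let $f:X\to X'$ be a morphism of preoperads. 1. The functor $H_X$ preserves coreflexive equalisers. 2. There is a unique natural transformation $\delta:H_X\to H_XH_X$ such that for all $V$ and all $S\xrightarrow{\alpha}R\xrightarrow{\beta}T$ in $\mathbb R$ the composition of $\delta$ with the projection $H_XH_X(V)(T)\to X(S)\otimes\bigotimes_\ell H_X(V)(T(\beta\alpha)_\ell)\to X(S)\otimes\bigotimes_\ell X(R(\alpha)_\ell)\otimes\bigotimes_m V(T(\beta)_m)$ for $\beta\alpha$ and for the morphisms $R(\alpha)_\ell\to T(\beta\alpha)_\ell$ induced by $\beta$ is equal to the composition of the projection $H_X(V)(T)\to X(R)\otimes\bigotimes_mV(T(\beta)_m)$ for $\beta$ with the map induced by $X(R)\to X(S)\otimes\bigotimes_\ell X(R(\alpha)_\ell)$; here $\ell$ ranges over the leaves of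 $S$ and $m$ over the leaves of $R$. 3. The functor $f_!:Prealg(X)\to Prealg(X')$ has a right adjoint $f^*:Prealg(X')\to Prealg(X)$. For a prealgebra $M'$ over $X'$ with $\theta'=\theta_{M'}$, the map $$i:f^*(M')\xrightarrow{\ \theta_{f^*(M')}\ }H_X(f^*(M'))\longrightarrow H_X(M'),$$ where the second map is $H_X$ of the counit $f_!f^*(M')\to M'$ of the adjunction, is the equaliser in $Psh(\mathbb R)$ of the parallel maps $$H_X(\theta'),\ \ H_X(H_f)\circ\delta\ :\ H_X(M')\rightrightarrows H_XH_{X'}(M').$$ This pair is coreflexive: $H_X(\varepsilon'):H_XH_{X'}(M')\to H_X(M')$, with $\varepsilon'$ the counit of $H_{X'}$, is a retraction of both maps. -/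

import Mathlib

open CategoryTheory Limits MonoidalCategory

universe v w u

noncomputable section

set_option linter.unusedSectionVars false
set_option linter.unusedSimpArgs false

/-! ### The symmetric monoidal category of chain complexes -/

namespace Koszul

open GradedObject GradedObject.Monoidal Category

variable {C : Type*} [Category C] [MonoidalCategory C] [SymmetricCategory C] [Preadditive C]
  [MonoidalPreadditive C]
  [∀ (X₁ X₂ : GradedObject ℤ C), GradedObject.HasTensor X₁ X₂]
  [∀ (X₁ X₂ X₃ : GradedObject ℤ C), HasGoodTensor₁₂Tensor X₁ X₂ X₃]
  [∀ (X₁ X₂ X₃ : GradedObject ℤ C), HasGoodTensorTensor₂₃ X₁ X₂ X₃]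
variable (X Y Z : GradedObject ℤ C)

lemma units_smul_comp {A B D : C} (r : ℤˣ) (f : A ⟶ B) (g : B ⟶ D) : (r • f) ≫ g = r • (f ≫ g) := by
  rw [Units.smul_def, Units.smul_def, Preadditive.zsmul_comp]
lemma comp_units_smul {A B D : C} (r : ℤˣ) (f : A ⟶ B) (g : B ⟶ D) : f ≫ (r • g) = r • (f ≫ g) := by
  rw [Units.smul_def, Units.smul_def, Preadditive.comp_zsmul]
lemma units_smul_whiskerRight {A B : C} (D : C) (r : ℤˣ) (f : A ⟶ B) : (r • f) ▷ D = r • (f ▷ D) := by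
  exact ((tensoringRight C).obj D).map_units_smul r f
lemma whiskerLeft_units_smul {A B : C} (D : C) (r : ℤˣ) (f : A ⟶ B) : D ◁ (r • f) = r • (D ◁ f) := by
  exact ((tensoringLeft C).obj D).map_units_smul r f

/-- The symmetry `x ⊗ y ↦ (-1)^(ij) y ⊗ x` of the tensor product of graded objects. -/
def braiding : GradedObject.Monoidal.tensorObj X Y ≅ GradedObject.Monoidal.tensorObj Y X where
  hom n := tensorObjDesc (fun i j hij => (i * j).negOnePow • ((β_ (X i) (Y j)).hom ≫
    ιTensorObj Y X j i n (by simpa only [add_comm j i] using hij)))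
  inv n := tensorObjDesc (fun i j hij => (i * j).negOnePow • ((β_ (X j) (Y i)).inv ≫
    ιTensorObj X Y j i n (by simpa only [add_comm j i] using hij)))
  hom_inv_id := by
    ext n i j h
    simp [comp_units_smul, units_smul_comp, smul_smul, mul_comm i j]
  inv_hom_id := by
    ext n i j h
    simp [comp_units_smul, units_smul_comp, smul_smul, mul_comm i j]

lemma symmetry :
    (braiding X Y).hom ≫ (braiding Y X).hom = 𝟙 _ := by
  ext n i j h
  simp [braiding, comp_units_smul, units_smul_comp, smul_smul, mul_comm i j]

variable {Y Z} in
lemma braiding_naturality_right (f : Y ⟶ Z) :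
    GradedObject.Monoidal.whiskerLeft X f ≫ (braiding X Z).hom = (braiding X Y).hom ≫ GradedObject.Monoidal.whiskerRight f X := by
  ext n i j h
  simp [braiding, GradedObject.Monoidal.whiskerLeft, GradedObject.Monoidal.whiskerRight, comp_units_smul, units_smul_comp]

lemma hexagon_forward :
    (associator X Y Z).hom ≫ (braiding X (GradedObject.Monoidal.tensorObj Y Z)).hom ≫ (associator Y Z X).hom =
      GradedObject.Monoidal.whiskerRight (braiding X Y).hom Z ≫ (associator Y X Z).hom ≫
        GradedObject.Monoidal.whiskerLeft Y (braiding X Z).hom := by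
  ext k i₁ i₂ i₃ h
  dsimp [braiding]
  conv_lhs => rw [ιTensorObj₃'_associator_hom_assoc, ιTensorObj₃_eq X Y Z i₁ i₂ i₃ k h _ rfl,
    assoc, ι_tensorObjDesc_assoc, units_smul_comp, comp_units_smul, assoc, ← MonoidalCategory.id_tensorHom,
    BraidedCategory.braiding_naturality_assoc,
    BraidedCategory.braiding_tensor_right_hom, assoc, assoc, assoc, assoc, comp_units_smul, Iso.hom_inv_id_assoc,
    MonoidalCategory.tensorHom_id,
    ← ιTensorObj₃'_eq_assoc Y Z X i₂ i₃ i₁ k (by rw [add_comm _ i₁, ← add_assoc, h]) _ rfl,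
    ιTensorObj₃'_associator_hom, Iso.inv_hom_id_assoc]
  conv_rhs => rw [ιTensorObj₃'_eq X Y Z i₁ i₂ i₃ k h _ rfl, assoc, ι_tensorHom_assoc,
    ← MonoidalCategory.tensorHom_id,
    MonoidalCategory.tensorHom_comp_tensorHom_assoc, id_comp, ι_tensorObjDesc,
    categoryOfGradedObjects_id, MonoidalCategory.tensorHom_id, units_smul_whiskerRight, units_smul_comp,
    ← MonoidalCategory.tensorHom_id, MonoidalCategory.comp_tensor_id, assoc,
    MonoidalCategory.tensorHom_id, MonoidalCategory.tensorHom_id,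
    ← ιTensorObj₃'_eq_assoc Y X Z i₂ i₁ i₃ k
      (by rw [add_comm i₂ i₁, h]) (i₁ + i₂) (add_comm i₂ i₁),
    ιTensorObj₃'_associator_hom_assoc,
    ιTensorObj₃_eq Y X Z i₂ i₁ i₃ k (by rw [add_comm i₂ i₁, h]) _ rfl, assoc,
    ι_tensorHom, categoryOfGradedObjects_id, ← MonoidalCategory.tensorHom_id,
    ← MonoidalCategory.id_tensorHom,
    ← MonoidalCategory.id_tensor_comp_assoc,
    ι_tensorObjDesc, MonoidalCategory.id_tensorHom, whiskerLeft_units_smul, units_smul_comp, comp_units_smul, comp_units_smul, smul_smul,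
    ← MonoidalCategory.id_tensorHom, MonoidalCategory.id_tensor_comp, assoc,
    ← MonoidalCategory.id_tensor_comp_assoc, MonoidalCategory.tensorHom_id,
    MonoidalCategory.id_tensorHom, MonoidalCategory.whiskerLeft_comp, assoc,
    ← ιTensorObj₃_eq Y Z X i₂ i₃ i₁ k (by rw [add_comm _ i₁, ← add_assoc, h])
      (i₁ + i₃) (add_comm _ _)]
  rw [mul_add, Int.negOnePow_add]

end Koszul

/-- The differential of a tensor product is `d x ⊗ y + (-1)^i x ⊗ d y`. -/
instance downIntTensorSigns : (ComplexShape.down ℤ).TensorSigns where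
  ε' := MonoidHom.mk' Int.negOnePow Int.negOnePow_add
  rel_add p q r (hpq : q + 1 = p) := by change q + r + 1 = p + r; lia
  add_rel p q r (hpq : q + 1 = p) := by change r + q + 1 = r + p; lia
  ε'_succ := by
    intro p q (hpq : q + 1 = p)
    subst hpq
    change q.negOnePow = - (q+1).negOnePow
    rw [Int.negOnePow_succ, neg_neg]

/-- Chain complexes of vector spaces over `k`, with the usual tensor product. -/
abbrev Ch (k : Type u) [Field k] := ChainComplex (ModuleCat.{u} k) ℤ

namespace Ch
open HomologicalComplex Koszul
variable {k : Type u} [Field k]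

instance : MonoidalCategory (Ch k) := inferInstanceAs (MonoidalCategory (HomologicalComplex (ModuleCat.{u} k) (ComplexShape.down ℤ)))

variable (K L M : Ch k)

/-- The component in degree `n` of the symmetry `x ⊗ y ↦ (-1)^(pq) y ⊗ x`. -/
def braidX (n : ℤ) : (HomologicalComplex.tensorObj K L).X n ⟶ (HomologicalComplex.tensorObj L K).X n :=
  mapBifunctorDesc (fun p q h => (p * q).negOnePow • ((β_ (K.X p) (L.X q)).hom ≫
    ιTensorObj L K q p n (by rw [add_comm]; exact h)))

lemma ι_braidX (p q n : ℤ) (h : p + q = n) :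
    ιTensorObj K L p q n h ≫ braidX K L n = (p * q).negOnePow • ((β_ (K.X p) (L.X q)).hom ≫
    ιTensorObj L K q p n (by rw [add_comm]; exact h)) := by
  apply ι_mapBifunctorDesc

lemma braid_comm (i j : ℤ) (h : (ComplexShape.down ℤ).Rel i j) :
    braidX K L i ≫ (HomologicalComplex.tensorObj L K).d i j =
      (HomologicalComplex.tensorObj K L).d i j ≫ braidX K L j := by
  apply HomologicalComplex.mapBifunctor.hom_ext
  intro p q hpq
  have hpq' : p + q = i := hpq
  have hij : j + 1 = i := h
  have hp : (ComplexShape.down ℤ).Rel p (p-1) := by simp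
  have hq : (ComplexShape.down ℤ).Rel q (q-1) := by simp
  have e1 : ComplexShape.π (.down ℤ) (.down ℤ) (.down ℤ) (p-1, q) = j := by
    change p - 1 + q = j; lia
  have e2 : ComplexShape.π (.down ℤ) (.down ℤ) (.down ℤ) (p, q-1) = j := by
    change p + (q-1) = j; lia
  have e3 : ComplexShape.π (.down ℤ) (.down ℤ) (.down ℤ) (q-1, p) = j := by
    change q-1 + p = j; lia
  have e4 : ComplexShape.π (.down ℤ) (.down ℤ) (.down ℤ) (q, p-1) = j := by
    change q + (p-1) = j; lia
  have s1 : ComplexShape.ε₁ (.down ℤ) (.down ℤ) (.down ℤ) (p,q) = 1 := rfl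
  have s2 : ComplexShape.ε₂ (.down ℤ) (.down ℤ) (.down ℤ) (p,q) = p.negOnePow := rfl
  have s3 : ComplexShape.ε₁ (.down ℤ) (.down ℤ) (.down ℤ) (q,p) = 1 := rfl
  have s4 : ComplexShape.ε₂ (.down ℤ) (.down ℤ) (.down ℤ) (q,p) = q.negOnePow := rfl
  have f1 := ι_braidX K L (p-1) q j e1
  have f2 := ι_braidX K L p (q-1) j e2
  have f3 := ι_braidX K L p q i hpq
  rw [← Category.assoc, ← Category.assoc]
  erw [f3]
  simp only [mapBifunctor.d_eq, Preadditive.comp_add, Preadditive.add_comp, mapBifunctor.ι_D₁, mapBifunctor.ι_D₂,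
    Koszul.units_smul_comp, Category.assoc]
  rw [mapBifunctor.d₁_eq _ _ _ _ hp _ _ e1, mapBifunctor.d₂_eq _ _ _ _ _ hq _ e2,
    mapBifunctor.d₁_eq _ _ _ _ hq _ _ e3, mapBifunctor.d₂_eq _ _ _ _ _ hp _ e4, s1, s2, s3, s4]
  simp only [Koszul.units_smul_comp, Koszul.comp_units_smul, Category.assoc]
  erw [f1, f2]
  simp only [Koszul.units_smul_comp, Koszul.comp_units_smul, Category.assoc]
  dsimp
  simp only [BraidedCategory.braiding_naturality_left_assoc, BraidedCategory.braiding_naturality_right_assoc, smul_smul, smul_add]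
  have t1 : (p * q).negOnePow * q.negOnePow = 1 * ((p-1)*q).negOnePow := by
    rw [sub_mul, one_mul, Int.negOnePow_sub, one_mul]
  have t2 : (p * q).negOnePow * 1 = p.negOnePow * (p*(q-1)).negOnePow := by
    rw [mul_sub, mul_one, Int.negOnePow_sub, mul_one, mul_left_comm, ← Int.negOnePow_add,
      Int.negOnePow_even _ (Even.add_self p), mul_one]
  rw [t1, t2, add_comm]

def braid : K ⊗ L ⟶ L ⊗ K where
  f := braidX K L
  comm' := braid_comm K L

lemma braid_f (n : ℤ) : (braid K L).f n = (Koszul.braiding K.X L.X).hom n := rfl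

lemma braid_symm : braid K L ≫ braid L K = 𝟙 _ := by
  ext1 n
  exact congrFun (Koszul.symmetry K.X L.X) n

lemma braid_nat {L M} (f : L ⟶ M) : K ◁ f ≫ braid K M = braid K L ≫ f ▷ K := by
  ext1 n
  exact congrFun (Koszul.braiding_naturality_right K.X (Y := L.X) (Z := M.X) f.f) n

lemma braid_hex : (α_ K L M).hom ≫ braid K (L ⊗ M) ≫ (α_ L M K).hom =
    braid K L ▷ M ≫ (α_ L K M).hom ≫ L ◁ braid K M := by
  ext1 n
  exact congrFun (Koszul.hexagon_forward K.X L.X M.X) n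

def braidIso : K ⊗ L ≅ L ⊗ K where
  hom := braid K L
  inv := braid L K
  hom_inv_id := braid_symm K L
  inv_hom_id := braid_symm L K

instance : SymmetricCategory (Ch k) where
  braiding := braidIso
  braiding_naturality_right K _ _ f := braid_nat K f
  braiding_naturality_left {K L} f M := by
    rw [← cancel_mono (braidIso L M).inv, Category.assoc, Category.assoc, Iso.hom_inv_id,
      Category.comp_id]
    change f ▷ M = braid K M ≫ M ◁ f ≫ braid M L
    rw [braid_nat, ← Category.assoc, braid_symm, Category.id_comp]
  hexagon_forward := braid_hex
  hexagon_reverse K L M := by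
    have h : α_ M K L ≪≫ braidIso M (K ⊗ L) ≪≫ α_ K L M =
        whiskerRightIso (braidIso M K) L ≪≫ α_ K M L ≪≫ whiskerLeftIso K (braidIso M L) :=
      Iso.ext (braid_hex M K L)
    have h' := congrArg Iso.inv h
    simp only [Iso.trans_inv, Category.assoc, whiskerLeftIso_inv, whiskerRightIso_inv] at h'
    exact h'
  symmetry := braid_symm

end Ch

/-! ### Tensor products of families in a symmetric monoidal category -/

section Tens

variable {C : Type w} [Category.{v} C] [MonoidalCategory C]

/-- The tensor product of the objects `V i`, with `i` ranging over a list. -/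
def tens {ι : Type*} (V : ι → C) : List ι → C
  | [] => 𝟙_ C
  | i :: l => V i ⊗ tens V l

/-- Functoriality of the tensor product in the family. -/
def tensMap {ι : Type*} {V W : ι → C} (f : ∀ i, V i ⟶ W i) : (l : List ι) → (tens V l ⟶ tens W l)
  | [] => 𝟙 _
  | i :: l => f i ⊗ₘ tensMap f l

lemma tensMap_id {ι : Type*} (V : ι → C) (l : List ι) : tensMap (fun i => 𝟙 (V i)) l = 𝟙 _ := by
  induction l with
  | nil => rfl
  | cons i l ih =>
    change 𝟙 (V i) ⊗ₘ tensMap (fun i => 𝟙 (V i)) l = 𝟙 (V i ⊗ tens V l)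
    rw [ih, MonoidalCategory.id_tensorHom_id]

lemma tensMap_comp {ι : Type*} {V W U : ι → C} (f : ∀ i, V i ⟶ W i) (g : ∀ i, W i ⟶ U i)
    (l : List ι) : tensMap (fun i => f i ≫ g i) l = tensMap f l ≫ tensMap g l := by
  induction l with
  | nil => exact (Category.comp_id _).symm
  | cons i l ih =>
    change (f i ≫ g i) ⊗ₘ tensMap (fun i => f i ≫ g i) l = (f i ⊗ₘ tensMap f l) ≫ (g i ⊗ₘ tensMap g l)
    rw [ih, MonoidalCategory.tensorHom_comp_tensorHom]

/-- Change of index set along a map `g`. -/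
def tensRelabel {ι κ : Type*} (g : ι → κ) (V : κ → C) :
    (l : List ι) → (tens V (l.map g) ≅ tens (fun i => V (g i)) l)
  | [] => Iso.refl _
  | i :: l => whiskerLeftIso (V (g i)) (tensRelabel g V l)

lemma tensRelabel_naturality {ι κ : Type*} (g : ι → κ) {V W : κ → C} (f : ∀ i, V i ⟶ W i)
    (l : List ι) : tensMap f (l.map g) ≫ (tensRelabel g W l).hom =
      (tensRelabel g V l).hom ≫ tensMap (fun i => f (g i)) l := by
  induction l with
  | nil => exact (Category.comp_id _).trans (Category.id_comp _).symm
  | cons i l ih =>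
    change (f (g i) ⊗ₘ tensMap f (l.map g)) ≫ W (g i) ◁ (tensRelabel g W l).hom =
      V (g i) ◁ (tensRelabel g V l).hom ≫ (f (g i) ⊗ₘ tensMap (fun i => f (g i)) l)
    rw [← MonoidalCategory.id_tensorHom, ← MonoidalCategory.id_tensorHom,
      MonoidalCategory.tensorHom_comp_tensorHom, MonoidalCategory.tensorHom_comp_tensorHom, ih,
      Category.comp_id, Category.id_comp]

variable [SymmetricCategory C]

/-- The isomorphism `A ⊗ (B ⊗ D) ⟶ B ⊗ (A ⊗ D)`. -/
def swapFront (A B D : C) : A ⊗ (B ⊗ D) ⟶ B ⊗ (A ⊗ D) :=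
  (α_ A B D).inv ≫ (β_ A B).hom ▷ D ≫ (α_ B A D).hom

lemma swapFront_naturality {A B D A' B' D' : C} (f : A ⟶ A') (g : B ⟶ B') (h : D ⟶ D') :
    (f ⊗ₘ (g ⊗ₘ h)) ≫ swapFront A' B' D' = swapFront A B D ≫ (g ⊗ₘ (f ⊗ₘ h)) := by
  simp only [swapFront, Category.assoc]
  rw [MonoidalCategory.associator_inv_naturality_assoc, ← MonoidalCategory.tensorHom_id,
    ← MonoidalCategory.tensorHom_id, MonoidalCategory.tensorHom_comp_tensorHom_assoc,
    BraidedCategory.braiding_naturality, ← MonoidalCategory.associator_naturality,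
    MonoidalCategory.tensorHom_comp_tensorHom_assoc, Category.id_comp, Category.comp_id]

/-- Moving the factor in position `n` to the front. -/
def tensExtract {ι : Type*} (V : ι → C) : (l : List ι) → (n : ℕ) → (h : n < l.length) →
    (tens V l ⟶ V l[n] ⊗ tens V (l.eraseIdx n))
  | _ :: _, 0, _ => 𝟙 _
  | i :: l, n + 1, h =>
    V i ◁ tensExtract V l n (Nat.lt_of_succ_lt_succ h) ≫
      swapFront (V i) (V (l[n]'(Nat.lt_of_succ_lt_succ h))) (tens V (l.eraseIdx n))

lemma tensExtract_naturality {ι : Type*} {V W : ι → C} (f : ∀ i, V i ⟶ W i) (l : List ι) (n : ℕ)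
    (h : n < l.length) : tensMap f l ≫ tensExtract W l n h =
      tensExtract V l n h ≫ (f l[n] ⊗ₘ tensMap f (l.eraseIdx n)) := by
  induction l generalizing n with
  | nil => exact absurd h (Nat.not_lt_zero _)
  | cons i l ih =>
    cases n with
    | zero => exact (Category.comp_id _).trans (Category.id_comp _).symm
    | succ n =>
      have hn := Nat.lt_of_succ_lt_succ h
      have ih := ih n hn
      change (f i ⊗ₘ tensMap f l) ≫ W i ◁ tensExtract W l n hn ≫
          swapFront (W i) (W (l[n]'hn)) (tens W (l.eraseIdx n)) =
        (V i ◁ tensExtract V l n hn ≫ swapFront (V i) (V (l[n]'hn)) (tens V (l.eraseIdx n))) ≫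
          (f (l[n]'hn) ⊗ₘ (f i ⊗ₘ tensMap f (l.eraseIdx n)))
      rw [Category.assoc, ← swapFront_naturality, ← Category.assoc, ← Category.assoc,
        ← MonoidalCategory.id_tensorHom, ← MonoidalCategory.id_tensorHom,
        MonoidalCategory.tensorHom_comp_tensorHom, MonoidalCategory.tensorHom_comp_tensorHom, ih,
        Category.comp_id, Category.id_comp]

open Classical in
/-- The symmetry isomorphism relating the tensor products over two lists which are permutations
of each other. -/
def tensPerm {ι : Type*} (V : ι → C) : (l l' : List ι) → (h : l.Perm l') →
    (tens V l ⟶ tens V l')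
  | l, [], h => eqToHom (by rw [h.eq_nil])
  | l, i :: l', h =>
    have hi : i ∈ l := h.symm.subset (List.mem_cons_self)
    have hn : l.idxOf i < l.length := List.idxOf_lt_length_iff.2 hi
    tensExtract V l (l.idxOf i) hn ≫
      (eqToHom (by rw [List.getElem_idxOf hn]) ⊗ₘ tensPerm V (l.eraseIdx (l.idxOf i)) l' (by
        rw [← List.erase_eq_eraseIdx_of_idxOf rfl]
        exact (List.cons_perm_iff_perm_erase.1 h.symm).2.symm))

open Classical in
lemma tensPerm_naturality {ι : Type*} {V W : ι → C} (f : ∀ i, V i ⟶ W i)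
    (l l' : List ι) (h : l.Perm l') : tensMap f l ≫ tensPerm W l l' h =
      tensPerm V l l' h ≫ tensMap f l' := by
  have key : ∀ (i j : ι) (hij : i = j),
      f i ≫ eqToHom (congrArg W hij) = eqToHom (congrArg V hij) ≫ f j := by
    rintro i _ rfl; simp
  induction l' generalizing l with
  | nil =>
    obtain rfl := h.eq_nil
    exact (Category.comp_id _).trans (Category.id_comp _).symm
  | cons i l' ih =>
    have hi : i ∈ l := h.symm.subset (List.mem_cons_self)
    have hn : l.idxOf i < l.length := List.idxOf_lt_length_iff.2 hi
    have hp : (l.eraseIdx (l.idxOf i)).Perm l' := by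
      rw [← List.erase_eq_eraseIdx_of_idxOf rfl]
      exact (List.cons_perm_iff_perm_erase.1 h.symm).2.symm
    have hg := List.getElem_idxOf hn
    change tensMap f l ≫ tensExtract W l (l.idxOf i) hn ≫
        (eqToHom (congrArg W hg) ⊗ₘ tensPerm W (l.eraseIdx (l.idxOf i)) l' hp) =
      (tensExtract V l (l.idxOf i) hn ≫
        (eqToHom (congrArg V hg) ⊗ₘ tensPerm V (l.eraseIdx (l.idxOf i)) l' hp)) ≫
        (f i ⊗ₘ tensMap f l')
    rw [← Category.assoc, tensExtract_naturality, Category.assoc, Category.assoc,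
      MonoidalCategory.tensorHom_comp_tensorHom, MonoidalCategory.tensorHom_comp_tensorHom, ih,
      key _ _ hg]

/-- The canonical map `⨂_{i ∈ l} Vᵢ ⟶ ⨂_{k ∈ l'} V_{g(k)}` for a bijection `g` from `l'` to `l`. -/
def tensReindex {ι κ : Type*} (V : ι → C) (g : κ → ι) {l : List ι} {l' : List κ}
    (h : (l'.map g).Perm l) : tens V l ⟶ tens (fun k => V (g k)) l' :=
  tensPerm V _ _ h.symm ≫ (tensRelabel g V l').hom

lemma tensReindex_naturality {ι κ : Type*} {V W : ι → C} (f : ∀ i, V i ⟶ W i) (g : κ → ι)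
    {l : List ι} {l' : List κ} (h : (l'.map g).Perm l) :
    tensMap f l ≫ tensReindex W g h = tensReindex V g h ≫ tensMap (fun k => f (g k)) l' := by
  rw [tensReindex, tensReindex, ← Category.assoc, tensPerm_naturality, Category.assoc,
    Category.assoc, tensRelabel_naturality]

/-- The tensor product over a list with one element. -/
def tensSingle {ι : Type*} (V : ι → C) (i : ι) : tens V [i] ⟶ V i := (ρ_ (V i)).hom

lemma tensSingle_naturality {ι : Type*} {V W : ι → C} (f : ∀ i, V i ⟶ W i) (i : ι) :
    tensMap f [i] ≫ tensSingle W i = tensSingle V i ≫ f i := by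
  change (f i ⊗ₘ 𝟙 (𝟙_ C)) ≫ (ρ_ (W i)).hom = (ρ_ (V i)).hom ≫ f i
  rw [MonoidalCategory.tensorHom_id, MonoidalCategory.rightUnitor_naturality]

/-- Concatenation. -/
def tensAppend {ι : Type*} (V : ι → C) : (l l' : List ι) →
    (tens V l ⊗ tens V l' ⟶ tens V (l ++ l'))
  | [], l' => (λ_ (tens V l')).hom
  | i :: l, l' => (α_ (V i) (tens V l) (tens V l')).hom ≫ V i ◁ tensAppend V l l'

/-- An iterated tensor product as a single tensor product. -/
def tensFlatten {ι : Type*} {κ : ι → Type*} (V : (Σ i, κ i) → C) (m : (i : ι) → List (κ i)) :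
    (l : List ι) → (tens (fun i => tens (fun k => V ⟨i, k⟩) (m i)) l ⟶ tens V (l.sigma m))
  | [] => 𝟙 _
  | i :: l => ((tensRelabel (Sigma.mk i) V (m i)).inv ⊗ₘ tensFlatten V m l) ≫
      tensAppend V ((m i).map (Sigma.mk i)) (l.sigma m)

/-- The canonical map `⨂ (A i ⊗ B i) ⟶ (⨂ A i) ⊗ (⨂ B i)`. -/
def tensUnzip {ι : Type*} (A B : ι → C) :
    (l : List ι) → (tens (fun i => A i ⊗ B i) l ⟶ tens A l ⊗ tens B l)
  | [] => (λ_ (𝟙_ C)).inv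
  | i :: l => (A i ⊗ B i) ◁ tensUnzip A B l ≫ tensorμ (A i) (B i) (tens A l) (tens B l)

lemma tensUnzip_naturality {ι : Type*} {A A' B B' : ι → C} (f : ∀ i, A i ⟶ A' i)
    (g : ∀ i, B i ⟶ B' i) (l : List ι) :
    tensMap (fun i => f i ⊗ₘ g i) l ≫ tensUnzip A' B' l =
      tensUnzip A B l ≫ (tensMap f l ⊗ₘ tensMap g l) := by
  induction l with
  | nil =>
    change 𝟙 (𝟙_ C) ≫ (λ_ (𝟙_ C)).inv = (λ_ (𝟙_ C)).inv ≫ (𝟙 (𝟙_ C) ⊗ₘ 𝟙 (𝟙_ C))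
    simp
  | cons i l ih =>
    change ((f i ⊗ₘ g i) ⊗ₘ tensMap (fun i => f i ⊗ₘ g i) l) ≫
        (A' i ⊗ B' i) ◁ tensUnzip A' B' l ≫ tensorμ (A' i) (B' i) (tens A' l) (tens B' l) =
      ((A i ⊗ B i) ◁ tensUnzip A B l ≫ tensorμ (A i) (B i) (tens A l) (tens B l)) ≫
        ((f i ⊗ₘ tensMap f l) ⊗ₘ (g i ⊗ₘ tensMap g l))
    rw [Category.assoc, ← tensorμ_natural, ← Category.assoc, ← Category.assoc,
      ← MonoidalCategory.id_tensorHom, ← MonoidalCategory.id_tensorHom,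
      MonoidalCategory.tensorHom_comp_tensorHom, MonoidalCategory.tensorHom_comp_tensorHom, ih,
      Category.comp_id, Category.id_comp]

/-- The canonical map `A₀ ⊗ ⨂ᵢ (Aᵢ ⊗ ⨂ₖ Bᵢₖ) ⟶ (A₀ ⊗ ⨂ᵢ Aᵢ) ⊗ ⨂ⱼ Dⱼ` which is given by maps from
`Bᵢₖ` to `D_{g(i,k)}` for a bijection `g` from the set of the pairs `(i,k)` to the set of the `j`. -/
def regroup {ι σ : Type*} {κ : ι → Type*} (A₀ : C) (A : ι → C) {B : (i : ι) → κ i → C} {D : σ → C}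
    {m : (i : ι) → List (κ i)} {l : List ι} {l' : List σ} (g : (Σ i, κ i) → σ)
    (b : ∀ (i : ι) (k : κ i), B i k ⟶ D (g ⟨i, k⟩)) (h : ((l.sigma m).map g).Perm l') :
    A₀ ⊗ tens (fun i => A i ⊗ tens (B i) (m i)) l ⟶ (A₀ ⊗ tens A l) ⊗ tens D l' :=
  A₀ ◁ tensUnzip A (fun i => tens (B i) (m i)) l ≫ (α_ _ _ _).inv ≫
    (A₀ ⊗ tens A l) ◁ (tensMap (fun i => tensMap (b i) (m i)) l ≫
      tensFlatten (fun x => D (g x)) m l ≫ (tensRelabel g D (l.sigma m)).inv ≫ tensPerm D _ _ h)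

lemma regroup_naturality {ι σ : Type*} {κ : ι → Type*} {A₀ A₀' : C} {A A' : ι → C} (f₀ : A₀ ⟶ A₀')
    (f : ∀ i, A i ⟶ A' i) {B : (i : ι) → κ i → C} {D : σ → C}
    {m : (i : ι) → List (κ i)} {l : List ι} {l' : List σ} (g : (Σ i, κ i) → σ)
    (b : ∀ (i : ι) (k : κ i), B i k ⟶ D (g ⟨i, k⟩)) (h : ((l.sigma m).map g).Perm l') :
    (f₀ ⊗ₘ tensMap (fun i => f i ▷ tens (B i) (m i)) l) ≫ regroup A₀' A' g b h =
      regroup A₀ A g b h ≫ ((f₀ ⊗ₘ tensMap f l) ▷ tens D l') := by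
  have h1 := tensUnzip_naturality f (fun i => 𝟙 (tens (B i) (m i))) l
  simp only [MonoidalCategory.tensorHom_id, tensMap_id] at h1
  simp only [regroup, Category.assoc]
  rw [MonoidalCategory.whisker_exchange, ← MonoidalCategory.id_tensorHom A₀',
    MonoidalCategory.tensorHom_comp_tensorHom_assoc, h1, Category.comp_id]
  have h2 : (f₀ ⊗ₘ (tensUnzip A (fun i => tens (B i) (m i)) l ≫ tensMap f l ▷ _)) =
      A₀ ◁ tensUnzip A (fun i => tens (B i) (m i)) l ≫ (f₀ ⊗ₘ (tensMap f l ⊗ₘ 𝟙 _)) := by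
    rw [← MonoidalCategory.id_tensorHom, MonoidalCategory.tensorHom_comp_tensorHom,
      Category.id_comp, MonoidalCategory.tensorHom_id]
  rw [h2, Category.assoc, MonoidalCategory.associator_inv_naturality_assoc,
    MonoidalCategory.tensorHom_id]

end Tens

/-- An open reduced tree, presented by its partially ordered set of edges: the edges are labelled by
a finite set of natural numbers, `le x y` means that `x` lies on the path from `y` down to the root,
the leaves are the maximal edges and every edge which is not a leaf is the output edge of a vertex
whose inputs are the edges directly above it. The edges below a given edge form a chain, and
`reduced` says that every vertex has at least two inputs. As every maximal edge is a leaf, there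
are no vertices without inputs. Only the restriction of `le` to `edges` matters. -/
structure OTree where
  edges : Finset ℕ
  le : ℕ → ℕ → Prop
  root : ℕ
  root_mem : root ∈ edges
  root_le : ∀ x ∈ edges, le root x
  le_refl : ∀ x ∈ edges, le x x
  le_antisymm : ∀ x ∈ edges, ∀ y ∈ edges, le x y → le y x → x = y
  le_trans : ∀ x ∈ edges, ∀ y ∈ edges, ∀ z ∈ edges, le x y → le y z → le x z
  le_total_below : ∀ x ∈ edges, ∀ y ∈ edges, ∀ z ∈ edges, le x z → le y z → le x y ∨ le y x
  reduced : ∀ x ∈ edges, ∀ y ∈ edges, le x y → x ≠ y →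
    ∃ z ∈ edges, le x z ∧ ¬ le y z ∧ ¬ le z y

namespace OTree

abbrev Edge (T : OTree) : Type := {x : ℕ // x ∈ T.edges}

/-- The root edge. -/
def rootEdge (T : OTree) : T.Edge := ⟨T.root, T.root_mem⟩

/-- The leaves are the maximal edges. -/
def IsLeaf (T : OTree) (x : T.Edge) : Prop := ∀ y : T.Edge, T.le x.1 y.1 → y = x

abbrev Leaf (T : OTree) : Type := {x : T.Edge // T.IsLeaf x}

open Classical in
/-- The leaves of a tree, in some fixed order. -/
def leaves (T : OTree) : List T.Leaf := (Finset.univ : Finset T.Leaf).toList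

lemma leaves_nodup (T : OTree) : T.leaves.Nodup := Finset.nodup_toList _

lemma mem_leaves (T : OTree) (l : T.Leaf) : l ∈ T.leaves := by simp [leaves]

/-- Morphisms of trees in the category `R`: maps of trees preserving the root. On edges these are
the order embeddings which preserve the root and are such that every leaf of the target lies above
the image of a leaf of the source: the image of a vertex `v` of the source is then the subtree of
the target whose root and leaves are the images of the output and of the inputs of `v`. -/
@[ext]
structure Hom (S T : OTree) where
  toFun : S.Edge → T.Edge
  map_root : toFun S.rootEdge = T.rootEdge
  le_iff : ∀ x y : S.Edge, T.le (toFun x).1 (toFun y).1 ↔ S.le x.1 y.1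
  exists_leaf_le : ∀ x : T.Edge, T.IsLeaf x → ∃ l : S.Edge, S.IsLeaf l ∧ T.le (toFun l).1 x.1

instance : Category OTree where
  Hom := Hom
  id T := ⟨fun x => x, rfl, fun _ _ => Iff.rfl, fun x hx => ⟨x, hx, T.le_refl _ x.2⟩⟩
  comp {S T U} f g := ⟨fun x => g.toFun (f.toFun x), by rw [f.map_root, g.map_root],
    fun x y => (g.le_iff _ _).trans (f.le_iff x y), fun x hx => by
      obtain ⟨l, hl, hlx⟩ := g.exists_leaf_le x hx
      obtain ⟨m, hm, hml⟩ := f.exists_leaf_le l hl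
      exact ⟨m, hm, U.le_trans _ (g.toFun _).2 _ (g.toFun l).2 _ x.2 ((g.le_iff _ _).2 hml) hlx⟩⟩

lemma Hom.injective {S T : OTree} (f : S ⟶ T) : Function.Injective f.toFun := by
  intro x y h
  apply Subtype.ext
  apply S.le_antisymm _ x.2 _ y.2
  · rw [← f.le_iff, h]; exact T.le_refl _ (f.toFun y).2
  · rw [← f.le_iff, h]; exact T.le_refl _ (f.toFun y).2

/-- The morphisms of the category `A`, the compositions of isomorphisms and inner faces: these are
the morphisms of `R` which send leaves to leaves. -/
def inner : MorphismProperty OTree := fun S _ f => ∀ l : S.Edge, S.IsLeaf l → IsLeaf _ (f.toFun l)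

instance : inner.IsMultiplicative where
  id_mem _ _ hl := hl
  comp_mem _ _ hf hg l hl := hg _ (hf l hl)

open Classical in
/-- The subtree of all edges above `e`, with root `e`. -/
def above (T : OTree) (e : T.Edge) : OTree where
  edges := T.edges.filter (fun x => T.le e.1 x)
  le := T.le
  root := e.1
  root_mem := by simpa using T.le_refl _ e.2
  root_le x hx := (Finset.mem_filter.1 hx).2
  le_refl x hx := T.le_refl _ (Finset.mem_filter.1 hx).1
  le_antisymm x hx y hy := T.le_antisymm _ (Finset.mem_filter.1 hx).1 _ (Finset.mem_filter.1 hy).1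
  le_trans x hx y hy z hz := T.le_trans _ (Finset.mem_filter.1 hx).1 _ (Finset.mem_filter.1 hy).1 _
    (Finset.mem_filter.1 hz).1
  le_total_below x hx y hy z hz := T.le_total_below _ (Finset.mem_filter.1 hx).1 _
    (Finset.mem_filter.1 hy).1 _ (Finset.mem_filter.1 hz).1
  reduced x hx y hy hxy hne := by
    simp only [Finset.mem_filter] at hx hy ⊢
    obtain ⟨z, hz, hxz, h⟩ := T.reduced x hx.1 y hy.1 hxy hne
    exact ⟨z, ⟨hz, T.le_trans _ e.2 _ hx.1 _ hz hx.2 hxz⟩, hxz, h⟩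

lemma mem_above {T : OTree} {e : T.Edge} {x : ℕ} :
    x ∈ (T.above e).edges ↔ x ∈ T.edges ∧ T.le e.1 x := by
  classical
  exact Finset.mem_filter

open Classical in
/-- The tree obtained by cutting `T` at all the edges in `C` and keeping the component of the root:
it consists of the edges of `T` which are not strictly above an edge in `C`. -/
def cut (T : OTree) (C : List T.Edge) : OTree where
  edges := T.edges.filter (fun x => ∀ c ∈ C, T.le c.1 x → x = c.1)
  le := T.le
  root := T.root
  root_mem := Finset.mem_filter.2 ⟨T.root_mem, fun c _ h =>
    T.le_antisymm _ T.root_mem _ c.2 (T.root_le _ c.2) h⟩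
  root_le x hx := T.root_le _ (Finset.mem_filter.1 hx).1
  le_refl x hx := T.le_refl _ (Finset.mem_filter.1 hx).1
  le_antisymm x hx y hy := T.le_antisymm _ (Finset.mem_filter.1 hx).1 _ (Finset.mem_filter.1 hy).1
  le_trans x hx y hy z hz := T.le_trans _ (Finset.mem_filter.1 hx).1 _ (Finset.mem_filter.1 hy).1 _
    (Finset.mem_filter.1 hz).1
  le_total_below x hx y hy z hz := T.le_total_below _ (Finset.mem_filter.1 hx).1 _
    (Finset.mem_filter.1 hy).1 _ (Finset.mem_filter.1 hz).1
  reduced x hx y hy hxy hne := by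
    simp only [Finset.mem_filter] at hx hy ⊢
    obtain ⟨hx, hxC⟩ := hx
    obtain ⟨hy, hyC⟩ := hy
    -- a minimal edge among those which are suitable in `T` lies in the tree that is left
    let s := T.edges.filter (fun z => T.le x z ∧ ¬ T.le y z ∧ ¬ T.le z y)
    have hs : s.Nonempty := by
      obtain ⟨z, hz, h⟩ := T.reduced x hx y hy hxy hne
      exact ⟨z, Finset.mem_filter.2 ⟨hz, h⟩⟩
    obtain ⟨z, hzs, hmin⟩ := s.exists_min_image
      (fun z => (T.edges.filter (fun w => T.le w z)).card) hs
    have hz := Finset.mem_filter.1 hzs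
    refine ⟨z, ⟨hz.1, fun c hc hcz => ?_⟩, hz.2⟩
    by_contra hne'
    have hxc : T.le x c.1 := by
      rcases T.le_total_below _ hx _ c.2 _ hz.1 hz.2.1 hcz with h | h
      · exact h
      · rw [hxC c hc h]; exact T.le_refl _ c.2
    have hcs : c.1 ∈ s := by
      refine Finset.mem_filter.2 ⟨c.2, hxc, fun h => hz.2.2.1 ?_, fun h => ?_⟩
      · exact T.le_trans _ hy _ c.2 _ hz.1 h hcz
      · exact hz.2.2.1 (hyC c hc h ▸ hcz)
    have := hmin _ hcs
    refine absurd this (not_le.2 (Finset.card_lt_card ?_))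
    refine Finset.ssubset_iff_of_subset (fun w hw => ?_) |>.2
      ⟨z, Finset.mem_filter.2 ⟨hz.1, T.le_refl _ hz.1⟩, fun h => hne' ?_⟩
    · have hw := Finset.mem_filter.1 hw
      exact Finset.mem_filter.2 ⟨hw.1, T.le_trans _ hw.1 _ c.2 _ hz.1 hw.2 hcz⟩
    · exact T.le_antisymm _ hz.1 _ c.2 (Finset.mem_filter.1 h).2 hcz

lemma mem_cut {T : OTree} {C : List T.Edge} {x : ℕ} :
    x ∈ (T.cut C).edges ↔ x ∈ T.edges ∧ ∀ c ∈ C, T.le c.1 x → x = c.1 := by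
  classical
  exact Finset.mem_filter

/-- Two trees with the same edges, the same root and the same order. -/
structure Same (S T : OTree) : Prop where
  mem_iff : ∀ x, x ∈ S.edges ↔ x ∈ T.edges
  root : S.root = T.root
  le_iff : ∀ x ∈ S.edges, ∀ y ∈ S.edges, S.le x y ↔ T.le x y

/-- The isomorphism which is the identity on edges. -/
def Same.hom {S T : OTree} (h : Same S T) : S ⟶ T where
  toFun x := ⟨x.1, (h.mem_iff _).1 x.2⟩
  map_root := Subtype.ext h.root
  le_iff x y := (h.le_iff _ x.2 _ y.2).symm
  exists_leaf_le x hx := ⟨⟨x.1, (h.mem_iff _).2 x.2⟩, fun y hy => Subtype.ext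
    ((congrArg Subtype.val (hx ⟨y.1, (h.mem_iff _).1 y.2⟩
      ((h.le_iff _ ((h.mem_iff _).2 x.2) _ y.2).1 hy)) :)), T.le_refl _ x.2⟩

lemma Same.inner {S T : OTree} (h : Same S T) : inner h.hom := fun l hl y hy => Subtype.ext
  ((congrArg Subtype.val (hl ⟨y.1, (h.mem_iff _).2 y.2⟩
    ((h.le_iff _ l.2 _ ((h.mem_iff _).2 y.2)).2 hy)) :))

/-- The tree with a single edge, which is both the root and a leaf. -/
def eta : OTree where
  edges := {0}
  le _ _ := True
  root := 0
  root_mem := by simp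
  root_le _ _ := trivial
  le_refl _ _ := trivial
  le_antisymm x hx y hy _ _ := by simp_all
  le_trans _ _ _ _ _ _ _ _ := trivial
  le_total_below _ _ _ _ _ _ _ _ := Or.inl trivial
  reduced x hx y hy _ h := by simp_all

lemma eta_edge (x y : eta.Edge) : x = y := by
  obtain ⟨x, hx⟩ := x
  obtain ⟨y, hy⟩ := y
  simp only [eta, Finset.mem_singleton] at hx hy
  exact Subtype.ext (hx.trans hy.symm)

/-- The unique leaf of `eta`. -/
def etaLeaf : eta.Leaf := ⟨eta.rootEdge, fun _ _ => eta_edge _ _⟩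

/-- The inclusion of the root. -/
def rootInc (T : OTree) : eta ⟶ T where
  toFun _ := T.rootEdge
  map_root := rfl
  le_iff _ _ := iff_of_true (T.le_refl _ T.root_mem) trivial
  exists_leaf_le x _ := ⟨eta.rootEdge, fun _ _ => eta_edge _ _, T.root_le _ x.2⟩

lemma rootInc_inner (T : OTree) (h : T.IsLeaf T.rootEdge) : inner (rootInc T) := fun _ _ => h

/-- The map `T(e) ⟶ T'(f e)` between the subtrees above `e` and `f e` induced by `f : T ⟶ T'`. -/
def aboveMap {T T' : OTree} (f : T ⟶ T') (e : T.Edge) : T.above e ⟶ T'.above (f.toFun e) where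
  toFun x := ⟨(f.toFun ⟨x.1, (mem_above.1 x.2).1⟩).1, mem_above.2
    ⟨(f.toFun _).2, (f.le_iff _ _).2 (mem_above.1 x.2).2⟩⟩
  map_root := rfl
  le_iff x y := f.le_iff ⟨x.1, (mem_above.1 x.2).1⟩ ⟨y.1, (mem_above.1 y.2).1⟩
  exists_leaf_le x hx := by
    have hx1 := mem_above.1 x.2
    have hxT : T'.IsLeaf ⟨x.1, hx1.1⟩ := fun y hy => by
      have := hx ⟨y.1, mem_above.2 ⟨y.2, T'.le_trans _ (f.toFun e).2 _ hx1.1 _ y.2 hx1.2 hy⟩⟩ hy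
      exact Subtype.ext ((congrArg Subtype.val this :))
    obtain ⟨l, hl, hlx⟩ := f.exists_leaf_le _ hxT
    have hel : T.le e.1 l.1 := by
      rcases T'.le_total_below _ (f.toFun e).2 _ (f.toFun l).2 _ hx1.1 hx1.2 hlx with h | h
      · exact (f.le_iff _ _).1 h
      · rw [hl e ((f.le_iff _ _).1 h)]; exact T.le_refl _ l.2
    refine ⟨⟨l.1, mem_above.2 ⟨l.2, hel⟩⟩, fun y hy => ?_, hlx⟩
    exact Subtype.ext ((congrArg Subtype.val (hl ⟨y.1, (mem_above.1 y.2).1⟩ hy) :))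

lemma isLeaf_of_above {T : OTree} {e : T.Edge} (x : (T.above e).Edge) (hx : (T.above e).IsLeaf x) :
    T.IsLeaf ⟨x.1, (mem_above.1 x.2).1⟩ := fun y hy => by
  have hx1 := mem_above.1 x.2
  have := hx ⟨y.1, mem_above.2 ⟨y.2, T.le_trans _ e.2 _ hx1.1 _ y.2 hx1.2 hy⟩⟩ hy
  exact Subtype.ext ((congrArg Subtype.val this :))

lemma isLeaf_above {T : OTree} {e : T.Edge} (x : (T.above e).Edge)
    (hx : T.IsLeaf ⟨x.1, (mem_above.1 x.2).1⟩) : (T.above e).IsLeaf x := fun y hy =>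
  Subtype.ext ((congrArg Subtype.val (hx ⟨y.1, (mem_above.1 y.2).1⟩ hy) :))

lemma aboveMap_inner {T T' : OTree} (f : T ⟶ T') (hf : inner f) (e : T.Edge) :
    inner (aboveMap f e) := fun l hl => isLeaf_above _ (hf _ (isLeaf_of_above l hl))

lemma cut_singleton_leaf {T : OTree} (e : T.Edge) (x : (T.cut [e]).Edge) :
    (T.cut [e]).IsLeaf x ↔ x.1 = e.1 ∨ T.IsLeaf ⟨x.1, (mem_cut.1 x.2).1⟩ := by
  have hxe := (mem_cut.1 x.2).2 e (by simp)
  have hxT := (mem_cut.1 x.2).1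
  constructor
  · intro hx
    by_cases h : x.1 = e.1
    · exact Or.inl h
    · right
      intro y hy
      by_cases hye : T.le e.1 y.1
      · exfalso
        rcases T.le_total_below _ e.2 _ hxT _ y.2 hye hy with h' | h'
        · exact h (hxe h')
        · have hc : e.1 ∈ (T.cut [e]).edges := mem_cut.2 ⟨e.2, by simp⟩
          exact h ((congrArg Subtype.val (hx ⟨e.1, hc⟩ h') :)).symm
      · have hc : y.1 ∈ (T.cut [e]).edges := mem_cut.2 ⟨y.2, fun c hc hcy => by
          rw [List.mem_singleton] at hc; subst hc; exact absurd hcy hye⟩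
        exact Subtype.ext ((congrArg Subtype.val (hx ⟨y.1, hc⟩ hy) :))
  · rintro (h | h) y hy
    · apply Subtype.ext
      rw [h]
      exact (mem_cut.1 y.2).2 e (by simp) (h ▸ hy)
    · exact Subtype.ext ((congrArg Subtype.val (h ⟨y.1, (mem_cut.1 y.2).1⟩ hy) :))

/-- The map `T.cut [e] ⟶ T'.cut [f e]` induced by a morphism `f : T ⟶ T'`. -/
def cutMap {T T' : OTree} (f : T ⟶ T') (e : T.Edge) :
    T.cut [e] ⟶ T'.cut [f.toFun e] where
  toFun x := ⟨(f.toFun ⟨x.1, (mem_cut.1 x.2).1⟩).1, mem_cut.2 ⟨(f.toFun _).2, fun c hc h => by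
    rw [List.mem_singleton] at hc
    subst hc
    have := (mem_cut.1 x.2).2 e (by simp) ((f.le_iff e ⟨x.1, (mem_cut.1 x.2).1⟩).1 h)
    exact congrArg (fun y => (f.toFun y).1) (Subtype.ext this)⟩⟩
  map_root := Subtype.ext ((congrArg Subtype.val f.map_root :))
  le_iff x y := f.le_iff ⟨x.1, (mem_cut.1 x.2).1⟩ ⟨y.1, (mem_cut.1 y.2).1⟩
  exists_leaf_le x hx := by
    have hxT := (mem_cut.1 x.2).1
    have hee : e.1 ∈ (T.cut [e]).edges := mem_cut.2 ⟨e.2, by simp⟩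
    have heleaf : (T.cut [e]).IsLeaf ⟨e.1, hee⟩ := (cut_singleton_leaf _ _).2 (Or.inl rfl)
    rcases (cut_singleton_leaf _ _).1 hx with h | h
    · refine ⟨⟨e.1, hee⟩, heleaf, ?_⟩
      change T'.le (f.toFun e).1 x.1
      rw [h]
      exact T'.le_refl _ (f.toFun e).2
    · obtain ⟨l, hl, hlx⟩ := f.exists_leaf_le _ h
      by_cases hel : T.le e.1 l.1
      · exact ⟨⟨e.1, hee⟩, heleaf, T'.le_trans _ (f.toFun e).2 _ (f.toFun l).2 _ hxT
          ((f.le_iff _ _).2 hel) hlx⟩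
      · refine ⟨⟨l.1, mem_cut.2 ⟨l.2, fun c hc hcl => ?_⟩⟩, ?_, hlx⟩
        · rw [List.mem_singleton] at hc; subst hc; exact absurd hcl hel
        · exact (cut_singleton_leaf _ _).2 (Or.inr hl)

lemma cutMap_inner {T T' : OTree} (f : T ⟶ T') (hf : inner f) (e : T.Edge) :
    inner (cutMap f e) := fun l hl => by
  rcases (cut_singleton_leaf _ _).1 hl with h | h
  · exact (cut_singleton_leaf _ _).2 (Or.inl (congrArg (fun y => (f.toFun y).1)
      (Subtype.ext h : (⟨l.1, (mem_cut.1 l.2).1⟩ : T.Edge) = e)))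
  · exact (cut_singleton_leaf _ _).2 (Or.inr (hf _ h))

/-- The images of the leaves of `S` under a morphism `α : S ⟶ T`. -/
abbrev leafImages {S T : OTree} (α : S ⟶ T) : List T.Edge := S.leaves.map (fun l => α.toFun l.1)

lemma mem_cut_leafImages {S T : OTree} (α : S ⟶ T) (x : S.Edge) :
    (α.toFun x).1 ∈ (T.cut (leafImages α)).edges := mem_cut.2 ⟨(α.toFun x).2, fun c hc h => by
  obtain ⟨l, -, rfl⟩ := List.mem_map.1 hc
  rw [l.2 x ((α.le_iff _ _).1 h)]⟩

/-- The first half of the factorisation of `α : S ⟶ T` as an inner face followed by an external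
one: the pruning of `T` whose leaves are the images of the leaves of `S`. -/
def toPruning {S T : OTree} (α : S ⟶ T) : S ⟶ T.cut (leafImages α) where
  toFun x := ⟨(α.toFun x).1, mem_cut_leafImages α x⟩
  map_root := Subtype.ext ((congrArg Subtype.val α.map_root :))
  le_iff x y := α.le_iff x y
  exists_leaf_le x hx := by
    have hxT := (mem_cut.1 x.2).1
    classical
    -- a leaf `y` of `T` above `x`
    obtain ⟨y, hy, hmax⟩ := (T.edges.filter (fun y => T.le x.1 y)).exists_max_image
      (fun z => (T.edges.filter (fun w => T.le w z)).card)
      ⟨x.1, Finset.mem_filter.2 ⟨hxT, T.le_refl _ hxT⟩⟩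
    have hy := Finset.mem_filter.1 hy
    have hleaf : T.IsLeaf ⟨y, hy.1⟩ := fun z hyz => by
      by_contra hne
      refine absurd (hmax z.1 (Finset.mem_filter.2
        ⟨z.2, T.le_trans _ hxT _ hy.1 _ z.2 hy.2 hyz⟩)) (not_le.2 (Finset.card_lt_card ?_))
      refine Finset.ssubset_iff_of_subset (fun w hw => ?_) |>.2
        ⟨z.1, Finset.mem_filter.2 ⟨z.2, T.le_refl _ z.2⟩, fun h => hne (Subtype.ext ?_)⟩
      · have hw := Finset.mem_filter.1 hw
        exact Finset.mem_filter.2 ⟨hw.1, T.le_trans _ hw.1 _ hy.1 _ z.2 hw.2 hyz⟩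
      · exact T.le_antisymm _ z.2 _ hy.1 (Finset.mem_filter.1 h).2 hyz
    obtain ⟨l, hl, hly⟩ := α.exists_leaf_le _ hleaf
    refine ⟨l, hl, ?_⟩
    rcases T.le_total_below _ (α.toFun l).2 _ hxT _ hy.1 hly hy.2 with h | h
    · exact h
    · have := hx ⟨(α.toFun l).1, mem_cut_leafImages α l⟩ h
      have := (congrArg Subtype.val this :)
      change T.le (α.toFun l).1 x.1
      rw [← this]
      exact T.le_refl _ (α.toFun l).2

lemma toPruning_inner {S T : OTree} (α : S ⟶ T) : inner (toPruning α) := fun l hl y hy => by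
  apply Subtype.ext
  exact (mem_cut.1 y.2).2 (α.toFun l) (List.mem_map.2 ⟨⟨l, hl⟩, S.mem_leaves _, rfl⟩) hy

/-- A list of pairwise incomparable edges. -/
def Incomp (T : OTree) (C : List T.Edge) : Prop :=
  C.Pairwise (fun x y => ¬ T.le x.1 y.1 ∧ ¬ T.le y.1 x.1)

lemma leafImages_incomp {S T : OTree} (α : S ⟶ T) : T.Incomp (leafImages α) := by
  refine List.pairwise_map.2 (S.leaves_nodup.imp ?_)
  intro a b hab
  refine ⟨fun h => hab (Subtype.ext ?_), fun h => hab (Subtype.ext ?_)⟩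
  · exact (a.2 _ ((α.le_iff _ _).1 h)).symm
  · exact b.2 _ ((α.le_iff _ _).1 h)

lemma Incomp.mem_cut {T : OTree} {c : T.Edge} {C : List T.Edge} (h : T.Incomp (c :: C)) :
    c.1 ∈ (T.cut C).edges :=
  OTree.mem_cut.2 ⟨c.2, fun d hd hdc => absurd hdc ((List.pairwise_cons.1 h).1 d hd).2⟩

lemma same_cut_nil (T : OTree) : Same (T.cut []) T where
  mem_iff x := by simp [mem_cut]
  root := rfl
  le_iff _ _ _ _ := Iff.rfl

lemma same_cut_cons {T : OTree} {c : T.Edge} {C : List T.Edge} (h : T.Incomp (c :: C)) :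
    Same (T.cut (c :: C)) ((T.cut C).cut [⟨c.1, h.mem_cut⟩]) where
  mem_iff x := by
    rw [OTree.mem_cut, OTree.mem_cut, OTree.mem_cut]
    simp only [List.mem_cons, forall_eq_or_imp, List.not_mem_nil, false_imp_iff, implies_true,
      and_true]
    constructor
    · rintro ⟨h1, h2, h3⟩; exact ⟨⟨h1, h3⟩, h2⟩
    · rintro ⟨⟨h1, h3⟩, h2⟩; exact ⟨h1, h2, h3⟩
  root := rfl
  le_iff _ _ _ _ := Iff.rfl

lemma same_above_cons {T : OTree} {c : T.Edge} {C : List T.Edge} (h : T.Incomp (c :: C)) :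
    Same (T.above c) ((T.cut C).above ⟨c.1, h.mem_cut⟩) where
  mem_iff x := by
    rw [mem_above, mem_above, OTree.mem_cut]
    refine ⟨fun hx => ⟨⟨hx.1, fun d hd hdx => ?_⟩, hx.2⟩, fun hx => ⟨hx.1.1, hx.2⟩⟩
    have hi := (List.pairwise_cons.1 h).1 d hd
    rcases T.le_total_below _ c.2 _ d.2 _ hx.1 hx.2 hdx with h' | h'
    · exact absurd h' hi.1
    · exact absurd h' hi.2
  root := rfl
  le_iff _ _ _ _ := Iff.rfl

lemma same_above_root (T : OTree) : Same T (T.above T.rootEdge) where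
  mem_iff x := by rw [mem_above]; exact ⟨fun h => ⟨h, T.root_le _ h⟩, fun h => h.1⟩
  root := rfl
  le_iff _ _ _ _ := Iff.rfl

/-- All morphisms `eta ⟶ T` are equal to the inclusion of the root. -/
lemma eq_rootInc {T : OTree} (α : eta ⟶ T) : α = rootInc T := by
  refine Hom.ext (funext fun x => ?_)
  rw [eta_edge x eta.rootEdge]
  exact α.map_root

lemma same_above_of_eta {T : OTree} (α : eta ⟶ T) : Same T (T.above (α.toFun etaLeaf.1)) := by
  rw [eq_rootInc α]
  exact same_above_root T

lemma same_above_above {T : OTree} (a : T.Edge) (b : (T.above a).Edge) :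
    Same (T.above ⟨b.1, (mem_above.1 b.2).1⟩) ((T.above a).above b) where
  mem_iff x := by
    refine ⟨fun h => ?_, fun h => ?_⟩
    · have h := mem_above.1 h
      exact mem_above.2 ⟨mem_above.2 ⟨h.1, T.le_trans _ a.2 _ (mem_above.1 b.2).1 _ h.1
        (mem_above.1 b.2).2 h.2⟩, h.2⟩
    · have h := mem_above.1 h
      exact mem_above.2 ⟨(mem_above.1 h.1).1, h.2⟩
  root := rfl
  le_iff _ _ _ _ := Iff.rfl

lemma same_cut_leaf {T : OTree} (l : T.Leaf) : Same T (T.cut [l.1]) where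
  mem_iff x := by
    rw [mem_cut]
    refine ⟨fun h => ⟨h, fun c hc hcx => ?_⟩, fun h => h.1⟩
    rw [List.mem_singleton] at hc
    subst hc
    exact (congrArg Subtype.val (l.2 ⟨x, h⟩ hcx) :)
  root := rfl
  le_iff _ _ _ _ := Iff.rfl

lemma isLeaf_cut_root (T : OTree) :
    (T.cut [T.rootEdge]).IsLeaf (T.cut [T.rootEdge]).rootEdge :=
  (cut_singleton_leaf _ _).2 (Or.inl rfl)

lemma isLeaf_above_leaf {T : OTree} (l : T.Leaf) :
    (T.above l.1).IsLeaf (T.above l.1).rootEdge := isLeaf_above _ l.2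

lemma perm_leaves {T : OTree} {l : List T.Leaf} (hn : l.Nodup) (hm : ∀ x, x ∈ l) :
    l.Perm T.leaves :=
  (List.perm_ext_iff_of_nodup hn T.leaves_nodup).2 fun x => iff_of_true (hm x) (T.mem_leaves x)

/-- The bijection on leaves induced by a morphism of `A`. -/
def leafMap {S S' : OTree} (γ : S ⟶ S') (hγ : inner γ) (l : S.Leaf) : S'.Leaf :=
  ⟨γ.toFun l.1, hγ _ l.2⟩

lemma leafMap_perm {S S' : OTree} (γ : S ⟶ S') (hγ : inner γ) :
    (S.leaves.map (leafMap γ hγ)).Perm S'.leaves := by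
  refine perm_leaves (S.leaves_nodup.map fun x y h => ?_) fun x => List.mem_map.2 ?_
  · exact Subtype.ext (γ.injective (congrArg Subtype.val h :))
  · obtain ⟨l, hl, hlx⟩ := γ.exists_leaf_le _ x.2
    exact ⟨⟨l, hl⟩, S.mem_leaves _, Subtype.ext (hγ l hl _ hlx).symm⟩

/-- Given `α : S ⟶ R`, the leaves of the subtrees of `R` above the images of the leaves of `S`
are the leaves of `R`. -/
def leafUp {S R : OTree} (α : S ⟶ R) (x : Σ l : S.Leaf, (R.above (α.toFun l.1)).Leaf) : R.Leaf :=
  ⟨⟨x.2.1.1, (mem_above.1 x.2.1.2).1⟩, isLeaf_of_above _ x.2.2⟩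

lemma leafUp_perm {S R : OTree} (α : S ⟶ R) :
    ((S.leaves.sigma fun l => (R.above (α.toFun l.1)).leaves).map (leafUp α)).Perm R.leaves := by
  refine perm_leaves (List.Nodup.map ?_ (S.leaves_nodup.sigma fun _ => leaves_nodup _))
    fun x => List.mem_map.2 ?_
  · rintro ⟨l, x⟩ ⟨m, y⟩ h
    have hxy : x.1.1 = y.1.1 := congrArg (fun z : R.Leaf => z.1.1) h
    have hlm : l = m := by
      have hx := mem_above.1 x.1.2
      have hy := mem_above.1 y.1.2
      rw [← hxy] at hy
      rcases R.le_total_below _ (α.toFun l.1).2 _ (α.toFun m.1).2 _ hx.1 hx.2 hy.2 with h | h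
      · exact Subtype.ext (l.2 _ ((α.le_iff _ _).1 h)).symm
      · exact Subtype.ext (m.2 _ ((α.le_iff _ _).1 h))
    subst hlm
    exact congrArg _ (Subtype.ext (Subtype.ext hxy))
  · obtain ⟨l, hl, hlx⟩ := α.exists_leaf_le _ x.2
    exact ⟨⟨⟨l, hl⟩, ⟨⟨x.1.1, mem_above.2 ⟨x.1.2, hlx⟩⟩, isLeaf_above _ x.2⟩⟩,
      List.mem_sigma.2 ⟨S.mem_leaves _, mem_leaves _ _⟩, rfl⟩

lemma eta_leaves_perm : eta.leaves.Perm [etaLeaf] :=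
  (perm_leaves (by simp) fun x => List.mem_singleton.2 (Subtype.ext (eta_edge _ _))).symm

end OTree

/-! ### Preoperads -/

namespace OTree

lemma Incomp.pair {T : OTree} {e e' : T.Edge} (h : ¬ T.le e.1 e'.1 ∧ ¬ T.le e'.1 e.1) :
    T.Incomp [e, e'] := List.pairwise_pair.2 h

lemma Incomp.pair_symm {T : OTree} {e e' : T.Edge} (h : ¬ T.le e.1 e'.1 ∧ ¬ T.le e'.1 e.1) :
    T.Incomp [e', e] := Incomp.pair ⟨h.2, h.1⟩

/-- An edge `e` below `e'` is an edge of the tree which is left after cutting at `e'`. -/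
lemma mem_cut_of_le {T : OTree} {e : T.Edge} (e' : (T.above e).Edge) :
    e.1 ∈ (T.cut [⟨e'.1, (mem_above.1 e'.2).1⟩]).edges :=
  mem_cut.2 ⟨e.2, fun c hc h => by
    rw [List.mem_singleton] at hc
    subst hc
    exact T.le_antisymm _ e.2 _ (mem_above.1 e'.2).1 (mem_above.1 e'.2).2 h⟩

lemma same_nested_cut {T : OTree} {e : T.Edge} (e' : (T.above e).Edge) :
    Same (T.cut [e]) ((T.cut [⟨e'.1, (mem_above.1 e'.2).1⟩]).cut [⟨e.1, mem_cut_of_le e'⟩]) where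
  mem_iff x := by
    have he := mem_above.1 e'.2
    simp only [mem_cut, List.mem_singleton, forall_eq]
    refine ⟨fun h => ⟨⟨h.1, fun h' => ?_⟩, h.2⟩, fun h => ⟨h.1.1, h.2⟩⟩
    have hx := h.2 (T.le_trans _ e.2 _ he.1 _ h.1 he.2 h')
    refine T.le_antisymm _ h.1 _ he.1 ?_ h'
    rw [hx]
    exact he.2
  root := rfl
  le_iff _ _ _ _ := Iff.rfl

lemma same_nested_above {T : OTree} {e : T.Edge} (e' : (T.above e).Edge) :
    Same ((T.above e).cut [e'])
      ((T.cut [⟨e'.1, (mem_above.1 e'.2).1⟩]).above ⟨e.1, mem_cut_of_le e'⟩) where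
  mem_iff x := by
    rw [mem_cut, mem_above, mem_above, mem_cut]
    have h1 : (∀ c ∈ [e'], T.le c.1 x → x = c.1) ↔ (T.le e'.1 x → x = e'.1) := by
      simp only [List.mem_singleton, forall_eq]
    have h2 : (∀ c ∈ [(⟨e'.1, (mem_above.1 e'.2).1⟩ : T.Edge)], T.le c.1 x → x = c.1) ↔
        (T.le e'.1 x → x = e'.1) := by
      simp only [List.mem_singleton, forall_eq]
    change (_ ∧ ∀ c ∈ [e'], T.le c.1 x → x = c.1) ↔ (_ ∧ _) ∧ T.le e.1 x
    rw [h1, h2]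
    tauto
  root := rfl
  le_iff _ _ _ _ := Iff.rfl

lemma same_parallel_cut {T : OTree} {e e' : T.Edge} (h : ¬ T.le e.1 e'.1 ∧ ¬ T.le e'.1 e.1) :
    Same ((T.cut [e]).cut [⟨e'.1, (Incomp.pair_symm h).mem_cut⟩])
      ((T.cut [e']).cut [⟨e.1, (Incomp.pair h).mem_cut⟩]) where
  mem_iff x := by
    simp only [mem_cut, List.mem_singleton, forall_eq]
    simp only [cut]
    tauto
  root := rfl
  le_iff _ _ _ _ := Iff.rfl

lemma Same.symm {S T : OTree} (h : Same S T) : Same T S where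
  mem_iff x := (h.mem_iff x).symm
  root := h.root.symm
  le_iff x hx y hy := (h.le_iff x ((h.mem_iff x).2 hx) y ((h.mem_iff y).2 hy)).symm

end OTree

section Preoperads

open Opposite

variable (C : Type w) [Category.{v} C] [MonoidalCategory C] [SymmetricCategory C]

/-- Presheaves on the category `A`. -/
abbrev PshA := (WideSubcategory OTree.inner)ᵒᵖ ⥤ C

variable {C}

/-- The value of a presheaf on `A` at a tree. -/
abbrev PshA.ob (X : PshA C) (T : OTree) : C := X.obj (op ⟨T⟩)

/-- The restriction along a morphism of `A`. -/
abbrev PshA.res (X : PshA C) {S T : OTree} (f : S ⟶ T) (hf : OTree.inner f) : X.ob T ⟶ X.ob S :=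
  X.map (Quiver.Hom.op (X := (⟨S⟩ : WideSubcategory OTree.inner)) (Y := ⟨T⟩) ⟨f, hf⟩)

/-- The restriction along the isomorphism of two trees which is the identity on edges. -/
abbrev PshA.resSame (X : PshA C) {S T : OTree} (h : OTree.Same S T) : X.ob T ⟶ X.ob S :=
  X.res h.hom h.inner

variable (C)

/-- Preoperads: presheaves `X` on the category `A` with decomposition maps
`X(T) ⟶ X(T.cut e) ⊗ X(T.above e)` for every edge `e` of a tree `T`. The tree `T` is the grafting
of `T.above e` onto the leaf `e` of `T.cut e`, and every grafting is of this form. -/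
structure Preoperad where
  presheaf : PshA C
  θ (T : OTree) (e : T.Edge) : presheaf.ob T ⟶ presheaf.ob (T.cut [e]) ⊗ presheaf.ob (T.above e)
  unit : presheaf.ob OTree.eta ≅ 𝟙_ C
  naturality {T T' : OTree} (f : T ⟶ T') (hf : OTree.inner f) (e : T.Edge) :
    θ T' (f.toFun e) ≫ (presheaf.res (OTree.cutMap f e) (OTree.cutMap_inner f hf e) ⊗ₘ
      presheaf.res (OTree.aboveMap f e) (OTree.aboveMap_inner f hf e)) = presheaf.res f hf ≫ θ T e
  /-- grafting onto the unit tree -/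
  root_cut (T : OTree) : θ T T.rootEdge ≫
    (presheaf.res (OTree.rootInc (T.cut [T.rootEdge]))
        (OTree.rootInc_inner _ (OTree.isLeaf_cut_root T)) ≫ unit.hom ⊗ₘ
      presheaf.resSame (OTree.same_above_root T)) ≫ (λ_ _).hom = 𝟙 _
  /-- grafting the unit tree -/
  leaf_cut (T : OTree) (l : T.Leaf) : θ T l.1 ≫
    (presheaf.resSame (OTree.same_cut_leaf l) ⊗ₘ
      presheaf.res (OTree.rootInc (T.above l.1))
        (OTree.rootInc_inner _ (OTree.isLeaf_above_leaf l)) ≫ unit.hom) ≫ (ρ_ _).hom = 𝟙 _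
  /-- associativity for an edge `e` and an edge `e'` above it -/
  nested (T : OTree) (e : T.Edge) (e' : (T.above e).Edge) :
    θ T e ≫ (presheaf.ob (T.cut [e]) ◁ θ (T.above e) e') =
      θ T ⟨e'.1, (OTree.mem_above.1 e'.2).1⟩ ≫
        (θ (T.cut [⟨e'.1, (OTree.mem_above.1 e'.2).1⟩]) ⟨e.1, OTree.mem_cut_of_le e'⟩ ▷ _) ≫
        (α_ _ _ _).hom ≫
        (presheaf.resSame (OTree.same_nested_cut e') ⊗ₘ
          (presheaf.resSame (OTree.same_nested_above e') ⊗ₘ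
            presheaf.resSame (OTree.same_above_above e e').symm))
  /-- associativity for two incomparable edges `e` and `e'` -/
  parallel (T : OTree) (e e' : T.Edge) (h : ¬ T.le e.1 e'.1 ∧ ¬ T.le e'.1 e.1) :
    θ T e ≫ (θ (T.cut [e]) ⟨e'.1, (OTree.Incomp.pair_symm h).mem_cut⟩ ▷ _) ≫ (α_ _ _ _).hom =
      θ T e' ≫ (θ (T.cut [e']) ⟨e.1, (OTree.Incomp.pair h).mem_cut⟩ ▷ _) ≫ (α_ _ _ _).hom ≫
        (_ ◁ (β_ _ _).hom) ≫
        (presheaf.resSame (OTree.same_parallel_cut h) ⊗ₘ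
          (presheaf.resSame (OTree.same_above_cons (OTree.Incomp.pair_symm h)).symm ⊗ₘ
            presheaf.resSame (OTree.same_above_cons (OTree.Incomp.pair h))))

namespace Preoperad

variable {C}

/-- The value of a preoperad at a tree. -/
abbrev ob (X : Preoperad C) (T : OTree) : C := X.presheaf.ob T

/-- Morphisms of preoperads: maps of presheaves which are compatible with the decomposition maps
and with the identification of the values at the unit tree with the unit object. -/
@[ext]
structure Hom (X Y : Preoperad C) where
  toNatTrans : X.presheaf ⟶ Y.presheaf
  comp_θ (T : OTree) (e : T.Edge) : toNatTrans.app (op ⟨T⟩) ≫ Y.θ T e =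
    X.θ T e ≫ (toNatTrans.app (op ⟨T.cut [e]⟩) ⊗ₘ toNatTrans.app (op ⟨T.above e⟩))
  comp_unit : toNatTrans.app (op ⟨OTree.eta⟩) ≫ Y.unit.hom = X.unit.hom

instance : Category (Preoperad C) where
  Hom := Hom
  id X := ⟨𝟙 _, fun T e => by simp, by simp⟩
  comp f g := ⟨f.toNatTrans ≫ g.toNatTrans, fun T e => by
    simp only [NatTrans.comp_app, Category.assoc, g.comp_θ]
    rw [← Category.assoc, f.comp_θ, Category.assoc, MonoidalCategory.tensorHom_comp_tensorHom],
    by simp only [NatTrans.comp_app, Category.assoc, g.comp_unit, f.comp_unit]⟩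
  id_comp f := Hom.ext (Category.id_comp _)
  comp_id f := Hom.ext (Category.comp_id _)
  assoc f g h := Hom.ext (Category.assoc _ _ _)

/-- The component of a morphism of preoperads at a tree. -/
abbrev Hom.app {X Y : Preoperad C} (f : X ⟶ Y) (T : OTree) : X.ob T ⟶ Y.ob T :=
  f.toNatTrans.app (op ⟨T⟩)

lemma Hom.res {X Y : Preoperad C} (f : X ⟶ Y) {S T : OTree} (a : S ⟶ T) (ha : OTree.inner a) :
    X.presheaf.res a ha ≫ Hom.app f S = Hom.app f T ≫ Y.presheaf.res a ha :=
  f.toNatTrans.naturality _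

/-- The decomposition map `X(T) ⟶ X(T.cut C) ⊗ ⨂_{c ∈ C} X(T.above c)`, for pairwise incomparable
edges `c`, obtained by cutting the edges one after the other. -/
def iter (X : Preoperad C) (T : OTree) : (c : List T.Edge) → T.Incomp c →
    (X.ob T ⟶ X.ob (T.cut c) ⊗ tens (fun e => X.ob (T.above e)) c)
  | [], _ => X.presheaf.resSame T.same_cut_nil ≫ (ρ_ _).inv
  | e :: c, h => iter X T c (List.pairwise_cons.1 h).2 ≫
      (X.θ (T.cut c) ⟨e.1, h.mem_cut⟩ ▷ _) ≫ (α_ _ _ _).hom ≫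
      (X.presheaf.resSame (OTree.same_cut_cons h) ⊗ₘ
        (X.presheaf.resSame (OTree.same_above_cons h) ▷ _))

/-- The decomposition map `X(R) ⟶ X(S) ⊗ ⨂_ℓ X(R_ℓ)` of a preoperad for a morphism of trees
`α : S ⟶ R`, where `ℓ` ranges over the leaves of `S` and `R_ℓ` is the subtree of `R` above `α ℓ`. -/
def decomp (X : Preoperad C) {S R : OTree} (α : S ⟶ R) :
    X.ob R ⟶ X.ob S ⊗ tens (fun l : S.Leaf => X.ob (R.above (α.toFun l.1))) S.leaves :=
  X.iter R (OTree.leafImages α) (OTree.leafImages_incomp α) ≫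
    (X.presheaf.res (OTree.toPruning α) (OTree.toPruning_inner α) ⊗ₘ
      (tensRelabel (fun l : S.Leaf => α.toFun l.1) (fun e => X.ob (R.above e)) S.leaves).hom)

lemma tensor_aux {C : Type w} [Category.{v} C] [MonoidalCategory C] {A B B' D E E' F F' : C} (p : A ⟶ B ⊗ D) (a : B ⟶ B') (b : D ⟶ E)
    (t : F ⟶ F') (r : B' ⟶ E') {G : C} (s : E ⟶ G) :
    ((p ≫ (a ⊗ₘ b)) ⊗ₘ t) ≫ (α_ B' E F').hom ≫ (r ⊗ₘ (s ⊗ₘ 𝟙 F')) =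
      (p ⊗ₘ 𝟙 F) ≫ (α_ B D F).hom ≫ (a ≫ r ⊗ₘ (b ≫ s ⊗ₘ t)) := by
  have h : ((p ≫ (a ⊗ₘ b)) ⊗ₘ t) = (p ⊗ₘ 𝟙 F) ≫ ((a ⊗ₘ b) ⊗ₘ t) := by
    rw [MonoidalCategory.tensorHom_comp_tensorHom, Category.id_comp]
  rw [h, Category.assoc, MonoidalCategory.associator_naturality_assoc,
    MonoidalCategory.tensorHom_comp_tensorHom, MonoidalCategory.tensorHom_comp_tensorHom,
    Category.comp_id]

lemma iter_naturality {X Y : Preoperad C} (f : X ⟶ Y) (T : OTree) (c : List T.Edge)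
    (h : T.Incomp c) : Hom.app f T ≫ Y.iter T c h =
      X.iter T c h ≫ (Hom.app f (T.cut c) ⊗ₘ tensMap (fun e => Hom.app f (T.above e)) c) := by
  induction c with
  | nil =>
    change Hom.app f T ≫ Y.presheaf.resSame T.same_cut_nil ≫ (ρ_ _).inv =
      (X.presheaf.resSame T.same_cut_nil ≫ (ρ_ _).inv) ≫ (Hom.app f (T.cut []) ⊗ₘ 𝟙 (𝟙_ C))
    rw [← Category.assoc, ← Hom.res]
    simp
  | cons e c ih =>
    have h' := (List.pairwise_cons.1 h).2
    have ih := ih h'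
    change Hom.app f T ≫ Y.iter T c h' ≫ (Y.θ (T.cut c) ⟨e.1, h.mem_cut⟩ ▷ _) ≫ (α_ _ _ _).hom ≫
        (Y.presheaf.resSame (OTree.same_cut_cons h) ⊗ₘ
          (Y.presheaf.resSame (OTree.same_above_cons h) ▷ _)) =
      (X.iter T c h' ≫ (X.θ (T.cut c) ⟨e.1, h.mem_cut⟩ ▷ _) ≫ (α_ _ _ _).hom ≫
        (X.presheaf.resSame (OTree.same_cut_cons h) ⊗ₘ
          (X.presheaf.resSame (OTree.same_above_cons h) ▷ _))) ≫
        (Hom.app f (T.cut (e :: c)) ⊗ₘ (Hom.app f (T.above e) ⊗ₘ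
          tensMap (fun e => Hom.app f (T.above e)) c))
    rw [← Category.assoc, ih]
    simp only [Category.assoc]
    congr 1
    simp only [← MonoidalCategory.tensorHom_id]
    rw [MonoidalCategory.tensorHom_comp_tensorHom_assoc, f.comp_θ, Category.comp_id]
    simp only [MonoidalCategory.tensorHom_comp_tensorHom]
    rw [Category.id_comp]
    have e1 := Hom.res f (OTree.same_cut_cons h).hom (OTree.same_cut_cons h).inner
    have e2 := Hom.res f (OTree.same_above_cons h).hom (OTree.same_above_cons h).inner
    rw [PshA.resSame, PshA.resSame, e1, e2]
    exact tensor_aux _ _ _ _ _ _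

lemma decomp_naturality {X Y : Preoperad C} (f : X ⟶ Y) {S R : OTree} (α : S ⟶ R) :
    Hom.app f R ≫ Y.decomp α = X.decomp α ≫
      (Hom.app f S ⊗ₘ tensMap (fun l : S.Leaf => Hom.app f (R.above (α.toFun l.1))) S.leaves) := by
  have e1 := Hom.res f (OTree.toPruning α) (OTree.toPruning_inner α)
  have e2 := tensRelabel_naturality (fun l : S.Leaf => α.toFun l.1)
    (fun e => Hom.app f (R.above e)) S.leaves
  rw [decomp, decomp, Category.assoc, MonoidalCategory.tensorHom_comp_tensorHom, e1, ← e2,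
    ← MonoidalCategory.tensorHom_comp_tensorHom, ← Category.assoc, ← Category.assoc,
    iter_naturality]

end Preoperad

/-! ### Prealgebras -/

/-- Presheaves on the category `R`. -/
abbrev PshR := OTreeᵒᵖ ⥤ C

variable {C}

/-- The tensor product `⨂_ℓ V(T_ℓ)` for `α : S ⟶ T`, where `ℓ` ranges over the leaves of `S`. -/
abbrev leafTens (V : PshR C) {S T : OTree} (α : S ⟶ T) : C :=
  tens (fun l : S.Leaf => V.obj (op (T.above (α.toFun l.1)))) S.leaves

/-- The canonical isomorphism `⨂_ℓ V(T_ℓ) ⟶ ⨂_ℓ V(T_ℓ)` for a morphism `γ : S ⟶ S'` of `A` over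
`T`, which induces a bijection on leaves. -/
def leafReindex (V : PshR C) {S S' T : OTree} (γ : S ⟶ S') (hγ : OTree.inner γ) (α : S' ⟶ T) :
    leafTens V α ⟶ leafTens V (γ ≫ α) :=
  tensReindex (fun l : S'.Leaf => V.obj (op (T.above (α.toFun l.1)))) (OTree.leafMap γ hγ)
    (OTree.leafMap_perm γ hγ)

/-- The map `⨂_ℓ V(T'_ℓ) ⟶ ⨂_ℓ V(T_ℓ)` induced by `β : T ⟶ T'`. -/
def leafRestrict (V : PshR C) {S T T' : OTree} (α : S ⟶ T) (β : T ⟶ T') :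
    leafTens V (α ≫ β) ⟶ leafTens V α :=
  tensMap (fun l : S.Leaf => V.map (OTree.aboveMap β (α.toFun l.1)).op) S.leaves

/-- The map `⨂_ℓ V(T_ℓ) ⟶ ⨂_ℓ W(T_ℓ)` induced by `V ⟶ W`. -/
def leafTensMap {V W : PshR C} (f : V ⟶ W) {S T : OTree} (α : S ⟶ T) :
    leafTens V α ⟶ leafTens W α :=
  tensMap (fun l : S.Leaf => f.app (op (T.above (α.toFun l.1)))) S.leaves

/-- The canonical isomorphism `⨂_ℓ V(T_ℓ) ⟶ V(T)` for the inclusion of the root of `T`. -/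
def leafRoot (V : PshR C) {T : OTree} (α : OTree.eta ⟶ T) : leafTens V α ⟶ V.obj (op T) :=
  tensPerm _ _ _ OTree.eta_leaves_perm ≫
    tensSingle (fun l : OTree.eta.Leaf => V.obj (op (T.above (α.toFun l.1)))) OTree.etaLeaf ≫
    V.map (OTree.same_above_of_eta α).hom.op

/-- For `S ⟶ R ⟶ T` given by `α` and `β`, the canonical isomorphism
`X(S) ⊗ ⨂_ℓ (X(R_ℓ) ⊗ ⨂_k V(T_k)) ⟶ (X(S) ⊗ ⨂_ℓ X(R_ℓ)) ⊗ ⨂_k V(T_k)`, where `ℓ` ranges over the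
leaves of `S`, and `k` over the leaves of `R_ℓ` on the left and over the leaves of `R` on the
right. -/
def leafRegroup (X : Preoperad C) (V : PshR C) {S R T : OTree} (α : S ⟶ R) (β : R ⟶ T) :
    X.ob S ⊗ tens (fun l : S.Leaf => X.ob (R.above (α.toFun l.1)) ⊗
        leafTens V (OTree.aboveMap β (α.toFun l.1))) S.leaves ⟶
      (X.ob S ⊗ tens (fun l : S.Leaf => X.ob (R.above (α.toFun l.1))) S.leaves) ⊗ leafTens V β :=
  regroup (X.ob S) (fun l : S.Leaf => X.ob (R.above (α.toFun l.1)))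
    (B := fun l (k : (R.above (α.toFun l.1)).Leaf) => V.obj (op
      ((T.above (β.toFun (α.toFun l.1))).above ((OTree.aboveMap β (α.toFun l.1)).toFun k.1))))
    (D := fun k : R.Leaf => V.obj (op (T.above (β.toFun k.1))))
    (OTree.leafUp α)
    (fun l k => V.map (OTree.same_above_above (β.toFun (α.toFun l.1))
      ((OTree.aboveMap β (α.toFun l.1)).toFun k.1)).hom.op)
    (OTree.leafUp_perm α)

lemma leafReindex_naturality {V W : PshR C} (f : V ⟶ W) {S S' T : OTree} (γ : S ⟶ S')
    (hγ : OTree.inner γ) (α : S' ⟶ T) :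
    leafTensMap f α ≫ leafReindex W γ hγ α = leafReindex V γ hγ α ≫ leafTensMap f (γ ≫ α) :=
  tensReindex_naturality (fun l : S'.Leaf => f.app (op (T.above (α.toFun l.1))))
    (OTree.leafMap γ hγ) (OTree.leafMap_perm γ hγ)

lemma leafReindex_restrict (V : PshR C) {S S' T T' : OTree} (γ : S ⟶ S')
    (hγ : OTree.inner γ) (α : S' ⟶ T) (β : T ⟶ T') :
    leafRestrict V α β ≫ leafReindex V γ hγ α =
      leafReindex V γ hγ (α ≫ β) ≫ leafRestrict V (γ ≫ α) β :=
  tensReindex_naturality (fun l : S'.Leaf => V.map (OTree.aboveMap β (α.toFun l.1)).op)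
    (OTree.leafMap γ hγ) (OTree.leafMap_perm γ hγ)

lemma leafRestrict_id (V : PshR C) {S T : OTree} (α : S ⟶ T) :
    leafRestrict V α (𝟙 T) = 𝟙 (leafTens V α) := by
  refine Eq.trans ?_ (tensMap_id (fun l : S.Leaf => V.obj (op (T.above (α.toFun l.1)))) S.leaves)
  refine congrArg (fun f => tensMap f S.leaves) (funext fun l => ?_)
  exact V.map_id _

lemma leafRestrict_comp (V : PshR C) {S T T' T'' : OTree} (α : S ⟶ T) (β : T ⟶ T')
    (β' : T' ⟶ T'') :
    leafRestrict V α (β ≫ β') = leafRestrict V (α ≫ β) β' ≫ leafRestrict V α β := by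
  refine Eq.trans ?_ (tensMap_comp (fun l : S.Leaf =>
    V.map (OTree.aboveMap β' (β.toFun (α.toFun l.1))).op)
    (fun l : S.Leaf => V.map (OTree.aboveMap β (α.toFun l.1)).op) S.leaves)
  refine congrArg (fun f => tensMap f S.leaves) (funext fun l => ?_)
  exact V.map_comp (OTree.aboveMap β' (β.toFun (α.toFun l.1))).op
    (OTree.aboveMap β (α.toFun l.1)).op

lemma leafTensMap_id (V : PshR C) {S T : OTree} (α : S ⟶ T) :
    leafTensMap (𝟙 V) α = 𝟙 (leafTens V α) :=
  tensMap_id (fun l : S.Leaf => V.obj (op (T.above (α.toFun l.1)))) S.leaves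

lemma leafTensMap_comp {U V W : PshR C} (f : U ⟶ V) (g : V ⟶ W) {S T : OTree} (α : S ⟶ T) :
    leafTensMap (f ≫ g) α = leafTensMap f α ≫ leafTensMap g α :=
  tensMap_comp _ _ _

lemma leafTensMap_restrict {V W : PshR C} (f : V ⟶ W) {S T T' : OTree} (α : S ⟶ T) (β : T ⟶ T') :
    leafTensMap f (α ≫ β) ≫ leafRestrict W α β = leafRestrict V α β ≫ leafTensMap f α := by
  refine (tensMap_comp (fun l : S.Leaf => f.app (op (T'.above (β.toFun (α.toFun l.1)))))
    (fun l : S.Leaf => W.map (OTree.aboveMap β (α.toFun l.1)).op) S.leaves).symm.trans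
    (Eq.trans ?_ (tensMap_comp (fun l : S.Leaf => V.map (OTree.aboveMap β (α.toFun l.1)).op)
      (fun l : S.Leaf => f.app (op (T.above (α.toFun l.1)))) S.leaves))
  refine congrArg (fun f => tensMap f S.leaves) (funext fun l => ?_)
  exact (f.naturality (OTree.aboveMap β (α.toFun l.1)).op).symm

lemma leafRoot_aux {ι : Type*} {V W : ι → C} (f : ∀ i, V i ⟶ W i) {l : List ι} (i : ι)
    (h : l.Perm [i]) {A B : C} (p : V i ⟶ A) (q : W i ⟶ B) (m : A ⟶ B) (hm : f i ≫ q = p ≫ m) :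
    tensMap f l ≫ tensPerm W l [i] h ≫ tensSingle W i ≫ q =
      (tensPerm V l [i] h ≫ tensSingle V i ≫ p) ≫ m := by
  rw [← Category.assoc, tensPerm_naturality, Category.assoc, Category.assoc, Category.assoc, ← hm,
    ← Category.assoc (tensMap f [i]), tensSingle_naturality, Category.assoc]

lemma leafRoot_naturality {V W : PshR C} (f : V ⟶ W) {T : OTree} (α : OTree.eta ⟶ T) :
    leafTensMap f α ≫ leafRoot W α = leafRoot V α ≫ f.app (op T) :=
  leafRoot_aux (fun l : OTree.eta.Leaf => f.app (op (T.above (α.toFun l.1)))) OTree.etaLeaf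
    OTree.eta_leaves_perm _ _ _ (f.naturality (OTree.same_above_of_eta α).hom.op).symm

lemma leafRoot_restrict (V : PshR C) {T T' : OTree} (α : OTree.eta ⟶ T) (β : T ⟶ T') :
    leafRestrict V α β ≫ leafRoot V α = leafRoot V (α ≫ β) ≫ V.map β.op :=
  leafRoot_aux (fun l : OTree.eta.Leaf => V.map (OTree.aboveMap β (α.toFun l.1)).op)
    OTree.etaLeaf OTree.eta_leaves_perm _ _ _ ((V.map_comp _ _).symm.trans
      (V.map_comp (OTree.same_above_of_eta (α ≫ β)).hom.op β.op))

/-- Prealgebras over a preoperad `X`: presheaves `M` on the category `R` with structure maps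
`M(T) ⟶ X(S) ⊗ ⨂_ℓ M(T_ℓ)` for all morphisms `α : S ⟶ T` of `R`, where `ℓ` ranges over the leaves
of `S` and `T_ℓ` is the subtree of `T` above `α ℓ`. -/
structure Prealg (X : Preoperad C) where
  presheaf : PshR C
  τ {S T : OTree} (α : S ⟶ T) : presheaf.obj (op T) ⟶ X.ob S ⊗ leafTens presheaf α
  naturality_target {S T T' : OTree} (α : S ⟶ T) (β : T ⟶ T') :
    τ (α ≫ β) ≫ (X.ob S ◁ leafRestrict presheaf α β) = presheaf.map β.op ≫ τ α
  naturality_source {S S' T : OTree} (γ : S ⟶ S') (hγ : OTree.inner γ) (α : S' ⟶ T) :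
    τ (γ ≫ α) = τ α ≫ (X.presheaf.res γ hγ ⊗ₘ leafReindex presheaf γ hγ α)
  unit (T : OTree) :
    τ (OTree.rootInc T) ≫ (X.unit.hom ⊗ₘ leafRoot presheaf (OTree.rootInc T)) ≫ (λ_ _).hom = 𝟙 _
  assoc {S R T : OTree} (α : S ⟶ R) (β : R ⟶ T) :
    τ β ≫ (X.decomp α ▷ leafTens presheaf β) =
      τ (α ≫ β) ≫
        (X.ob S ◁ tensMap (fun l : S.Leaf => τ (OTree.aboveMap β (α.toFun l.1))) S.leaves) ≫
        leafRegroup X presheaf α β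

namespace Prealg

/-- Morphisms of prealgebras are maps of presheaves which commute with the structure maps. -/
@[ext]
structure Hom {X : Preoperad C} (M N : Prealg X) where
  toNatTrans : M.presheaf ⟶ N.presheaf
  comp_τ {S T : OTree} (α : S ⟶ T) : toNatTrans.app (op T) ≫ N.τ α =
    M.τ α ≫ (X.ob S ◁ leafTensMap toNatTrans α)

instance (X : Preoperad C) : Category (Prealg X) where
  Hom := Hom
  id M := ⟨𝟙 _, fun {S T} α => by
    simp only [NatTrans.id_app, leafTensMap_id, Category.id_comp, MonoidalCategory.whiskerLeft_id,
      Category.comp_id]⟩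
  comp f g := ⟨f.toNatTrans ≫ g.toNatTrans, fun {S T} α => by
    simp only [NatTrans.comp_app, leafTensMap_comp, MonoidalCategory.whiskerLeft_comp, Category.assoc,
      g.comp_τ]
    rw [← Category.assoc, f.comp_τ, Category.assoc]⟩
  id_comp f := Hom.ext (Category.id_comp _)
  comp_id f := Hom.ext (Category.comp_id _)
  assoc f g h := Hom.ext (Category.assoc _ _ _)

end Prealg

/-- The functor `f_! : Prealg(X) ⥤ Prealg(Y)` for a morphism of preoperads `f : X ⟶ Y`: it keeps
the presheaf and composes the structure maps with `f`. -/
def pushforward {X Y : Preoperad C} (f : X ⟶ Y) : Prealg X ⥤ Prealg Y where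
  obj M :=
    { presheaf := M.presheaf
      τ := fun {S _} α => M.τ α ≫ (Preoperad.Hom.app f S ▷ _)
      naturality_target := fun α β => by
        rw [Category.assoc, ← MonoidalCategory.whisker_exchange, ← Category.assoc,
          M.naturality_target, Category.assoc]
      naturality_source := fun γ hγ α => by
        rw [M.naturality_source γ hγ α, Category.assoc, Category.assoc,
          ← MonoidalCategory.tensorHom_id, ← MonoidalCategory.tensorHom_id,
          MonoidalCategory.tensorHom_comp_tensorHom, MonoidalCategory.tensorHom_comp_tensorHom,
          Category.comp_id, Category.id_comp, Preoperad.Hom.res]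
      unit := fun T => by
        have := M.unit T
        rw [← f.comp_unit, ← Category.id_comp (leafRoot M.presheaf (OTree.rootInc T)),
          ← MonoidalCategory.tensorHom_comp_tensorHom, Category.assoc,
          MonoidalCategory.tensorHom_id] at this
        rw [Category.assoc]
        exact this
      assoc := fun {S R T} α β => by
        have h := M.assoc α β
        have hr : ((Preoperad.Hom.app f S) ⊗ₘ tensMap (fun l : S.Leaf =>
              Preoperad.Hom.app f (R.above (α.toFun l.1)) ▷
                leafTens M.presheaf (OTree.aboveMap β (α.toFun l.1))) S.leaves) ≫
              leafRegroup Y M.presheaf α β =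
            leafRegroup X M.presheaf α β ≫ (((Preoperad.Hom.app f S) ⊗ₘ
              tensMap (fun l : S.Leaf => Preoperad.Hom.app f (R.above (α.toFun l.1)))
                S.leaves) ▷ leafTens M.presheaf β) :=
          regroup_naturality _ _ _ _ _
        rw [Category.assoc, ← MonoidalCategory.comp_whiskerRight, Preoperad.decomp_naturality,
          MonoidalCategory.comp_whiskerRight, ← Category.assoc, h, Category.assoc, Category.assoc,
          ← hr, tensMap_comp, MonoidalCategory.whiskerLeft_comp]
        simp only [Category.assoc]
        congr 1
        rw [MonoidalCategory.tensorHom_def, Category.assoc, whisker_exchange_assoc] }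
  map g := ⟨g.toNatTrans, fun {S T} α => by
    change g.toNatTrans.app (op T) ≫ _ ≫ _ = (_ ≫ _) ≫ _
    rw [← Category.assoc, g.comp_τ, Category.assoc, Category.assoc,
      MonoidalCategory.whisker_exchange]⟩
  map_id _ := rfl
  map_comp _ _ := rfl

/-! ### The endofunctor `H_X` -/

section Aux

variable {A B B' D D' E F M N : C}

lemma tens_aux₁ (p : A ⟶ B ⊗ D) (a : B ⟶ B') (b : D ⟶ E) (c : E ⟶ F) (c' : D ⟶ D') (b' : D' ⟶ F)
    (h : c' ≫ b' = b ≫ c) : (p ≫ (a ⊗ₘ b)) ≫ (B' ◁ c) = (p ≫ (B ◁ c')) ≫ (a ⊗ₘ b') := by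
  rw [Category.assoc, Category.assoc, ← id_tensorHom, ← id_tensorHom, tensorHom_comp_tensorHom,
    tensorHom_comp_tensorHom, h, Category.id_comp, Category.comp_id]

lemma tens_aux₂ (p : A ⟶ B ⊗ D) (a : B ⟶ B') (b : D ⟶ E) (c : B' ⟶ F) (c' : B ⟶ D') (a' : D' ⟶ F)
    (h : c' ≫ a' = a ≫ c) : (p ≫ (a ⊗ₘ b)) ≫ (c ▷ E) = (p ≫ (c' ▷ D)) ≫ (a' ⊗ₘ b) := by
  rw [Category.assoc, Category.assoc, ← tensorHom_id, ← tensorHom_id, tensorHom_comp_tensorHom,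
    tensorHom_comp_tensorHom, h, Category.id_comp, Category.comp_id]

lemma tens_aux₃ (p : A ⟶ B ⊗ D) (u : B ⟶ 𝟙_ C) (c : D ⟶ E) (r' : E ⟶ N) (r : D ⟶ M) (m : M ⟶ N)
    (h : c ≫ r' = r ≫ m) : (p ≫ (B ◁ c)) ≫ (u ⊗ₘ r') ≫ (λ_ N).hom =
      (p ≫ (u ⊗ₘ r) ≫ (λ_ M).hom) ≫ m := by
  rw [Category.assoc, Category.assoc, Category.assoc, ← leftUnitor_naturality, ← id_tensorHom,
    ← id_tensorHom, tensorHom_comp_tensorHom_assoc, tensorHom_comp_tensorHom_assoc, h,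
    Category.id_comp, Category.comp_id]

end Aux

namespace Preoperad

variable [HasLimitsOfSize.{0, 0} C]

/-- The diagram whose limit is the object of invariants in the product of the objects
`X(S) ⊗ ⨂_ℓ V(T_ℓ)` over all `α : S ⟶ T` in `R`: a family `ω` is invariant if
`ω (γ ≫ α) = (γ^* ⊗ id) (ω α)` for all morphisms `γ` of `A`. -/
def index (X : Preoperad C) (V : PshR C) (T : OTree) :
    MulticospanIndex ⟨Σ S : OTree, (S ⟶ T),
      Σ (S S' : OTree) (_ : S' ⟶ T), {γ : S ⟶ S' // OTree.inner γ},
      fun x => ⟨x.1, x.2.2.2.1 ≫ x.2.2.1⟩, fun x => ⟨x.2.1, x.2.2.1⟩⟩ C where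
  left a := X.ob a.1 ⊗ leafTens V a.2
  right x := X.ob x.1 ⊗ leafTens V (x.2.2.2.1 ≫ x.2.2.1)
  fst _ := 𝟙 _
  snd x := X.presheaf.res x.2.2.2.1 x.2.2.2.2 ⊗ₘ leafReindex V x.2.2.2.1 x.2.2.2.2 x.2.2.1

/-- The value of `H_X(V)` at `T`. -/
def HObj (X : Preoperad C) (V : PshR C) (T : OTree) : C := multiequalizer (X.index V T)

/-- The projection of `H_X(V)(T)` onto the factor of `α : S ⟶ T`. -/
def π (X : Preoperad C) (V : PshR C) {S T : OTree} (α : S ⟶ T) :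
    X.HObj V T ⟶ X.ob S ⊗ leafTens V α :=
  Multiequalizer.ι (X.index V T) ⟨S, α⟩

lemma π_inner (X : Preoperad C) (V : PshR C) {S S' T : OTree} (γ : S ⟶ S') (hγ : OTree.inner γ)
    (α : S' ⟶ T) :
    X.π V (γ ≫ α) = X.π V α ≫ (X.presheaf.res γ hγ ⊗ₘ leafReindex V γ hγ α) :=
  (Category.comp_id _).symm.trans
    (Multiequalizer.condition (X.index V T) ⟨S, S', α, γ, hγ⟩)

/-- The map into `H_X(V)(T)` given by an invariant family of maps. -/
def lift (X : Preoperad C) (V : PshR C) {T : OTree} {A : C}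
    (ω : ∀ {S : OTree} (α : S ⟶ T), A ⟶ X.ob S ⊗ leafTens V α)
    (h : ∀ {S S' : OTree} (γ : S ⟶ S') (hγ : OTree.inner γ) (α : S' ⟶ T),
      ω (γ ≫ α) = ω α ≫ (X.presheaf.res γ hγ ⊗ₘ leafReindex V γ hγ α)) : A ⟶ X.HObj V T :=
  Multiequalizer.lift (X.index V T) A (fun a => ω a.2)
    (fun x => (Category.comp_id _).trans (h x.2.2.2.1 x.2.2.2.2 x.2.2.1))

lemma lift_π (X : Preoperad C) (V : PshR C) {S T : OTree} {A : C}
    (ω : ∀ {S : OTree} (α : S ⟶ T), A ⟶ X.ob S ⊗ leafTens V α)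
    (h : ∀ {S S' : OTree} (γ : S ⟶ S') (hγ : OTree.inner γ) (α : S' ⟶ T),
      ω (γ ≫ α) = ω α ≫ (X.presheaf.res γ hγ ⊗ₘ leafReindex V γ hγ α)) (α : S ⟶ T) :
    X.lift V ω h ≫ X.π V α = ω α :=
  Multiequalizer.lift_ι _ _ _ _ _

lemma HObj_ext (X : Preoperad C) (V : PshR C) {T : OTree} {A : C} {f g : A ⟶ X.HObj V T}
    (h : ∀ {S : OTree} (α : S ⟶ T), f ≫ X.π V α = g ≫ X.π V α) : f = g :=
  Multiequalizer.hom_ext _ _ _ fun a => h a.2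

/-- The restriction map `H_X(V)(T') ⟶ H_X(V)(T)` along `β : T ⟶ T'`. -/
def HRes (X : Preoperad C) (V : PshR C) {T T' : OTree} (β : T ⟶ T') : X.HObj V T' ⟶ X.HObj V T :=
  X.lift V (fun {S} α => X.π V (α ≫ β) ≫ (X.ob S ◁ leafRestrict V α β))
    (fun γ hγ α => (congrArg (fun z => z ≫ _) (X.π_inner V γ hγ (α ≫ β))).trans
      (tens_aux₁ _ _ _ _ _ _ (leafReindex_restrict V γ hγ α β)))

lemma HRes_π (X : Preoperad C) (V : PshR C) {S T T' : OTree} (α : S ⟶ T) (β : T ⟶ T') :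
    X.HRes V β ≫ X.π V α = X.π V (α ≫ β) ≫ (X.ob S ◁ leafRestrict V α β) :=
  Multiequalizer.lift_ι _ _ _ _ _

lemma HRes_id (X : Preoperad C) (V : PshR C) (T : OTree) : X.HRes V (𝟙 T) = 𝟙 _ := by
  refine X.HObj_ext V fun {S} α => ?_
  rw [HRes_π, leafRestrict_id, Category.id_comp]
  exact (congrArg (fun z => X.π V α ≫ z) (whiskerLeft_id _ _)).trans (Category.comp_id _)

lemma HRes_comp (X : Preoperad C) (V : PshR C) {T T' T'' : OTree} (β : T ⟶ T') (β' : T' ⟶ T'') :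
    X.HRes V (β ≫ β') = X.HRes V β' ≫ X.HRes V β := by
  refine X.HObj_ext V fun {S} α => ?_
  rw [HRes_π, Category.assoc, X.HRes_π V α β]
  refine Eq.trans (Eq.trans ?_ (Category.assoc _ _ _).symm)
    ((congrArg (fun z => z ≫ _) (X.HRes_π V (α ≫ β) β').symm).trans (Category.assoc _ _ _))
  exact congrArg (fun z => X.π V (α ≫ β ≫ β') ≫ z)
    ((congrArg (fun z => X.ob S ◁ z) (leafRestrict_comp V α β β')).trans (whiskerLeft_comp _ _ _))

/-- The map `H_X(V)(T) ⟶ H_X(W)(T)` induced by `V ⟶ W`. -/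
def HTensMap (X : Preoperad C) {V W : PshR C} (f : V ⟶ W) (T : OTree) : X.HObj V T ⟶ X.HObj W T :=
  X.lift W (fun {S} α => X.π V α ≫ (X.ob S ◁ leafTensMap f α))
    (fun γ hγ α => (congrArg (fun z => z ≫ _) (X.π_inner V γ hγ α)).trans
      (tens_aux₁ _ _ _ _ _ _ (leafReindex_naturality f γ hγ α)))

lemma HTensMap_π (X : Preoperad C) {V W : PshR C} (f : V ⟶ W) {S T : OTree} (α : S ⟶ T) :
    X.HTensMap f T ≫ X.π W α = X.π V α ≫ (X.ob S ◁ leafTensMap f α) :=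
  Multiequalizer.lift_ι _ _ _ _ _

lemma HTensMap_id (X : Preoperad C) (V : PshR C) (T : OTree) : X.HTensMap (𝟙 V) T = 𝟙 _ := by
  refine X.HObj_ext V fun {S} α => ?_
  rw [HTensMap_π, leafTensMap_id, whiskerLeft_id, Category.comp_id, Category.id_comp]

lemma HTensMap_comp (X : Preoperad C) {U V W : PshR C} (f : U ⟶ V) (g : V ⟶ W) (T : OTree) :
    X.HTensMap (f ≫ g) T = X.HTensMap f T ≫ X.HTensMap g T := by
  refine X.HObj_ext W fun {S} α => ?_
  rw [HTensMap_π, Category.assoc, HTensMap_π, ← Category.assoc, HTensMap_π, Category.assoc,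
    leafTensMap_comp, whiskerLeft_comp]

lemma HRes_HTensMap (X : Preoperad C) {V W : PshR C} (f : V ⟶ W) {T T' : OTree} (β : T ⟶ T') :
    X.HRes V β ≫ X.HTensMap f T = X.HTensMap f T' ≫ X.HRes W β := by
  refine X.HObj_ext W fun {S} α => ?_
  rw [Category.assoc, Category.assoc, HTensMap_π, HRes_π, ← Category.assoc, HRes_π,
    ← Category.assoc, HTensMap_π, Category.assoc, Category.assoc, ← whiskerLeft_comp,
    ← whiskerLeft_comp, leafTensMap_restrict]

/-- The functor `H_X` from the category of presheaves on `R` to itself. -/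
def H (X : Preoperad C) : PshR C ⥤ PshR C where
  obj V :=
    { obj T := X.HObj V T.unop
      map β := X.HRes V β.unop
      map_id T := X.HRes_id V T.unop
      map_comp β β' := X.HRes_comp V β'.unop β.unop }
  map f :=
    { app T := X.HTensMap f T.unop
      naturality _ _ β := X.HRes_HTensMap f β.unop }
  map_id V := NatTrans.ext (funext fun T => X.HTensMap_id V T.unop)
  map_comp f g := NatTrans.ext (funext fun T => X.HTensMap_comp f g T.unop)

/-- The counit at `T`, for `α` the inclusion of the root of `T`. -/
def counitApp (X : Preoperad C) (V : PshR C) {T : OTree} (α : OTree.eta ⟶ T) :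
    X.HObj V T ⟶ V.obj (op T) :=
  X.π V α ≫ (X.unit.hom ⊗ₘ leafRoot V α) ≫ (λ_ _).hom

lemma counitApp_eq (X : Preoperad C) (V : PshR C) {T : OTree} (α : OTree.eta ⟶ T) :
    X.counitApp V α = X.counitApp V (OTree.rootInc T) := by rw [OTree.eq_rootInc α]

/-- The counit `H_X(V) ⟶ V`: the projection onto the factor of the inclusion of the root. -/
def counit (X : Preoperad C) : X.H ⟶ 𝟭 (PshR C) where
  app V :=
    { app T := X.counitApp V (OTree.rootInc T.unop)
      naturality T' T β := by
        have h : X.HRes V β.unop ≫ X.counitApp V (OTree.rootInc T.unop) =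
            X.counitApp V (OTree.rootInc T.unop ≫ β.unop) ≫ V.map β.unop.op := by
          rw [counitApp, ← Category.assoc, HRes_π]
          exact tens_aux₃ _ _ _ _ _ _ (leafRoot_restrict V _ β.unop)
        rw [X.counitApp_eq V (OTree.rootInc T.unop ≫ β.unop)] at h
        exact h }
  naturality V W f := by
    ext T : 2
    have h : X.HTensMap f T.unop ≫ X.counitApp W (OTree.rootInc T.unop) =
        X.counitApp V (OTree.rootInc T.unop) ≫ f.app (op T.unop) := by
      rw [counitApp, ← Category.assoc, HTensMap_π]
      exact tens_aux₃ _ _ _ _ _ _ (leafRoot_naturality f _)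
    exact h

/-- The component at `V` and `T` of the map `H_X ⟶ H_Y` induced by `f : X ⟶ Y`. -/
def HmapApp {X Y : Preoperad C} (f : X ⟶ Y) (V : PshR C) (T : OTree) : X.HObj V T ⟶ Y.HObj V T :=
  Y.lift V (fun {S} α => X.π V α ≫ (Hom.app f S ▷ leafTens V α))
    (fun γ hγ α => (congrArg (fun z => z ≫ _) (X.π_inner V γ hγ α)).trans
      (tens_aux₂ _ _ _ _ _ _ (Hom.res f γ hγ).symm))

lemma HmapApp_π {X Y : Preoperad C} (f : X ⟶ Y) (V : PshR C) {S T : OTree} (α : S ⟶ T) :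
    HmapApp f V T ≫ Y.π V α = X.π V α ≫ (Hom.app f S ▷ leafTens V α) :=
  Multiequalizer.lift_ι _ _ _ _ _

/-- The map `H_X ⟶ H_Y` induced by a morphism of preoperads `f : X ⟶ Y`. -/
def Hmap {X Y : Preoperad C} (f : X ⟶ Y) : X.H ⟶ Y.H where
  app V :=
    { app T := HmapApp f V T.unop
      naturality T' T β := by
        have h : X.HRes V β.unop ≫ HmapApp f V T.unop = HmapApp f V T'.unop ≫ Y.HRes V β.unop := by
          refine Y.HObj_ext V fun {S} α => ?_
          rw [Category.assoc, Category.assoc, HmapApp_π, HRes_π, ← Category.assoc, HRes_π,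
            ← Category.assoc, HmapApp_π, Category.assoc, Category.assoc, whisker_exchange]
        exact h }
  naturality V W g := by
    ext T : 2
    have h : X.HTensMap g T.unop ≫ HmapApp f W T.unop =
        HmapApp f V T.unop ≫ Y.HTensMap g T.unop := by
      refine Y.HObj_ext W fun {S} α => ?_
      rw [Category.assoc, Category.assoc, HmapApp_π, HTensMap_π, ← Category.assoc, HTensMap_π,
        ← Category.assoc, HmapApp_π, Category.assoc, Category.assoc, whisker_exchange]
    exact h

/-- The structure map `M ⟶ H_X(M)` of a prealgebra: its component at `α` is that of `M`. -/
def structureMap {X : Preoperad C} (M : Prealg X) : M.presheaf ⟶ X.H.obj M.presheaf where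
  app T := X.lift M.presheaf (fun α => M.τ α) (fun γ hγ α => M.naturality_source γ hγ α)
  naturality T' T β := by
    have h : M.presheaf.map β.unop.op ≫
        X.lift M.presheaf (fun α => M.τ α) (fun γ hγ α => M.naturality_source γ hγ α) =
        X.lift M.presheaf (fun α => M.τ α) (fun γ hγ α => M.naturality_source γ hγ α) ≫
          X.HRes M.presheaf β.unop := by
      refine X.HObj_ext M.presheaf fun {S} α => ?_
      rw [Category.assoc, Category.assoc, lift_π, HRes_π, ← Category.assoc, lift_π,
        M.naturality_target]
    exact h

/-- The property which characterises the comultiplication `δ : H_X ⟶ H_X H_X`: for all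
`S ⟶ R ⟶ T` given by `α` and `β`, the diagram with the following sides commutes:
`H_X(V)(T) ⟶ H_X(H_X(V))(T) ⟶ X(S) ⊗ ⨂_ℓ H_X(V)(T_ℓ) ⟶ X(S) ⊗ ⨂_ℓ (X(R_ℓ) ⊗ ⨂_k V(T_k))` and
`H_X(V)(T) ⟶ X(R) ⊗ ⨂_k V(T_k) ⟶ (X(S) ⊗ ⨂_ℓ X(R_ℓ)) ⊗ ⨂_k V(T_k)`. -/
def IsComult (X : Preoperad C) (δ : X.H ⟶ X.H ⋙ X.H) : Prop :=
  ∀ (V : PshR C) {S R T : OTree} (α : S ⟶ R) (β : R ⟶ T),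
    (δ.app V).app (op T) ≫ X.π (X.H.obj V) (α ≫ β) ≫
        (X.ob S ◁ tensMap (fun l : S.Leaf => X.π V (OTree.aboveMap β (α.toFun l.1))) S.leaves) ≫
        leafRegroup X V α β =
      X.π V β ≫ (X.decomp α ▷ leafTens V β)

end Preoperad

end Preoperads

end

-- The product defining `H_X(V)(T)` runs over all morphisms `α : S ⟶ T`. Each of them is a morphism
-- of `A` followed by the inclusion of a pruning of `T`, and the pruning is determined by the set of
-- images of the leaves of `S`. Invariance therefore leaves one free component for each pruning `P`:
-- `H_X(V)(T)` is the finite direct sum of the objects `X(P) ⊗ ⨂_k V(T_k)` (`sum_π_fromPruning`).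
-- Tensor products distribute over finite direct sums, so a map into `Z ⊗ ⨂_l H_X(V)(T_l)` is the
-- same as a compatible family of maps indexed by the factorisations `S ⟶ R ⟶ T` of `α`
-- (`hom_ext_of_factoring`, `exists_of_factoring`). The condition on `δ` prescribes such a family,
-- once the isomorphism regrouping the tensor factors is inverted, and so `δ` exists and is unique.
--
-- With `δ` and `ε`, the functor `H_X` is a comonad. The two counit laws come from cutting a tree at
-- its leaves and at its root (`decomp_id_evalRoot`, `decomp_rootInc`), coassociativity from the
-- associativity of the decomposition maps of `X` (`decomp_assoc`). Prealgebras over `X` are the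
-- coalgebras of this comonad (`structureMap_comult`, `Prealg.ofCoalgebra`), and `f_!` is
-- composition of the coaction with `H_f`. Its right adjoint is the classical one: the equaliser of
-- the two maps from `H_X(M')` to `H_X H_{X'}(M')` inherits a coaction because `H_X`, and `H_X`
-- applied twice, preserve it (`Cofree.homEquiv`).
--
-- That `H_X` preserves coreflexive equalisers rests on linear algebra over a field. An equaliser of
-- complexes is split in each degree, hence preserved by tensoring with a fixed complex. For
-- coreflexive pairs, the tensor product of several equalisers is again an equaliser
-- (`IsEqualizer.tensor`), and limits commute with equalisers.
--
-- Two kinds of bookkeeping are settled beforehand. Canonical maps between iterated tensor products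
-- are compared by naming the factors with distinct letters: such maps permute letters, and a
-- permutation of distinct letters is determined by its source and target words
-- (`Structural.unique`). The axioms of a preoperad concern a single cut, while the decomposition
-- maps make many; `IsDecomp` records a sequence of cuts, in which neighbouring incomparable edges
-- may be exchanged and nested decompositions merged, and the resulting map depends only on the
-- recorded data (`IsDecomp.unique`).

attribute [reducible] tens

open Opposite

noncomputable section

set_option linter.unusedSectionVars false

/-! ### Coherence for permutations of words with distinct letters -/

section Coherence

variable {C : Type w} [Category.{v} C] [MonoidalCategory C] [SymmetricCategory C]

lemma swapFront_swapFront (A B D : C) : swapFront A B D ≫ swapFront B A D = 𝟙 _ := by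
  simp [swapFront, ← comp_whiskerRight_assoc]

/-- Up to reassociation this is the Yang–Baxter relation of the braiding, whiskered by `E`. -/
lemma swapFront_yangBaxter (A B D E : C) :
    swapFront A B (D ⊗ E) ≫ B ◁ swapFront A D E ≫ swapFront B D (A ⊗ E) =
      A ◁ swapFront B D E ≫ swapFront A D (B ⊗ E) ≫ D ◁ swapFront A B E := by
  have h := congrArg (fun f => (α_ A B (D ⊗ E)).inv ≫ (α_ (A ⊗ B) D E).inv ≫ (α_ A B D).hom ▷ E ≫
    f ▷ E ≫ (α_ D (B ⊗ A) E).hom ≫ D ◁ (α_ B A E).hom) (BraidedCategory.yang_baxter A B D)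
  simp only [swapFront]
  simp only [comp_whiskerRight, whiskerLeft_comp, Category.assoc] at h ⊢
  calc _ = _ := by monoidal
    _ = _ := h
    _ = _ := by monoidal

variable {Q : Type*}

/-- `Insertion i r l` exhibits the list `l` as the list `r` with the letter `i` inserted. -/
inductive Insertion (i : Q) : List Q → List Q → Type _
  | head (l : List Q) : Insertion i l (i :: l)
  | tail (a : Q) {r l : List Q} (h : Insertion i r l) : Insertion i (a :: r) (a :: l)

/-- Moving the inserted letter to the front. -/
def Insertion.map (V : Q → C) {i : Q} : {r l : List Q} → Insertion i r l →
    (tens V l ⟶ V i ⊗ tens V r)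
  | _, _, .head _ => 𝟙 _
  | _, _, .tail (r := r) a h => V a ◁ h.map V ≫ swapFront (V a) (V i) (tens V r)

/-- A rearrangement of a list. -/
inductive Shuffle : List Q → List Q → Type _
  | nil : Shuffle [] []
  | cons {i : Q} {r l l' : List Q} (h : Insertion i r l) (s : Shuffle r l') : Shuffle l (i :: l')

/-- The symmetry isomorphism of a rearrangement. -/
def Shuffle.map (V : Q → C) : {l l' : List Q} → Shuffle l l' → (tens V l ⟶ tens V l')
  | _, _, .nil => 𝟙 _
  | _, _, .cons (i := i) h s => (h.map V ≫ V i ◁ s.map V :)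

lemma Insertion.perm {i : Q} {r l : List Q} (h : Insertion i r l) : l.Perm (i :: r) := by
  induction h with
  | head => rfl
  | tail a h ih => exact (ih.cons a).trans (List.Perm.swap _ _ _)

lemma Shuffle.perm {l l' : List Q} (s : Shuffle l l') : l.Perm l' := by
  induction s with
  | nil => rfl
  | cons h s ih => exact h.perm.trans (ih.cons _)

/-- Two successive extractions can be made in the other order, at the cost of one swap in front. For
a letter passed by both, this is the braid relation. If the extraction of `i` stops at the first
letter, two swaps of `i` and `j` cancel, which uses the symmetry. -/
lemma Insertion.exchange (V : Q → C) {i j : Q} {l m m' : List Q} (h : Insertion j m l)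
    (h' : Insertion i m' m) : ∃ (n : List Q) (k : Insertion i n l) (k' : Insertion j m' n),
      h.map V ≫ V j ◁ h'.map V ≫ swapFront (V j) (V i) (tens V m') =
        k.map V ≫ V i ◁ k'.map V := by
  induction h generalizing m' with
  | head l =>
    exact ⟨_, .tail j h', .head _, by
      change 𝟙 _ ≫ _ = (V j ◁ h'.map V ≫ swapFront _ _ _) ≫ V i ◁ 𝟙 _
      rw [Category.id_comp, whiskerLeft_id, Category.comp_id]⟩
  | @tail a m₀ l₀ h ih =>
    cases h' with
    | head =>
      refine ⟨_, .head _, h, ?_⟩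
      change (V i ◁ h.map V ≫ swapFront (V i) (V j) (tens V m₀)) ≫
        V j ◁ 𝟙 (V i ⊗ tens V m₀) ≫ swapFront _ _ _ = 𝟙 (V i ⊗ tens V l₀) ≫ V i ◁ h.map V
      rw [whiskerLeft_id, Category.id_comp, Category.id_comp, Category.assoc,
        swapFront_swapFront, Category.comp_id]
    | @tail _ m₁ _ h' =>
      obtain ⟨n, k, k', e⟩ := ih h'
      refine ⟨_, .tail a k, .tail a k', ?_⟩
      change (V a ◁ h.map V ≫ swapFront (V a) (V j) (tens V m₀)) ≫
          V j ◁ (V a ◁ h'.map V ≫ swapFront (V a) (V i) (tens V m₁)) ≫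
          swapFront (V j) (V i) (V a ⊗ tens V m₁) =
        (V a ◁ k.map V ≫ swapFront (V a) (V i) (tens V n)) ≫
          V i ◁ (V a ◁ k'.map V ≫ swapFront (V a) (V j) (tens V m₁))
      have n1 := swapFront_naturality (𝟙 (V a)) (𝟙 (V j)) (h'.map V)
      have n2 := swapFront_naturality (𝟙 (V a)) (𝟙 (V i)) (k'.map V)
      simp only [id_tensorHom] at n1 n2
      simp only [whiskerLeft_comp, Category.assoc]
      rw [← reassoc_of% n1, ← reassoc_of% n2, swapFront_yangBaxter, ← whiskerLeft_comp_assoc,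
        ← whiskerLeft_comp_assoc, ← whiskerLeft_comp_assoc]
      simp only [Category.assoc]
      rw [e]

/-- Induction on `s`: a letter which is not the first one of `l'` is extracted after it, and
`Insertion.exchange` swaps the two extractions. -/
lemma Shuffle.insertion (V : Q → C) {i : Q} {l l' r' : List Q} (s : Shuffle l l')
    (h : Insertion i r' l') : ∃ (r : List Q) (k : Insertion i r l) (t : Shuffle r r'),
      s.map V ≫ h.map V = k.map V ≫ V i ◁ t.map V := by
  induction s generalizing r' with
  | nil => cases h
  | @cons j m l l'' g s ih =>
    cases h with
    | head =>
      refine ⟨_, g, s, ?_⟩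
      change (g.map V ≫ V i ◁ s.map V) ≫ 𝟙 (V i ⊗ tens V _) = _
      rw [Category.comp_id]
    | tail _ h =>
      obtain ⟨m', k, t, e⟩ := ih h
      obtain ⟨n, k', k'', e'⟩ := g.exchange V k
      refine ⟨n, k', .cons k'' t, ?_⟩
      change (g.map V ≫ V j ◁ s.map V) ≫ V j ◁ h.map V ≫ swapFront (V j) (V i) (tens V _) =
        k'.map V ≫ V i ◁ (k''.map V ≫ V j ◁ t.map V)
      have n1 := swapFront_naturality (𝟙 (V j)) (𝟙 (V i)) (t.map V)
      simp only [id_tensorHom] at n1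
      rw [Category.assoc, ← whiskerLeft_comp_assoc, e, whiskerLeft_comp, whiskerLeft_comp,
        Category.assoc, n1, ← reassoc_of% e']

/-- The letters of `l''` are pulled back through `s` one at a time, by `Shuffle.insertion`. -/
lemma Shuffle.exists_comp (V : Q → C) {l l' l'' : List Q} (s : Shuffle l l') (t : Shuffle l' l'') :
    ∃ u : Shuffle l l'', s.map V ≫ t.map V = u.map V := by
  induction t generalizing l with
  | nil => exact ⟨s, Category.comp_id _⟩
  | @cons i r l' l'' h t ih =>
    obtain ⟨m, k, s', e⟩ := s.insertion V h
    obtain ⟨u, e'⟩ := ih s'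
    refine ⟨.cons k u, ?_⟩
    change s.map V ≫ h.map V ≫ V i ◁ t.map V = k.map V ≫ V i ◁ u.map V
    rw [reassoc_of% e, ← whiskerLeft_comp, e']

lemma Shuffle.exists_id (V : Q → C) (l : List Q) : ∃ u : Shuffle l l, u.map V = 𝟙 _ := by
  induction l with
  | nil => exact ⟨.nil, rfl⟩
  | cons i l ih =>
    obtain ⟨u, hu⟩ := ih
    refine ⟨.cons (.head l) u, ?_⟩
    change 𝟙 _ ≫ V i ◁ u.map V = 𝟙 (V i ⊗ tens V l)
    rw [hu, whiskerLeft_id, Category.comp_id]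

lemma Insertion.eq_of_nodup {i : Q} {r r' l : List Q} (h : Insertion i r l) (h' : Insertion i r' l)
    (hl : l.Nodup) : ∃ e : r = r', e ▸ h = h' := by
  induction h generalizing r' with
  | head l =>
    cases h' with
    | head => exact ⟨rfl, rfl⟩
    | tail _ h' => exact absurd (h'.perm.symm.subset List.mem_cons_self) (List.nodup_cons.1 hl).1
  | @tail a r l h ih =>
    cases h' with
    | head => exact absurd (h.perm.symm.subset List.mem_cons_self) (List.nodup_cons.1 hl).1
    | tail _ h' =>
      obtain ⟨rfl, rfl⟩ := ih h' (List.nodup_cons.1 hl).2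
      exact ⟨rfl, rfl⟩

/-- A letter occurring once can be extracted in one way only, so every choice made by a shuffle is
forced. This is the coherence theorem that the rest relies on. -/
lemma Shuffle.eq_of_nodup {l l' : List Q} (s t : Shuffle l l') (hl : l.Nodup) : s = t := by
  induction s with
  | nil => cases t; rfl
  | cons h s ih =>
    cases t with
    | cons h' t =>
      obtain ⟨rfl, rfl⟩ := h.eq_of_nodup h' hl
      rw [ih t (List.nodup_cons.1 (h.perm.nodup_iff.1 hl)).2]

/-- The map `w` undoes the swaps in reverse order, each swap being inverse to the opposite one. It
is itself a shuffle: the letters of `l` are extracted in turn from `i :: r`. -/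
lemma Insertion.exists_inverse (V : Q → C) {i : Q} {r l : List Q} (h : Insertion i r l) :
    ∃ (u : Shuffle (i :: r) l) (w : V i ⊗ tens V r ⟶ tens V l), u.map V = w ∧
      h.map V ≫ w = 𝟙 _ ∧ w ≫ h.map V = 𝟙 _ := by
  induction h with
  | head l =>
    obtain ⟨u, hu⟩ := Shuffle.exists_id V (i :: l)
    exact ⟨u, _, rfl, (Category.id_comp _).trans hu, (Category.comp_id _).trans hu⟩
  | @tail a r l h ih =>
    obtain ⟨u, w, hw, hu, hu'⟩ := ih
    refine ⟨.cons (.tail i (.head r)) u, swapFront (V i) (V a) (tens V r) ≫ V a ◁ w, ?_, ?_, ?_⟩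
    · change (V i ◁ 𝟙 (V a ⊗ tens V r) ≫ swapFront (V i) (V a) (tens V r)) ≫ V a ◁ u.map V = _
      rw [whiskerLeft_id, Category.id_comp]
      exact congrArg (fun z => swapFront (V i) (V a) (tens V r) ≫ V a ◁ z) hw
    · change (V a ◁ h.map V ≫ swapFront (V a) (V i) (tens V r)) ≫
        swapFront (V i) (V a) (tens V r) ≫ V a ◁ w = 𝟙 (V a ⊗ tens V l)
      rw [Category.assoc, reassoc_of% swapFront_swapFront, ← whiskerLeft_comp, hu, whiskerLeft_id]
    · change (swapFront (V i) (V a) (tens V r) ≫ V a ◁ w) ≫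
        (V a ◁ h.map V ≫ swapFront (V a) (V i) (tens V r)) = 𝟙 (V i ⊗ V a ⊗ tens V r)
      rw [Category.assoc, ← whiskerLeft_comp_assoc, hu', whiskerLeft_id, Category.id_comp,
        swapFront_swapFront]

lemma Shuffle.exists_inverse (V : Q → C) {l l' : List Q} (s : Shuffle l l') :
    ∃ u : Shuffle l' l, s.map V ≫ u.map V = 𝟙 _ ∧ u.map V ≫ s.map V = 𝟙 _ := by
  induction s with
  | nil => exact ⟨.nil, Category.comp_id _, Category.comp_id _⟩
  | @cons i r l l' h s ih =>
    obtain ⟨u, hu, hu'⟩ := ih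
    obtain ⟨t, w, hw, ht, ht'⟩ := h.exists_inverse V
    obtain ⟨t', e⟩ := Shuffle.exists_comp V (.cons (.head l') u) t
    have e' : t'.map V = V i ◁ u.map V ≫ w := by
      rw [← hw]
      exact e.symm.trans (congrArg (fun z => z ≫ t.map V) (Category.id_comp (V i ◁ u.map V)))
    refine ⟨t', ?_, ?_⟩
    · refine (congrArg (fun z => (h.map V ≫ V i ◁ s.map V) ≫ z) e').trans ?_
      rw [Category.assoc, ← whiskerLeft_comp_assoc, hu, whiskerLeft_id, Category.id_comp, ht]
    · refine (congrArg (fun z => z ≫ (h.map V ≫ V i ◁ s.map V)) e').trans ?_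
      change (V i ◁ u.map V ≫ w) ≫ h.map V ≫ V i ◁ s.map V = 𝟙 (V i ⊗ tens V l')
      rw [Category.assoc, reassoc_of% ht', ← whiskerLeft_comp, hu', whiskerLeft_id]

end Coherence

/-! ### Structural maps between iterated tensor products -/

section Presentations

variable {C : Type w} [Category.{v} C] [MonoidalCategory C]

/-- Concatenation as an isomorphism. -/
def tensAppendIso {ι : Type*} (V : ι → C) : (l l' : List ι) →
    (tens V l ⊗ tens V l' ≅ tens V (l ++ l'))
  | [], l' => λ_ (tens V l')
  | i :: l, l' => α_ (V i) (tens V l) (tens V l') ≪≫ whiskerLeftIso (V i) (tensAppendIso V l l')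

lemma tensAppendIso_hom {ι : Type*} (V : ι → C) (l l' : List ι) :
    (tensAppendIso V l l').hom = tensAppend V l l' := by
  induction l with
  | nil => rfl
  | cons i l ih =>
    change (α_ _ _ _).hom ≫ V i ◁ (tensAppendIso V l l').hom = (α_ _ _ _).hom ≫ V i ◁ _
    rw [ih]

variable {Q : Type*}

lemma tensAppend_nil (V : Q → C) (l : List Q) : tensAppend V [] l = (λ_ (tens V l)).hom := rfl

lemma tensAppend_cons (V : Q → C) (i : Q) (l l' : List Q) : tensAppend V (i :: l) l' =
    (α_ (V i) (tens V l) (tens V l')).hom ≫ V i ◁ tensAppend V l l' := rfl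

variable [SymmetricCategory C]

lemma Insertion.exists_append (V : Q → C) {i : Q} {r l : List Q} (h : Insertion i r l)
    (l' : List Q) : ∃ k : Insertion i (r ++ l') (l ++ l'), tensAppend V l l' ≫ k.map V =
      h.map V ▷ tens V l' ≫ (α_ _ _ _).hom ≫ V i ◁ tensAppend V r l' := by
  induction h with
  | head l =>
    refine ⟨.head _, ?_⟩
    change tensAppend V (i :: l) l' ≫ 𝟙 _ = 𝟙 (V i ⊗ tens V l) ▷ _ ≫ _
    rw [Category.comp_id, id_whiskerRight, Category.id_comp]
    rfl
  | @tail a r l h ih =>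
    obtain ⟨k, e⟩ := ih
    refine ⟨.tail a k, ?_⟩
    change ((α_ (V a) (tens V l) (tens V l')).hom ≫ V a ◁ tensAppend V l l') ≫
        V a ◁ k.map V ≫ swapFront (V a) (V i) (tens V (r ++ l')) =
      (V a ◁ h.map V ≫ swapFront (V a) (V i) (tens V r)) ▷ tens V l' ≫
        (α_ (V i) (V a ⊗ tens V r) (tens V l')).hom ≫ V i ◁ ((α_ (V a) (tens V r) (tens V l')).hom ≫
          V a ◁ tensAppend V r l')
    have n1 := swapFront_naturality (𝟙 (V a)) (𝟙 (V i)) (tensAppend V r l')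
    simp only [id_tensorHom] at n1
    rw [Category.assoc, ← whiskerLeft_comp_assoc, e]
    simp only [whiskerLeft_comp, Category.assoc, comp_whiskerRight]
    rw [n1]
    simp only [swapFront]
    monoidal

lemma Shuffle.exists_append (V : Q → C) {l₁ l₁' l₂ l₂' : List Q} (s : Shuffle l₁ l₁')
    (t : Shuffle l₂ l₂') : ∃ u : Shuffle (l₁ ++ l₂) (l₁' ++ l₂'),
      tensAppend V l₁ l₂ ≫ u.map V = (s.map V ⊗ₘ t.map V) ≫ tensAppend V l₁' l₂' := by
  induction s with
  | nil =>
    refine ⟨t, ?_⟩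
    change (λ_ (tens V l₂)).hom ≫ t.map V = (𝟙 (𝟙_ C) ⊗ₘ t.map V) ≫ (λ_ (tens V l₂')).hom
    simp
  | @cons i r l l' h s ih =>
    obtain ⟨u, e⟩ := ih
    obtain ⟨k, e'⟩ := h.exists_append V l₂
    refine ⟨.cons k u, ?_⟩
    change tensAppend V l l₂ ≫ k.map V ≫ V i ◁ u.map V = ((h.map V ≫ V i ◁ s.map V) ⊗ₘ t.map V) ≫
      (α_ _ _ _).hom ≫ V i ◁ tensAppend V l' l₂'
    rw [reassoc_of% e', ← whiskerLeft_comp, e]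
    simp only [MonoidalCategory.tensorHom_def]
    monoidal

lemma Shuffle.exists_append_nil (V : Q → C) (l : List Q) : ∃ u : Shuffle (l ++ []) l,
    tensAppend V l [] ≫ u.map V = (ρ_ (tens V l)).hom := by
  induction l with
  | nil =>
    refine ⟨.nil, ?_⟩
    change (λ_ (𝟙_ C)).hom ≫ 𝟙 _ = (ρ_ (𝟙_ C)).hom
    rw [Category.comp_id, unitors_equal]
  | cons i l ih =>
    obtain ⟨u, e⟩ := ih
    refine ⟨.cons (.head _) u, ?_⟩
    change ((α_ (V i) (tens V l) (𝟙_ C)).hom ≫ V i ◁ tensAppend V l []) ≫ 𝟙 _ ≫ V i ◁ u.map V =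
      (ρ_ (V i ⊗ tens V l)).hom
    rw [Category.id_comp, Category.assoc, ← whiskerLeft_comp, e]
    simp

lemma Shuffle.exists_assoc (V : Q → C) (l l' l'' : List Q) :
    ∃ u : Shuffle ((l ++ l') ++ l'') (l ++ (l' ++ l'')),
      tensAppend V l l' ▷ tens V l'' ≫ tensAppend V (l ++ l') l'' ≫ u.map V =
        (α_ _ _ _).hom ≫ tens V l ◁ tensAppend V l' l'' ≫ tensAppend V l (l' ++ l'') := by
  induction l with
  | nil =>
    obtain ⟨u, hu⟩ := Shuffle.exists_id V (l' ++ l'')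
    refine ⟨u, ?_⟩
    refine (congrArg (fun z => tensAppend V [] l' ▷ tens V l'' ≫ tensAppend V l' l'' ≫ z) hu).trans ?_
    change (λ_ (tens V l')).hom ▷ tens V l'' ≫ tensAppend V l' l'' ≫ 𝟙 _ =
      (α_ (𝟙_ C) _ _).hom ≫ 𝟙_ C ◁ tensAppend V l' l'' ≫ (λ_ (tens V (l' ++ l''))).hom
    simp
  | cons i l ih =>
    obtain ⟨u, e⟩ := ih
    refine ⟨.cons (.head _) u, ?_⟩
    change ((α_ (V i) (tens V l) (tens V l')).hom ≫ V i ◁ tensAppend V l l') ▷ tens V l'' ≫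
        ((α_ (V i) (tens V (l ++ l')) (tens V l'')).hom ≫ V i ◁ tensAppend V (l ++ l') l'') ≫
          𝟙 _ ≫ V i ◁ u.map V =
      (α_ (V i ⊗ tens V l) _ _).hom ≫ (V i ⊗ tens V l) ◁ tensAppend V l' l'' ≫
        (α_ (V i) (tens V l) (tens V (l' ++ l''))).hom ≫ V i ◁ tensAppend V l (l' ++ l'')
    have e' := congrArg (fun z => (α_ (V i) (tens V l) (tens V l')).hom ▷ tens V l'' ≫
      (α_ (V i) (tens V l ⊗ tens V l') (tens V l'')).hom ≫ V i ◁ z) e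
    simp only [whiskerLeft_comp] at e'
    simp only [Category.id_comp, comp_whiskerRight, Category.assoc]
    rw [associator_naturality_middle_assoc, e']
    monoidal

lemma Insertion.exists_append_cons (V : Q → C) (l : List Q) (j : Q) (l' : List Q) :
    ∃ k : Insertion j (l ++ l') (l ++ j :: l'), tensAppend V l (j :: l') ≫ k.map V =
      swapFront (tens V l) (V j) (tens V l') ≫ V j ◁ tensAppend V l l' := by
  induction l with
  | nil =>
    refine ⟨.head _, ?_⟩
    change (λ_ (V j ⊗ tens V l')).hom ≫ 𝟙 _ = swapFront (𝟙_ C) _ _ ≫ V j ◁ (λ_ (tens V l')).hom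
    simp [swapFront]
  | cons a l ih =>
    obtain ⟨k, e⟩ := ih
    refine ⟨.tail a k, ?_⟩
    change ((α_ (V a) (tens V l) (V j ⊗ tens V l')).hom ≫ V a ◁ tensAppend V l (j :: l')) ≫
        V a ◁ k.map V ≫ swapFront (V a) (V j) (tens V (l ++ l')) =
      swapFront (V a ⊗ tens V l) (V j) (tens V l') ≫
        V j ◁ ((α_ (V a) (tens V l) (tens V l')).hom ≫ V a ◁ tensAppend V l l')
    have n1 := swapFront_naturality (𝟙 (V a)) (𝟙 (V j)) (tensAppend V l l')
    simp only [id_tensorHom] at n1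
    rw [Category.assoc, ← whiskerLeft_comp_assoc, e]
    simp only [whiskerLeft_comp, Category.assoc]
    rw [n1]
    simp only [swapFront, BraidedCategory.braiding_tensor_left_hom]
    monoidal

/-- The block `l'` crosses `l` one letter at a time; the hexagon axiom breaks up the braiding in the
same way. -/
lemma Shuffle.exists_swap (V : Q → C) (l l' : List Q) : ∃ u : Shuffle (l ++ l') (l' ++ l),
    tensAppend V l l' ≫ u.map V = (β_ (tens V l) (tens V l')).hom ≫ tensAppend V l' l := by
  induction l' with
  | nil =>
    obtain ⟨u, e⟩ := Shuffle.exists_append_nil V l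
    refine ⟨u, e.trans ?_⟩
    change _ = (β_ (tens V l) (𝟙_ C)).hom ≫ (λ_ (tens V l)).hom
    simp
  | cons j l' ih =>
    obtain ⟨u, e⟩ := ih
    obtain ⟨k, e'⟩ := Insertion.exists_append_cons V l j l'
    refine ⟨.cons k u, ?_⟩
    change tensAppend V l (j :: l') ≫ k.map V ≫ V j ◁ u.map V =
      (β_ (tens V l) (V j ⊗ tens V l')).hom ≫ (α_ _ _ _).hom ≫ V j ◁ tensAppend V l' l
    rw [reassoc_of% e', ← whiskerLeft_comp, e]
    simp [swapFront, BraidedCategory.braiding_tensor_right_hom]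

/-- An identification of an object with the tensor product of the letters of a word. -/
structure Presentation (V : Q → C) (A : C) where
  letters : List Q
  iso : A ≅ tens V letters

namespace Presentation

variable {V : Q → C}

def var (q : Q) : Presentation V (V q) := ⟨[q], (ρ_ (V q)).symm⟩

def ofIso {A B : C} (P : Presentation V A) (e : B ≅ A) : Presentation V B :=
  ⟨P.letters, e ≪≫ P.iso⟩

def unit : Presentation V (𝟙_ C) := ⟨[], Iso.refl _⟩

def tensor {A B : C} (P : Presentation V A) (P' : Presentation V B) : Presentation V (A ⊗ B) :=
  ⟨P.letters ++ P'.letters, (P.iso ⊗ᵢ P'.iso) ≪≫ tensAppendIso V _ _⟩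

def list {ι : Type*} {F : ι → C} (p : ∀ i, Presentation V (F i)) :
    (l : List ι) → Presentation V (tens F l)
  | [] => unit
  | i :: l => (p i).tensor (list p l)

lemma list_letters {ι : Type*} {F : ι → C} (p : ∀ i, Presentation V (F i)) (l : List ι) :
    (list p l).letters = l.flatMap fun i => (p i).letters := by
  induction l with
  | nil => rfl
  | cons i l ih =>
    change (p i).letters ++ (list p l).letters = _
    rw [ih, List.flatMap_cons]

end Presentation

/-- A map is structural, with respect to presentations of source and target, if it permutes the
letters. -/
def Structural {V : Q → C} {A B : C} (P : Presentation V A) (P' : Presentation V B) (f : A ⟶ B) :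
    Prop :=
  ∃ s : Shuffle P.letters P'.letters, f ≫ P'.iso.hom = P.iso.hom ≫ s.map V

namespace Structural

variable {V : Q → C} {A B A' B' D E : C} {P : Presentation V A} {P' : Presentation V B}
  {P₂ : Presentation V A'} {P₂' : Presentation V B'} {R : Presentation V D} {R' : Presentation V E}

/-- Read through the presentations, both maps are symmetry isomorphisms of shuffles between the same
two words, and for distinct letters there is only one such shuffle. The coherence identities below
are instances of this, for suitable names of the factors. -/
lemma unique {f g : A ⟶ B} (hf : Structural P P' f) (hg : Structural P P' g)
    (h : P'.letters.Nodup) : f = g := by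
  obtain ⟨s, hs⟩ := hf
  obtain ⟨t, ht⟩ := hg
  rw [← cancel_mono P'.iso.hom, hs, ht, s.eq_of_nodup t (s.perm.nodup_iff.2 h)]

lemma comp {f : A ⟶ B} {g : B ⟶ D} (hf : Structural P P' f) (hg : Structural P' R g) :
    Structural P R (f ≫ g) := by
  obtain ⟨s, hs⟩ := hf
  obtain ⟨t, ht⟩ := hg
  obtain ⟨u, e⟩ := s.exists_comp V t
  exact ⟨u, by rw [Category.assoc, ht, ← e, reassoc_of% hs]⟩

/-- The identity shuffle works. In this way isomorphisms that only change the name of an object,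
such as restrictions between trees with the same edges, do not move any letter. -/
lemma ofLetters {l : List Q} {e : A ≅ tens V l} {e' : B ≅ tens V l} {f : A ⟶ B}
    (h : f ≫ e'.hom = e.hom) : Structural ⟨l, e⟩ ⟨l, e'⟩ f := by
  obtain ⟨u, hu⟩ := Shuffle.exists_id V l
  exact ⟨u, by rw [hu, Category.comp_id]; exact h⟩

lemma fromOfIso (P : Presentation V D) (e : A ≅ D) : Structural (P.ofIso e) P e.hom :=
  ofLetters (by simp)

variable (P) in
lemma id : Structural P P (𝟙 A) := ofLetters (Category.id_comp _)

lemma inv {f : A ⟶ B} [IsIso f] (hf : Structural P P' f) : Structural P' P (CategoryTheory.inv f) := by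
  obtain ⟨s, hs⟩ := hf
  obtain ⟨u, hu, -⟩ := s.exists_inverse V
  refine ⟨u, ?_⟩
  rw [IsIso.inv_comp_eq, reassoc_of% hs, hu, Category.comp_id]

lemma iso_inv {e : A ≅ B} (hf : Structural P P' e.hom) : Structural P' P e.inv := by
  rw [← IsIso.Iso.inv_hom]; exact hf.inv

lemma tensorHom {f : A ⟶ B} {g : A' ⟶ B'} (hf : Structural P P' f) (hg : Structural P₂ P₂' g) :
    Structural (P.tensor P₂) (P'.tensor P₂') (f ⊗ₘ g) := by
  obtain ⟨s, hs⟩ := hf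
  obtain ⟨t, ht⟩ := hg
  obtain ⟨u, e⟩ := s.exists_append V t
  refine ⟨u, ?_⟩
  simp only [Presentation.tensor, Iso.trans_hom, tensorIso_hom, tensAppendIso_hom, Category.assoc,
    e, tensorHom_comp_tensorHom_assoc, hs, ht]

lemma whiskerLeft (R : Presentation V D) {f : A ⟶ B} (hf : Structural P P' f) :
    Structural (R.tensor P) (R.tensor P') (D ◁ f) := by
  rw [← id_tensorHom]; exact (id R).tensorHom hf

lemma whiskerRight {f : A ⟶ B} (hf : Structural P P' f) (R : Presentation V D) :
    Structural (P.tensor R) (P'.tensor R) (f ▷ D) := by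
  rw [← tensorHom_id]; exact hf.tensorHom (id R)

variable (P P' R)

lemma associator : Structural ((P.tensor P').tensor R) (P.tensor (P'.tensor R)) (α_ A B D).hom := by
  obtain ⟨u, e⟩ := Shuffle.exists_assoc V P.letters P'.letters R.letters
  refine ⟨u, ?_⟩
  simp only [Presentation.tensor, Iso.trans_hom, tensorIso_hom, tensAppendIso_hom, Category.assoc]
  have h : ((P.iso.hom ⊗ₘ P'.iso.hom) ≫ tensAppend V _ _ ⊗ₘ R.iso.hom) ≫
      tensAppend V (P.letters ++ P'.letters) R.letters ≫ u.map V =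
      ((P.iso.hom ⊗ₘ P'.iso.hom) ⊗ₘ R.iso.hom) ≫ tensAppend V P.letters P'.letters ▷ _ ≫
        tensAppend V (P.letters ++ P'.letters) R.letters ≫ u.map V := by
    rw [← tensorHom_id, tensorHom_comp_tensorHom_assoc, Category.comp_id]
  rw [h, e, associator_naturality_assoc, ← id_tensorHom, tensorHom_comp_tensorHom_assoc,
    Category.comp_id]

lemma associator_inv :
    Structural (P.tensor (P'.tensor R)) ((P.tensor P').tensor R) (α_ A B D).inv :=
  (associator P P' R).iso_inv

lemma braiding : Structural (P.tensor P') (P'.tensor P) (β_ A B).hom := by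
  obtain ⟨u, e⟩ := Shuffle.exists_swap V P.letters P'.letters
  refine ⟨u, ?_⟩
  simp [Presentation.tensor, tensAppendIso_hom, e]

lemma leftUnitor : Structural (Presentation.unit.tensor P) P (λ_ A).hom := by
  obtain ⟨u, hu⟩ := Shuffle.exists_id V P.letters
  refine ⟨u, ?_⟩
  change _ = ((𝟙 (𝟙_ C) ⊗ₘ P.iso.hom) ≫ (λ_ (tens V P.letters)).hom) ≫ u.map V
  rw [hu]
  simp

lemma leftUnitor_inv : Structural P (Presentation.unit.tensor P) (λ_ A).inv :=
  (leftUnitor P).iso_inv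

lemma rightUnitor : Structural (P.tensor Presentation.unit) P (ρ_ A).hom := by
  obtain ⟨u, e⟩ := Shuffle.exists_append_nil V P.letters
  refine ⟨u, ?_⟩
  change _ = ((P.iso.hom ⊗ₘ 𝟙 (𝟙_ C)) ≫ (tensAppendIso V P.letters []).hom) ≫ u.map V
  rw [tensAppendIso_hom, Category.assoc, e]
  simp

lemma swapFront : Structural (P.tensor (P'.tensor R)) (P'.tensor (P.tensor R)) (swapFront A B D) :=
  (associator_inv P P' R).comp (((braiding P P').whiskerRight R).comp (associator P' P R))

lemma tensorμ : Structural ((P.tensor P').tensor (R.tensor R'))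
    ((P.tensor R).tensor (P'.tensor R')) (tensorμ A B D E) :=
  (associator _ _ _).comp (((associator_inv P' R R').whiskerLeft P).comp
    ((((braiding P' R).whiskerRight R').whiskerLeft P).comp
      (((associator R P' R').whiskerLeft P).comp (associator_inv _ _ _))))

variable {P P' R}
variable {ι κ : Type*}

lemma eqToHom {F : ι → C} (p : ∀ i, Presentation V (F i)) {i j : ι} (h : i = j) :
    Structural (p i) (p j) (eqToHom (congrArg F h)) := by
  subst h; exact id _

lemma tensMap {F G : ι → C} {p : ∀ i, Presentation V (F i)} {q : ∀ i, Presentation V (G i)}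
    {f : ∀ i, F i ⟶ G i} (h : ∀ i, Structural (p i) (q i) (f i)) (l : List ι) :
    Structural (.list p l) (.list q l) (tensMap f l) := by
  induction l with
  | nil => exact id _
  | cons i l ih => exact (h i).tensorHom ih

lemma tensRelabel {F : κ → C} (p : ∀ i, Presentation V (F i)) (g : ι → κ) (l : List ι) :
    Structural (.list p (l.map g)) (.list (fun i => p (g i)) l) (tensRelabel g F l).hom := by
  induction l with
  | nil => exact id _
  | cons i l ih => exact ih.whiskerLeft (p (g i))

lemma tensAppend {F : ι → C} (p : ∀ i, Presentation V (F i)) (l l' : List ι) :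
    Structural ((Presentation.list p l).tensor (.list p l')) (.list p (l ++ l'))
      (tensAppend F l l') := by
  induction l with
  | nil => exact leftUnitor _
  | cons i l ih => exact (associator (p i) _ _).comp (ih.whiskerLeft (p i))

lemma tensExtract {F : ι → C} (p : ∀ i, Presentation V (F i)) (l : List ι) (n : ℕ)
    (h : n < l.length) :
    Structural (.list p l) ((p l[n]).tensor (.list p (l.eraseIdx n))) (tensExtract F l n h) := by
  induction l generalizing n with
  | nil => exact absurd h (Nat.not_lt_zero _)
  | cons i l ih =>
    cases n with
    | zero => exact id _
    | succ n => exact ((ih n (Nat.lt_of_succ_lt_succ h)).whiskerLeft (p i)).comp (swapFront _ _ _)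

lemma tensPerm {F : ι → C} (p : ∀ i, Presentation V (F i)) (l l' : List ι) (h : l.Perm l') :
    Structural (.list p l) (.list p l') (tensPerm F l l' h) := by
  induction l' generalizing l with
  | nil =>
    obtain rfl := h.eq_nil
    exact id _
  | cons i l' ih =>
    classical
    have hi : i ∈ l := h.symm.subset (List.mem_cons_self)
    have hn : l.idxOf i < l.length := List.idxOf_lt_length_iff.2 hi
    exact (tensExtract p l _ _).comp ((eqToHom p (List.getElem_idxOf hn)).tensorHom (ih _ _))

lemma tensReindex {F : ι → C} (p : ∀ i, Presentation V (F i)) (g : κ → ι) {l : List ι}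
    {l' : List κ} (h : (l'.map g).Perm l) :
    Structural (.list p l) (.list (fun k => p (g k)) l') (tensReindex F g h) :=
  (tensPerm p _ _ _).comp (tensRelabel p g l')

lemma tensSingle {F : ι → C} (p : ∀ i, Presentation V (F i)) (i : ι) :
    Structural (.list p [i]) (p i) (tensSingle F i) := rightUnitor _

lemma tensFlatten {κ : ι → Type*} {F : (Σ i, κ i) → C} (p : ∀ x, Presentation V (F x))
    (m : (i : ι) → List (κ i)) (l : List ι) :
    Structural (.list (fun i => .list (fun k => p ⟨i, k⟩) (m i)) l) (.list p (l.sigma m))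
      (tensFlatten F m l) := by
  induction l with
  | nil => exact id _
  | cons i l ih =>
    exact (((tensRelabel p (Sigma.mk i) (m i)).iso_inv).tensorHom ih).comp (tensAppend p _ _)

lemma tensUnzip {F G : ι → C} (p : ∀ i, Presentation V (F i)) (q : ∀ i, Presentation V (G i))
    (l : List ι) : Structural (.list (fun i => (p i).tensor (q i)) l)
      ((Presentation.list p l).tensor (.list q l)) (tensUnzip F G l) := by
  induction l with
  | nil => exact leftUnitor_inv _
  | cons i l ih =>
    exact (ih.whiskerLeft ((p i).tensor (q i))).comp (tensorμ _ _ _)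

/-- The maps `b i k` only have to be structural, which leaves room for comparison isomorphisms
between iterated and simple subtrees. -/
lemma regroup {σ : Type*} {κ : ι → Type*} {A₀ : C} {A : ι → C} {B : (i : ι) → κ i → C}
    {D : σ → C} {m : (i : ι) → List (κ i)} {l : List ι} {l' : List σ} {g : (Σ i, κ i) → σ}
    {b : ∀ (i : ι) (k : κ i), B i k ⟶ D (g ⟨i, k⟩)} (h : ((l.sigma m).map g).Perm l')
    (p₀ : Presentation V A₀) (p : ∀ i, Presentation V (A i)) {q : ∀ i k, Presentation V (B i k)}
    {q' : ∀ s, Presentation V (D s)} (hb : ∀ i k, Structural (q i k) (q' (g ⟨i, k⟩)) (b i k)) :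
    Structural (p₀.tensor (.list (fun i => (p i).tensor (.list (q i) (m i))) l))
      ((p₀.tensor (.list p l)).tensor (.list q' l')) (regroup A₀ A g b h) :=
  ((tensUnzip p (fun i => .list (q i) (m i)) l).whiskerLeft p₀).comp
    ((associator_inv _ _ _).comp
      (((tensMap (fun i => tensMap (hb i) (m i)) l).comp
        ((tensFlatten (fun x => q' (g x)) m l).comp
          ((tensRelabel q' g _).iso_inv.comp (tensPerm q' _ _ h)))).whiskerLeft _))

end Structural

end Presentations

/-! ### Cutting a tree at one edge, up to trees with the same edges -/

namespace OTree

lemma Same.refl (T : OTree) : Same T T := ⟨fun _ => Iff.rfl, rfl, fun _ _ _ _ => Iff.rfl⟩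

lemma Same.trans {S T U : OTree} (h : Same S T) (h' : Same T U) : Same S U where
  mem_iff x := (h.mem_iff x).trans (h'.mem_iff x)
  root := h.root.trans h'.root
  le_iff x hx y hy := (h.le_iff x hx y hy).trans
    (h'.le_iff x ((h.mem_iff x).1 hx) y ((h.mem_iff y).1 hy))

/-- `A` is the tree which is left after cutting `T` at `e`. -/
structure IsCut (T A : OTree) (e : ℕ) : Prop where
  mem : e ∈ T.edges
  mem_iff : ∀ x, x ∈ A.edges ↔ x ∈ T.edges ∧ (T.le e x → x = e)
  root : A.root = T.root
  le_iff : ∀ x ∈ A.edges, ∀ y ∈ A.edges, A.le x y ↔ T.le x y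

/-- `B` is the subtree of `T` above `e`. -/
structure IsAbove (T B : OTree) (e : ℕ) : Prop where
  mem : e ∈ T.edges
  mem_iff : ∀ x, x ∈ B.edges ↔ x ∈ T.edges ∧ T.le e x
  root : B.root = e
  le_iff : ∀ x ∈ B.edges, ∀ y ∈ B.edges, B.le x y ↔ T.le x y

variable {T A B : OTree} {e e' : ℕ}

lemma IsCut.same (h : IsCut T A e) : Same A (T.cut [⟨e, h.mem⟩]) where
  mem_iff x := by rw [h.mem_iff, mem_cut]; simp
  root := h.root
  le_iff := h.le_iff

lemma IsAbove.same (h : IsAbove T B e) : Same B (T.above ⟨e, h.mem⟩) where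
  mem_iff x := by rw [h.mem_iff, mem_above]
  root := h.root
  le_iff := h.le_iff

lemma isCut_cut (T : OTree) (e : T.Edge) : IsCut T (T.cut [e]) e.1 where
  mem := e.2
  mem_iff x := by rw [mem_cut]; simp
  root := rfl
  le_iff _ _ _ _ := Iff.rfl

lemma isAbove_above (T : OTree) (e : T.Edge) : IsAbove T (T.above e) e.1 where
  mem := e.2
  mem_iff _ := mem_above
  root := rfl
  le_iff _ _ _ _ := Iff.rfl

lemma IsCut.of_same {T' A' : OTree} (h : IsCut T A e) (hT : Same T' T) (hA : Same A' A) :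
    IsCut T' A' e where
  mem := (hT.mem_iff e).2 h.mem
  mem_iff x := by
    rw [hA.mem_iff, h.mem_iff, hT.mem_iff]
    refine and_congr_right fun hx => ?_
    rw [hT.le_iff _ ((hT.mem_iff e).2 h.mem) _ ((hT.mem_iff x).2 hx)]
  root := by rw [hA.root, hT.root, h.root]
  le_iff x hx y hy := by
    have hx' := (hA.mem_iff x).1 hx
    have hy' := (hA.mem_iff y).1 hy
    rw [hA.le_iff x hx y hy, h.le_iff x hx' y hy', hT.le_iff _ ((hT.mem_iff x).2
      ((h.mem_iff x).1 hx').1) _ ((hT.mem_iff y).2 ((h.mem_iff y).1 hy').1)]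

lemma IsAbove.of_same {T' B' : OTree} (h : IsAbove T B e) (hT : Same T' T) (hB : Same B' B) :
    IsAbove T' B' e where
  mem := (hT.mem_iff e).2 h.mem
  mem_iff x := by
    rw [hB.mem_iff, h.mem_iff, hT.mem_iff]
    refine and_congr_right fun hx => ?_
    rw [hT.le_iff _ ((hT.mem_iff e).2 h.mem) _ ((hT.mem_iff x).2 hx)]
  root := by rw [hB.root, h.root]
  le_iff x hx y hy := by
    have hx' := (hB.mem_iff x).1 hx
    have hy' := (hB.mem_iff y).1 hy
    rw [hB.le_iff x hx y hy, h.le_iff x hx' y hy', hT.le_iff _ ((hT.mem_iff x).2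
      ((h.mem_iff x).1 hx').1) _ ((hT.mem_iff y).2 ((h.mem_iff y).1 hy').1)]

/-- `a : A ⟶ A'` is a restriction of `f : T ⟶ T'`. -/
def Restricts {A A' T T' : OTree} (a : A ⟶ A') (f : T ⟶ T') : Prop :=
  ∀ x : A.Edge, ∃ h : x.1 ∈ T.edges, (a.toFun x).1 = (f.toFun ⟨x.1, h⟩).1

lemma hom_ext_val {S T : OTree} {f g : S ⟶ T} (h : ∀ x, (f.toFun x).1 = (g.toFun x).1) : f = g :=
  Hom.ext (funext fun x => Subtype.ext (h x))

lemma Restricts.eq {A A' T T' : OTree} {a a' : A ⟶ A'} {f : T ⟶ T'} (h : Restricts a f)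
    (h' : Restricts a' f) : a = a' :=
  hom_ext_val fun x => by
    obtain ⟨_, e⟩ := h x
    obtain ⟨_, e'⟩ := h' x
    rw [e, e']

lemma exists_cutMap {T T' A A' : OTree} {f : T ⟶ T'} (hf : inner f) {e e' : ℕ} (h : IsCut T A e)
    (h' : IsCut T' A' e') (he : (f.toFun ⟨e, h.mem⟩).1 = e') :
    ∃ a : A ⟶ A', inner a ∧ Restricts a f := by
  subst he
  exact ⟨h.same.hom ≫ cutMap f ⟨e, h.mem⟩ ≫ h'.same.symm.hom,
    inner.comp_mem _ _ h.same.inner (inner.comp_mem _ _ (cutMap_inner f hf _) h'.same.symm.inner),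
    fun x => ⟨((h.mem_iff _).1 x.2).1, rfl⟩⟩

end OTree

/-! ### Splitting the value of a preoperad at one edge -/

section

variable {C : Type w} [Category.{v} C] [MonoidalCategory C] [SymmetricCategory C]

lemma PshA.res_comp (X : PshA C) {S T U : OTree} (f : S ⟶ T) (hf : OTree.inner f) (g : T ⟶ U)
    (hg : OTree.inner g) (hfg : OTree.inner (f ≫ g)) :
    X.res (f ≫ g) hfg = X.res g hg ≫ X.res f hf :=
  X.map_comp (Quiver.Hom.op (X := (⟨T⟩ : WideSubcategory OTree.inner)) (Y := ⟨U⟩) ⟨g, hg⟩)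
    (Quiver.Hom.op (X := (⟨S⟩ : WideSubcategory OTree.inner)) (Y := ⟨T⟩) ⟨f, hf⟩)

lemma PshA.res_id (X : PshA C) (T : OTree) (h : OTree.inner (𝟙 T)) : X.res (𝟙 T) h = 𝟙 _ :=
  X.map_id _

lemma PshA.res_res (X : PshA C) {S T U : OTree} (f : S ⟶ T) (hf : OTree.inner f) (g : T ⟶ U)
    (hg : OTree.inner g) (k : S ⟶ U) (hk : OTree.inner k) (h : f ≫ g = k) :
    X.res g hg ≫ X.res f hf = X.res k hk := by
  subst h; exact (X.res_comp f hf g hg hk).symm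

lemma PshA.resSame_trans (X : PshA C) {S T U : OTree} (h : OTree.Same S T) (h' : OTree.Same T U) :
    X.resSame h' ≫ X.resSame h = X.resSame (h.trans h') :=
  X.res_res _ _ _ _ _ _ rfl

lemma PshA.resSame_refl (X : PshA C) {S : OTree} (h : OTree.Same S S) :
    X.resSame h = 𝟙 _ := X.res_id _ _

namespace Preoperad

open OTree

variable (X : Preoperad C)

/-- The decomposition of `X(T)` given by cutting at an edge, for any choice of the two parts. -/
def split {T A B : OTree} {e : ℕ} (h : IsCut T A e) (h' : IsAbove T B e) :
    X.ob T ⟶ X.ob A ⊗ X.ob B :=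
  X.θ T ⟨e, h.mem⟩ ≫ (X.presheaf.resSame h.same ⊗ₘ X.presheaf.resSame h'.same)

/-- The parts are arbitrary trees with the right edges, and `a`, `b` are only asked to restrict `f`.
The axiom for the standard parts transfers because a morphism of trees is determined by its effect
on edges. -/
lemma split_naturality {T T' A A' B B' : OTree} {e e' : ℕ} {f : T ⟶ T'} (hf : inner f)
    (hA : IsCut T A e) (hB : IsAbove T B e) (hA' : IsCut T' A' e') (hB' : IsAbove T' B' e')
    (he : (f.toFun ⟨e, hA.mem⟩).1 = e') {a : A ⟶ A'} (ha : inner a) (haf : Restricts a f)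
    {b : B ⟶ B'} (hb : inner b) (hbf : Restricts b f) :
    X.presheaf.res f hf ≫ X.split hA hB =
      X.split hA' hB' ≫ (X.presheaf.res a ha ⊗ₘ X.presheaf.res b hb) := by
  subst he
  rw [split, split, ← reassoc_of% X.naturality f hf ⟨e, hA.mem⟩, Category.assoc,
    tensorHom_comp_tensorHom, tensorHom_comp_tensorHom]
  congr 2
  · refine (PshA.res_res _ _ _ _ _ (a ≫ hA'.same.hom)
      (inner.comp_mem _ _ ha hA'.same.inner) ?_).trans (PshA.res_comp _ _ _ _ _ _)
    refine hom_ext_val fun x => ?_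
    obtain ⟨_, h⟩ := haf x
    exact h.symm
  · refine (PshA.res_res _ _ _ _ _ (b ≫ hB'.same.hom)
      (inner.comp_mem _ _ hb hB'.same.inner) ?_).trans (PshA.res_comp _ _ _ _ _ _)
    refine hom_ext_val fun x => ?_
    obtain ⟨_, h⟩ := hbf x
    exact h.symm

lemma split_same {T T' A A' B B' : OTree} {e : ℕ} (hT : Same T T') (hA : IsCut T A e)
    (hB : IsAbove T B e) (hA' : IsCut T' A' e) (hB' : IsAbove T' B' e) (hAA' : Same A A')
    (hBB' : Same B B') : X.presheaf.resSame hT ≫ X.split hA hB =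
      X.split hA' hB' ≫ (X.presheaf.resSame hAA' ⊗ₘ X.presheaf.resSame hBB') :=
  X.split_naturality _ hA hB hA' hB' rfl _ (fun x => ⟨((hA.mem_iff _).1 x.2).1, rfl⟩) _
    (fun x => ⟨((hB.mem_iff _).1 x.2).1, rfl⟩)

lemma split_cut_above (T : OTree) (e : T.Edge) :
    X.split (isCut_cut T e) (isAbove_above T e) = X.θ T e := by
  rw [split, PshA.resSame_refl, PshA.resSame_refl, id_tensorHom_id, Category.comp_id]

/-- The axiom for nested edges, with the comparison isomorphisms absorbed into the free choice of
the parts: the same trees `A`, `B₁` and `B₂` can be used on both sides. -/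
lemma split_nested {T A B B₁ B₂ U : OTree} {e e' : ℕ} (hA : IsCut T A e) (hB : IsAbove T B e)
    (hB₁ : IsCut B B₁ e') (hB₂ : IsAbove B B₂ e') (hU : IsCut T U e') (hB₂' : IsAbove T B₂ e')
    (hA' : IsCut U A e) (hB₁' : IsAbove U B₁ e) :
    X.split hA hB ≫ X.ob A ◁ X.split hB₁ hB₂ =
      X.split hU hB₂' ≫ X.split hA' hB₁' ▷ X.ob B₂ ≫ (α_ _ _ _).hom := by
  have he' : e' ∈ (T.above ⟨e, hA.mem⟩).edges := (hB.same.mem_iff _).1 hB₁.mem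
  have h := X.nested T ⟨e, hA.mem⟩ ⟨e', he'⟩
  have k₁ := (hB₁.of_same hB.same.symm (Same.refl _)).same
  have k₂ := (hB₂.of_same hB.same.symm (Same.refl _)).same
  have k₃ := (hA'.of_same hU.same.symm (Same.refl _)).same
  have k₄ := (hB₁'.of_same hU.same.symm (Same.refl _)).same
  have hs := X.split_same hB.same hB₁ hB₂ (isCut_cut (T.above ⟨e, hA.mem⟩) ⟨e', he'⟩)
    (isAbove_above (T.above ⟨e, hA.mem⟩) ⟨e', he'⟩) k₁ k₂
  have hs' := X.split_same hU.same hA' hB₁'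
    (isCut_cut (T.cut [⟨e', hU.mem⟩]) ⟨e, mem_cut_of_le ⟨e', he'⟩⟩)
    (isAbove_above (T.cut [⟨e', hU.mem⟩]) ⟨e, mem_cut_of_le ⟨e', he'⟩⟩) k₃ k₄
  rw [split_cut_above] at hs hs'
  have l : X.split hA hB ≫ X.ob A ◁ X.split hB₁ hB₂ =
      (X.θ T ⟨e, hA.mem⟩ ≫ _ ◁ X.θ (T.above ⟨e, hA.mem⟩) ⟨e', he'⟩) ≫
        (X.presheaf.resSame hA.same ⊗ₘ
          (X.presheaf.resSame k₁ ⊗ₘ X.presheaf.resSame k₂)) := by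
    rw [split, Category.assoc, Category.assoc, ← id_tensorHom, ← id_tensorHom,
      tensorHom_comp_tensorHom, tensorHom_comp_tensorHom, hs, Category.comp_id, Category.id_comp]
  have r : X.split hU hB₂' ≫ X.split hA' hB₁' ▷ X.ob B₂ ≫ (α_ _ _ _).hom =
      X.θ T ⟨e', hU.mem⟩ ≫ (X.θ (T.cut [⟨e', hU.mem⟩]) ⟨e, mem_cut_of_le ⟨e', he'⟩⟩ ▷ _) ≫
        (α_ _ _ _).hom ≫ (X.presheaf.resSame k₃ ⊗ₘ
          (X.presheaf.resSame k₄ ⊗ₘ X.presheaf.resSame hB₂'.same)) := by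
    rw [← associator_naturality, split, Category.assoc, ← tensorHom_id, ← tensorHom_id,
      tensorHom_comp_tensorHom_assoc, tensorHom_comp_tensorHom_assoc, hs', Category.comp_id,
      Category.id_comp]
  rw [l, r, h]
  simp only [Category.assoc, tensorHom_comp_tensorHom, PshA.resSame_trans]

lemma split_parallel {T A B A' B' U : OTree} {e e' : ℕ} (hA : IsCut T A e) (hB : IsAbove T B e)
    (hA' : IsCut A A' e') (hB' : IsAbove A B' e') (hU : IsCut T U e') (hBT' : IsAbove T B' e')
    (hUA' : IsCut U A' e) (hUB : IsAbove U B e) (h : ¬ T.le e e' ∧ ¬ T.le e' e) :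
    X.split hA hB ≫ X.split hA' hB' ▷ X.ob B ≫ (α_ _ _ _).hom =
      X.split hU hBT' ≫ X.split hUA' hUB ▷ X.ob B' ≫ (α_ _ _ _).hom ≫ X.ob A' ◁ (β_ _ _).hom := by
  have h' : ¬ T.le (⟨e, hA.mem⟩ : T.Edge).1 (⟨e', hU.mem⟩ : T.Edge).1 ∧
      ¬ T.le (⟨e', hU.mem⟩ : T.Edge).1 (⟨e, hA.mem⟩ : T.Edge).1 := h
  have hp := X.parallel T ⟨e, hA.mem⟩ ⟨e', hU.mem⟩ h'
  have k₁ := (hA'.of_same hA.same.symm (Same.refl _)).same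
  have k₂ := (hB'.of_same hA.same.symm (Same.refl _)).same
  have k₃ := (hUA'.of_same hU.same.symm (Same.refl _)).same
  have k₄ := (hUB.of_same hU.same.symm (Same.refl _)).same
  have hs := X.split_same hA.same hA' hB' (isCut_cut _ ⟨e', (Incomp.pair_symm h').mem_cut⟩)
    (isAbove_above _ ⟨e', (Incomp.pair_symm h').mem_cut⟩) k₁ k₂
  have hs' := X.split_same hU.same hUA' hUB (isCut_cut _ ⟨e, (Incomp.pair h').mem_cut⟩)
    (isAbove_above _ ⟨e, (Incomp.pair h').mem_cut⟩) k₃ k₄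
  rw [split_cut_above] at hs hs'
  have l : X.split hA hB ≫ X.split hA' hB' ▷ X.ob B ≫ (α_ _ _ _).hom =
      (X.θ T ⟨e, hA.mem⟩ ≫ (X.θ (T.cut [⟨e, hA.mem⟩]) ⟨e', (Incomp.pair_symm h').mem_cut⟩ ▷ _) ≫
        (α_ _ _ _).hom) ≫ (X.presheaf.resSame k₁ ⊗ₘ
          (X.presheaf.resSame k₂ ⊗ₘ X.presheaf.resSame hB.same)) := by
    rw [Category.assoc, Category.assoc, ← associator_naturality, split, Category.assoc,
      ← tensorHom_id, ← tensorHom_id,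
      tensorHom_comp_tensorHom_assoc, tensorHom_comp_tensorHom_assoc, hs, Category.comp_id,
      Category.id_comp]
  have r : X.split hU hBT' ≫ X.split hUA' hUB ▷ X.ob B' ≫ (α_ _ _ _).hom ≫
        X.ob A' ◁ (β_ _ _).hom =
      X.θ T ⟨e', hU.mem⟩ ≫ (X.θ (T.cut [⟨e', hU.mem⟩]) ⟨e, (Incomp.pair h').mem_cut⟩ ▷ _) ≫
        (α_ _ _ _).hom ≫ _ ◁ (β_ _ _).hom ≫ (X.presheaf.resSame k₃ ⊗ₘ
          (X.presheaf.resSame hBT'.same ⊗ₘ X.presheaf.resSame k₄)) := by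
    rw [← id_tensorHom, ← id_tensorHom, tensorHom_comp_tensorHom,
      ← BraidedCategory.braiding_naturality, Category.id_comp,
      ← Category.comp_id (X.presheaf.resSame k₃),
      ← tensorHom_comp_tensorHom, ← associator_naturality_assoc, split, Category.assoc,
      ← tensorHom_id, ← tensorHom_id, tensorHom_comp_tensorHom_assoc,
      tensorHom_comp_tensorHom_assoc, hs', Category.comp_id, Category.id_comp]
  rw [l, r, hp]
  simp only [Category.assoc, tensorHom_comp_tensorHom, PshA.resSame_trans]

end Preoperad

end

/-! ### Exchanging the order of two cuts -/

namespace OTree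

/-- Take for `U` the tree `T` cut at `e'` alone. The three final parts are the same trees in either
order of cutting. -/
lemma isCut_isAbove_nested {T A B B₁ B₂ : OTree} {e e' : ℕ} (hA : IsCut T A e) (hB : IsAbove T B e)
    (hB₁ : IsCut B B₁ e') (hB₂ : IsAbove B B₂ e') :
    ∃ U, IsCut T U e' ∧ IsAbove T B₂ e' ∧ IsCut U A e ∧ IsAbove U B₁ e := by
  have he' := (hB.mem_iff _).1 hB₁.mem
  have heB : e ∈ B.edges := (hB.mem_iff _).2 ⟨hB.mem, T.le_refl _ hB.mem⟩
  have hU := isCut_cut T ⟨e', he'.1⟩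
  refine ⟨_, hU, ⟨he'.1, fun x => ?_, hB₂.root, fun x hx y hy => ?_⟩,
    ⟨(hU.mem_iff _).2 ⟨hB.mem, fun h => T.le_antisymm _ hB.mem _ he'.1 he'.2 h⟩, fun x => ?_,
      hA.root, hA.le_iff⟩,
    ⟨(hU.mem_iff _).2 ⟨hB.mem, fun h => T.le_antisymm _ hB.mem _ he'.1 he'.2 h⟩, fun x => ?_,
      hB₁.root.trans hB.root, fun x hx y hy => ?_⟩⟩
  · rw [hB₂.mem_iff, hB.mem_iff]
    constructor
    · rintro ⟨h, h'⟩
      exact ⟨h.1, (hB.le_iff _ hB₁.mem _ ((hB.mem_iff _).2 h)).1 h'⟩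
    · rintro ⟨h, h'⟩
      have hx : T.le e x := T.le_trans _ hB.mem _ he'.1 _ h he'.2 h'
      exact ⟨⟨h, hx⟩, (hB.le_iff _ hB₁.mem _ ((hB.mem_iff _).2 ⟨h, hx⟩)).2 h'⟩
  · rw [hB₂.le_iff x hx y hy, hB.le_iff x ((hB₂.mem_iff _).1 hx).1 y ((hB₂.mem_iff _).1 hy).1]
  · rw [hA.mem_iff, hU.mem_iff]
    refine ⟨fun h => ⟨⟨h.1, fun h' => ?_⟩, h.2⟩, fun h => ⟨h.1.1, h.2⟩⟩
    have hx := h.2 (T.le_trans _ hB.mem _ he'.1 _ h.1 he'.2 h')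
    refine T.le_antisymm _ h.1 _ he'.1 ?_ h'
    rw [hx]
    exact he'.2
  · rw [hB₁.mem_iff, hB.mem_iff, hU.mem_iff]
    constructor
    · rintro ⟨h, h'⟩
      exact ⟨⟨h.1, fun hx => h' ((hB.le_iff _ hB₁.mem _ ((hB.mem_iff _).2 h)).2 hx)⟩, h.2⟩
    · rintro ⟨h, h'⟩
      exact ⟨⟨h.1, h'⟩, fun hx => h.2 ((hB.le_iff _ hB₁.mem _ ((hB.mem_iff _).2 ⟨h.1, h'⟩)).1 hx)⟩
  · rw [hB₁.le_iff x hx y hy, hB.le_iff x ((hB₁.mem_iff _).1 hx).1 y ((hB₁.mem_iff _).1 hy).1]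
    rfl

/-- An edge above both `e` and `e'` would make these comparable, so each cut leaves the part above
the other edge untouched. -/
lemma isCut_isAbove_parallel {T A B A' B' : OTree} {e e' : ℕ} (hA : IsCut T A e)
    (hB : IsAbove T B e) (hA' : IsCut A A' e') (hB' : IsAbove A B' e')
    (h : ¬ T.le e e' ∧ ¬ T.le e' e) :
    ∃ U, IsCut T U e' ∧ IsAbove T B' e' ∧ IsCut U A' e ∧ IsAbove U B e := by
  have he' := (hA.mem_iff _).1 hA'.mem
  have hU := isCut_cut T ⟨e', he'.1⟩
  have heU := (hU.mem_iff _).2 ⟨hA.mem, fun h' => absurd h' h.2⟩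
  refine ⟨_, hU, ⟨he'.1, fun x => ?_, hB'.root, fun x hx y hy => ?_⟩,
    ⟨heU, fun x => ?_, hA'.root.trans hA.root, fun x hx y hy => ?_⟩,
    ⟨heU, fun x => ?_, hB.root, hB.le_iff⟩⟩
  · rw [hB'.mem_iff, hA.mem_iff]
    constructor
    · rintro ⟨hx, h'⟩
      exact ⟨hx.1, (hA.le_iff _ hA'.mem _ ((hA.mem_iff _).2 hx)).1 h'⟩
    · rintro ⟨hx, h'⟩
      have : T.le e x → x = e := fun hex => by
        rcases T.le_total_below _ hA.mem _ he'.1 _ hx hex h' with h1 | h1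
        · exact absurd h1 h.1
        · exact absurd h1 h.2
      exact ⟨⟨hx, this⟩, (hA.le_iff _ hA'.mem _ ((hA.mem_iff _).2 ⟨hx, this⟩)).2 h'⟩
  · rw [hB'.le_iff x hx y hy, hA.le_iff x ((hB'.mem_iff _).1 hx).1 y ((hB'.mem_iff _).1 hy).1]
  · rw [hA'.mem_iff, hA.mem_iff, hU.mem_iff]
    constructor
    · rintro ⟨hx, h'⟩
      exact ⟨⟨hx.1, fun h1 => h' ((hA.le_iff _ hA'.mem _ ((hA.mem_iff _).2 hx)).2 h1)⟩, hx.2⟩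
    · rintro ⟨⟨hx, h1⟩, h2⟩
      exact ⟨⟨hx, h2⟩, fun h3 => h1 ((hA.le_iff _ hA'.mem _ ((hA.mem_iff _).2 ⟨hx, h2⟩)).1 h3)⟩
  · rw [hA'.le_iff x hx y hy, hA.le_iff x ((hA'.mem_iff _).1 hx).1 y ((hA'.mem_iff _).1 hy).1]
    rfl
  · rw [hB.mem_iff, hU.mem_iff]
    refine ⟨fun hx => ⟨⟨hx.1, fun h' => ?_⟩, hx.2⟩, fun hx => ⟨hx.1.1, hx.2⟩⟩
    rcases T.le_total_below _ hA.mem _ he'.1 _ hx.1 hx.2 h' with h1 | h1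
    · exact absurd h1 h.1
    · exact absurd h1 h.2

end OTree

/-! ### Iterated decompositions -/

section

variable {C : Type w} [Category.{v} C] [MonoidalCategory C] [SymmetricCategory C]

namespace Preoperad

open OTree

variable (X : Preoperad C) {ι κ : Type*}

/-- `X.IsDecomp e B T l A f` says that `f` is obtained by cutting `T` at the edges `e i`, for `i` in
the list `l`, beginning with the last one and always taking the component of the root, with pieces
`B i` and with `A` as the tree that is left. -/
def IsDecomp (e : ι → ℕ) (B : ι → OTree) (T : OTree) : (l : List ι) → (A : OTree) →
    (X.ob T ⟶ X.ob A ⊗ tens (fun i => X.ob (B i)) l) → Prop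
  | [], A, f => ∃ h : Same A T, f = X.presheaf.resSame h ≫ (ρ_ _).inv
  | i :: l, A, f => ∃ (U : OTree) (g : X.ob T ⟶ X.ob U ⊗ tens (fun i => X.ob (B i)) l)
      (h : IsCut U A (e i)) (h' : IsAbove U (B i) (e i)), IsDecomp e B T l U g ∧
        f = g ≫ X.split h h' ▷ _ ≫ (α_ _ _ _).hom

namespace IsDecomp

variable {X} {e : ι → ℕ} {B : ι → OTree} {T A : OTree} {l : List ι}
  {f : X.ob T ⟶ X.ob A ⊗ tens (fun i => X.ob (B i)) l}

lemma subtree (h : X.IsDecomp e B T l A f) : (∀ x ∈ A.edges, x ∈ T.edges) ∧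
    ∀ x ∈ A.edges, ∀ y ∈ A.edges, A.le x y ↔ T.le x y := by
  induction l generalizing A with
  | nil =>
    obtain ⟨h, -⟩ := h
    exact ⟨fun x => (h.mem_iff x).1, h.le_iff⟩
  | cons i l ih =>
    obtain ⟨U, g, h, -, hg, -⟩ := h
    obtain ⟨h1, h2⟩ := ih hg
    have h3 : ∀ x ∈ A.edges, x ∈ U.edges := fun x hx => ((h.mem_iff x).1 hx).1
    exact ⟨fun x hx => h1 _ (h3 _ hx), fun x hx y hy =>
      (h.le_iff x hx y hy).trans (h2 x (h3 _ hx) y (h3 _ hy))⟩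

lemma cons {i : ι} (hf : X.IsDecomp e B T l A f) {A' : OTree} (h : IsCut A A' (e i))
    (h' : IsAbove A (B i) (e i)) :
    X.IsDecomp e B T (i :: l) A' (f ≫ X.split h h' ▷ _ ≫ (α_ _ _ _).hom) :=
  ⟨A, f, h, h', hf, rfl⟩

lemma nil {A : OTree} (h : Same A T) :
    X.IsDecomp e B T [] A (X.presheaf.resSame h ≫ (ρ_ _).inv) := ⟨h, rfl⟩

/-- Induction on the cuts, with `split_naturality` for each one. The restriction of `t` to the
remaining trees is constructed along the way, because the intermediate trees of the two
decompositions are not fixed in advance. -/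
lemma exists_naturality {e' : ι → ℕ} {B' : ι → OTree} {T' A' : OTree}
    {f' : X.ob T' ⟶ X.ob A' ⊗ tens (fun i => X.ob (B' i)) l} {t : T ⟶ T'} (ht : inner t)
    (b : ∀ i, B i ⟶ B' i) (hb : ∀ i, inner (b i)) (hbt : ∀ i, Restricts (b i) t)
    (he : ∀ i, ∀ x : T.Edge, x.1 = e i → (t.toFun x).1 = e' i) (hf : X.IsDecomp e B T l A f)
    (hf' : X.IsDecomp e' B' T' l A' f') : ∃ (a : A ⟶ A') (ha : inner a), Restricts a t ∧
      X.presheaf.res t ht ≫ f =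
        f' ≫ (X.presheaf.res a ha ⊗ₘ tensMap (fun i => X.presheaf.res (b i) (hb i)) l) := by
  induction l generalizing A A' with
  | nil =>
    obtain ⟨h, rfl⟩ := hf
    obtain ⟨h', rfl⟩ := hf'
    refine ⟨h.hom ≫ t ≫ h'.symm.hom, inner.comp_mem _ _ h.inner
      (inner.comp_mem _ _ ht h'.symm.inner), fun x => ⟨(h.mem_iff _).1 x.2, rfl⟩, ?_⟩
    change _ = _ ≫ (_ ⊗ₘ 𝟙 (𝟙_ C))
    rw [Category.assoc, tensorHom_id, ← rightUnitor_inv_naturality, ← Category.assoc,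
      ← Category.assoc]
    congr 1
    exact (PshA.res_res _ _ _ _ _ (h.hom ≫ t) (inner.comp_mem _ _ h.inner ht) rfl).trans
      (PshA.res_res X.presheaf (h.hom ≫ t ≫ h'.symm.hom) (inner.comp_mem _ _ h.inner
        (inner.comp_mem _ _ ht h'.symm.inner)) h'.hom h'.inner (h.hom ≫ t)
        (inner.comp_mem _ _ h.inner ht) rfl).symm
  | cons i l ih =>
    obtain ⟨U, g, h, h', hg, rfl⟩ := hf
    obtain ⟨U', g', k, k', hg', rfl⟩ := hf'
    obtain ⟨a, ha, hat, hag⟩ := ih hg hg'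
    have hei : (a.toFun ⟨e i, h.mem⟩).1 = e' i := by
      obtain ⟨hx, e1⟩ := hat ⟨e i, h.mem⟩
      rw [e1]
      exact he i _ rfl
    obtain ⟨c, hc, hca⟩ := exists_cutMap ha h k hei
    have hba : Restricts (b i) a := fun x => by
      have hx := ((h'.mem_iff _).1 x.2).1
      obtain ⟨_, e1⟩ := hat ⟨x.1, hx⟩
      obtain ⟨_, e2⟩ := hbt i x
      exact ⟨hx, e2.trans e1.symm⟩
    refine ⟨c, hc, fun x => ?_, ?_⟩
    · obtain ⟨hx, e1⟩ := hca x
      obtain ⟨hx', e2⟩ := hat ⟨x.1, hx⟩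
      exact ⟨hx', e1.trans e2⟩
    · have hs := X.split_naturality ha h h' k k' hei hc hca (hb i) hba
      change _ = _ ≫ (X.presheaf.res c hc ⊗ₘ (X.presheaf.res (b i) (hb i) ⊗ₘ
        tensMap (fun i => X.presheaf.res (b i) (hb i)) l))
      rw [reassoc_of% hag, ← tensorHom_id, tensorHom_comp_tensorHom_assoc, hs, Category.comp_id]
      simp only [Category.assoc]
      rw [← associator_naturality, ← tensorHom_id, tensorHom_comp_tensorHom_assoc, Category.id_comp]

/-- Naturality for the identity of `T`; the map it gives between the remaining trees restricts the
identity, so it is the identity. Hence a decomposition depends only on the edges with their order,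
the pieces and the remaining tree, and not on intermediate choices. -/
lemma unique {f' : X.ob T ⟶ X.ob A ⊗ tens (fun i => X.ob (B i)) l}
    (hf : X.IsDecomp e B T l A f) (hf' : X.IsDecomp e B T l A f')
    (hB : ∀ i, ∀ x ∈ (B i).edges, x ∈ T.edges) : f = f' := by
  obtain ⟨a, ha, hat, h⟩ := exists_naturality (t := 𝟙 T) (inner.id_mem T) (fun i => 𝟙 (B i))
    (fun i => inner.id_mem _) (fun i x => ⟨hB i _ x.2, rfl⟩) (fun i x h => h) hf hf'
  have : a = 𝟙 A := hat.eq fun x => ⟨hf.subtree.1 _ x.2, rfl⟩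
  subst this
  simpa only [PshA.res_id, tensMap_id, id_tensorHom_id, Category.comp_id, Category.id_comp] using h

lemma comp_same (hf : X.IsDecomp e B T l A f) {A' : OTree} (h : Same A' A) :
    X.IsDecomp e B T l A' (f ≫ X.presheaf.resSame h ▷ _) := by
  cases l with
  | nil =>
    obtain ⟨h', rfl⟩ := hf
    refine ⟨h.trans h', ?_⟩
    rw [← PshA.resSame_trans X.presheaf h h', Category.assoc, Category.assoc,
      rightUnitor_inv_naturality]
  | cons i l =>
    obtain ⟨U, g, k, k', hg, rfl⟩ := hf
    refine ⟨U, g, k.of_same (Same.refl _) h, k', hg, ?_⟩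
    have hs := X.split_same (Same.refl U) (k.of_same (Same.refl _) h) k' k k' h (Same.refl _)
    rw [PshA.resSame_refl, PshA.resSame_refl, Category.id_comp, tensorHom_id] at hs
    rw [hs, comp_whiskerRight]
    simp only [Category.assoc, associator_naturality_left]

lemma comp_pieces {B' : ι → OTree} (h : ∀ i, Same (B' i) (B i)) (hf : X.IsDecomp e B T l A f) :
    X.IsDecomp e B' T l A (f ≫ _ ◁ tensMap (fun i => X.presheaf.resSame (h i)) l) := by
  induction l generalizing A with
  | nil =>
    obtain ⟨h', rfl⟩ := hf
    refine ⟨h', ?_⟩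
    change _ ≫ _ ◁ 𝟙 (𝟙_ C) = _
    rw [whiskerLeft_id, Category.comp_id]
  | cons i l ih =>
    obtain ⟨U, g, k, k', hg, rfl⟩ := hf
    refine ⟨U, _, k, k'.of_same (Same.refl _) (h i), ih hg, ?_⟩
    have hs := X.split_same (Same.refl U) k (k'.of_same (Same.refl _) (h i)) k k' (Same.refl _) (h i)
    rw [PshA.resSame_refl, PshA.resSame_refl, Category.id_comp, id_tensorHom] at hs
    change _ ≫ X.ob A ◁ (X.presheaf.resSame (h i) ⊗ₘ
      tensMap (fun i => X.presheaf.resSame (h i)) l) = _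
    rw [hs, MonoidalCategory.tensorHom_def]
    simp only [Category.assoc, comp_whiskerRight, whiskerLeft_comp]
    rw [whisker_exchange_assoc, whisker_exchange_assoc]
    monoidal

lemma map (h : κ → ι) {l : List κ} {f : X.ob T ⟶ X.ob A ⊗ tens (fun i => X.ob (B (h i))) l}
    (hf : X.IsDecomp (fun i => e (h i)) (fun i => B (h i)) T l A f) :
    X.IsDecomp e B T (l.map h) A (f ≫ _ ◁ (tensRelabel h (fun i => X.ob (B i)) l).inv) := by
  induction l generalizing A with
  | nil =>
    obtain ⟨h', rfl⟩ := hf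
    refine ⟨h', ?_⟩
    change _ ≫ _ ◁ 𝟙 (𝟙_ C) = _
    rw [whiskerLeft_id, Category.comp_id]
  | cons i l ih =>
    obtain ⟨U, g, k, k', hg, rfl⟩ := hf
    refine ⟨U, _, k, k', ih hg, ?_⟩
    change _ ≫ X.ob A ◁ X.ob (B (h i)) ◁ (tensRelabel h (fun i => X.ob (B i)) l).inv = _
    simp only [Category.assoc]
    rw [whisker_exchange_assoc]
    monoidal

lemma of_map (h : κ → ι) {l : List κ} {f : X.ob T ⟶ X.ob A ⊗ tens (fun i => X.ob (B i)) (l.map h)}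
    (hf : X.IsDecomp e B T (l.map h) A f) :
    X.IsDecomp (fun i => e (h i)) (fun i => B (h i)) T l A
      (f ≫ _ ◁ (tensRelabel h (fun i => X.ob (B i)) l).hom) := by
  induction l generalizing A with
  | nil =>
    obtain ⟨h', rfl⟩ := hf
    refine ⟨h', ?_⟩
    change _ ≫ _ ◁ 𝟙 (𝟙_ C) = _
    rw [whiskerLeft_id, Category.comp_id]
  | cons i l ih =>
    obtain ⟨U, g, k, k', hg, rfl⟩ := hf
    refine ⟨U, _, k, k', ih hg, ?_⟩
    change _ ≫ X.ob A ◁ X.ob (B (h i)) ◁ (tensRelabel h (fun i => X.ob (B i)) l).hom = _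
    simp only [Category.assoc]
    rw [whisker_exchange_assoc]
    monoidal

/-- The later cuts `l'` stand in front, as the head of a list is the last cut. -/
lemma append {U : OTree} {l' : List ι} {g : X.ob A ⟶ X.ob U ⊗ tens (fun i => X.ob (B i)) l'}
    (hf : X.IsDecomp e B T l A f) (hg : X.IsDecomp e B A l' U g) :
    X.IsDecomp e B T (l' ++ l) U
      (f ≫ g ▷ _ ≫ (α_ _ _ _).hom ≫ _ ◁ tensAppend (fun i => X.ob (B i)) l' l) := by
  induction l' generalizing U with
  | nil =>
    obtain ⟨h, rfl⟩ := hg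
    refine (congrArg (X.IsDecomp e B T l U) ?_).mpr (hf.comp_same h)
    rw [tensAppend_nil]
    monoidal
  | cons i l' ih =>
    obtain ⟨U', g, k, k', hg, rfl⟩ := hg
    refine ⟨U', _, k, k', ih hg, ?_⟩
    change f ≫ (g ≫ X.split k k' ▷ _ ≫ (α_ _ _ _).hom) ▷ _ ≫ (α_ _ _ _).hom ≫
        _ ◁ tensAppend (fun i => X.ob (B i)) (i :: l') l =
      (f ≫ g ▷ _ ≫ (α_ _ _ _).hom ≫ _ ◁ tensAppend (fun i => X.ob (B i)) l' l) ≫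
        X.split k k' ▷ tens (fun i => X.ob (B i)) (l' ++ l) ≫ (α_ _ _ _).hom
    rw [tensAppend_cons]
    simp only [Category.assoc, comp_whiskerRight, whiskerLeft_comp]
    rw [whisker_exchange_assoc]
    monoidal

end IsDecomp

end Preoperad

end

/-! ### Reordering and flattening decompositions -/

section

variable {Q : Type*}

/-- The letters which an insertion passes. -/
def Insertion.passed {i : Q} : {r l : List Q} → Insertion i r l → List Q
  | _, _, .head _ => []
  | _, _, .tail a h => a :: h.passed

lemma Insertion.sublist {i : Q} {r l : List Q} (h : Insertion i r l) : r.Sublist l := by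
  induction h with
  | head l => exact List.sublist_cons_self _ _
  | tail a h ih => exact ih.cons_cons a

/-- The first occurrence of `i` is used, so that all passed letters differ from `i`. -/
lemma exists_insertion {i : Q} {l : List Q} (hi : i ∈ l) :
    ∃ (r : List Q) (h : Insertion i r l), ∀ a ∈ h.passed, [a, i].Sublist l ∧ a ≠ i := by
  induction l with
  | nil => cases hi
  | cons a l ih =>
    by_cases hai : a = i
    · subst hai
      exact ⟨l, .head l, fun _ h => by cases h⟩
    · have hil : i ∈ l := (List.mem_cons.1 hi).resolve_left fun h => hai h.symm
      obtain ⟨r, h, hp⟩ := ih hil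
      refine ⟨_, .tail a h, fun b hb => ?_⟩
      rcases List.mem_cons.1 hb with rfl | hb
      · exact ⟨(List.singleton_sublist.2 hil).cons_cons _, hai⟩
      · exact ⟨(hp b hb).1.cons _, (hp b hb).2⟩

end

section

variable {C : Type w} [Category.{v} C] [MonoidalCategory C]

/-- The tensor product of the `F c ⊗ ⨂_{i ∈ D c} F i` as a single tensor product. -/
def tensJoin {κ ι : Type*} (F : κ ⊕ ι → C) (D : κ → List ι) : (l : List κ) →
    (tens (fun c => F (.inl c) ⊗ tens (fun i => F (.inr i)) (D c)) l ⟶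
      tens F (l.flatMap fun c => .inl c :: (D c).map .inr))
  | [] => 𝟙 _
  | c :: l => ((F (.inl c) ◁ (tensRelabel .inr F (D c)).inv) ⊗ₘ tensJoin F D l) ≫
      tensAppend F (.inl c :: (D c).map .inr) (l.flatMap fun c => .inl c :: (D c).map .inr)

variable [SymmetricCategory C]

lemma Structural.tensJoin {Q : Type*} {V : Q → C} {κ ι : Type*} {F : κ ⊕ ι → C}
    (p : ∀ x, Presentation V (F x)) (D : κ → List ι) (l : List κ) :
    Structural (.list (fun c => (p (.inl c)).tensor (.list (fun i => p (.inr i)) (D c))) l)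
      (.list p (l.flatMap fun c => .inl c :: (D c).map .inr)) (tensJoin F D l) := by
  induction l with
  | nil => exact id _
  | cons c l ih =>
    exact ((((tensRelabel p .inr (D c)).iso_inv).whiskerLeft _).tensorHom ih).comp
      (tensAppend p (.inl c :: (D c).map .inr) _)

namespace Preoperad.IsDecomp

open OTree

variable {X : Preoperad C} {ι κ : Type*} {e : ι → ℕ} {B : ι → OTree} {T A : OTree} {l : List ι}
  {f : X.ob T ⟶ X.ob A ⊗ tens (fun i => X.ob (B i)) l}

/-- This makes the cut at `e i` the last one. Each passed cut is exchanged with it by the parallel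
axiom, for which the two edges have to be incomparable; the braiding in that axiom cancels against
the one in the swap. -/
lemma extract {i : ι} {r l : List ι} {f : X.ob T ⟶ X.ob A ⊗ tens (fun i => X.ob (B i)) l}
    (h : Insertion i r l) (hp : ∀ a ∈ h.passed, ¬ T.le (e a) (e i) ∧ ¬ T.le (e i) (e a))
    (hf : X.IsDecomp e B T l A f) :
    X.IsDecomp e B T (i :: r) A (f ≫ _ ◁ h.map (fun i => X.ob (B i))) := by
  induction h generalizing A with
  | head l =>
    refine (congrArg (X.IsDecomp e B T (i :: l) A) ?_).mpr hf
    change f ≫ _ ◁ 𝟙 (tens (fun i => X.ob (B i)) (i :: l)) = f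
    rw [whiskerLeft_id, Category.comp_id]
  | @tail a r l h ih =>
    obtain ⟨U, g, k, k', hg, rfl⟩ := hf
    obtain ⟨U₂, g₂, m, m', hg₂, e₂⟩ := ih (fun b hb => hp b (List.mem_cons_of_mem _ hb)) hg
    have hk := ((m.mem_iff _).1 k.mem).1
    have ha := hp a List.mem_cons_self
    rw [← hg₂.subtree.2 _ hk _ m.mem, ← hg₂.subtree.2 _ m.mem _ hk] at ha
    obtain ⟨U₃, n, n', m₂, m₂'⟩ := isCut_isAbove_parallel m m' k k' ha.symm
    refine ⟨U₃, _, m₂, m₂', hg₂.cons n n', ?_⟩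
    have sp := congrArg (fun z => g₂ ≫ z ▷ tens (fun i => X.ob (B i)) r ≫
      (α_ _ _ _).hom ≫ X.ob A ◁ (β_ _ _).hom ▷ tens (fun i => X.ob (B i)) r ≫
      X.ob A ◁ (α_ _ _ _).hom) (X.split_parallel m m' k k' n n' m₂ m₂' ha.symm)
    simp only [comp_whiskerRight, Category.assoc] at sp
    change (g ≫ X.split k k' ▷ _ ≫ (α_ _ _ _).hom) ≫ X.ob A ◁ (X.ob (B a) ◁ h.map _ ≫
      swapFront (X.ob (B a)) (X.ob (B i)) (tens (fun i => X.ob (B i)) r)) = _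
    have e₃ : (g ≫ X.split k k' ▷ _ ≫ (α_ _ _ _).hom) ≫ X.ob A ◁ (X.ob (B a) ◁ h.map _ ≫
        swapFront (X.ob (B a)) (X.ob (B i)) (tens (fun i => X.ob (B i)) r)) =
        (g ≫ X.ob U ◁ h.map _) ≫ X.split k k' ▷ _ ≫ (α_ _ _ _).hom ≫
        X.ob A ◁ swapFront (X.ob (B a)) (X.ob (B i)) (tens (fun i => X.ob (B i)) r) := by
      simp only [Category.assoc, whiskerLeft_comp]
      rw [whisker_exchange_assoc]
      monoidal
    rw [e₃, e₂]
    calc _ = _ := by simp only [swapFront]; monoidal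
      _ = _ := sp
      _ = (g₂ ≫ X.split n n' ▷ tens (fun i => X.ob (B i)) r ≫ (α_ _ _ _).hom) ≫
        X.split m₂ m₂' ▷ (X.ob (B a) ⊗ tens (fun i => X.ob (B i)) r) ≫ (α_ _ _ _).hom ≫
        X.ob A ◁ (α_ _ _ _).inv ≫ X.ob A ◁ ((β_ _ _).hom ≫ (β_ _ _).hom) ▷ _ ≫
        X.ob A ◁ (α_ _ _ _).hom := by
          simp only [whiskerLeft_comp, comp_whiskerRight]; monoidal
      _ = _ := by rw [SymmetricCategory.symmetry]; monoidal

/-- Only pairs whose order differs in `l` and `l'` get exchanged, so only these have to be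
incomparable. -/
lemma exists_shuffle {l' : List ι} (hf : X.IsDecomp e B T l A f) (hl : l.Perm l')
    (h : ∀ x y, [x, y].Sublist l → [y, x].Sublist l' → ¬ T.le (e x) (e y) ∧ ¬ T.le (e y) (e x)) :
    ∃ s : Shuffle l l', X.IsDecomp e B T l' A (f ≫ _ ◁ s.map (fun i => X.ob (B i))) := by
  induction l' generalizing l A with
  | nil =>
    obtain rfl := hl.eq_nil
    refine ⟨.nil, (congrArg (X.IsDecomp e B T [] A) ?_).mpr hf⟩
    change f ≫ _ ◁ 𝟙 (𝟙_ C) = f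
    rw [whiskerLeft_id, Category.comp_id]
  | cons i l' ih =>
    obtain ⟨r, k, hk⟩ := exists_insertion (hl.symm.subset (List.mem_cons_self))
    have hk' : ∀ a ∈ k.passed, ¬ T.le (e a) (e i) ∧ ¬ T.le (e i) (e a) := fun a ha => by
      refine h a i (hk a ha).1 ?_
      have : a ∈ i :: l' := hl.subset ((hk a ha).1.subset List.mem_cons_self)
      exact (List.singleton_sublist.2
        ((List.mem_cons.1 this).resolve_left (hk a ha).2)).cons_cons _
    obtain ⟨U, g, m, m', hg, e₂⟩ := hf.extract k hk'
    obtain ⟨s, hs⟩ := ih hg ((k.perm.symm.trans hl).cons_inv) fun x y hx hy =>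
      h x y (hx.trans k.sublist) (hy.cons _)
    refine ⟨.cons k s, (congrArg (X.IsDecomp e B T (i :: l') A) ?_).mpr (hs.cons m m')⟩
    change f ≫ _ ◁ (k.map _ ≫ X.ob (B i) ◁ s.map _) = _
    rw [whiskerLeft_comp, reassoc_of% e₂]
    simp only [Category.assoc]
    rw [whisker_exchange_assoc]
    monoidal

/-- By the nested axiom, one cut at a time: the cuts above `e₀` can be made in `T` before the cut at
`e₀`, which then separates what remains of `Bt`. -/
lemma nested {e₀ : ℕ} {Bt V : OTree} (hA : IsCut T A e₀) (hB : IsAbove T Bt e₀)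
    {g : X.ob Bt ⟶ X.ob V ⊗ tens (fun i => X.ob (B i)) l} (hg : X.IsDecomp e B Bt l V g) :
    ∃ (U : OTree) (f : X.ob T ⟶ X.ob U ⊗ tens (fun i => X.ob (B i)) l) (k : IsCut U A e₀)
      (k' : IsAbove U V e₀), X.IsDecomp e B T l U f ∧
        X.split hA hB ≫ X.ob A ◁ g = f ≫ X.split k k' ▷ _ ≫ (α_ _ _ _).hom := by
  induction l generalizing V with
  | nil =>
    obtain ⟨h, rfl⟩ := hg
    refine ⟨T, _, hA, hB.of_same (Same.refl T) h, .nil (Same.refl T), ?_⟩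
    have hs := X.split_same (Same.refl T) hA (hB.of_same (Same.refl T) h) hA hB (Same.refl _) h
    rw [PshA.resSame_refl, PshA.resSame_refl, Category.id_comp, id_tensorHom] at hs
    rw [hs, PshA.resSame_refl, whiskerLeft_comp]
    monoidal
  | cons j l ih =>
    obtain ⟨V', g', m, m', hg', rfl⟩ := hg
    obtain ⟨U', f', k, k', hf', eq⟩ := ih hg'
    obtain ⟨U, n, n', n₂, n₂'⟩ := isCut_isAbove_nested k k' m m'
    refine ⟨U, _, n₂, n₂', hf'.cons n n', ?_⟩
    have sn := congrArg (fun z => f' ≫ z ▷ tens (fun i => X.ob (B i)) l ≫ (α_ _ _ _).hom ≫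
      X.ob A ◁ (α_ _ _ _).hom) (X.split_nested k k' m m' n n' n₂ n₂')
    simp only [comp_whiskerRight, Category.assoc] at sn
    rw [whiskerLeft_comp, reassoc_of% eq]
    calc _ = _ := by monoidal
      _ = _ := sn
      _ = _ := by monoidal

/-- Decomposing the pieces further amounts to a single decomposition of `T` in which the cuts inside
a piece are made just before the cut separating that piece. Later cuts come first in the list, hence
`.inl c` in front of the edges of `D c`. -/
lemma flatten {e : κ ⊕ ι → ℕ} {B : κ ⊕ ι → OTree} {B₀ : κ → OTree} {D : κ → List ι} {l : List κ}
    {f : X.ob T ⟶ X.ob A ⊗ tens (fun c => X.ob (B₀ c)) l}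
    {g : ∀ c, X.ob (B₀ c) ⟶ X.ob (B (.inl c)) ⊗ tens (fun i => X.ob (B (.inr i))) (D c)}
    (hg : ∀ c, X.IsDecomp (fun i => e (.inr i)) (fun i => B (.inr i)) (B₀ c) (D c)
      (B (.inl c)) (g c))
    (hf : X.IsDecomp (fun c => e (.inl c)) B₀ T l A f) :
    X.IsDecomp e B T (l.flatMap fun c => .inl c :: (D c).map .inr) A
      (f ≫ _ ◁ (tensMap g l ≫ tensJoin (fun x => X.ob (B x)) D l)) := by
  induction l generalizing A with
  | nil =>
    obtain ⟨h, rfl⟩ := hf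
    refine ⟨h, ?_⟩
    change _ ≫ _ ◁ (𝟙 (𝟙_ C) ≫ 𝟙 (𝟙_ C)) = _
    rw [Category.comp_id, whiskerLeft_id, Category.comp_id]
  | cons c l ih =>
    obtain ⟨U, ψ, k, k', hψ, rfl⟩ := hf
    obtain ⟨V, f', m, m', hf', eq⟩ := nested k k' ((hg c).map (e := e) (B := B) Sum.inr)
    have h1 : X.IsDecomp e B U (.inl c :: (D c).map .inr) A _ := ⟨V, f', m, m', hf', eq⟩
    refine (congrArg (X.IsDecomp e B T
      ((.inl c :: (D c).map .inr) ++ (l.flatMap fun c => .inl c :: (D c).map .inr)) A) ?_).mpr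
      ((ih hψ).append h1)
    change (ψ ≫ X.split k k' ▷ _ ≫ (α_ _ _ _).hom) ≫ X.ob A ◁ ((g c ⊗ₘ tensMap g l) ≫
      ((X.ob (B (.inl c)) ◁ (tensRelabel .inr (fun x => X.ob (B x)) (D c)).inv) ⊗ₘ
        tensJoin (fun x => X.ob (B x)) D l) ≫
      tensAppend (fun x => X.ob (B x)) (.inl c :: (D c).map .inr)
        (l.flatMap fun c => .inl c :: (D c).map .inr)) = _
    rw [tensorHom_comp_tensorHom_assoc, MonoidalCategory.tensorHom_def']
    simp only [Category.assoc, comp_whiskerRight, whiskerLeft_comp]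
    rw [whisker_exchange_assoc, whisker_exchange_assoc]
    monoidal

end Preoperad.IsDecomp

end

/-! ### Flattened decompositions and regrouping -/

section

variable {C : Type w} [Category.{v} C] [MonoidalCategory C] [SymmetricCategory C]

lemma Structural.insertion {Q ι : Type*} {V : Q → C} {F : ι → C} (p : ∀ i, Presentation V (F i))
    {i : ι} {r l : List ι} (h : Insertion i r l) :
    Structural (.list p l) ((p i).tensor (.list p r)) (h.map F) := by
  induction h with
  | head => exact id _
  | tail a h ih => exact (ih.whiskerLeft (p a)).comp (swapFront _ _ _)

lemma Structural.shuffle {Q ι : Type*} {V : Q → C} {F : ι → C} (p : ∀ i, Presentation V (F i))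
    {l l' : List ι} (s : Shuffle l l') : Structural (.list p l) (.list p l') (s.map F) := by
  induction s with
  | nil => exact id _
  | @cons i r l l' h s ih => exact (insertion p h).comp (ih.whiskerLeft (p i))

@[simp] lemma Presentation.tensor_letters {Q : Type*} {V : Q → C} {A B : C}
    (P : Presentation V A) (P' : Presentation V B) :
    (P.tensor P').letters = P.letters ++ P'.letters := rfl

@[simp] lemma Presentation.var_letters {Q : Type*} {V : Q → C} (q : Q) :
    (Presentation.var q : Presentation V (V q)).letters = [q] := rfl

@[simp] lemma Presentation.ofIso_letters {Q : Type*} {V : Q → C} {A B : C}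
    (P : Presentation V A) (e : B ≅ A) : (P.ofIso e).letters = P.letters := rfl

lemma Presentation.list_letters_of_eq {Q ι : Type*} {V : Q → C} {F : ι → C}
    (p : ∀ i, Presentation V (F i)) (h : ι → Q) (hp : ∀ i, (p i).letters = [h i]) (l : List ι) :
    (Presentation.list p l).letters = l.map h := by
  rw [list_letters]
  simp only [hp]
  exact List.flatMap_pure_eq_map h l

/-- Concatenation, for a family indexed by a disjoint union. -/
def sumAppend {κ ι : Type*} (F : κ ⊕ ι → C) (A : C) (l : List κ) (l' : List ι) :
    (A ⊗ tens (fun c => F (.inl c)) l) ⊗ tens (fun i => F (.inr i)) l' ≅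
      A ⊗ tens F (l.map .inl ++ l'.map .inr) :=
  α_ _ _ _ ≪≫ whiskerLeftIso A (((tensRelabel .inl F l).symm ⊗ᵢ (tensRelabel .inr F l').symm) ≪≫
    tensAppendIso F _ _)

lemma sumAppend_naturality {κ ι : Type*} (F : κ ⊕ ι → C) {A A' : C} (r : A ⟶ A') (l : List κ)
    (l' : List ι) : (sumAppend F A l l').hom ≫ r ▷ _ =
      (r ▷ _) ▷ _ ≫ (sumAppend F A' l l').hom := by
  simp only [sumAppend, Iso.trans_hom, whiskerLeftIso_hom, Category.assoc]
  rw [whisker_exchange, associator_naturality_left_assoc]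

lemma Structural.sumAppend {Q κ ι : Type*} {V : Q → C} {F : κ ⊕ ι → C} {A : C}
    (P : Presentation V A) (p : ∀ i, Presentation V (F i)) (l : List κ) (l' : List ι) :
    Structural ((P.tensor (.list (fun c => p (.inl c)) l)).tensor (.list (fun i => p (.inr i)) l'))
      (P.tensor (.list p (l.map .inl ++ l'.map .inr))) (sumAppend F A l l').hom := by
  refine (associator _ _ _).comp (Structural.whiskerLeft _ ?_)
  refine ((tensRelabel p .inl l).iso_inv.tensorHom (tensRelabel p .inr l').iso_inv).comp ?_
  rw [tensAppendIso_hom]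
  exact tensAppend p _ _

/-- By coherence, `regroup` joins all factors into one word, then undoes the shuffle `s` and
`sumAppend`. The hypothesis `e` compares both sides after joining, so undoing these maps gives the
claim. -/
lemma regroup_eq_of_join {κ ι : Type*} {κ' : κ → Type*} {F : κ ⊕ ι → C} {A₁ A₂ P : C}
    {B : (c : κ) → κ' c → C} {m : (c : κ) → List (κ' c)} {l : List κ} {l' : List ι}
    (g : (Σ c, κ' c) → ι) (b : ∀ c k, B c k ⟶ F (.inr (g ⟨c, k⟩))) [∀ c k, IsIso (b c k)]
    (h : ((l.sigma m).map g).Perm l') (hl : l.Nodup) (hl' : l'.Nodup)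
    (ψ : P ⟶ (A₁ ⊗ tens (fun c => F (.inl c)) l) ⊗ tens (fun i => F (.inr i)) l')
    (φ : P ⟶ A₂ ⊗ tens (fun c => F (.inl c) ⊗ tens (B c) (m c)) l) (r : A₁ ⟶ A₂)
    (s : Shuffle (l.map .inl ++ l'.map .inr)
      (l.flatMap fun c => .inl c :: ((m c).map fun k => g ⟨c, k⟩).map .inr))
    (e : φ ≫ A₂ ◁ (tensMap (fun c => F (.inl c) ◁ (tensMap (b c) (m c) ≫
        (tensRelabel (fun k => g ⟨c, k⟩) (fun i => F (.inr i)) (m c)).inv)) l ≫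
        tensJoin F (fun c => (m c).map fun k => g ⟨c, k⟩) l) =
      (ψ ≫ (sumAppend F A₁ l l').hom ≫ A₁ ◁ s.map F) ≫ r ▷ _) :
    φ ≫ regroup A₂ (fun c => F (.inl c)) g b h = ψ ≫ (r ▷ _) ▷ _ := by
  obtain ⟨u, -, -⟩ := s.exists_inverse F
  -- One letter for `A₂` and one for each `F x`. The objects `B c k` share the letters of the
  -- corresponding `F (.inr _)`, through the isomorphisms `b c k`.
  let V : Option (κ ⊕ ι) → C := fun x => x.elim A₂ F
  let p₀ : Presentation V A₂ := .var none
  let p : ∀ x, Presentation V (F x) := fun x => .var (some x)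
  let q : ∀ c k, Presentation V (B c k) := fun c k => (p (.inr (g ⟨c, k⟩))).ofIso (asIso (b c k))
  have hq : ∀ c k, Structural (q c k) (p (.inr (g ⟨c, k⟩))) (b c k) := fun c k => .fromOfIso _ _
  have s1 := Structural.sumAppend p₀ p l l'
  have su := ((Structural.shuffle p u).whiskerLeft p₀).comp s1.iso_inv
  have s2 := Structural.regroup (A := fun c => F (.inl c)) (D := fun i => F (.inr i)) (b := b)
    (g := g) h p₀ (fun c => p (.inl c)) (q' := fun i => p (.inr i)) hq
  have s3 := ((Structural.tensMap (fun c => ((Structural.tensMap (hq c) (m c)).comp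
    (Structural.tensRelabel (fun i => p (.inr i)) (fun k => g ⟨c, k⟩) (m c)).iso_inv).whiskerLeft
      (p (.inl c))) l).comp
    (Structural.tensJoin p (fun c => (m c).map fun k => g ⟨c, k⟩) l)).whiskerLeft p₀
  have hn : ((p₀.tensor (.list (fun c => p (.inl c)) l)).tensor
      (.list (fun i => p (.inr i)) l')).letters.Nodup := by
    have e₁ := Presentation.list_letters_of_eq (fun c => p (.inl c)) (fun c => some (.inl c))
      (fun _ => rfl) l
    have e₂ := Presentation.list_letters_of_eq (fun c => p (.inr c)) (fun c => some (.inr c))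
      (fun _ => rfl) l'
    rw [Presentation.tensor_letters, Presentation.tensor_letters, e₁, e₂]
    change (([none] ++ _) ++ _).Nodup
    simp only [List.nodup_append, List.nodup_singleton, true_and]
    refine ⟨⟨hl.map fun x y h => by simpa using h, ?_⟩, hl'.map fun x y h => by simpa using h, ?_⟩
    · simp
    · simp
  have := (s1.comp (((Structural.shuffle p s).whiskerLeft p₀).comp su)).unique (.id _) hn
  rw [s2.unique (s3.comp su) hn, reassoc_of% e, whisker_exchange_assoc,
    reassoc_of% sumAppend_naturality, this, Category.comp_id]

end

/-! ### Decomposition maps of a preoperad: naturality and units -/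

section

variable {C : Type w} [Category.{v} C] [MonoidalCategory C] [SymmetricCategory C]

/-- The tensor product of copies of the unit object. -/
def tensUnit {ι : Type*} : (l : List ι) → (tens (fun _ => 𝟙_ C) l ⟶ 𝟙_ C)
  | [] => 𝟙 _
  | _ :: l => 𝟙_ C ◁ tensUnit l ≫ (λ_ _).hom

lemma Structural.tensUnit {Q ι : Type*} {V : Q → C} (l : List ι) :
    Structural (V := V) (.list (fun _ => .unit) l) .unit (tensUnit l) := by
  induction l with
  | nil => exact id _
  | cons i l ih => exact (ih.whiskerLeft .unit).comp (leftUnitor _)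

lemma tensPerm_refl {ι : Type*} (V : ι → C) (l : List ι) (hl : l.Nodup) (h : l.Perm l) :
    tensPerm V l l h = 𝟙 _ := by
  refine (Structural.tensPerm (fun i => .var (V := V) i) l l h).unique (.id _) ?_
  rw [Presentation.list_letters_of_eq _ id (fun _ => rfl), List.map_id]
  exact hl

lemma decomp_aux₁ {P A A' L L₁ L₂ B B' : C} (p : P ⟶ A ⊗ L) (h : A ⟶ A') (t : L ⟶ L₁)
    (r : L₁ ⟶ L₂) (x : A' ⟶ B) (y : A ⟶ B') (z : B' ⟶ B) (e : h ≫ x = y ≫ z) :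
    (((p ≫ A ◁ t) ≫ h ▷ L₁) ≫ A' ◁ r) ≫ x ▷ L₂ = (p ≫ y ▷ L) ≫ (z ⊗ₘ (t ≫ r)) := by
  have e' := congrArg (fun k => p ≫ A ◁ (t ≫ r) ≫ k ▷ L₂) e
  simp only [comp_whiskerRight, whiskerLeft_comp, Category.assoc, whisker_exchange_assoc,
    whisker_exchange, MonoidalCategory.tensorHom_def'] at e' ⊢
  exact e'

lemma decomp_aux₂ {P U A B L L' : C} (g : P ⟶ U ⊗ L) (s : U ⟶ A ⊗ B) (u : B ⟶ 𝟙_ C) (m : L ⟶ L')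
    (t : L' ⟶ 𝟙_ C) :
    (g ≫ s ▷ L ≫ (α_ _ _ _).hom) ≫ A ◁ ((u ⊗ₘ m) ≫ 𝟙_ C ◁ t ≫ (λ_ _).hom) ≫ (ρ_ _).hom =
      (g ≫ U ◁ (m ≫ t) ≫ (ρ_ _).hom) ≫ s ≫ A ◁ u ≫ (ρ_ _).hom := by
  have h : (g ≫ U ◁ (m ≫ t) ≫ (ρ_ _).hom) ≫ s ≫ A ◁ u ≫ (ρ_ _).hom =
      g ≫ (s ≫ A ◁ u ≫ (ρ_ _).hom) ▷ L ≫ A ◁ (m ≫ t) ≫ (ρ_ _).hom := by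
    rw [← whisker_exchange_assoc, rightUnitor_naturality]
    simp
  rw [h, MonoidalCategory.tensorHom_def]
  monoidal

namespace Preoperad

open OTree

variable (X : Preoperad C)

lemma isDecomp_iter (T : OTree) (c : List T.Edge) (h : T.Incomp c) :
    X.IsDecomp (fun e : T.Edge => e.1) T.above T c (T.cut c) (X.iter T c h) := by
  induction c with
  | nil => exact ⟨T.same_cut_nil, rfl⟩
  | cons e c ih =>
    refine ⟨T.cut c, _, (isCut_cut (T.cut c) ⟨e.1, h.mem_cut⟩).of_same (Same.refl _)
      (same_cut_cons h), (isAbove_above (T.cut c) ⟨e.1, h.mem_cut⟩).of_same (Same.refl _)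
      (same_above_cons h), ih (List.pairwise_cons.1 h).2, ?_⟩
    change X.iter T c (List.pairwise_cons.1 h).2 ≫
      (X.θ (T.cut c) ⟨e.1, h.mem_cut⟩ ▷ _) ≫ (α_ _ _ _).hom ≫
      (X.presheaf.resSame (OTree.same_cut_cons h) ⊗ₘ
        (X.presheaf.resSame (OTree.same_above_cons h) ▷ _)) =
      X.iter T c _ ≫ (X.θ (T.cut c) ⟨e.1, h.mem_cut⟩ ≫
        (X.presheaf.resSame (OTree.same_cut_cons h) ⊗ₘ
          X.presheaf.resSame (OTree.same_above_cons h))) ▷ _ ≫ (α_ _ _ _).hom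
    rw [comp_whiskerRight, Category.assoc, ← tensorHom_id (_ ⊗ₘ _), associator_naturality,
      tensorHom_id]

/-- The decomposition of `X(R)` at the images of the leaves of `S`. -/
def cutDecomp {S R : OTree} (α : S ⟶ R) : X.ob R ⟶ X.ob (R.cut (leafImages α)) ⊗
    tens (fun l : S.Leaf => X.ob (R.above (α.toFun l.1))) S.leaves :=
  X.iter R (leafImages α) (leafImages_incomp α) ≫
    X.ob (R.cut (leafImages α)) ◁
      (tensRelabel (fun l : S.Leaf => α.toFun l.1) (fun e => X.ob (R.above e)) S.leaves).hom

lemma decomp_eq {S R : OTree} (α : S ⟶ R) :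
    X.decomp α = X.cutDecomp α ≫ X.presheaf.res (toPruning α) (toPruning_inner α) ▷ _ := by
  rw [cutDecomp, decomp, MonoidalCategory.tensorHom_def', Category.assoc]

lemma isDecomp_cutDecomp {S R : OTree} (α : S ⟶ R) :
    X.IsDecomp (ι := S.Leaf) (fun l => (α.toFun l.1).1) (fun l => R.above (α.toFun l.1)) R S.leaves
      (R.cut (leafImages α)) (X.cutDecomp α) :=
  (X.isDecomp_iter R (leafImages α) (leafImages_incomp α)).of_map (fun l : S.Leaf => α.toFun l.1)

/-- `R` and `R'` are cut at the images of the same leaves, and decompositions are natural for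
morphisms of `A`. Afterwards both remaining trees are restricted to `S`, by maps which agree on
edges. -/
lemma res_decomp {S R R' : OTree} (a : S ⟶ R) (γ : R ⟶ R') (hγ : inner γ) :
    X.presheaf.res γ hγ ≫ X.decomp a = X.decomp (a ≫ γ) ≫ X.ob S ◁ tensMap (fun l : S.Leaf =>
      X.presheaf.res (aboveMap γ (a.toFun l.1)) (aboveMap_inner γ hγ _)) S.leaves := by
  obtain ⟨c, hc, hct, e⟩ := (X.isDecomp_cutDecomp a).exists_naturality hγ
    (fun l : S.Leaf => aboveMap γ (a.toFun l.1)) (fun l => aboveMap_inner γ hγ _)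
    (fun l x => ⟨(mem_above.1 x.2).1, rfl⟩)
    (fun l x h => congrArg (fun y => (γ.toFun y).1) (Subtype.ext h)) (X.isDecomp_cutDecomp (a ≫ γ))
  rw [decomp_eq, decomp_eq, reassoc_of% e, Category.assoc, MonoidalCategory.tensorHom_def,
    Category.assoc, whisker_exchange, ← comp_whiskerRight_assoc,
    PshA.res_res _ _ _ _ _ (toPruning (a ≫ γ)) (toPruning_inner _)]
  · rfl
  · refine hom_ext_val fun x => ?_
    obtain ⟨_, h⟩ := hct ((toPruning a).toFun x)
    exact h

/-- Composition with `γ` keeps the set of edges at which `T` is cut and changes only their order.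
Images of distinct leaves are incomparable, so the cuts may be reordered. -/
lemma decomp_inner_comp {S S' T : OTree} (γ : S ⟶ S') (hγ : inner γ) (α : S' ⟶ T) :
    X.decomp (γ ≫ α) = X.decomp α ≫ (X.presheaf.res γ hγ ⊗ₘ
      tensReindex (fun l : S'.Leaf => X.ob (T.above (α.toFun l.1))) (leafMap γ hγ)
        (leafMap_perm γ hγ)) := by
  obtain ⟨s, hs⟩ := (X.isDecomp_cutDecomp α).exists_shuffle (leafMap_perm γ hγ).symm
    fun x y hx _ => by
      have hxy : x ≠ y := by
        rintro rfl
        simpa using hx.nodup S'.leaves_nodup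
      exact ⟨fun h => hxy (Subtype.ext (x.2 _ ((α.le_iff _ _).1 h)).symm),
        fun h => hxy (Subtype.ext (y.2 _ ((α.le_iff _ _).1 h)))⟩
  have hm : ∀ x, x ∈ leafImages (γ ≫ α) ↔ x ∈ leafImages α := fun x => by
    simp only [List.mem_map]
    constructor
    · rintro ⟨l, -, rfl⟩
      exact ⟨leafMap γ hγ l, S'.mem_leaves _, rfl⟩
    · rintro ⟨l, -, rfl⟩
      obtain ⟨l', -, rfl⟩ := List.mem_map.1 ((leafMap_perm γ hγ).symm.subset (S'.mem_leaves l))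
      exact ⟨l', S.mem_leaves _, rfl⟩
  have hc : Same (T.cut (leafImages (γ ≫ α))) (T.cut (leafImages α)) :=
    ⟨fun x => by simp only [mem_cut, hm], rfl, fun _ _ _ _ => Iff.rfl⟩
  have e := (X.isDecomp_cutDecomp (γ ≫ α)).unique
    ((hs.comp_same hc).of_map (leafMap γ hγ)) fun l x hx => (mem_above.1 hx).1
  -- Both sides permute distinct factors, so the shuffle obtained above is the canonical reindexing.
  have e' : s.map (fun l : S'.Leaf => X.ob (T.above (α.toFun l.1))) ≫
      (tensRelabel (leafMap γ hγ) (fun l : S'.Leaf => X.ob (T.above (α.toFun l.1)))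
        S.leaves).hom = tensReindex (fun l : S'.Leaf => X.ob (T.above (α.toFun l.1)))
          (leafMap γ hγ) (leafMap_perm γ hγ) := by
    let p := fun l : S'.Leaf =>
      (.var l : Presentation (fun l : S'.Leaf => X.ob (T.above (α.toFun l.1))) _)
    refine ((Structural.shuffle p s).comp (Structural.tensRelabel p _ _)).unique
      (Structural.tensReindex p _ _) ?_
    rw [Presentation.list_letters_of_eq _ (leafMap γ hγ) (fun _ => rfl)]
    exact (leafMap_perm γ hγ).nodup_iff.2 S'.leaves_nodup
  rw [decomp_eq, decomp_eq, e, ← e']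
  refine decomp_aux₁ _ _ _ _ _ _ _ ?_
  rw [PshA.res_res _ _ _ _ _ (toPruning (γ ≫ α) ≫ hc.hom)
      (inner.comp_mem _ _ (toPruning_inner _) hc.inner) rfl,
    PshA.res_res X.presheaf γ hγ (toPruning α) (toPruning_inner _) (toPruning (γ ≫ α) ≫ hc.hom)
      (inner.comp_mem _ _ (toPruning_inner _) hc.inner) rfl]

/-- The evaluation at a tree with one edge. -/
def evalRoot {T : OTree} (h : T.IsLeaf T.rootEdge) : X.ob T ⟶ 𝟙_ C :=
  X.presheaf.res (rootInc T) (rootInc_inner T h) ≫ X.unit.hom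

lemma split_evalRoot {T A B : OTree} {e : ℕ} (h : IsCut T A e) (h' : IsAbove T B e)
    (hB : B.IsLeaf B.rootEdge) (hA : Same A T) :
    X.split h h' ≫ X.ob A ◁ X.evalRoot hB ≫ (ρ_ _).hom = X.presheaf.resSame hA := by
  have he : T.IsLeaf ⟨e, h.mem⟩ := fun y hy => by
    have hyB : y.1 ∈ B.edges := (h'.mem_iff _).2 ⟨y.2, hy⟩
    have hB' := hB ⟨y.1, hyB⟩ (B.root_le _ hyB)
    exact Subtype.ext (((congrArg Subtype.val hB' :)).trans h'.root)
  have hl := congrArg (fun z => z ≫ X.presheaf.resSame hA) (X.leaf_cut T ⟨⟨e, h.mem⟩, he⟩)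
  simp only [Category.assoc, Category.id_comp] at hl
  have e : X.presheaf.resSame h'.same ≫ X.evalRoot hB = X.presheaf.res (rootInc _)
      (rootInc_inner _ (isLeaf_above_leaf ⟨⟨e, h.mem⟩, he⟩)) ≫ X.unit.hom := by
    rw [evalRoot, ← Category.assoc]
    exact congrArg (fun z => z ≫ X.unit.hom) (PshA.res_res _ _ _ _ _ _ _ (eq_rootInc _))
  rw [← hl, ← rightUnitor_naturality, split, Category.assoc, ← id_tensorHom, ← tensorHom_id,
    tensorHom_comp_tensorHom_assoc, tensorHom_comp_tensorHom_assoc, Category.comp_id,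
    Category.comp_id, e, PshA.resSame_trans]

/-- Each cut separates a tree with a single edge. By the axiom `leaf_cut` such a piece can be
evaluated away, and the cut has no effect. -/
lemma IsDecomp.evalRoot {X : Preoperad C} {ι : Type*} {e : ι → ℕ} {B : ι → OTree} {T A : OTree}
    {l : List ι} {f : X.ob T ⟶ X.ob A ⊗ tens (fun i => X.ob (B i)) l} (hf : X.IsDecomp e B T l A f)
    (hB : ∀ i, (B i).IsLeaf (B i).rootEdge) : ∃ h : Same A T,
      f ≫ X.ob A ◁ (tensMap (fun i => X.evalRoot (hB i)) l ≫ tensUnit l) ≫ (ρ_ _).hom =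
        X.presheaf.resSame h := by
  induction l generalizing A with
  | nil =>
    obtain ⟨h, rfl⟩ := hf
    refine ⟨h, ?_⟩
    change (_ ≫ (ρ_ _).inv) ≫ X.ob A ◁ (𝟙 (𝟙_ C) ≫ 𝟙 (𝟙_ C)) ≫ (ρ_ _).hom = _
    simp
  | cons i l ih =>
    obtain ⟨U, g, k, k', hg, rfl⟩ := hf
    obtain ⟨h, e⟩ := ih hg
    have hA : Same A U := by
      refine ⟨fun x => ?_, k.root, k.le_iff⟩
      rw [k.mem_iff]
      refine ⟨fun hx => hx.1, fun hx => ⟨hx, fun hx' => ?_⟩⟩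
      have hxB := (k'.mem_iff _).2 ⟨hx, hx'⟩
      exact ((congrArg Subtype.val (hB i ⟨x, hxB⟩ ((B i).root_le _ hxB)) :)).trans k'.root
    refine ⟨hA.trans h, ?_⟩
    rw [← PshA.resSame_trans _ hA h, ← e, ← X.split_evalRoot k k' (hB i) hA]
    exact decomp_aux₂ _ _ _ _ _

/-- Along the identity, the cuts are made at the leaves. This is the source of the counit law in
which the counit is applied inside `H_X`. -/
lemma decomp_id_evalRoot (T : OTree) :
    X.decomp (𝟙 T) ≫ X.ob T ◁ (tensMap (fun l : T.Leaf => X.evalRoot (isLeaf_above_leaf l))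
      T.leaves ≫ tensUnit T.leaves) ≫ (ρ_ _).hom = 𝟙 _ := by
  obtain ⟨h, e⟩ := (X.isDecomp_cutDecomp (𝟙 T)).evalRoot fun l => isLeaf_above_leaf l
  have e' := congrArg (fun z => z ≫ X.presheaf.res (toPruning (𝟙 T)) (toPruning_inner (𝟙 T))) e
  rw [PshA.res_res _ _ _ _ _ (𝟙 T) (inner.id_mem T) rfl, PshA.res_id] at e'
  rw [decomp_eq, ← e', Category.assoc, Category.assoc, Category.assoc, ← rightUnitor_naturality]
  congr 1
  exact (whisker_exchange_assoc _ _ _).symm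

lemma split_root {T A B : OTree} {e : ℕ} (h : IsCut T A e) (h' : IsAbove T B e) (he : e = T.root)
    (a : eta ⟶ A) (ha : inner a) (hB : Same T B) : X.split h h' ≫
      (X.presheaf.res a ha ≫ X.unit.hom ⊗ₘ X.presheaf.resSame hB) ≫ (λ_ _).hom = 𝟙 _ := by
  subst he
  obtain rfl := eq_rootInc a
  rw [split, Category.assoc, tensorHom_comp_tensorHom_assoc, ← Category.assoc (X.presheaf.res _ _),
    PshA.resSame_trans]
  refine Eq.trans ?_ (X.root_cut T)
  congr 4
  exact PshA.res_res _ _ _ _ _ _ _ (eq_rootInc _)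

lemma IsDecomp.root {X : Preoperad C} {ι : Type*} {e : ι → ℕ} {B : ι → OTree} {T A : OTree}
    {l : List ι} {f : X.ob T ⟶ X.ob A ⊗ tens (fun i => X.ob (B i)) l} (hf : X.IsDecomp e B T l A f)
    {i : ι} (hl : l.Perm [i]) (he : e i = T.root) (a : eta ⟶ A) (ha : inner a)
    (hB : Same T (B i)) : f ≫ (X.presheaf.res a ha ≫ X.unit.hom ⊗ₘ
      tensPerm (fun i => X.ob (B i)) l [i] hl ≫ tensSingle _ i ≫ X.presheaf.resSame hB) ≫
        (λ_ _).hom = 𝟙 _ := by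
  obtain rfl := List.perm_singleton.1 hl
  obtain ⟨U, g, k, k', ⟨h, rfl⟩, rfl⟩ := hf
  rw [tensPerm_refl _ _ (List.nodup_singleton i), Category.id_comp]
  have hr := X.split_root (k.of_same h.symm (Same.refl _)) (k'.of_same h.symm (Same.refl _)) he
    a ha hB
  have hs := X.split_same h k k' (k.of_same h.symm (Same.refl _)) (k'.of_same h.symm (Same.refl _))
    (Same.refl _) (Same.refl _)
  rw [PshA.resSame_refl, PshA.resSame_refl, id_tensorHom_id, Category.comp_id] at hs
  rw [← hs] at hr
  refine Eq.trans ?_ hr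
  change ((_ ≫ (ρ_ _).inv) ≫ X.split k k' ▷ 𝟙_ C ≫ (α_ _ _ _).hom) ≫
    (_ ⊗ₘ ((ρ_ (X.ob (B i))).hom ≫ X.presheaf.resSame hB)) ≫ _ = _
  rw [MonoidalCategory.tensorHom_def', MonoidalCategory.tensorHom_def']
  monoidal

/-- The only cut is at the root, and the axiom `root_cut` applies. This is the source of the counit
law for the outer `H_X`. -/
lemma decomp_rootInc (T : OTree) : X.decomp (rootInc T) ≫ (X.unit.hom ⊗ₘ
    tensPerm (fun l : eta.Leaf => X.ob (T.above ((rootInc T).toFun l.1))) _ _ eta_leaves_perm ≫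
      tensSingle (fun l : eta.Leaf => X.ob (T.above ((rootInc T).toFun l.1))) etaLeaf ≫
      X.presheaf.resSame (same_above_of_eta (rootInc T))) ≫ (λ_ _).hom = 𝟙 _ := by
  have h := (X.isDecomp_cutDecomp (rootInc T)).root eta_leaves_perm rfl (toPruning (rootInc T))
    (toPruning_inner _) (same_above_of_eta (rootInc T))
  refine Eq.trans ?_ h
  rw [decomp_eq, Category.assoc, ← tensorHom_id, tensorHom_comp_tensorHom_assoc, Category.id_comp]

end Preoperad

end

/-! ### Associativity of the decomposition maps -/

section

namespace OTree

/-- Inside the subtree above the image of `l`, a cut at a leaf of `R` matters only if this leaf lies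
above `a l`. So the pieces do not depend on the order of cutting and passing to the subtree. -/
lemma same_cut_above {S R P : OTree} (a : S ⟶ R) (b : R ⟶ P) (l : S.Leaf) :
    Same ((P.above (b.toFun (a.toFun l.1))).cut (leafImages (aboveMap b (a.toFun l.1))))
      ((P.cut (leafImages b)).above ((toPruning b).toFun (a.toFun l.1))) where
  mem_iff x := by
    rw [mem_cut, mem_above, mem_above, mem_cut]
    constructor
    · rintro ⟨⟨h₁, h₂⟩, h₃⟩
      refine ⟨⟨h₁, fun c hc hcx => ?_⟩, h₂⟩
      obtain ⟨m, -, rfl⟩ := List.mem_map.1 hc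
      have hm : R.le (a.toFun l.1).1 m.1.1 := by
        rcases P.le_total_below _ (b.toFun (a.toFun l.1)).2 _ (b.toFun m.1).2 _ h₁ h₂ hcx with h | h
        · exact (b.le_iff _ _).1 h
        · rw [m.2 _ ((b.le_iff _ _).1 h)]
          exact R.le_refl _ m.1.2
      exact h₃ _ (List.mem_map.2 ⟨⟨⟨m.1.1, mem_above.2 ⟨m.1.2, hm⟩⟩, isLeaf_above _ m.2⟩,
        mem_leaves _ _, rfl⟩) hcx
    · rintro ⟨⟨h₁, h₂⟩, h₃⟩
      refine ⟨⟨h₁, h₃⟩, fun c hc hcx => ?_⟩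
      obtain ⟨m, -, rfl⟩ := List.mem_map.1 hc
      exact h₂ _ (List.mem_map.2 ⟨leafUp a ⟨l, m⟩, mem_leaves _ _, rfl⟩) hcx
  root := rfl
  le_iff _ _ _ _ := Iff.rfl

/-- Every leaf of `R` lies above the image of a leaf of `S`, so cutting at the leaves of `R`
beforehand does not change the component of the root. -/
lemma same_cut_cut {S R P : OTree} (a : S ⟶ R) (b : R ⟶ P) : Same (P.cut (leafImages (a ≫ b)))
    ((P.cut (leafImages b)).cut (leafImages (a ≫ toPruning b))) where
  mem_iff x := by
    rw [mem_cut, mem_cut, mem_cut]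
    refine ⟨fun ⟨h₁, h₂⟩ => ⟨⟨h₁, fun c hc hcx => ?_⟩, fun c hc hcx => ?_⟩,
      fun ⟨⟨h₁, h₂⟩, h₃⟩ => ⟨h₁, fun c hc hcx => ?_⟩⟩
    · obtain ⟨m, -, rfl⟩ := List.mem_map.1 hc
      obtain ⟨l, hl, hlm⟩ := a.exists_leaf_le _ m.2
      have hbl := (b.le_iff _ _).2 hlm
      have hx := h₂ _ (List.mem_map.2 ⟨⟨l, hl⟩, S.mem_leaves _, rfl⟩)
        (P.le_trans _ (b.toFun _).2 _ (b.toFun m.1).2 _ h₁ hbl hcx)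
      rw [hx] at hcx
      rw [hx, ← m.2 _ ((b.le_iff _ _).1 hcx)]
      rfl
    · obtain ⟨l, -, rfl⟩ := List.mem_map.1 hc
      exact h₂ _ (List.mem_map.2 ⟨l, S.mem_leaves _, rfl⟩) hcx
    · obtain ⟨l, -, rfl⟩ := List.mem_map.1 hc
      exact h₃ _ (List.mem_map.2 ⟨l, S.mem_leaves _, rfl⟩) hcx
  root := rfl
  le_iff _ _ _ _ := Iff.rfl

lemma interleave_perm {S R : OTree} (a : S ⟶ R) :
    ((S.leaves.map Sum.inl : List (S.Leaf ⊕ R.Leaf)) ++ R.leaves.map Sum.inr).Perm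
      (S.leaves.flatMap fun c => Sum.inl c ::
        ((R.above (a.toFun c.1)).leaves.map fun k => leafUp a ⟨c, k⟩).map Sum.inr) := by
  refine List.Perm.trans ?_ (List.flatMap_append_perm S.leaves (fun c => [Sum.inl c]) fun c =>
    ((R.above (a.toFun c.1)).leaves.map fun k => leafUp a ⟨c, k⟩).map Sum.inr)
  have h : (S.leaves.flatMap fun c => [(.inl c : S.Leaf ⊕ R.Leaf)]) = S.leaves.map Sum.inl :=
    List.flatMap_pure_eq_map _ _
  rw [h]
  refine List.Perm.append_left _ ?_
  refine ((leafUp_perm a).symm.map Sum.inr).trans (List.Perm.of_eq ?_)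
  simp only [List.sigma, List.map_flatMap, List.map_map]
  rfl

/-- Within its own block `c` comes first, so `m` belongs to the block of another leaf of `S`. The
images of the two leaves are incomparable, and `m` cannot lie above both. -/
lemma interleave_incomp {S R : OTree} (a : S ⟶ R) {c : S.Leaf} {m : R.Leaf}
    (h : [(.inr m : S.Leaf ⊕ R.Leaf), .inl c].Sublist (S.leaves.flatMap fun c => Sum.inl c ::
        ((R.above (a.toFun c.1)).leaves.map fun k => leafUp a ⟨c, k⟩).map Sum.inr)) :
    ¬ R.le (a.toFun c.1).1 m.1.1 := by
  have hp : (S.leaves.flatMap fun c => (.inl c : S.Leaf ⊕ R.Leaf) ::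
      ((R.above (a.toFun c.1)).leaves.map fun k => leafUp a ⟨c, k⟩).map Sum.inr).Pairwise
      fun x y => ∀ m c, x = .inr m → y = .inl c → ¬ R.le (a.toFun c.1).1 m.1.1 := by
    rw [List.pairwise_flatMap]
    refine ⟨fun c _ => ?_, S.leaves_nodup.imp fun {c d} hcd => ?_⟩
    · rw [List.pairwise_cons]
      refine ⟨fun _ _ _ _ h => by simp at h, ?_⟩
      rw [List.pairwise_map]
      exact List.pairwise_of_forall fun _ _ _ _ _ h => by simp at h
    · rintro x hx y hy m c' rfl rfl hle
      simp only [List.mem_cons, reduceCtorEq, List.mem_map, Sum.inr.injEq, exists_eq_right,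
        false_or, Sum.inl.injEq, and_false, exists_false, or_false] at hx hy
      subst hy
      obtain ⟨k, -, rfl⟩ := hx
      have hk := mem_above.1 k.1.2
      rcases R.le_total_below _ (a.toFun c.1).2 _ (a.toFun c'.1).2 _ hk.1 hk.2 hle with h | h
      · exact hcd (Subtype.ext (c.2 _ ((a.le_iff _ _).1 h)).symm)
      · exact hcd (Subtype.ext (c'.2 _ ((a.le_iff _ _).1 h)))
  have := List.pairwise_pair.1 (hp.sublist h)
  exact this m c rfl rfl

end OTree

variable {C : Type w} [Category.{v} C] [MonoidalCategory C] [SymmetricCategory C]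

lemma decomp_aux₃ {κ ι : Type*} {F : κ ⊕ ι → C} {P A A₁ : C} {l : List κ} {l' : List ι}
    (f : P ⟶ A ⊗ tens (fun i => F (.inr i)) l') (g : A ⟶ A₁ ⊗ tens (fun i => F (.inl i)) l) :
    (f ≫ A ◁ (tensRelabel .inr F l').inv) ≫ (g ≫ A₁ ◁ (tensRelabel .inl F l).inv) ▷ _ ≫
      (α_ _ _ _).hom ≫ _ ◁ tensAppend F _ _ = (f ≫ g ▷ _) ≫ (sumAppend F A₁ l l').hom := by
  simp only [sumAppend, Iso.trans_hom, whiskerLeftIso_hom, tensorIso_hom, tensAppendIso_hom,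
    Iso.symm_hom, Category.assoc, MonoidalCategory.tensorHom_def, whiskerLeft_comp,
    comp_whiskerRight]
  rw [whisker_exchange_assoc, whisker_exchange_assoc]
  monoidal

lemma regroup_eq_of_join' {κ ι : Type*} {κ' : κ → Type*} {F : κ ⊕ ι → C} {A₁ A₂ A₃ P : C}
    {B : (c : κ) → κ' c → C} {G H : κ → C} {m : (c : κ) → List (κ' c)} {l : List κ} {l' : List ι}
    (g : (Σ c, κ' c) → ι) (b : ∀ c k, B c k ⟶ F (.inr (g ⟨c, k⟩))) (hb : ∀ c k, IsIso (b c k))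
    (h : ((l.sigma m).map g).Perm l') (hl : l.Nodup) (hl' : l'.Nodup)
    (ψ : P ⟶ (A₁ ⊗ tens (fun c => F (.inl c)) l) ⊗ tens (fun i => F (.inr i)) l')
    (f : P ⟶ A₂ ⊗ tens G l) (f' : ∀ c, G c ⟶ F (.inl c) ⊗ tens (B c) (m c)) (r : A₁ ⟶ A₂)
    (s : Shuffle (l.map .inl ++ l'.map .inr)
      (l.flatMap fun c => .inl c :: ((m c).map fun k => g ⟨c, k⟩).map .inr))
    (e : f ≫ A₂ ◁ (tensMap (fun c => (f' c ≫ F (.inl c) ◁ tensMap (b c) (m c)) ≫ F (.inl c) ◁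
        (tensRelabel (fun k => g ⟨c, k⟩) (fun i => F (.inr i)) (m c)).inv) l ≫
        tensJoin F (fun c => (m c).map fun k => g ⟨c, k⟩) l) =
      ((ψ ≫ (sumAppend F A₁ l l').hom) ≫ A₁ ◁ s.map F) ≫ r ▷ _)
    (z : A₂ ⟶ A₃) (w : ∀ c, F (.inl c) ⟶ H c) :
    (f ≫ z ▷ _) ≫ A₃ ◁ tensMap (fun c => f' c ≫ w c ▷ _) l ≫ regroup A₃ H g b h =
      ψ ≫ (r ≫ z ⊗ₘ tensMap w l) ▷ _ := by
  have := regroup_eq_of_join g b h hl hl' ψ (f ≫ A₂ ◁ tensMap f' l) r s (by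
    rw [← Category.assoc ψ]
    refine Eq.trans ?_ e
    simp only [Category.assoc, whiskerLeft_comp, tensMap_comp])
  rw [← Category.id_comp (tensMap w l), ← tensorHom_comp_tensorHom, comp_whiskerRight,
    tensorHom_id, ← reassoc_of% this, ← regroup_naturality, tensMap_comp,
    MonoidalCategory.tensorHom_def]
  simp only [Category.assoc, whiskerLeft_comp]
  rw [whisker_exchange_assoc]

lemma decomp_aux₄ {P A L' R S N A₁ M : C} (c : P ⟶ A ⊗ L') (x : A ⟶ R) (D : R ⟶ S ⊗ N)
    (g : A ⟶ A₁ ⊗ M) (y : A₁ ⟶ S) (w : M ⟶ N) (hx : x ≫ D = g ≫ (y ⊗ₘ w)) :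
    (c ≫ x ▷ L') ≫ D ▷ L' = (c ≫ g ▷ L') ≫ (y ⊗ₘ w) ▷ L' := by
  simp only [Category.assoc, ← comp_whiskerRight, hx]

lemma decomp_aux₅ {A A₁ S M N N' : C} (c : A ⟶ A₁ ⊗ M) (y : A₁ ⟶ S) (t : M ⟶ N) (w : N ⟶ N')
    (v : M ⟶ N') (h : t ≫ w = v) : (c ≫ y ▷ M) ≫ S ◁ v = (c ≫ A₁ ◁ t) ≫ (y ⊗ₘ w) := by
  subst h
  rw [MonoidalCategory.tensorHom_def, Category.assoc, Category.assoc, whisker_exchange_assoc,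
    whiskerLeft_comp]

instance (X : PshA C) {S T : OTree} (h : OTree.Same S T) : IsIso (X.resSame h) :=
  ⟨X.resSame h.symm, by rw [PshA.resSame_trans, PshA.resSame_refl],
    by rw [PshA.resSame_trans, PshA.resSame_refl]⟩

namespace Preoperad

open OTree

variable (X : Preoperad C)

/-- Both sides cut `P` at the images of the leaves of `R` and of `S`. On the left all leaves of `R`
come first. On the right the pieces for the leaves of `S` are decomposed further, which by `flatten`
means that for each leaf of `S` the cuts above it are made and then its own. Passing from one order
to the other exchanges incomparable edges only, so `IsDecomp.unique` compares the two. -/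
lemma decomp_assoc {S R P : OTree} (a : S ⟶ R) (b : R ⟶ P) :
    X.decomp b ≫ (X.decomp a ▷ _) = X.decomp (a ≫ b) ≫
      X.ob S ◁ tensMap (fun l : S.Leaf => X.decomp (aboveMap b (a.toFun l.1))) S.leaves ≫
      regroup (X.ob S) (fun l : S.Leaf => X.ob (R.above (a.toFun l.1)))
        (B := fun l (k : (R.above (a.toFun l.1)).Leaf) => X.ob
          ((P.above (b.toFun (a.toFun l.1))).above ((aboveMap b (a.toFun l.1)).toFun k.1)))
        (D := fun k : R.Leaf => X.ob (P.above (b.toFun k.1))) (leafUp a)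
        (fun l k => X.presheaf.resSame (same_above_above (b.toFun (a.toFun l.1))
          ((aboveMap b (a.toFun l.1)).toFun k.1))) (leafUp_perm a) := by
  -- The labels form a disjoint union because an edge of `P` may be the image of a leaf of `S` and
  -- of a leaf of `R`. It is then cut twice, and the cut labelled by the leaf of `S` separates a
  -- tree with one edge.
  let e : S.Leaf ⊕ R.Leaf → ℕ :=
    Sum.elim (fun l => (b.toFun (a.toFun l.1)).1) (fun m => (b.toFun m.1).1)
  let B : S.Leaf ⊕ R.Leaf → OTree := Sum.elim
    (fun l => (P.above (b.toFun (a.toFun l.1))).cut (leafImages (aboveMap b (a.toFun l.1))))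
    (fun m => P.above (b.toFun m.1))
  let g := X.cutDecomp (a ≫ toPruning b) ≫ _ ◁ tensMap (fun l : S.Leaf =>
    X.presheaf.resSame (same_cut_above a b l)) S.leaves
  have h₁ : X.IsDecomp e B P (S.leaves.map .inl ++ R.leaves.map .inr) _ _ :=
    ((X.isDecomp_cutDecomp b).map (e := e) (B := B) .inr).append
      (((X.isDecomp_cutDecomp (a ≫ toPruning b)).comp_pieces (same_cut_above a b)).map
        (e := e) (B := B) .inl)
  have h₁' : X.IsDecomp e B P (S.leaves.map .inl ++ R.leaves.map .inr) _
      ((X.cutDecomp b ≫ g ▷ _) ≫ (sumAppend (fun x => X.ob (B x)) _ S.leaves R.leaves).hom) :=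
    (congrArg (X.IsDecomp e B P (S.leaves.map .inl ++ R.leaves.map .inr) _)
      (decomp_aux₃ (F := fun x => X.ob (B x)) (X.cutDecomp b) g)).mp h₁
  have h₂ := IsDecomp.flatten (e := e) (B := B) (fun l : S.Leaf =>
    ((X.isDecomp_cutDecomp (aboveMap b (a.toFun l.1))).comp_pieces
      (fun k : (R.above (a.toFun l.1)).Leaf =>
      same_above_above (b.toFun (a.toFun l.1)) ((aboveMap b (a.toFun l.1)).toFun k.1))).map
        (e := fun i => e (.inr i)) (B := fun i => B (.inr i)) (fun k => leafUp a ⟨l, k⟩))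
    (X.isDecomp_cutDecomp (a ≫ b))
  have hinc : ∀ x y, [x, y].Sublist (S.leaves.map Sum.inl ++ R.leaves.map Sum.inr) →
      [y, x].Sublist (S.leaves.flatMap fun c => Sum.inl c ::
        ((R.above (a.toFun c.1)).leaves.map fun k => leafUp a ⟨c, k⟩).map Sum.inr) →
      ¬ P.le (e x) (e y) ∧ ¬ P.le (e y) (e x) := by
    intro x y hx hy
    have hnd : (S.leaves.map Sum.inl ++ R.leaves.map Sum.inr : List (S.Leaf ⊕ R.Leaf)).Nodup :=
      List.nodup_append.2 ⟨S.leaves_nodup.map Sum.inl_injective,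
        R.leaves_nodup.map Sum.inr_injective, by simp⟩
    have hxy : x ≠ y := by
      rintro rfl
      simpa using hx.nodup hnd
    rcases x with x | x <;> rcases y with y | y
    · have hxy : x ≠ y := fun h => hxy (congrArg _ h)
      exact ⟨fun h => hxy (Subtype.ext (x.2 _ ((a.le_iff _ _).1 ((b.le_iff _ _).1 h))).symm),
        fun h => hxy (Subtype.ext (y.2 _ ((a.le_iff _ _).1 ((b.le_iff _ _).1 h))))⟩
    · have h := interleave_incomp a hy
      refine ⟨fun h' => h ((b.le_iff _ _).1 h'), fun h' => h ?_⟩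
      rw [y.2 _ ((b.le_iff _ _).1 h')]
      exact R.le_refl _ y.1.2
    · exfalso
      have hp : (S.leaves.map Sum.inl ++ R.leaves.map Sum.inr : List (S.Leaf ⊕ R.Leaf)).Pairwise
          fun x y => ¬ (x.isRight ∧ y.isLeft) := by
        rw [List.pairwise_append, List.pairwise_map, List.pairwise_map]
        exact ⟨List.pairwise_of_forall (by simp), List.pairwise_of_forall (by simp), by simp⟩
      exact List.pairwise_pair.1 (hp.sublist hx) ⟨rfl, rfl⟩
    · have hxy : x ≠ y := fun h => hxy (congrArg _ h)
      exact ⟨fun h => hxy (Subtype.ext (x.2 _ ((b.le_iff _ _).1 h)).symm),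
        fun h => hxy (Subtype.ext (y.2 _ ((b.le_iff _ _).1 h)))⟩
  obtain ⟨s, hs⟩ := h₁'.exists_shuffle (interleave_perm a) hinc
  have h₃ := h₂.unique (hs.comp_same (same_cut_cut a b)) (by
    rintro (l | m) x hx
    · exact (mem_above.1 (mem_cut.1 hx).1).1
    · exact (mem_above.1 hx).1)
  have : ∀ (c : S.Leaf) (k : (R.above (a.toFun c.1)).Leaf), IsIso (X.presheaf.resSame
      (same_above_above (b.toFun (a.toFun c.1)) ((aboveMap b (a.toFun c.1)).toFun k.1))) :=
    fun _ _ => inferInstance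
  have h₄ := regroup_eq_of_join' (F := fun x => X.ob (B x)) (leafUp a) (fun l k =>
    X.presheaf.resSame (same_above_above (b.toFun (a.toFun l.1))
      ((aboveMap b (a.toFun l.1)).toFun k.1))) this (leafUp_perm a) S.leaves_nodup R.leaves_nodup
    (X.cutDecomp b ≫ g ▷ _) (X.cutDecomp (a ≫ b))
      (fun l : S.Leaf => X.cutDecomp (aboveMap b (a.toFun l.1)))
    (X.presheaf.resSame (same_cut_cut a b)) s h₃
    (X.presheaf.res (toPruning (a ≫ b)) (toPruning_inner _))
    (fun l : S.Leaf => X.presheaf.res (toPruning (aboveMap b (a.toFun l.1))) (toPruning_inner _))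
  rw [PshA.res_res _ _ _ _ _ (toPruning (a ≫ toPruning b)) (toPruning_inner _) rfl] at h₄
  simp only [decomp_eq X b, decomp_eq X (a ≫ b), decomp_eq X (aboveMap _ _)]
  -- So far the remaining trees are prunings; restricting them to `S` and to the subtrees of `R`
  -- yields the decomposition maps.
  refine Eq.trans (decomp_aux₄ _ _ _ g _ _ ?_) h₄.symm
  refine (X.res_decomp a (toPruning b) (toPruning_inner b)).trans ?_
  rw [decomp_eq]
  refine decomp_aux₅ _ _ _ _ _ ((tensMap_comp _ _ _).symm.trans ?_)
  refine congrArg (fun z => tensMap z S.leaves) (funext fun l => ?_)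
  exact PshA.res_res _ _ _ _ _ _ _ rfl

end Preoperad

end

/-! ### Regrouping factors over the leaves: naturality and invertibility -/

section

variable {C : Type w} [Category.{v} C] [MonoidalCategory C]

lemma tensAppend_naturality {ι : Type*} {V W : ι → C} (f : ∀ i, V i ⟶ W i) (l l' : List ι) :
    (tensMap f l ⊗ₘ tensMap f l') ≫ tensAppend W l l' = tensAppend V l l' ≫ tensMap f (l ++ l') := by
  induction l with
  | nil =>
    change (𝟙 (𝟙_ C) ⊗ₘ tensMap f l') ≫ (λ_ _).hom = (λ_ _).hom ≫ tensMap f l'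
    rw [id_tensorHom, leftUnitor_naturality]
  | cons i l ih =>
    change ((f i ⊗ₘ tensMap f l) ⊗ₘ tensMap f l') ≫ (α_ _ _ _).hom ≫ W i ◁ tensAppend W l l' =
      ((α_ _ _ _).hom ≫ V i ◁ tensAppend V l l') ≫ (f i ⊗ₘ tensMap f (l ++ l'))
    rw [associator_naturality_assoc, Category.assoc, ← id_tensorHom, ← id_tensorHom,
      tensorHom_comp_tensorHom, tensorHom_comp_tensorHom, ih, Category.comp_id, Category.id_comp]

lemma tensRelabel_inv_naturality {ι κ : Type*} (g : ι → κ) {V W : κ → C} (f : ∀ i, V i ⟶ W i)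
    (l : List ι) : tensMap (fun i => f (g i)) l ≫ (tensRelabel g W l).inv =
      (tensRelabel g V l).inv ≫ tensMap f (l.map g) := by
  rw [Iso.comp_inv_eq, Category.assoc, tensRelabel_naturality, Iso.inv_hom_id_assoc]

lemma tensFlatten_naturality {ι : Type*} {κ : ι → Type*} {V W : (Σ i, κ i) → C}
    (f : ∀ x, V x ⟶ W x) (m : (i : ι) → List (κ i)) (l : List ι) :
    tensMap (fun i => tensMap (fun k => f ⟨i, k⟩) (m i)) l ≫ tensFlatten W m l =
      tensFlatten V m l ≫ tensMap f (l.sigma m) := by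
  induction l with
  | nil => rfl
  | cons i l ih =>
    have h := tensRelabel_inv_naturality (Sigma.mk i) f (m i)
    have h' := tensAppend_naturality f ((m i).map (Sigma.mk i)) (l.sigma m)
    change (_ ⊗ₘ _) ≫ ((tensRelabel (Sigma.mk i) W (m i)).inv ⊗ₘ tensFlatten W m l) ≫
      tensAppend W ((m i).map (Sigma.mk i)) (l.sigma m) =
      (((tensRelabel (Sigma.mk i) V (m i)).inv ⊗ₘ tensFlatten V m l) ≫
      tensAppend V ((m i).map (Sigma.mk i)) (l.sigma m)) ≫
        tensMap f ((m i).map (Sigma.mk i) ++ l.sigma m)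
    rw [Category.assoc, ← h', tensorHom_comp_tensorHom_assoc, h, ih,
      ← tensorHom_comp_tensorHom_assoc]

variable [SymmetricCategory C]

lemma Structural.isIso {Q : Type*} {V : Q → C} {A B : C} {P : Presentation V A}
    {P' : Presentation V B} {f : A ⟶ B} (h : Structural P P' f) : IsIso f := by
  obtain ⟨s, hs⟩ := h
  obtain ⟨u, hu, hu'⟩ := s.exists_inverse V
  rw [← Iso.eq_comp_inv] at hs
  subst hs
  have : IsIso (s.map V) := ⟨u.map V, hu, hu'⟩
  infer_instance

lemma Presentation.nodup_regroup {Q Q' ι σ : Type*} {V : Option (Q ⊕ Q') → C} {A₀ : C} {A : ι → C}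
    {D : σ → C} {p₀ : Presentation V A₀} {p : ∀ i, Presentation V (A i)}
    {q : ∀ s, Presentation V (D s)} {f : ι → Q} {f' : σ → Q'} {l : List ι} {l' : List σ}
    (h₀ : p₀.letters = [none]) (h : ∀ i, (p i).letters = [some (.inl (f i))])
    (h' : ∀ s, (q s).letters = [some (.inr (f' s))]) (hl : (l.map f).Nodup)
    (hl' : (l'.map f').Nodup) :
    ((p₀.tensor (.list p l)).tensor (.list q l')).letters.Nodup := by
  rw [tensor_letters, tensor_letters, h₀, list_letters_of_eq p _ h, list_letters_of_eq q _ h']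
  have e : l.map (fun i => some (.inl (f i))) = (l.map f).map (some ∘ (Sum.inl : Q → Q ⊕ Q')) := by
    simp
  have e' : l'.map (fun i => some (.inr (f' i))) =
      (l'.map f').map (some ∘ (Sum.inr : Q' → Q ⊕ Q')) := by simp
  rw [e, e', List.nodup_append, List.nodup_append]
  refine ⟨⟨List.nodup_singleton _, hl.map ((Option.some_injective _).comp Sum.inl_injective), ?_⟩,
    hl'.map ((Option.some_injective _).comp Sum.inr_injective), ?_⟩
  · simp
  · simp

lemma regroup_naturality_right {ι σ : Type*} {κ : ι → Type*} (A₀ : C) (A : ι → C)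
    {B B' : (i : ι) → κ i → C} {D D' : σ → C} {m : (i : ι) → List (κ i)} {l : List ι} {l' : List σ}
    (g : (Σ i, κ i) → σ) (b : ∀ (i : ι) (k : κ i), B i k ⟶ D (g ⟨i, k⟩))
    (b' : ∀ (i : ι) (k : κ i), B' i k ⟶ D' (g ⟨i, k⟩)) (h : ((l.sigma m).map g).Perm l')
    (f : ∀ i k, B i k ⟶ B' i k) (f' : ∀ s, D s ⟶ D' s)
    (e : ∀ i k, f i k ≫ b' i k = b i k ≫ f' (g ⟨i, k⟩)) :
    A₀ ◁ tensMap (fun i => A i ◁ tensMap (f i) (m i)) l ≫ regroup A₀ A g b' h =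
      regroup A₀ A g b h ≫ _ ◁ tensMap f' l' := by
  have h1 := tensUnzip_naturality (fun i => 𝟙 (A i)) (fun i => tensMap (f i) (m i)) l
  simp only [id_tensorHom, tensMap_id] at h1
  have h3 : tensMap (fun i => tensMap (f i) (m i)) l ≫ tensMap (fun i => tensMap (b' i) (m i)) l =
      tensMap (fun i => tensMap (b i) (m i)) l ≫
        tensMap (fun i => tensMap (fun k => f' (g ⟨i, k⟩)) (m i)) l := by
    rw [← tensMap_comp, ← tensMap_comp]
    refine congrArg (fun z => tensMap z l) (funext fun i => ?_)
    rw [← tensMap_comp, ← tensMap_comp]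
    exact congrArg (fun z => tensMap z (m i)) (funext fun k => e i k)
  have h2 : tensMap (fun i => tensMap (f i) (m i)) l ≫ tensMap (fun i => tensMap (b' i) (m i)) l ≫
      tensFlatten (fun x => D' (g x)) m l ≫ (tensRelabel g D' (l.sigma m)).inv ≫ tensPerm D' _ _ h =
      (tensMap (fun i => tensMap (b i) (m i)) l ≫
      tensFlatten (fun x => D (g x)) m l ≫ (tensRelabel g D (l.sigma m)).inv ≫ tensPerm D _ _ h) ≫
      tensMap f' l' := by
    simp only [Category.assoc]
    rw [← tensPerm_naturality, ← reassoc_of% tensRelabel_inv_naturality g f' (l.sigma m),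
      ← reassoc_of% tensFlatten_naturality (fun x => f' (g x)) m l, reassoc_of% h3]
  simp only [regroup, Category.assoc]
  rw [← whiskerLeft_comp_assoc, h1, ← whiskerLeft_comp, ← h2]
  simp only [whiskerLeft_comp, Category.assoc]
  rw [associator_inv_naturality_right_assoc]

section Leaves

open OTree

variable (V : PshR C)

/-- Regrouping the factors `V(T_k)`, with coefficients in arbitrary objects. -/
def regroupLeaves {S R T : OTree} (α : S ⟶ R) (β : R ⟶ T) (A₀ : C) (A : S.Leaf → C) :
    A₀ ⊗ tens (fun l : S.Leaf => A l ⊗ leafTens V (aboveMap β (α.toFun l.1))) S.leaves ⟶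
      (A₀ ⊗ tens A S.leaves) ⊗ leafTens V β :=
  regroup A₀ A
    (B := fun l (k : (R.above (α.toFun l.1)).Leaf) => V.obj (op
      ((T.above (β.toFun (α.toFun l.1))).above ((aboveMap β (α.toFun l.1)).toFun k.1))))
    (D := fun k : R.Leaf => V.obj (op (T.above (β.toFun k.1))))
    (leafUp α)
    (fun l k => V.map (same_above_above (β.toFun (α.toFun l.1))
      ((aboveMap β (α.toFun l.1)).toFun k.1)).hom.op)
    (leafUp_perm α)

/-- The isomorphism `V(T) ≅ V(S)` for two trees which are the same. -/
def sameIso {S T : OTree} (h : Same S T) : V.obj (op T) ≅ V.obj (op S) :=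
  V.mapIso (⟨h.hom, h.symm.hom, rfl, rfl⟩ : S ≅ T).op

variable {V}

lemma Structural.regroupLeaves {Q : Type*} {U : Q → C} {S R T : OTree} {α : S ⟶ R} {β : R ⟶ T}
    {A₀ : C} {A : S.Leaf → C} (p₀ : Presentation U A₀) (p : ∀ l, Presentation U (A l))
    {q' : ∀ k : R.Leaf, Presentation U (V.obj (op (T.above (β.toFun k.1))))}
    {q : ∀ (l : S.Leaf) (k : (R.above (α.toFun l.1)).Leaf), Presentation U (V.obj (op
      ((T.above (β.toFun (α.toFun l.1))).above ((aboveMap β (α.toFun l.1)).toFun k.1))))}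
    (h : ∀ l k, Structural (q l k) (q' (leafUp α ⟨l, k⟩)) (V.map (same_above_above
      (β.toFun (α.toFun l.1)) ((aboveMap β (α.toFun l.1)).toFun k.1)).hom.op)) :
    Structural (p₀.tensor (.list (fun l => (p l).tensor (.list (q l) _)) _))
      ((p₀.tensor (.list p _)).tensor (.list q' _)) (regroupLeaves V α β A₀ A) :=
  .regroup _ _ _ h

variable (V)

/-- Regrouping is structural and shuffles are invertible. The inverse enters the definition of the
comultiplication. -/
instance {S R T : OTree} (α : S ⟶ R) (β : R ⟶ T) (A₀ : C) (A : S.Leaf → C) :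
    IsIso (regroupLeaves V α β A₀ A) := by
  let U : Option (S.Leaf ⊕ R.Leaf) → C := fun x => x.elim A₀
    (Sum.elim A (fun k => V.obj (op (T.above (β.toFun k.1)))))
  let q' : ∀ k : R.Leaf, Presentation U (V.obj (op (T.above (β.toFun k.1)))) :=
    fun k => .var (some (Sum.inr k))
  exact (Structural.regroupLeaves (V := V) (α := α) (β := β) (.var none : Presentation U A₀)
    (fun l => (.var (some (Sum.inl l)) : Presentation U (A l))) (q' := q')
    (q := fun l k => (q' (leafUp α ⟨l, k⟩)).ofIso (sameIso V (same_above_above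
      (β.toFun (α.toFun l.1)) ((aboveMap β (α.toFun l.1)).toFun k.1))))
    fun l k => .fromOfIso _ _).isIso

lemma regroupLeaves_naturality_left {S R T : OTree} (α : S ⟶ R) (β : R ⟶ T) {A₀ A₀' : C}
    {A A' : S.Leaf → C} (f₀ : A₀ ⟶ A₀') (f : ∀ l, A l ⟶ A' l) :
    (f₀ ⊗ₘ tensMap (fun l : S.Leaf => f l ▷ leafTens V (aboveMap β (α.toFun l.1))) S.leaves) ≫
        regroupLeaves V α β A₀' A' =
      regroupLeaves V α β A₀ A ≫ ((f₀ ⊗ₘ tensMap f S.leaves) ▷ leafTens V β) :=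
  regroup_naturality _ _ _ _ _

variable {V} in
lemma regroupLeaves_map {W : PshR C} (φ : V ⟶ W) {S R T : OTree} (α : S ⟶ R) (β : R ⟶ T) (A₀ : C)
    (A : S.Leaf → C) :
    A₀ ◁ tensMap (fun l : S.Leaf => A l ◁ leafTensMap φ (aboveMap β (α.toFun l.1))) S.leaves ≫
        regroupLeaves W α β A₀ A =
      regroupLeaves V α β A₀ A ≫ _ ◁ leafTensMap φ β :=
  regroup_naturality_right A₀ A (leafUp α) _ _ (leafUp_perm α)
    (fun l k => φ.app (op ((T.above (β.toFun (α.toFun l.1))).above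
      ((aboveMap β (α.toFun l.1)).toFun k.1))))
    (fun k => φ.app (op (T.above (β.toFun k.1)))) fun _ _ => (φ.naturality _).symm

lemma regroupLeaves_restrict {S R T T' : OTree} (α : S ⟶ R) (β : R ⟶ T) (β' : T ⟶ T') (A₀ : C)
    (A : S.Leaf → C) :
    A₀ ◁ tensMap (fun l : S.Leaf => A l ◁ leafRestrict V (aboveMap β (α.toFun l.1))
        (aboveMap β' (β.toFun (α.toFun l.1)))) S.leaves ≫ regroupLeaves V α β A₀ A =
      regroupLeaves V α (β ≫ β') A₀ A ≫ _ ◁ leafRestrict V β β' :=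
  regroup_naturality_right A₀ A (leafUp α) _ _ (leafUp_perm α)
    (fun l k => V.map (aboveMap (aboveMap β' (β.toFun (α.toFun l.1)))
      ((aboveMap β (α.toFun l.1)).toFun k.1)).op)
    (fun k => V.map (aboveMap β' (β.toFun k.1)).op)
    fun l k => (V.map_comp _ _).symm.trans (V.map_comp (same_above_above
      (β'.toFun (β.toFun (α.toFun l.1))) ((aboveMap (β ≫ β') (α.toFun l.1)).toFun k.1)).hom.op
      (aboveMap β' (β.toFun (leafUp α ⟨l, k⟩).1)).op)

end Leaves

end

/-! ### Regrouping and reindexing along morphisms of `A` -/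

section

open OTree

variable {C : Type w} [Category.{v} C] [MonoidalCategory C] [SymmetricCategory C] (V : PshR C)

/-- The letters for the comparison of regroupings. -/
def regroupLetters {S R T : OTree} (β : R ⟶ T) (A₀ : C) (A : S.Leaf → C) :
    Option (S.Leaf ⊕ R.Leaf) → C :=
  fun x => x.elim A₀ (Sum.elim A (fun k => V.obj (op (T.above (β.toFun k.1)))))

/-- Both composites permute the factors `A₀`, `A l` and `V(T_k)`, which are given distinct letters:
`none`, one for each leaf of `S'` and one for each leaf of `R`. -/
lemma regroupLeaves_reindex_left {S S' R T : OTree} (γ : S ⟶ S') (hγ : inner γ) (α : S' ⟶ R)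
    (β : R ⟶ T) (A₀ : C) (A : S'.Leaf → C) :
    A₀ ◁ tensReindex (fun l : S'.Leaf => A l ⊗ leafTens V (aboveMap β (α.toFun l.1)))
        (leafMap γ hγ) (leafMap_perm γ hγ) ≫
      regroupLeaves V (γ ≫ α) β A₀ (fun l => A (leafMap γ hγ l)) =
    regroupLeaves V α β A₀ A ≫
      (A₀ ◁ tensReindex A (leafMap γ hγ) (leafMap_perm γ hγ)) ▷ leafTens V β := by
  let U := regroupLetters V β A₀ A
  let p₀ : Presentation U A₀ := .var none
  let p : ∀ l, Presentation U (A l) := fun l => .var (some (Sum.inl l))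
  let q' : ∀ k : R.Leaf, Presentation U (V.obj (op (T.above (β.toFun k.1)))) :=
    fun k => .var (some (Sum.inr k))
  let q : ∀ (l : S'.Leaf) (k : (R.above (α.toFun l.1)).Leaf), Presentation U (V.obj (op
      ((T.above (β.toFun (α.toFun l.1))).above ((aboveMap β (α.toFun l.1)).toFun k.1)))) :=
    fun l k => (q' (leafUp α ⟨l, k⟩)).ofIso (sameIso V (same_above_above
      (β.toFun (α.toFun l.1)) ((aboveMap β (α.toFun l.1)).toFun k.1)))
  have h1 : Structural (.list (fun l => (p l).tensor (.list (q l) (R.above (α.toFun l.1)).leaves))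
      S'.leaves)
      (.list (fun l => (p (leafMap γ hγ l)).tensor (.list (q (leafMap γ hγ l))
        (R.above (α.toFun (leafMap γ hγ l).1)).leaves)) S.leaves)
      (tensReindex (fun l : S'.Leaf => A l ⊗ leafTens V (aboveMap β (α.toFun l.1)))
        (leafMap γ hγ) (leafMap_perm γ hγ)) := .tensReindex _ _ _
  have h2 := Structural.regroupLeaves (V := V) (α := γ ≫ α) (β := β) p₀
    (fun l => p (leafMap γ hγ l)) (q' := q') (q := fun l k => q (leafMap γ hγ l) k)
    (fun l k => .fromOfIso _ _)
  have h3 := Structural.regroupLeaves (V := V) (α := α) (β := β) p₀ p (q' := q') (q := q)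
    (fun l k => .fromOfIso _ _)
  have h4 : Structural (.list p S'.leaves) (.list (fun l => p (leafMap γ hγ l)) S.leaves)
      (tensReindex A (leafMap γ hγ) (leafMap_perm γ hγ)) := .tensReindex _ _ _
  refine ((h1.whiskerLeft p₀).comp h2).unique (h3.comp ((h4.whiskerLeft p₀).whiskerRight _)) ?_
  refine Presentation.nodup_regroup (f := leafMap γ hγ) (f' := id) rfl (fun _ => rfl)
    (fun _ => rfl) ((leafMap_perm γ hγ).nodup_iff.2 S'.leaves_nodup) ?_
  rw [List.map_id]
  exact R.leaves_nodup

lemma regroupLeaves_reindex_right {S R R' T : OTree} (α : S ⟶ R) (γ : R ⟶ R') (hγ : inner γ)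
    (β : R' ⟶ T) (A₀ : C) (A : S.Leaf → C) :
    A₀ ◁ tensMap (fun l : S.Leaf => A l ◁ leafReindex V (aboveMap γ (α.toFun l.1))
        (aboveMap_inner γ hγ (α.toFun l.1)) (aboveMap β (γ.toFun (α.toFun l.1)))) S.leaves ≫
      regroupLeaves V α (γ ≫ β) A₀ A =
    regroupLeaves V (α ≫ γ) β A₀ A ≫ _ ◁ leafReindex V γ hγ β := by
  let U := regroupLetters V β A₀ A
  let p₀ : Presentation U A₀ := .var none
  let p : ∀ l, Presentation U (A l) := fun l => .var (some (Sum.inl l))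
  let q' : ∀ k : R'.Leaf, Presentation U (V.obj (op (T.above (β.toFun k.1)))) :=
    fun k => .var (some (Sum.inr k))
  let q : ∀ (l : S.Leaf) (k : (R'.above (γ.toFun (α.toFun l.1))).Leaf), Presentation U (V.obj (op
      ((T.above (β.toFun (γ.toFun (α.toFun l.1)))).above
        ((aboveMap β (γ.toFun (α.toFun l.1))).toFun k.1)))) :=
    fun l k => (q' (leafUp (α ≫ γ) ⟨l, k⟩)).ofIso (sameIso V (same_above_above
      (β.toFun (γ.toFun (α.toFun l.1))) ((aboveMap β (γ.toFun (α.toFun l.1))).toFun k.1)))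
  have h1 : ∀ l : S.Leaf, Structural (.list (q l) (R'.above (γ.toFun (α.toFun l.1))).leaves)
      (.list (fun k => q l (leafMap (aboveMap γ (α.toFun l.1)) (aboveMap_inner γ hγ _) k))
        (R.above (α.toFun l.1)).leaves)
      (leafReindex V (aboveMap γ (α.toFun l.1))
        (aboveMap_inner γ hγ (α.toFun l.1)) (aboveMap β (γ.toFun (α.toFun l.1)))) :=
    fun l => .tensReindex _ _ _
  have h2 := Structural.regroupLeaves (V := V) (α := α) (β := γ ≫ β) p₀ p
    (q' := fun k => q' (leafMap γ hγ k))
    (q := fun l k => q l (leafMap (aboveMap γ (α.toFun l.1)) (aboveMap_inner γ hγ _) k))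
    (fun l k => .fromOfIso _ _)
  have h3 := Structural.regroupLeaves (V := V) (α := α ≫ γ) (β := β) p₀ p (q' := q') (q := q)
    (fun l k => .fromOfIso _ _)
  have h4 : Structural (.list q' R'.leaves) (.list (fun l => q' (leafMap γ hγ l)) R.leaves)
      (leafReindex V γ hγ β) := .tensReindex _ _ _
  refine (((Structural.tensMap (fun l => (h1 l).whiskerLeft (p l)) S.leaves).whiskerLeft p₀).comp
    h2).unique (h3.comp (h4.whiskerLeft _)) ?_
  refine Presentation.nodup_regroup (f := id) (f' := leafMap γ hγ) rfl (fun _ => rfl)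
    (fun _ => rfl) ?_ ((leafMap_perm γ hγ).nodup_iff.2 R'.leaves_nodup)
  rw [List.map_id]
  exact S.leaves_nodup

lemma leafReindex_comp {S S' S'' T : OTree} (γ : S ⟶ S') (hγ : inner γ) (γ' : S' ⟶ S'')
    (hγ' : inner γ') (h : inner (γ ≫ γ')) (α : S'' ⟶ T) :
    leafReindex V (γ ≫ γ') h α = leafReindex V γ' hγ' α ≫ leafReindex V γ hγ (γ' ≫ α) := by
  let U : S''.Leaf → C := fun k => V.obj (op (T.above (α.toFun k.1)))
  refine (Structural.tensReindex (V := U) (fun k => .var k) (leafMap (γ ≫ γ') h)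
    (leafMap_perm (γ ≫ γ') h)).unique
    ((Structural.tensReindex (V := U) (fun k => .var k) (leafMap γ' hγ')
      (leafMap_perm γ' hγ')).comp (Structural.tensReindex (V := U)
        (fun k => .var (leafMap γ' hγ' k)) (leafMap γ hγ) (leafMap_perm γ hγ))) ?_
  rw [Presentation.list_letters_of_eq _ (leafMap (γ ≫ γ') h) (fun _ => rfl)]
  exact (leafMap_perm (γ ≫ γ') h).nodup_iff.2 S''.leaves_nodup

end

/-! ### Unit and associativity laws of regrouping -/

section

open OTree

variable {C : Type w} [Category.{v} C] [MonoidalCategory C] [SymmetricCategory C] (V : PshR C)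

/-- The canonical isomorphism `⨂_k V((T_l)_k) ⟶ V(T_l)` for a leaf `l` of `S`. -/
def leafTensLeaf {S T : OTree} (α : S ⟶ T) (l : S.Leaf) :
    leafTens V (aboveMap α l.1) ⟶ V.obj (op (T.above (α.toFun l.1))) :=
  leafReindex V (rootInc (S.above l.1)) (rootInc_inner _ (isLeaf_above_leaf l)) (aboveMap α l.1) ≫
    leafRoot V (rootInc (S.above l.1) ≫ aboveMap α l.1)

/-- The subtrees of `S` above its leaves have one edge each, so regrouping only moves unit objects.
These are presented by the empty word and leave no trace in the comparison. -/
lemma regroupLeaves_id_left {S T : OTree} (α : S ⟶ T) (A₀ : C) :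
    regroupLeaves V (𝟙 S) α A₀ (fun _ : S.Leaf => 𝟙_ C) ≫
        (A₀ ◁ tensUnit S.leaves ≫ (ρ_ A₀).hom) ▷ leafTens V α =
      A₀ ◁ tensMap (fun l : S.Leaf => 𝟙_ C ◁ leafTensLeaf V α l ≫ (λ_ _).hom) S.leaves := by
  let U := regroupLetters (S := S) V α A₀ (fun _ => 𝟙_ C)
  let p₀ : Presentation U A₀ := .var none
  let p : ∀ _ : S.Leaf, Presentation U (𝟙_ C) := fun l => .unit
  let q' : ∀ k : S.Leaf, Presentation U (V.obj (op (T.above (α.toFun k.1)))) :=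
    fun k => .var (some (Sum.inr k))
  let q : ∀ (l : S.Leaf) (k : (S.above l.1).Leaf), Presentation U (V.obj (op
      ((T.above (α.toFun l.1)).above ((aboveMap α l.1).toFun k.1)))) :=
    fun l k => (q' (leafUp (𝟙 S) ⟨l, k⟩)).ofIso (sameIso V (same_above_above
      (α.toFun l.1) ((aboveMap α l.1).toFun k.1)))
  have h1 : ∀ l : S.Leaf, Structural (.list (q l) (S.above l.1).leaves) (q' l)
      (leafTensLeaf V α l) := fun l => by
    let h := rootInc_inner _ (isLeaf_above_leaf l)
    refine (Structural.tensReindex (q l) (leafMap (rootInc (S.above l.1)) h)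
      (leafMap_perm _ h)).comp ?_
    refine (Structural.tensPerm (fun k => q l (leafMap (rootInc (S.above l.1)) h k)) _ _
      eta_leaves_perm).comp ((Structural.tensSingle _ etaLeaf).comp ?_)
    exact Structural.fromOfIso _ _
  have h3 := Structural.regroupLeaves (V := V) (α := 𝟙 S) (β := α) p₀ p (q' := q') (q := q)
    (fun l k => .fromOfIso _ _)
  refine (h3.comp ((((Structural.tensUnit S.leaves).whiskerLeft p₀).comp
    (.rightUnitor _)).whiskerRight _)).unique ((Structural.tensMap (fun l =>
      ((h1 l).whiskerLeft (p l)).comp (.leftUnitor _)) S.leaves).whiskerLeft p₀) ?_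
  rw [Presentation.tensor_letters, Presentation.list_letters_of_eq q' _ (fun _ => rfl)]
  refine List.nodup_cons.2 ⟨by simp, S.leaves_nodup.map ?_⟩
  exact fun x y h => Sum.inr_injective (Option.some_injective _ h)

/-- The canonical isomorphism `⨂_k V((T_r)_k) ⟶ ⨂_k V(T_k)`, where `r` is the root. -/
def leafTensRoot {S T : OTree} (α : S ⟶ T) :
    leafTens V (aboveMap α ((rootInc S).toFun etaLeaf.1)) ⟶ leafTens V α :=
  leafReindex V (same_above_of_eta (rootInc S)).hom (same_above_of_eta (rootInc S)).inner
      (aboveMap α ((rootInc S).toFun etaLeaf.1)) ≫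
    leafRestrict V α (same_above_of_eta (rootInc S ≫ α)).hom

/-- The tree `eta` has one leaf and the subtree above its image is all of `S`. The unit object in
place of `A₀` is the empty word. -/
lemma regroupLeaves_rootInc_left {S T : OTree} (α : S ⟶ T) (A : eta.Leaf → C) :
    regroupLeaves V (rootInc S) α (𝟙_ C) A ≫
        (𝟙_ C ◁ (tensPerm A _ _ eta_leaves_perm ≫ tensSingle A etaLeaf) ≫ (λ_ _).hom) ▷
          leafTens V α =
      𝟙_ C ◁ (tensPerm _ _ _ eta_leaves_perm ≫ tensSingle (fun l : eta.Leaf => A l ⊗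
        leafTens V (aboveMap α ((rootInc S).toFun l.1))) etaLeaf ≫
          A etaLeaf ◁ leafTensRoot V α) ≫ (λ_ _).hom := by
  let U := regroupLetters V α (𝟙_ C) A
  let p₀ : Presentation U (𝟙_ C) := .unit
  let p : ∀ l, Presentation U (A l) := fun l => .var (some (Sum.inl l))
  let q' : ∀ k : S.Leaf, Presentation U (V.obj (op (T.above (α.toFun k.1)))) :=
    fun k => .var (some (Sum.inr k))
  let q : ∀ (l : eta.Leaf) (k : (S.above ((rootInc S).toFun l.1)).Leaf),
      Presentation U (V.obj (op
      ((T.above (α.toFun ((rootInc S).toFun l.1))).above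
        ((aboveMap α ((rootInc S).toFun l.1)).toFun k.1)))) :=
    fun l k => (q' (leafUp (rootInc S) ⟨l, k⟩)).ofIso (sameIso V (same_above_above
      (α.toFun ((rootInc S).toFun l.1)) ((aboveMap α ((rootInc S).toFun l.1)).toFun k.1)))
  have h1 : Structural (.list (q etaLeaf) (S.above ((rootInc S).toFun etaLeaf.1)).leaves)
      (.list q' S.leaves) (leafTensRoot V α) := by
    refine (Structural.tensReindex (q etaLeaf) (leafMap (same_above_of_eta (rootInc S)).hom
      (same_above_of_eta (rootInc S)).inner) (leafMap_perm _ _)).comp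
        (Structural.tensMap (fun k => ?_) S.leaves)
    exact Structural.fromOfIso _ _
  have h3 := Structural.regroupLeaves (V := V) (α := rootInc S) (β := α) p₀ p (q' := q') (q := q)
    (fun l k => .fromOfIso _ _)
  have h4 : Structural (.list p eta.leaves) (p etaLeaf)
    (tensPerm A _ _ eta_leaves_perm ≫ tensSingle A etaLeaf) :=
    (Structural.tensPerm _ _ _ _).comp (.tensSingle _ _)
  have h5 : Structural
      (.list (fun l => (p l).tensor (.list (q l) (S.above ((rootInc S).toFun l.1)).leaves))
        eta.leaves) ((p etaLeaf).tensor (.list q' S.leaves))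
      (tensPerm _ _ _ eta_leaves_perm ≫ tensSingle (fun l : eta.Leaf => A l ⊗
        leafTens V (aboveMap α ((rootInc S).toFun l.1))) etaLeaf ≫
          A etaLeaf ◁ leafTensRoot V α) :=
    (Structural.tensPerm (fun l => (p l).tensor
      (.list (q l) (S.above ((rootInc S).toFun l.1)).leaves)) _ _ _).comp
      ((Structural.tensSingle _ _).comp (h1.whiskerLeft _))
  refine (h3.comp (((h4.whiskerLeft p₀).comp (.leftUnitor _)).whiskerRight _)).unique
    ((h5.whiskerLeft p₀).comp (.leftUnitor _)) ?_
  rw [Presentation.tensor_letters, Presentation.list_letters_of_eq q' _ (fun _ => rfl)]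
  refine List.nodup_cons.2 ⟨by simp, S.leaves_nodup.map ?_⟩
  exact fun x y h => Sum.inr_injective (Option.some_injective _ h)

/-- Regrouping the factors, with coefficients `X(R_l)` and `X(P_m)`, for `S ⟶ R ⟶ P`. -/
def regroupAbove (X : PshA C) {S R P : OTree} (α : S ⟶ R) (ψ : R ⟶ P) (A₀ : C)
    (A : S.Leaf → C) :
    A₀ ⊗ tens (fun l : S.Leaf => A l ⊗ tens (fun k : (R.above (α.toFun l.1)).Leaf =>
      X.ob ((P.above (ψ.toFun (α.toFun l.1))).above ((aboveMap ψ (α.toFun l.1)).toFun k.1)))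
        (R.above (α.toFun l.1)).leaves) S.leaves ⟶
      (A₀ ⊗ tens A S.leaves) ⊗ tens (fun k : R.Leaf => X.ob (P.above (ψ.toFun k.1))) R.leaves :=
  regroup A₀ A
    (B := fun l (k : (R.above (α.toFun l.1)).Leaf) => X.ob
      ((P.above (ψ.toFun (α.toFun l.1))).above ((aboveMap ψ (α.toFun l.1)).toFun k.1)))
    (D := fun k : R.Leaf => X.ob (P.above (ψ.toFun k.1)))
    (leafUp α)
    (fun l k => X.resSame (same_above_above (ψ.toFun (α.toFun l.1))
      ((aboveMap ψ (α.toFun l.1)).toFun k.1)))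
    (leafUp_perm α)

/-- Regrouping the factors `X(P_m) ⊗ ⨂_n V(T_n)`, for `S ⟶ R ⟶ P ⟶ T`. -/
def regroupAboveLeaves (X : PshA C) {S R P T : OTree} (α : S ⟶ R) (ψ : R ⟶ P) (χ : P ⟶ T)
    (A₀ : C) (A : S.Leaf → C) :
    A₀ ⊗ tens (fun l : S.Leaf => A l ⊗ tens (fun k : (R.above (α.toFun l.1)).Leaf =>
      X.ob ((P.above (ψ.toFun (α.toFun l.1))).above ((aboveMap ψ (α.toFun l.1)).toFun k.1)) ⊗
        leafTens V (aboveMap (aboveMap χ (ψ.toFun (α.toFun l.1)))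
          ((aboveMap ψ (α.toFun l.1)).toFun k.1)))
        (R.above (α.toFun l.1)).leaves) S.leaves ⟶
      (A₀ ⊗ tens A S.leaves) ⊗ tens (fun k : R.Leaf => X.ob (P.above (ψ.toFun k.1)) ⊗
        leafTens V (aboveMap χ (ψ.toFun k.1))) R.leaves :=
  regroup A₀ A
    (B := fun l (k : (R.above (α.toFun l.1)).Leaf) => X.ob
      ((P.above (ψ.toFun (α.toFun l.1))).above ((aboveMap ψ (α.toFun l.1)).toFun k.1)) ⊗
        leafTens V (aboveMap (aboveMap χ (ψ.toFun (α.toFun l.1)))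
          ((aboveMap ψ (α.toFun l.1)).toFun k.1)))
    (D := fun k : R.Leaf => X.ob (P.above (ψ.toFun k.1)) ⊗ leafTens V (aboveMap χ (ψ.toFun k.1)))
    (leafUp α)
    (fun l k => (X.resSame (same_above_above (ψ.toFun (α.toFun l.1))
      ((aboveMap ψ (α.toFun l.1)).toFun k.1)) ⊗ₘ
      leafReindex V (same_above_above (ψ.toFun (α.toFun l.1))
        ((aboveMap ψ (α.toFun l.1)).toFun k.1)).hom (same_above_above (ψ.toFun (α.toFun l.1))
          ((aboveMap ψ (α.toFun l.1)).toFun k.1)).inner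
        (aboveMap (aboveMap χ (ψ.toFun (α.toFun l.1))) ((aboveMap ψ (α.toFun l.1)).toFun k.1))) ≫
      X.ob _ ◁ leafRestrict V (aboveMap χ (ψ.toFun (leafUp α ⟨l, k⟩).1))
        (same_above_above (χ.toFun (ψ.toFun (α.toFun l.1)))
          ((aboveMap (ψ ≫ χ) (α.toFun l.1)).toFun k.1)).hom)
    (leafUp_perm α)

/-- The isomorphism between the values of a presheaf on `A` at trees which are the same. -/
def resSameIso (X : PshA C) {S T : OTree} (h : Same S T) : X.ob T ≅ X.ob S where
  hom := X.resSame h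
  inv := X.resSame h.symm
  hom_inv_id := (PshA.resSame_trans X _ _).trans (PshA.resSame_refl X _)
  inv_hom_id := (PshA.resSame_trans X _ _).trans (PshA.resSame_refl X _)

/-- The part of coassociativity that does not involve the structure of `X`: for `S ⟶ R ⟶ P ⟶ T`, the
factors can be collected over `R` and then over `P`, or inside each subtree over a leaf of `S`
first. -/
lemma regroupAboveLeaves_regroup (X : PshA C) {S R P T : OTree} (α : S ⟶ R) (ψ : R ⟶ P)
    (χ : P ⟶ T) (A₀ : C) (A : S.Leaf → C) :
    regroupAboveLeaves V X α ψ χ A₀ A ≫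
        regroupLeaves V ψ χ (A₀ ⊗ tens A S.leaves) (fun k : R.Leaf => X.ob (P.above (ψ.toFun k.1))) =
      A₀ ◁ tensMap (fun l : S.Leaf => regroupLeaves V (aboveMap ψ (α.toFun l.1))
          (aboveMap χ (ψ.toFun (α.toFun l.1))) (A l) (fun k : (R.above (α.toFun l.1)).Leaf =>
            X.ob ((P.above (ψ.toFun (α.toFun l.1))).above
              ((aboveMap ψ (α.toFun l.1)).toFun k.1)))) S.leaves ≫
        regroupLeaves V (α ≫ ψ) χ A₀ (fun l : S.Leaf => A l ⊗
          tens (fun k : (R.above (α.toFun l.1)).Leaf => X.ob ((P.above (ψ.toFun (α.toFun l.1))).above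
              ((aboveMap ψ (α.toFun l.1)).toFun k.1))) (R.above (α.toFun l.1)).leaves) ≫
        regroupAbove X α ψ A₀ A ▷ leafTens V χ := by
  let U : (Option (S.Leaf ⊕ R.Leaf)) ⊕ P.Leaf → C := Sum.elim (fun x => x.elim A₀
    (Sum.elim A (fun k => X.ob (P.above (ψ.toFun k.1)))))
    (fun n => V.obj (op (T.above (χ.toFun n.1))))
  let p₀ : Presentation U A₀ := .var (Sum.inl none)
  let p : ∀ l, Presentation U (A l) := fun l => .var (Sum.inl (some (Sum.inl l)))
  let x : ∀ k : R.Leaf, Presentation U (X.ob (P.above (ψ.toFun k.1))) :=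
    fun k => .var (Sum.inl (some (Sum.inr k)))
  let y : ∀ (l : S.Leaf) (k : (R.above (α.toFun l.1)).Leaf), Presentation U (X.ob
      ((P.above (ψ.toFun (α.toFun l.1))).above ((aboveMap ψ (α.toFun l.1)).toFun k.1))) :=
    fun l k => (x (leafUp α ⟨l, k⟩)).ofIso (resSameIso X (same_above_above
      (ψ.toFun (α.toFun l.1)) ((aboveMap ψ (α.toFun l.1)).toFun k.1)))
  let q : ∀ n : P.Leaf, Presentation U (V.obj (op (T.above (χ.toFun n.1)))) :=
    fun n => .var (Sum.inr n)
  let q₁ : ∀ (k : R.Leaf) (n : (P.above (ψ.toFun k.1)).Leaf), Presentation U (V.obj (op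
      ((T.above (χ.toFun (ψ.toFun k.1))).above ((aboveMap χ (ψ.toFun k.1)).toFun n.1)))) :=
    fun k n => (q (leafUp ψ ⟨k, n⟩)).ofIso (sameIso V (same_above_above
      (χ.toFun (ψ.toFun k.1)) ((aboveMap χ (ψ.toFun k.1)).toFun n.1)))
  let q₂ : ∀ (l : S.Leaf) (n : (P.above (ψ.toFun (α.toFun l.1))).Leaf), Presentation U (V.obj (op
      ((T.above (χ.toFun (ψ.toFun (α.toFun l.1)))).above
        ((aboveMap χ (ψ.toFun (α.toFun l.1))).toFun n.1)))) :=
    fun l n => (q (leafUp (α ≫ ψ) ⟨l, n⟩)).ofIso (sameIso V (same_above_above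
      (χ.toFun (ψ.toFun (α.toFun l.1))) ((aboveMap χ (ψ.toFun (α.toFun l.1))).toFun n.1)))
  let q₃ : ∀ (l : S.Leaf) (k : (R.above (α.toFun l.1)).Leaf)
      (n : ((P.above (ψ.toFun (α.toFun l.1))).above ((aboveMap ψ (α.toFun l.1)).toFun k.1)).Leaf),
      Presentation U (V.obj (op
        (((T.above (χ.toFun (ψ.toFun (α.toFun l.1)))).above
          ((aboveMap (ψ ≫ χ) (α.toFun l.1)).toFun k.1)).above
          ((aboveMap (aboveMap χ (ψ.toFun (α.toFun l.1)))
            ((aboveMap ψ (α.toFun l.1)).toFun k.1)).toFun n.1)))) :=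
    fun l k n => (q₂ l (leafUp (aboveMap ψ (α.toFun l.1)) ⟨k, n⟩)).ofIso
      (sameIso V (same_above_above ((aboveMap (ψ ≫ χ) (α.toFun l.1)).toFun k.1)
        ((aboveMap (aboveMap χ (ψ.toFun (α.toFun l.1)))
          ((aboveMap ψ (α.toFun l.1)).toFun k.1)).toFun n.1)))
  -- A doubly iterated subtree of `T` can be identified with a simple one in two ways. Both are the
  -- identity on edges, so the factors of `V` receive the same letters on both routes.
  have hV : ∀ (l : S.Leaf) (k : (R.above (α.toFun l.1)).Leaf)
      (n : (P.above (ψ.toFun (leafUp α ⟨l, k⟩).1)).Leaf),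
      V.map (aboveMap (same_above_above (χ.toFun (ψ.toFun (α.toFun l.1)))
          ((aboveMap (ψ ≫ χ) (α.toFun l.1)).toFun k.1)).hom
          ((aboveMap χ (ψ.toFun (leafUp α ⟨l, k⟩).1)).toFun n.1)).op ≫
        (q₁ (leafUp α ⟨l, k⟩) n).iso.hom =
      (q₃ l k (leafMap _ (same_above_above (ψ.toFun (α.toFun l.1))
          ((aboveMap ψ (α.toFun l.1)).toFun k.1)).inner n)).iso.hom := fun l k n => by
    have h := ((V.map_comp _ _).symm.trans (V.map_comp (same_above_above
      ((aboveMap (ψ ≫ χ) (α.toFun l.1)).toFun k.1)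
        ((aboveMap (aboveMap χ (ψ.toFun (α.toFun l.1)))
          ((aboveMap ψ (α.toFun l.1)).toFun k.1)).toFun (leafMap _ (same_above_above
            (ψ.toFun (α.toFun l.1)) ((aboveMap ψ (α.toFun l.1)).toFun k.1)).inner n).1)).hom.op
      (same_above_above (χ.toFun (ψ.toFun (α.toFun l.1)))
        ((aboveMap χ (ψ.toFun (α.toFun l.1))).toFun (leafUp (aboveMap ψ (α.toFun l.1))
          ⟨k, leafMap _ (same_above_above (ψ.toFun (α.toFun l.1))
          ((aboveMap ψ (α.toFun l.1)).toFun k.1)).inner n⟩).1)).hom.op) :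
      V.map (aboveMap (same_above_above (χ.toFun (ψ.toFun (α.toFun l.1)))
          ((aboveMap (ψ ≫ χ) (α.toFun l.1)).toFun k.1)).hom
          ((aboveMap χ (ψ.toFun (leafUp α ⟨l, k⟩).1)).toFun n.1)).op ≫ V.map (same_above_above
          (χ.toFun (ψ.toFun (leafUp α ⟨l, k⟩).1))
          ((aboveMap χ (ψ.toFun (leafUp α ⟨l, k⟩).1)).toFun n.1)).hom.op = _)
    exact (Category.assoc _ _ _).symm.trans ((congrArg (fun z => z ≫ _) h).trans
      (Category.assoc _ _ _))
  have hb : ∀ (l : S.Leaf) (k : (R.above (α.toFun l.1)).Leaf),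
      Structural ((y l k).tensor (.list (q₃ l k) _))
        ((x (leafUp α ⟨l, k⟩)).tensor (.list (q₁ (leafUp α ⟨l, k⟩)) _))
      ((X.resSame (same_above_above (ψ.toFun (α.toFun l.1))
        ((aboveMap ψ (α.toFun l.1)).toFun k.1)) ⊗ₘ
      leafReindex V (same_above_above (ψ.toFun (α.toFun l.1))
        ((aboveMap ψ (α.toFun l.1)).toFun k.1)).hom (same_above_above (ψ.toFun (α.toFun l.1))
          ((aboveMap ψ (α.toFun l.1)).toFun k.1)).inner
        (aboveMap (aboveMap χ (ψ.toFun (α.toFun l.1))) ((aboveMap ψ (α.toFun l.1)).toFun k.1))) ≫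
      X.ob _ ◁ leafRestrict V (aboveMap χ (ψ.toFun (leafUp α ⟨l, k⟩).1))
        (same_above_above (χ.toFun (ψ.toFun (α.toFun l.1)))
          ((aboveMap (ψ ≫ χ) (α.toFun l.1)).toFun k.1)).hom) := fun l k =>
    ((Structural.fromOfIso (x (leafUp α ⟨l, k⟩)) (resSameIso X (same_above_above
      (ψ.toFun (α.toFun l.1)) ((aboveMap ψ (α.toFun l.1)).toFun k.1)))).tensorHom
      (.tensReindex (q₃ l k) (leafMap _ (same_above_above (ψ.toFun (α.toFun l.1))
          ((aboveMap ψ (α.toFun l.1)).toFun k.1)).inner) (leafMap_perm _ _))).comp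
      (Structural.whiskerLeft _ (.tensMap (fun n => .ofLetters (hV l k n)) _))
  have h1 : Structural (p₀.tensor (.list (fun l : S.Leaf => (p l).tensor (.list
      (fun k : (R.above (α.toFun l.1)).Leaf => (y l k).tensor (.list (q₃ l k) _)) _)) _))
      ((p₀.tensor (.list p _)).tensor (.list (fun k : R.Leaf => (x k).tensor (.list (q₁ k) _)) _))
      (regroupAboveLeaves V X α ψ χ A₀ A) :=
    .regroup (g := leafUp α) (D := fun k : R.Leaf => X.ob (P.above (ψ.toFun k.1)) ⊗
      leafTens V (aboveMap χ (ψ.toFun k.1))) (leafUp_perm α) p₀ p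
      (q' := fun k : R.Leaf => (x k).tensor (.list (q₁ k) _)) hb
  have h2 := Structural.regroupLeaves (V := V) (α := ψ) (β := χ)
    (p₀.tensor (.list p S.leaves)) x (q' := q) (q := q₁) fun l k => .fromOfIso _ _
  have h3 := fun l : S.Leaf => Structural.regroupLeaves (V := V) (α := aboveMap ψ (α.toFun l.1))
    (β := aboveMap χ (ψ.toFun (α.toFun l.1))) (p l) (y l) (q' := q₂ l) (q := q₃ l)
    fun k n => .fromOfIso _ _
  have h4 := Structural.regroupLeaves (V := V) (α := α ≫ ψ) (β := χ) p₀
    (fun l : S.Leaf => (p l).tensor (.list (y l) (R.above (α.toFun l.1)).leaves))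
    (q' := q) (q := q₂) fun l k => .fromOfIso _ _
  have h5 : Structural (p₀.tensor (.list (fun l : S.Leaf => (p l).tensor (.list (y l) _)) _))
      ((p₀.tensor (.list p _)).tensor (.list x _)) (regroupAbove X α ψ A₀ A) :=
    .regroup (g := leafUp α) (D := fun k : R.Leaf => X.ob (P.above (ψ.toFun k.1))) (leafUp_perm α)
      p₀ p (q' := x) fun l k => .fromOfIso _ _
  refine (h1.comp h2).unique (((Structural.tensMap h3 S.leaves).whiskerLeft p₀).comp
    (h4.comp (h5.whiskerRight _))) ?_
  have e : (((p₀.tensor (.list p S.leaves)).tensor (.list x R.leaves)).tensor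
      (.list q P.leaves)).letters =
      ([none] ++ S.leaves.map (some ∘ Sum.inl) ++ R.leaves.map (some ∘ Sum.inr)).map Sum.inl ++
        P.leaves.map Sum.inr := by
    rw [Presentation.tensor_letters, Presentation.tensor_letters, Presentation.tensor_letters,
      Presentation.list_letters_of_eq p _ (fun _ => rfl),
      Presentation.list_letters_of_eq x _ (fun _ => rfl),
      Presentation.list_letters_of_eq q _ (fun _ => rfl)]
    simp [p₀, Function.comp_def]
  rw [e, List.nodup_append, List.nodup_map_iff Sum.inl_injective, List.nodup_append,
    List.nodup_append]
  refine ⟨⟨⟨List.nodup_singleton _, S.leaves_nodup.map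
    ((Option.some_injective _).comp Sum.inl_injective), ?_⟩, R.leaves_nodup.map
    ((Option.some_injective _).comp Sum.inr_injective), ?_⟩,
    P.leaves_nodup.map Sum.inr_injective, ?_⟩
  · simp; grind
  · simp; grind
  · simp

end

/-! ### Prunings and factorisations of morphisms of trees -/

namespace OTree

variable {S R T : OTree}

/-- The image of a morphism is closed under passing to smaller edges. -/
def Saturated (β : R ⟶ T) : Prop := ∀ (x : T.Edge) (y : R.Edge), T.le x.1 (β.toFun y).1 →
  ∃ z, β.toFun z = x

/-- The set of images of leaves. -/
def leafSet (α : S ⟶ T) : Set T.Edge := Set.range fun l : S.Leaf => α.toFun l.1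

lemma exists_isLeaf_above (x : T.Edge) : ∃ l : T.Leaf, T.le x.1 l.1.1 := by
  classical
  obtain ⟨y, hy, hmax⟩ := (T.edges.filter (fun y => T.le x.1 y)).exists_max_image
    (fun z => (T.edges.filter (fun w => T.le w z)).card)
    ⟨x.1, Finset.mem_filter.2 ⟨x.2, T.le_refl _ x.2⟩⟩
  have hy := Finset.mem_filter.1 hy
  refine ⟨⟨⟨y, hy.1⟩, fun z hyz => ?_⟩, hy.2⟩
  by_contra hne
  refine absurd (hmax z.1 (Finset.mem_filter.2
    ⟨z.2, T.le_trans _ x.2 _ hy.1 _ z.2 hy.2 hyz⟩)) (not_le.2 (Finset.card_lt_card ?_))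
  refine Finset.ssubset_iff_of_subset (fun w hw => ?_) |>.2
    ⟨z.1, Finset.mem_filter.2 ⟨z.2, T.le_refl _ z.2⟩, fun h => hne (Subtype.ext ?_)⟩
  · have hw := Finset.mem_filter.1 hw
    exact Finset.mem_filter.2 ⟨hw.1, T.le_trans _ hw.1 _ hy.1 _ z.2 hw.2 hyz⟩
  · exact T.le_antisymm _ z.2 _ hy.1 (Finset.mem_filter.1 h).2 hyz

/-- Every edge of `T` is comparable with the image of a leaf. -/
lemma exists_leaf_comparable (α : S ⟶ T) (x : T.Edge) :
    ∃ l : S.Leaf, T.le x.1 (α.toFun l.1).1 ∨ T.le (α.toFun l.1).1 x.1 := by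
  obtain ⟨y, hy⟩ := exists_isLeaf_above x
  obtain ⟨l, hl, hly⟩ := α.exists_leaf_le _ y.2
  exact ⟨⟨l, hl⟩, T.le_total_below _ x.2 _ (α.toFun l).2 _ y.1.2 hy hly⟩

/-- Lift edge by edge; `β` reflects the order and the root. A leaf of `R` is comparable with the
image of some leaf of `S`, and being maximal it lies above this image. -/
lemma exists_lift (α : S ⟶ T) (β : R ⟶ T) (h : ∀ x, ∃ z, β.toFun z = α.toFun x) :
    ∃ a : S ⟶ R, a ≫ β = α := by
  choose f hf using h
  refine ⟨⟨f, β.injective ?_, fun x y => ?_, fun x hx => ?_⟩, Hom.ext (funext hf)⟩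
  · rw [hf, α.map_root, β.map_root]
  · rw [← β.le_iff, hf, hf, α.le_iff]
  · obtain ⟨l, hl⟩ := exists_leaf_comparable α (β.toFun x)
    refine ⟨l.1, l.2, ?_⟩
    rw [← hf, β.le_iff, β.le_iff] at hl
    rcases hl with h | h
    · rw [hx _ h]; exact R.le_refl _ x.2
    · exact h

/-- Every edge of `S` lies below a leaf, so its image lies below an edge in the image of `β`, and
hence in this image by saturation. -/
lemma Saturated.exists_inner_lift {α : S ⟶ T} {β : R ⟶ T} (hβ : Saturated β)
    (h : leafSet α ⊆ leafSet β) : ∃ γ : S ⟶ R, inner γ ∧ γ ≫ β = α := by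
  obtain ⟨γ, hγ⟩ := exists_lift α β fun x => by
    obtain ⟨l, hl⟩ := exists_isLeaf_above x
    obtain ⟨l', hl'⟩ := h ⟨l, rfl⟩
    refine hβ _ l'.1 ?_
    rw [show β.toFun l'.1 = α.toFun l.1 from hl', α.le_iff]
    exact hl
  refine ⟨γ, fun l hl => ?_, hγ⟩
  subst hγ
  obtain ⟨l', hl'⟩ := h ⟨⟨l, hl⟩, rfl⟩
  rw [← β.injective hl']
  exact l'.2

lemma leafSet_inner_comp {S' : OTree} (γ : S ⟶ S') (hγ : inner γ) (α : S' ⟶ T) :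
    leafSet (γ ≫ α) = leafSet α := by
  ext x
  constructor
  · rintro ⟨l, rfl⟩
    exact ⟨leafMap γ hγ l, rfl⟩
  · rintro ⟨l, rfl⟩
    obtain ⟨m, -, hm⟩ := List.mem_map.1 ((leafMap_perm γ hγ).symm.subset (S'.mem_leaves l))
    exact ⟨m, congrArg (fun z : S'.Leaf => α.toFun z.1) hm⟩

/-- The inclusion of the tree which is obtained by cutting. -/
def cutInc (T : OTree) (C : List T.Edge) : T.cut C ⟶ T where
  toFun x := ⟨x.1, (mem_cut.1 x.2).1⟩
  map_root := rfl
  le_iff _ _ := Iff.rfl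
  exists_leaf_le x hx := by
    by_cases h : x.1 ∈ (T.cut C).edges
    · refine ⟨⟨x.1, h⟩, fun y hy => Subtype.ext ?_, T.le_refl _ x.2⟩
      exact (congrArg Subtype.val (hx ⟨y.1, (mem_cut.1 y.2).1⟩ hy) :)
    -- If `x` has been cut away, the lowest edge of `C` below `x` remains as a leaf.
    · classical
      have h' : (C.toFinset.filter fun c => T.le c.1 x.1).Nonempty := by
        by_contra h'
        refine h (mem_cut.2 ⟨x.2, fun c hc hcx => absurd ⟨c, ?_⟩ h'⟩)
        exact Finset.mem_filter.2 ⟨List.mem_toFinset.2 hc, hcx⟩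
      obtain ⟨c, hc, hmin⟩ := Finset.exists_min_image _
        (fun c : T.Edge => (T.edges.filter (fun w => T.le w c.1)).card) h'
      obtain ⟨hcC, hcx⟩ := Finset.mem_filter.1 hc
      rw [List.mem_toFinset] at hcC
      refine ⟨⟨c.1, mem_cut.2 ⟨c.2, fun d hd hdc => ?_⟩⟩, fun y hy =>
        Subtype.ext ((mem_cut.1 y.2).2 c hcC hy), hcx⟩
      by_contra hne
      refine absurd (hmin d (Finset.mem_filter.2 ⟨List.mem_toFinset.2 hd,
        T.le_trans _ d.2 _ c.2 _ x.2 hdc hcx⟩)) (not_le.2 (Finset.card_lt_card ?_))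
      refine Finset.ssubset_iff_of_subset (fun w hw => ?_) |>.2
        ⟨c.1, Finset.mem_filter.2 ⟨c.2, T.le_refl _ c.2⟩, fun h => hne ?_⟩
      · have hw := Finset.mem_filter.1 hw
        exact Finset.mem_filter.2 ⟨hw.1, T.le_trans _ hw.1 _ d.2 _ c.2 hw.2 hdc⟩
      · exact T.le_antisymm _ c.2 _ d.2 (Finset.mem_filter.1 h).2 hdc

lemma cutInc_saturated (T : OTree) (C : List T.Edge) : Saturated (T.cutInc C) := fun x y h => by
  have hy := mem_cut.1 y.2
  refine ⟨⟨x.1, mem_cut.2 ⟨x.2, fun c hc hcx => ?_⟩⟩, rfl⟩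
  have e := hy.2 c hc (T.le_trans _ c.2 _ x.2 _ hy.1 hcx h)
  change T.le x.1 y.1 at h
  rw [e] at h
  exact T.le_antisymm _ x.2 _ c.2 h hcx

/-- The map `S(x) ⟶ T(e)` induced by `β`, for `e = β x`. -/
def aboveTo (β : R ⟶ T) (x : R.Edge) (e : T.Edge) (h : β.toFun x = e) : R.above x ⟶ T.above e where
  toFun z := ⟨(β.toFun ⟨z.1, (mem_above.1 z.2).1⟩).1, mem_above.2
    ⟨(β.toFun _).2, by rw [← h]; exact (β.le_iff _ _).2 (mem_above.1 z.2).2⟩⟩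
  map_root := Subtype.ext ((congrArg Subtype.val h :))
  le_iff z w := β.le_iff ⟨z.1, (mem_above.1 z.2).1⟩ ⟨w.1, (mem_above.1 w.2).1⟩
  exists_leaf_le := by
    subst h
    exact (aboveMap β x).exists_leaf_le

lemma Saturated.aboveTo {β : R ⟶ T} (hβ : Saturated β) (x : R.Edge) (e : T.Edge)
    (h : β.toFun x = e) : Saturated (aboveTo β x e h) := by
  subst h
  intro y z hyz
  have hy := mem_above.1 y.2
  obtain ⟨w, hw⟩ := hβ ⟨y.1, hy.1⟩ ⟨z.1, (mem_above.1 z.2).1⟩ hyz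
  refine ⟨⟨w.1, mem_above.2 ⟨w.2, ?_⟩⟩, Subtype.ext ((congrArg Subtype.val hw :))⟩
  rw [← β.le_iff, hw]
  exact hy.2

/-- The possible sets of leaves of prunings of `T`. -/
def Pruning (T : OTree) : Type :=
  {L : Set T.Edge // ∃ (R : OTree) (β : R ⟶ T), Saturated β ∧ leafSet β = L}

/-- Recording leaf sets in place of trees makes this a part of the power set of a finite set.
Nothing is lost, since by `Saturated.exists_inner_lift` saturated maps with the same leaf set factor
through each other. -/
instance : Finite (Pruning T) := by unfold Pruning; infer_instance

noncomputable instance : Fintype (Pruning T) := Fintype.ofFinite _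

namespace Pruning

variable (L : Pruning T)

/-- The tree of a pruning. -/
def tree : OTree := L.2.choose

/-- The inclusion of a pruning. -/
def inc : L.tree ⟶ T := L.2.choose_spec.choose

lemma saturated : Saturated L.inc := L.2.choose_spec.choose_spec.1

lemma leafSet_inc : leafSet L.inc = L.1 := L.2.choose_spec.choose_spec.2

end Pruning

/-- The pruning whose leaves are the images of the leaves of `S`. -/
def pruning (α : S ⟶ T) : Pruning T :=
  ⟨leafSet α, T.cut (leafImages α), T.cutInc _, cutInc_saturated _ _,
    (leafSet_inner_comp (toPruning α) (toPruning_inner α) (T.cutInc (leafImages α))).symm⟩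

/-- Every morphism comes from a pruning by a morphism of `A`, and by `pruning_eq_of_lift` from only
one of the chosen ones. So an invariant family amounts to arbitrary values at the prunings. -/
lemma exists_inner_comp_inc (α : S ⟶ T) :
    ∃ γ : S ⟶ (pruning α).tree, inner γ ∧ γ ≫ (pruning α).inc = α :=
  (pruning α).saturated.exists_inner_lift (pruning α).leafSet_inc.symm.subset

lemma pruning_eq_of_lift (L : Pruning T) (γ : S ⟶ L.tree) (hγ : inner γ) :
    pruning (γ ≫ L.inc) = L :=
  Subtype.ext ((leafSet_inner_comp γ hγ L.inc).trans L.leafSet_inc)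

/-- A factorisation of a morphism of trees. -/
structure Factoring (α : S ⟶ T) where
  mid : OTree
  fst : S ⟶ mid
  snd : mid ⟶ T
  eq : fst ≫ snd = α

namespace Factoring

variable {α : S ⟶ T} (F : Factoring α)

lemma apply (x : S.Edge) : F.snd.toFun (F.fst.toFun x) = α.toFun x :=
  congrArg (fun z : S ⟶ T => z.toFun x) F.eq

/-- The induced maps `R_l ⟶ T_l`. -/
def above (x : S.Edge) : F.mid.above (F.fst.toFun x) ⟶ T.above (α.toFun x) :=
  aboveTo F.snd (F.fst.toFun x) (α.toFun x) (F.apply x)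

/-- The leaves of the middle tree are those of its subtrees above the leaves of `S`. Therefore the
leaf sets of the induced maps determine that of `F.snd`. -/
lemma mem_leafSet_snd {x : T.Edge} : x ∈ leafSet F.snd ↔
    ∃ (l : S.Leaf) (h : x.1 ∈ (T.above (α.toFun l.1)).edges), ⟨x.1, h⟩ ∈ leafSet (F.above l.1) := by
  constructor
  · rintro ⟨k, rfl⟩
    obtain ⟨⟨l, k⟩, -, rfl⟩ := List.mem_map.1 ((leafUp_perm F.fst).symm.subset (F.mid.mem_leaves k))
    exact ⟨l, ((F.above l.1).toFun k.1).2, k, rfl⟩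
  · rintro ⟨l, h, k, hk⟩
    exact ⟨leafUp F.fst ⟨l, k⟩, Subtype.ext ((congrArg Subtype.val hk :))⟩

/-- Given prunings of the trees `T_l`, there is a factorisation through a pruning of `T` which
induces them. -/
lemma exists_of_prunings (α : S ⟶ T) (L : ∀ l : S.Leaf, Pruning (T.above (α.toFun l.1))) :
    ∃ F : Factoring α, Saturated F.snd ∧
      ∀ l : S.Leaf, leafSet (L l).inc ⊆ leafSet (F.above l.1) := by
  classical
  -- `T` is cut at the leaves of all the given prunings, viewed as edges of `T`.
  let c : List T.Edge := (Finset.univ.filter fun x : T.Edge => ∃ (l : S.Leaf) (h : x.1 ∈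
    (T.above (α.toFun l.1)).edges), (⟨x.1, h⟩ : (T.above (α.toFun l.1)).Edge) ∈
      leafSet (L l).inc).toList
  have hc : ∀ x, x ∈ c ↔ ∃ (l : S.Leaf) (h : x.1 ∈
    (T.above (α.toFun l.1)).edges), (⟨x.1, h⟩ : (T.above (α.toFun l.1)).Edge) ∈
      leafSet (L l).inc := fun x => by simp [c]
  obtain ⟨a, ha⟩ := exists_lift α (T.cutInc c) fun x => by
    refine ⟨⟨(α.toFun x).1, mem_cut.2 ⟨(α.toFun x).2, fun d hd hdx => ?_⟩⟩, rfl⟩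
    obtain ⟨l, h, -⟩ := (hc d).1 hd
    have h := (mem_above.1 h).2
    have hx := l.2 x ((α.le_iff _ _).1 (T.le_trans _ (α.toFun l.1).2 _ d.2 _ (α.toFun x).2 h hdx))
    rw [← hx] at h
    exact T.le_antisymm _ (α.toFun x).2 _ d.2 h hdx
  refine ⟨⟨_, a, _, ha⟩, cutInc_saturated _ _, fun l => ?_⟩
  rintro _ ⟨k, rfl⟩
  have hk := mem_above.1 ((L l).inc.toFun k.1).2
  have hkc : (⟨((L l).inc.toFun k.1).1, hk.1⟩ : T.Edge) ∈ c :=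
    (hc _).2 ⟨l, ((L l).inc.toFun k.1).2, k, rfl⟩
  -- A cut edge below this one must come from the same `T_l`, and distinct leaves of one pruning are
  -- incomparable.
  have hcut : ((L l).inc.toFun k.1).1 ∈ (T.cut c).edges := mem_cut.2 ⟨hk.1, fun d hd hdk => by
    obtain ⟨m, hm, k', hk'⟩ := (hc d).1 hd
    have hm' := (mem_above.1 hm).2
    have hlm : l = m := by
      rcases T.le_total_below _ (α.toFun l.1).2 _ (α.toFun m.1).2 _ hk.1 hk.2
        (T.le_trans _ (α.toFun m.1).2 _ d.2 _ hk.1 hm' hdk) with h | h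
      · exact Subtype.ext (l.2 _ ((α.le_iff _ _).1 h)).symm
      · exact Subtype.ext (m.2 _ ((α.le_iff _ _).1 h))
    subst hlm
    have hkk : k = k' := by
      refine Subtype.ext (k'.2 _ (((L l).inc.le_iff _ _).1 ?_))
      rw [show (L l).inc.toFun k'.1 = _ from hk']
      exact hdk
    subst hkk
    exact congrArg Subtype.val hk'⟩
  have ha' : ((a.toFun l.1).1 : ℕ) = (α.toFun l.1).1 :=
    congrArg (fun z : S ⟶ T => (z.toFun l.1).1) ha
  have habove : ((L l).inc.toFun k.1).1 ∈ ((T.cut c).above (a.toFun l.1)).edges :=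
    mem_above.2 ⟨hcut, by rw [ha']; exact hk.2⟩
  refine ⟨⟨⟨_, habove⟩, fun y hy => Subtype.ext ?_⟩, rfl⟩
  exact (mem_cut.1 (mem_above.1 y.2).1).2 _ hkc hy

end Factoring

end OTree

/-! ### Maps into tensor products of finite direct sums -/

section

variable {C : Type w} [Category.{v} C] [MonoidalCategory C]

lemma tensMap_congr {ι : Type*} {V W : ι → C} {f g : ∀ i, V i ⟶ W i} {l : List ι}
    (h : ∀ i ∈ l, f i = g i) : tensMap f l = tensMap g l := by
  induction l with
  | nil => rfl
  | cons j l ih =>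
    change (f j ⊗ₘ tensMap f l) = (g j ⊗ₘ tensMap g l)
    rw [h j List.mem_cons_self, ih fun i hi => h i (List.mem_cons_of_mem _ hi)]

variable [Preadditive C] [MonoidalPreadditive C]

lemma tensMap_zero {ι : Type*} {V W : ι → C} (f : ∀ i, V i ⟶ W i)
    (l : List ι) {i : ι} (hi : i ∈ l) (h : f i = 0) : tensMap f l = 0 := by
  induction l with
  | nil => exact absurd hi List.not_mem_nil
  | cons j l ih =>
    change f j ⊗ₘ tensMap f l = 0
    rcases List.mem_cons.1 hi with rfl | hi
    · rw [h, MonoidalPreadditive.zero_tensor]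
    · rw [ih hi, MonoidalPreadditive.tensor_zero]

/-- If the identities of the factors are sums of endomorphisms, then these endomorphisms detect
whether a map into a tensor product is zero. -/
lemma eq_zero_of_tensMap {ι : Type*} {V : ι → C} {J : ι → Type*}
    [∀ i, Fintype (J i)] (e : ∀ i, J i → (V i ⟶ V i)) (he : ∀ i, ∑ j, e i j = 𝟙 (V i))
    (c₀ : ∀ i, J i) {l : List ι} (hl : l.Nodup) {A Z : C} (f : A ⟶ Z ⊗ tens V l)
    (h : ∀ c : ∀ i, J i, f ≫ Z ◁ tensMap (fun i => e i (c i)) l = 0) : f = 0 := by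
  classical
  induction l generalizing Z A with
  | nil =>
    -- The choice `c₀` keeps the hypothesis from being vacuous here.
    have := h c₀
    change f ≫ Z ◁ 𝟙 (𝟙_ C) = 0 at this
    rwa [whiskerLeft_id, Category.comp_id] at this
  | cons i l ih =>
    obtain ⟨hi, hl⟩ := List.nodup_cons.1 hl
    change A ⟶ Z ⊗ V i ⊗ tens V l at f
    -- Fix an endomorphism of the first factor, absorb this factor into `Z`, and use the induction
    -- hypothesis for the rest. Updating the choice at `i` is harmless, as `i` does not occur in
    -- `l`.
    have key : ∀ j, f ≫ Z ◁ (e i j ▷ tens V l) = 0 := fun j => by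
      have := ih hl (f ≫ Z ◁ (e i j ▷ tens V l) ≫ (α_ _ _ _).inv) fun c => by
        have hc := h (Function.update c i j)
        have h1 : tensMap (fun k => e k (Function.update c i j k)) (i :: l) =
            (e i j ⊗ₘ tensMap (fun k => e k (c k)) l) := by
          change (e i (Function.update c i j i) ⊗ₘ _) = _
          rw [Function.update_self]
          congr 1
          refine tensMap_congr fun k hk => ?_
          rw [Function.update_of_ne (fun e => hi (by rw [← e]; exact hk))]
        rw [h1, MonoidalCategory.tensorHom_def] at hc
        rw [Category.assoc, Category.assoc, ← associator_inv_naturality_right, ← whiskerLeft_comp_assoc,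
          reassoc_of% hc, zero_comp]
      rw [← Category.assoc, Preadditive.IsIso.comp_right_eq_zero] at this
      exact this
    rw [← Category.comp_id f, ← whiskerLeft_id, ← id_whiskerRight, ← he i,
      sum_whiskerRight, whiskerLeft_sum, Preadditive.comp_sum]
    exact Finset.sum_eq_zero fun j _ => key j

end

/-! ### `H_X(V)(T)` as a finite direct sum over prunings -/

section

open OTree

variable {C : Type w} [Category.{v} C] [MonoidalCategory C] [SymmetricCategory C]

lemma OTree.Hom.cancel {S R T : OTree} (β : R ⟶ T) {γ γ' : S ⟶ R} (h : γ ≫ β = γ' ≫ β) : γ = γ' :=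
  OTree.Hom.ext (funext fun x => β.injective (congrArg (fun z : S ⟶ T => z.toFun x) h))

namespace Preoperad

/-- The map `X(R) ⊗ ⨂ V(T_k) ⟶ X(S) ⊗ ⨂ V(T_l)` induced by a morphism `γ` of `A` over `T`. -/
def innerMap (X : Preoperad C) (V : PshR C) {S R T : OTree} (γ : S ⟶ R) (hγ : inner γ)
    (β : R ⟶ T) {α : S ⟶ T} (h : γ ≫ β = α) : X.ob R ⊗ leafTens V β ⟶ X.ob S ⊗ leafTens V α :=
  X.presheaf.res γ hγ ⊗ₘ (leafReindex V γ hγ β ≫ eqToHom (congrArg (leafTens V) h))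

lemma innerMap_rfl (X : Preoperad C) (V : PshR C) {S R T : OTree} (γ : S ⟶ R) (hγ : inner γ)
    (β : R ⟶ T) : X.innerMap V γ hγ β rfl = (X.presheaf.res γ hγ ⊗ₘ leafReindex V γ hγ β) := by
  rw [innerMap, eqToHom_refl, Category.comp_id]

lemma innerMap_congr (X : Preoperad C) (V : PshR C) {S R T : OTree} (γ γ' : S ⟶ R) (hγ : inner γ)
    (hγ' : inner γ') (β : R ⟶ T) {α : S ⟶ T} (h : γ ≫ β = α) (h' : γ' ≫ β = α) :
    X.innerMap V γ hγ β h = X.innerMap V γ' hγ' β h' := by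
  obtain rfl := Hom.cancel β (h.trans h'.symm)
  rfl

lemma innerMap_comp (X : Preoperad C) (V : PshR C) {S S' R T : OTree} (γ' : S' ⟶ S) (γ : S ⟶ R)
    (hγ' : inner γ') (hγ : inner γ) (β : R ⟶ T) {α : S ⟶ T} (h : γ ≫ β = α) :
    X.innerMap V γ hγ β h ≫ (X.presheaf.res γ' hγ' ⊗ₘ leafReindex V γ' hγ' α) =
      X.innerMap V (γ' ≫ γ) (inner.comp_mem _ _ hγ' hγ) β (congrArg (γ' ≫ ·) h) := by
  subst h
  rw [innerMap_rfl, MonoidalCategory.tensorHom_comp_tensorHom, ← PshA.res_comp,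
    ← leafReindex_comp]
  exact (innerMap_rfl X V (γ' ≫ γ) (inner.comp_mem _ _ hγ' hγ) β).symm

variable [HasLimitsOfSize.{0, 0} C]

lemma π_innerMap (X : Preoperad C) (V : PshR C) {S R T : OTree} (γ : S ⟶ R) (hγ : inner γ)
    (β : R ⟶ T) {α : S ⟶ T} (h : γ ≫ β = α) :
    X.π V β ≫ X.innerMap V γ hγ β h = X.π V α := by
  subst h
  rw [innerMap_rfl, π_inner]

variable [Preadditive C]

open Classical in
/-- The components of the inclusion of the factor of a pruning. -/
def fromPruningFamily (X : Preoperad C) (V : PshR C) {R T : OTree} (β : R ⟶ T) {S : OTree}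
    (α : S ⟶ T) : X.ob R ⊗ leafTens V β ⟶ X.ob S ⊗ leafTens V α :=
  if h : ∃ γ : S ⟶ R, inner γ ∧ γ ≫ β = α then
    X.innerMap V h.choose h.choose_spec.1 β h.choose_spec.2 else 0

/-- The morphisms `γ ≫ α` and `α` have the same leaf set, so by saturation one factors through `β`
by a morphism of `A` if and only if the other does. Hence extension by zero respects invariance. -/
lemma fromPruningFamily_inner (X : Preoperad C) (V : PshR C) {R T : OTree} (β : R ⟶ T)
    (hβ : Saturated β) {S S' : OTree} (γ : S ⟶ S') (hγ : inner γ) (α : S' ⟶ T) :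
    X.fromPruningFamily V β (γ ≫ α) =
      X.fromPruningFamily V β α ≫ (X.presheaf.res γ hγ ⊗ₘ leafReindex V γ hγ α) := by
  by_cases h : ∃ γ' : S' ⟶ R, inner γ' ∧ γ' ≫ β = α
  · have h' : ∃ γ' : S ⟶ R, inner γ' ∧ γ' ≫ β = γ ≫ α :=
      ⟨γ ≫ h.choose, inner.comp_mem _ _ hγ h.choose_spec.1,
        congrArg (γ ≫ ·) h.choose_spec.2⟩
    rw [fromPruningFamily, fromPruningFamily, dif_pos h, dif_pos h', innerMap_comp]
    exact X.innerMap_congr V _ _ _ _ _ _ _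
  · have h' : ¬ ∃ γ' : S ⟶ R, inner γ' ∧ γ' ≫ β = γ ≫ α := by
      rintro ⟨γ', hγ', e⟩
      refine h (hβ.exists_inner_lift ?_)
      rw [← leafSet_inner_comp γ hγ α, ← e, leafSet_inner_comp γ' hγ']
    rw [fromPruningFamily, fromPruningFamily, dif_neg h, dif_neg h', zero_comp]

/-- The inclusion of the factor of a pruning. -/
def fromPruning (X : Preoperad C) (V : PshR C) {R T : OTree} (β : R ⟶ T) (hβ : Saturated β) :
    X.ob R ⊗ leafTens V β ⟶ X.HObj V T :=
  X.lift V (fun {_} α => X.fromPruningFamily V β α) (X.fromPruningFamily_inner V β hβ)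

lemma fromPruning_π (X : Preoperad C) (V : PshR C) {S R T : OTree} (β : R ⟶ T) (hβ : Saturated β)
    {α : S ⟶ T} (γ : S ⟶ R) (hγ : inner γ) (h : γ ≫ β = α) :
    X.fromPruning V β hβ ≫ X.π V α = X.innerMap V γ hγ β h := by
  refine (X.lift_π V (fun {_} α => X.fromPruningFamily V β α)
    (X.fromPruningFamily_inner V β hβ) α).trans ?_
  rw [fromPruningFamily, dif_pos ⟨γ, hγ, h⟩]
  exact X.innerMap_congr V _ _ _ _ _ _ _

lemma fromPruning_π_eq_zero (X : Preoperad C) (V : PshR C) {S R T : OTree} (β : R ⟶ T)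
    (hβ : Saturated β) {α : S ⟶ T} (h : ¬ ∃ γ : S ⟶ R, inner γ ∧ γ ≫ β = α) :
    X.fromPruning V β hβ ≫ X.π V α = 0 := by
  refine (X.lift_π V (fun {_} α => X.fromPruningFamily V β α)
    (X.fromPruningFamily_inner V β hβ) α).trans ?_
  rw [fromPruningFamily, dif_neg h]

/-- The object `H_X(V)(T)` is the direct sum of the factors of the prunings of `T`. -/
lemma sum_π_fromPruning (X : Preoperad C) (V : PshR C) (T : OTree) :
    ∑ L : Pruning T, X.π V L.inc ≫ X.fromPruning V L.inc L.saturated = 𝟙 (X.HObj V T) := by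
  refine X.HObj_ext V fun {S} α => ?_
  -- At `α`, only the summand of the pruning of `α` contributes.
  rw [Preadditive.sum_comp, Finset.sum_eq_single (pruning α)]
  · obtain ⟨γ, hγ, h⟩ := exists_inner_comp_inc α
    rw [Category.assoc, X.fromPruning_π V _ _ γ hγ h, π_innerMap, Category.id_comp]
  · intro L _ hL
    rw [Category.assoc, fromPruning_π_eq_zero, comp_zero]
    rintro ⟨γ, hγ, rfl⟩
    exact hL (pruning_eq_of_lift L γ hγ).symm
  · exact fun h => absurd (Finset.mem_univ _) h

/-- The structure maps into the factors of factorisations detect equality of maps into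
`Z ⊗ ⨂_l H_X(V)(T_l)`. -/
lemma hom_ext_of_factoring [MonoidalPreadditive C] (X : Preoperad C) (V : PshR C) {S T : OTree}
    (α : S ⟶ T) {A Z : C} {f g : A ⟶ Z ⊗ tens (fun l : S.Leaf => X.HObj V (T.above (α.toFun l.1))) S.leaves}
    (h : ∀ F : Factoring α, Saturated F.snd →
      f ≫ Z ◁ tensMap (fun l : S.Leaf => X.π V (F.above l.1)) S.leaves =
        g ≫ Z ◁ tensMap (fun l : S.Leaf => X.π V (F.above l.1)) S.leaves) : f = g := by
  rw [← sub_eq_zero]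
  refine eq_zero_of_tensMap (V := fun l : S.Leaf => X.HObj V (T.above (α.toFun l.1)))
    (J := fun l => Pruning (T.above (α.toFun l.1)))
    (fun l L => X.π V L.inc ≫ X.fromPruning V L.inc L.saturated)
    (fun l => X.sum_π_fromPruning V _) (fun l => pruning (𝟙 _)) S.leaves_nodup _ fun c => ?_
  -- A choice of one summand in each tensor factor comes from a single factorisation `F`, and the
  -- projections onto the chosen summands factor through those belonging to `F`.
  obtain ⟨F, hF, hc⟩ := Factoring.exists_of_prunings α c
  have h1 : ∀ l : S.Leaf, ∃ m, X.π V (F.above l.1) ≫ m =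
      X.π V (c l).inc ≫ X.fromPruning V (c l).inc (c l).saturated := fun l => by
    obtain ⟨γ, hγ, e⟩ := (hF.aboveTo _ _ (F.apply l.1)).exists_inner_lift (hc l)
    exact ⟨X.innerMap V γ hγ _ e ≫ X.fromPruning V (c l).inc (c l).saturated,
      by rw [← Category.assoc]; exact congrArg (· ≫ _) (X.π_innerMap V γ hγ _ e)⟩
  choose m hm using h1
  have h2 : tensMap (fun l : S.Leaf => X.π V (c l).inc ≫
      X.fromPruning V (c l).inc (c l).saturated) S.leaves =
      tensMap (fun l : S.Leaf => X.π V (F.above l.1)) S.leaves ≫ tensMap m S.leaves := by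
    rw [← tensMap_comp]
    exact congrArg (fun z => tensMap z S.leaves) (funext fun l => (hm l).symm)
  rw [h2, Preadditive.sub_comp, whiskerLeft_comp, reassoc_of% (h F hF), sub_self]

/-- A compatible family of maps, indexed by factorisations, is induced by a map into
`Z ⊗ ⨂_l H_X(V)(T_l)`. -/
lemma exists_of_factoring [MonoidalPreadditive C] (X : Preoperad C) (V : PshR C) {S T : OTree}
    (α : S ⟶ T) {A Z : C}
    (ω : ∀ F : Factoring α, A ⟶ Z ⊗ tens (fun l : S.Leaf => X.ob (F.mid.above (F.fst.toFun l.1)) ⊗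
      leafTens V (F.above l.1)) S.leaves)
    (hω : ∀ {R R' : OTree} (a : S ⟶ R) (γ : R ⟶ R') (hγ : inner γ) (b : R' ⟶ T)
      (h : a ≫ γ ≫ b = α), ω ⟨R, a, γ ≫ b, h⟩ = ω ⟨R', a ≫ γ, b, h⟩ ≫
        Z ◁ tensMap (fun l : S.Leaf => (X.presheaf.res (aboveMap γ (a.toFun l.1))
          (aboveMap_inner γ hγ _) ⊗ₘ leafReindex V (aboveMap γ (a.toFun l.1))
            (aboveMap_inner γ hγ _) (Factoring.above ⟨R', a ≫ γ, b, h⟩ l.1))) S.leaves) :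
    ∃ d : A ⟶ Z ⊗ tens (fun l : S.Leaf => X.HObj V (T.above (α.toFun l.1))) S.leaves, ∀ F : Factoring α,
      d ≫ Z ◁ tensMap (fun l : S.Leaf => X.π V (F.above l.1)) S.leaves = ω F := by
  classical
  let G : Pruning T → Prop := fun L => ∃ a : S ⟶ L.tree, a ≫ L.inc = α
  let F' : ∀ L, G L → Factoring α := fun L h => ⟨L.tree, h.choose, L.inc, h.choose_spec⟩
  -- The sum runs over the prunings through which `α` factors; each term is the prescribed map
  -- followed by the inclusions of the corresponding summands of the `H_X(V)(T_l)`. At `F`, only the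
  -- pruning of `F.snd` contributes.
  refine ⟨∑ L : Pruning T, if h : G L then ω (F' L h) ≫ Z ◁ tensMap (fun l : S.Leaf =>
    X.fromPruning V ((F' L h).above l.1) (L.saturated.aboveTo _ _ _)) S.leaves else 0, fun F => ?_⟩
  obtain ⟨γ, hγ, e⟩ := exists_inner_comp_inc F.snd
  have hG : G (pruning F.snd) := ⟨F.fst ≫ γ, (congrArg (F.fst ≫ ·) e).trans F.eq⟩
  have main : ∀ (F₀ F : Factoring α) (γ : F.mid ⟶ F₀.mid),
      inner γ → γ ≫ F₀.snd = F.snd → ∀ h : Saturated F₀.snd,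
      ω F₀ ≫ Z ◁ (tensMap (fun l : S.Leaf => X.fromPruning V (F₀.above l.1) (h.aboveTo _ _ _))
        S.leaves ≫ tensMap (fun l : S.Leaf => X.π V (F.above l.1)) S.leaves) = ω F := by
    rintro ⟨R', a', b', h'⟩ ⟨R, a, b, h⟩ γ hγ e hs
    change R ⟶ R' at γ
    obtain rfl : γ ≫ b' = b := e
    obtain rfl : a ≫ γ = a' := Hom.cancel b' (h.trans h'.symm)
    rw [hω a γ hγ b' h, ← tensMap_comp]
    refine congrArg (fun z => ω _ ≫ Z ◁ tensMap z S.leaves) (funext fun l => ?_)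
    refine (X.fromPruning_π V _ _ (aboveMap γ (a.toFun l.1)) (aboveMap_inner γ hγ _) rfl).trans ?_
    exact innerMap_rfl X V _ _ _
  rw [Preadditive.sum_comp, Finset.sum_eq_single (pruning F.snd)]
  · rw [dif_pos hG, Category.assoc, ← whiskerLeft_comp]
    exact main (F' _ hG) F γ hγ e (pruning F.snd).saturated
  · intro L _ hL
    by_cases h : G L
    · rw [dif_pos h, Category.assoc, ← whiskerLeft_comp]
      have : tensMap (fun l : S.Leaf => X.fromPruning V ((F' L h).above l.1)
          (L.saturated.aboveTo _ _ _)) S.leaves ≫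
          tensMap (fun l : S.Leaf => X.π V (F.above l.1)) S.leaves = 0 := by
        rw [← tensMap_comp]
        -- A nonzero tensor product of maps has nonzero factors. Then the leaf sets agree above
        -- every leaf of `S`, which makes `L` the pruning of `F.snd`.
        by_contra h0
        refine hL (Subtype.ext (L.leafSet_inc.symm.trans (Set.ext fun x => ?_)))
        have h1 : ∀ l : S.Leaf, leafSet ((F' L h).above l.1) = leafSet (F.above l.1) := fun l => by
          by_contra hl
          refine h0 (tensMap_zero _ _ (S.mem_leaves l) (X.fromPruning_π_eq_zero V _ _ ?_))
          rintro ⟨γ, hγ, e⟩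
          rw [← e, leafSet_inner_comp γ hγ] at hl
          exact hl rfl
        change x ∈ leafSet (F' L h).snd ↔ x ∈ leafSet F.snd
        rw [Factoring.mem_leafSet_snd, Factoring.mem_leafSet_snd]
        simp only [h1]
      rw [this, MonoidalPreadditive.whiskerLeft_zero, comp_zero]
    · rw [dif_neg h, zero_comp]
  · exact fun h => absurd (Finset.mem_univ _) h

end Preoperad

end

/-! ### The components of the comultiplication -/

section

open OTree

variable {C : Type w} [Category.{v} C] [MonoidalCategory C] [SymmetricCategory C]

namespace OTree

/-- Every edge of `S'` lies below the image of a leaf of `S`, and the image of that leaf in `T`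
belongs to the saturated image of `b`. -/
lemma Saturated.exists_lift_of_inner_comp {S S' R T : OTree} {γ : S ⟶ S'} (hγ : inner γ)
    {α : S' ⟶ T} {b : R ⟶ T} (hb : Saturated b) (a : S ⟶ R) (h : a ≫ b = γ ≫ α) :
    ∃ a' : S' ⟶ R, a' ≫ b = α ∧ γ ≫ a' = a := by
  obtain ⟨a', ha'⟩ := exists_lift α b fun x => by
    obtain ⟨l, hl⟩ := exists_isLeaf_above x
    obtain ⟨m, -, rfl⟩ := List.mem_map.1 ((leafMap_perm γ hγ).symm.subset (S'.mem_leaves l))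
    refine hb _ (a.toFun m.1) ?_
    rw [show b.toFun (a.toFun m.1) = α.toFun (γ.toFun m.1) from
      congrArg (fun z : S ⟶ T => z.toFun m.1) h, α.le_iff]
    exact hl
  exact ⟨a', ha', Hom.cancel b ((congrArg (γ ≫ ·) ha').trans h.symm)⟩

end OTree

section Regroup

variable (V : PshR C)

/-- Regrouping the factors `V(T_k)`, as an isomorphism. -/
def regroupIso {S R T : OTree} (α : S ⟶ R) (β : R ⟶ T) (A₀ : C) (A : S.Leaf → C) :
    A₀ ⊗ tens (fun l : S.Leaf => A l ⊗ leafTens V (aboveMap β (α.toFun l.1))) S.leaves ≅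
      (A₀ ⊗ tens A S.leaves) ⊗ leafTens V β :=
  asIso (regroupLeaves V α β A₀ A)

lemma iso_inv_square {A B D E : C} {i : A ≅ B} {j : D ≅ E} {f : A ⟶ D} {g : B ⟶ E}
    (h : f ≫ j.hom = i.hom ≫ g) : g ≫ j.inv = i.inv ≫ f := by
  rw [Iso.comp_inv_eq, Category.assoc, h, Iso.inv_hom_id_assoc]

lemma regroupIso_inv_naturality_left {S R T : OTree} (α : S ⟶ R) (β : R ⟶ T) {A₀ A₀' : C}
    {A A' : S.Leaf → C} (f₀ : A₀ ⟶ A₀') (f : ∀ l, A l ⟶ A' l) :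
    ((f₀ ⊗ₘ tensMap f S.leaves) ▷ leafTens V β) ≫ (regroupIso V α β A₀' A').inv =
      (regroupIso V α β A₀ A).inv ≫ (f₀ ⊗ₘ tensMap (fun l : S.Leaf =>
        f l ▷ leafTens V (aboveMap β (α.toFun l.1))) S.leaves) :=
  iso_inv_square (regroupLeaves_naturality_left V α β f₀ f)

lemma regroupIso_inv_whiskerLeft {S R T : OTree} (α : S ⟶ R) (β : R ⟶ T) (A₀ : C)
    {A A' : S.Leaf → C} (f : ∀ l, A l ⟶ A' l) :
    ((A₀ ◁ tensMap f S.leaves) ▷ leafTens V β) ≫ (regroupIso V α β A₀ A').inv =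
      (regroupIso V α β A₀ A).inv ≫ A₀ ◁ tensMap (fun l : S.Leaf =>
        f l ▷ leafTens V (aboveMap β (α.toFun l.1))) S.leaves := by
  have h := regroupIso_inv_naturality_left V α β (𝟙 A₀) f
  rwa [id_tensorHom, id_tensorHom] at h

lemma regroupIso_inv_reindex_right {S R R' T : OTree} (α : S ⟶ R) (γ : R ⟶ R') (hγ : inner γ)
    (β : R' ⟶ T) (A₀ : C) (A : S.Leaf → C) :
    _ ◁ leafReindex V γ hγ β ≫ (regroupIso V α (γ ≫ β) A₀ A).inv =
      (regroupIso V (α ≫ γ) β A₀ A).inv ≫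
        A₀ ◁ tensMap (fun l : S.Leaf => A l ◁ leafReindex V (aboveMap γ (α.toFun l.1))
        (aboveMap_inner γ hγ (α.toFun l.1)) (aboveMap β (γ.toFun (α.toFun l.1)))) S.leaves :=
  iso_inv_square (regroupLeaves_reindex_right V α γ hγ β A₀ A)

lemma regroupIso_inv_reindex_left {S S' R T : OTree} (γ : S ⟶ S') (hγ : inner γ) (α : S' ⟶ R)
    (β : R ⟶ T) (A₀ : C) (A : S'.Leaf → C) :
    (A₀ ◁ tensReindex A (leafMap γ hγ) (leafMap_perm γ hγ)) ▷ leafTens V β ≫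
        (regroupIso V (γ ≫ α) β A₀ (fun l => A (leafMap γ hγ l))).inv =
      (regroupIso V α β A₀ A).inv ≫
        A₀ ◁ tensReindex (fun l : S'.Leaf => A l ⊗ leafTens V (aboveMap β (α.toFun l.1)))
          (leafMap γ hγ) (leafMap_perm γ hγ) :=
  iso_inv_square (regroupLeaves_reindex_left V γ hγ α β A₀ A)

lemma regroupIso_inv_map {V W : PshR C} (φ : V ⟶ W) {S R T : OTree} (α : S ⟶ R) (β : R ⟶ T)
    (A₀ : C) (A : S.Leaf → C) :
    _ ◁ leafTensMap φ β ≫ (regroupIso W α β A₀ A).inv = (regroupIso V α β A₀ A).inv ≫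
      A₀ ◁ tensMap (fun l : S.Leaf => A l ◁ leafTensMap φ (aboveMap β (α.toFun l.1))) S.leaves :=
  iso_inv_square (regroupLeaves_map φ α β A₀ A)

lemma regroupIso_inv_restrict {S R T T' : OTree} (α : S ⟶ R) (β : R ⟶ T) (β' : T ⟶ T') (A₀ : C)
    (A : S.Leaf → C) :
    _ ◁ leafRestrict V β β' ≫ (regroupIso V α β A₀ A).inv =
      (regroupIso V α (β ≫ β') A₀ A).inv ≫
        A₀ ◁ tensMap (fun l : S.Leaf => A l ◁ leafRestrict V (aboveMap β (α.toFun l.1))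
        (aboveMap β' (β.toFun (α.toFun l.1)))) S.leaves :=
  iso_inv_square (regroupLeaves_restrict V α β β' A₀ A)

end Regroup

lemma whiskerLeft_tensMap_tensorHom {ι : Type*} (Z : C) {A A' B B' : ι → C} (f : ∀ i, A i ⟶ A' i)
    (g : ∀ i, B i ⟶ B' i) (l : List ι) : Z ◁ tensMap (fun i => (f i ⊗ₘ g i)) l =
      Z ◁ tensMap (fun i => A i ◁ g i) l ≫ Z ◁ tensMap (fun i => f i ▷ B' i) l := by
  rw [← whiskerLeft_comp, ← tensMap_comp]
  exact congrArg (fun z => Z ◁ tensMap z l) (funext fun i => MonoidalCategory.tensorHom_def' _ _)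

lemma comult_aux₁ {P W W' L L' Z Z' Q Q' Q'' : C} (π : P ⟶ W ⊗ L) {r : W ⟶ W'} {ρ : L ⟶ L'}
    {d₁ : W' ⟶ Z'} {d₂ : W ⟶ Z} {m : Z ⟶ Z'} (h : r ≫ d₁ = d₂ ≫ m) {i₁ : Z' ⊗ L' ⟶ Q''}
    {i' : Z ⊗ L' ⟶ Q'} {i₂ : Z ⊗ L ⟶ Q} {t₁ : Q ⟶ Q'} {t₂ : Q' ⟶ Q''}
    (h₁ : m ▷ L' ≫ i₁ = i' ≫ t₂) (h₂ : Z ◁ ρ ≫ i' = i₂ ≫ t₁) :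
    (π ≫ (r ⊗ₘ ρ)) ≫ d₁ ▷ L' ≫ i₁ = (π ≫ d₂ ▷ L ≫ i₂) ≫ t₁ ≫ t₂ := by
  simp only [Category.assoc, MonoidalCategory.tensorHom_def']
  rw [← comp_whiskerRight_assoc, h, comp_whiskerRight_assoc, h₁, whisker_exchange_assoc,
    reassoc_of% h₂]

namespace Preoperad

variable [HasLimitsOfSize.{0, 0} C]
variable (X : Preoperad C) (V : PshR C)

/-- The composition of a component of the comultiplication with a projection. -/
def comultProj {S R T : OTree} (a : S ⟶ R) (b : R ⟶ T) : X.HObj V T ⟶ X.ob S ⊗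
    tens (fun l : S.Leaf => X.ob (R.above (a.toFun l.1)) ⊗ leafTens V (aboveMap b (a.toFun l.1)))
      S.leaves :=
  X.π V b ≫ X.decomp a ▷ leafTens V b ≫ (regroupIso V a b (X.ob S)
    (fun l : S.Leaf => X.ob (R.above (a.toFun l.1)))).inv

/-- The compositions of the components of the comultiplication with projections. -/
def comultFamily {S T : OTree} : {α : S ⟶ T} → (F : Factoring α) → (X.HObj V T ⟶ X.ob S ⊗
    tens (fun l : S.Leaf => X.ob (F.mid.above (F.fst.toFun l.1)) ⊗ leafTens V (F.above l.1)) S.leaves)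
  | _, ⟨_, a, b, rfl⟩ => X.comultProj V a b

/-- This is the compatibility demanded by `exists_of_factoring`. It combines `res_decomp`, for the
factors of `X`, with the naturality of regrouping, for those of `V`. -/
lemma comultProj_inner {S R R' T : OTree} (a : S ⟶ R) (γ : R ⟶ R') (hγ : inner γ)
    (b : R' ⟶ T) : X.comultProj V a (γ ≫ b) = X.comultProj V (a ≫ γ) b ≫
        X.ob S ◁ tensMap (fun l : S.Leaf => (X.presheaf.res (aboveMap γ (a.toFun l.1))
          (aboveMap_inner γ hγ _) ⊗ₘ leafReindex V (aboveMap γ (a.toFun l.1))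
            (aboveMap_inner γ hγ _) (aboveMap b (γ.toFun (a.toFun l.1))))) S.leaves := by
  rw [comultProj, π_inner _ _ _ hγ]
  refine Eq.trans (comult_aux₁ _ (X.res_decomp a γ hγ)
    (regroupIso_inv_whiskerLeft V a (γ ≫ b) (X.ob S)
      (fun l : S.Leaf => X.presheaf.res (aboveMap γ (a.toFun l.1)) (aboveMap_inner γ hγ _)))
    (regroupIso_inv_reindex_right V a γ hγ b (X.ob S)
      (fun l : S.Leaf => X.ob (R'.above (γ.toFun (a.toFun l.1))))))
    (congrArg (fun z => X.comultProj V (a ≫ γ) b ≫ z) (whiskerLeft_tensMap_tensorHom _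
      (fun l : S.Leaf => X.presheaf.res (aboveMap γ (a.toFun l.1)) (aboveMap_inner γ hγ _))
      (fun l : S.Leaf => leafReindex V (aboveMap γ (a.toFun l.1))
            (aboveMap_inner γ hγ _) (aboveMap b (γ.toFun (a.toFun l.1)))) S.leaves).symm)

variable [Preadditive C] [MonoidalPreadditive C]

lemma exists_comultComponent {S T : OTree} (α : S ⟶ T) :
    ∃ d : X.HObj V T ⟶ X.ob S ⊗ tens (fun l : S.Leaf => X.HObj V (T.above (α.toFun l.1))) S.leaves,
      ∀ F : Factoring α, d ≫ X.ob S ◁ tensMap (fun l : S.Leaf => X.π V (F.above l.1)) S.leaves =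
        X.comultFamily V F :=
  X.exists_of_factoring V α (X.comultFamily V) fun a γ hγ b h => by
    subst h
    exact X.comultProj_inner V a γ hγ b

/-- The component of the comultiplication at `α`. -/
def comultComponent {S T : OTree} (α : S ⟶ T) : X.HObj V T ⟶ X.ob S ⊗
    tens (fun l : S.Leaf => X.HObj V (T.above (α.toFun l.1))) S.leaves :=
  (X.exists_comultComponent V α).choose

lemma comultComponent_π {S R T : OTree} (a : S ⟶ R) (b : R ⟶ T) : X.comultComponent V (a ≫ b) ≫
    X.ob S ◁ tensMap (fun l : S.Leaf => X.π V (aboveMap b (a.toFun l.1))) S.leaves =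
      X.comultProj V a b :=
  (X.exists_comultComponent V (a ≫ b)).choose_spec ⟨R, a, b, rfl⟩

end Preoperad

end

/-! ### The comultiplication and its uniqueness -/

section

open OTree

variable {C : Type w} [Category.{v} C] [MonoidalCategory C] [SymmetricCategory C]

lemma regroupIso_inv_whiskerRight (V : PshR C) {S R T : OTree} (α : S ⟶ R) (β : R ⟶ T) {A₀ A₀' : C}
    (f : A₀ ⟶ A₀') (A : S.Leaf → C) :
    (f ▷ tens A S.leaves) ▷ leafTens V β ≫ (regroupIso V α β A₀' A).inv =
      (regroupIso V α β A₀ A).inv ≫ f ▷ _ := by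
  have h := regroupIso_inv_naturality_left V α β f (fun l => 𝟙 (A l))
  simp only [id_whiskerRight, tensMap_id, tensorHom_id] at h
  exact h

lemma comult_aux₂ {P W L Z Z' Z'' Q Q' Q'' : C} (π : P ⟶ W ⊗ L) {d : W ⟶ Z''} {d' : W ⟶ Z}
    {m : Z ⟶ Z'} {m' : Z' ⟶ Z''} (h : d = d' ≫ m ≫ m') {i : Z'' ⊗ L ⟶ Q''} {i' : Z ⊗ L ⟶ Q}
    {j : Z' ⊗ L ⟶ Q'} {t : Q ⟶ Q'} {t' : Q' ⟶ Q''} (h₁ : m ▷ L ≫ j = i' ≫ t)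
    (h₂ : m' ▷ L ≫ i = j ≫ t') : π ≫ d ▷ L ≫ i = (π ≫ d' ▷ L ≫ i') ≫ t ≫ t' := by
  simp only [h, comp_whiskerRight, Category.assoc, h₂, reassoc_of% h₁]

lemma comult_aux₃ {P P' W L L' Z Q Q' : C} {f : P ⟶ P'} {π : P ⟶ W ⊗ L} {π' : P' ⟶ W ⊗ L'}
    {m : L ⟶ L'} (h : f ≫ π' = π ≫ W ◁ m) (d : W ⟶ Z) {i : Z ⊗ L ⟶ Q} {i' : Z ⊗ L' ⟶ Q'}
    {t : Q ⟶ Q'} (h₁ : Z ◁ m ≫ i' = i ≫ t) : f ≫ π' ≫ d ▷ L' ≫ i' = (π ≫ d ▷ L ≫ i) ≫ t := by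
  simp only [Category.assoc, reassoc_of% h, whisker_exchange_assoc, h₁]

lemma comp_whiskerLeft_tensMap_congr {ι : Type*} {A Z : C} {F G G' K : ι → C} {l : List ι}
    {c : A ⟶ Z ⊗ tens F l} {p : A ⟶ Z ⊗ tens G l} {f : ∀ i, F i ⟶ G i} {g : ∀ i, G i ⟶ K i}
    {f' : ∀ i, F i ⟶ G' i} {g' : ∀ i, G' i ⟶ K i} (h : c ≫ Z ◁ tensMap f l = p)
    (e : ∀ i, f i ≫ g i = f' i ≫ g' i) :
    (c ≫ Z ◁ tensMap f' l) ≫ Z ◁ tensMap g' l = p ≫ Z ◁ tensMap g l := by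
  have e' : tensMap f' l ≫ tensMap g' l = tensMap f l ≫ tensMap g l := by
    rw [← tensMap_comp, ← tensMap_comp]
    exact congrArg (fun z => tensMap z l) (funext fun i => (e i).symm)
  rw [Category.assoc, ← whiskerLeft_comp, e', whiskerLeft_comp, reassoc_of% h]

lemma comp_assoc₄ {A B D E F : C} (f : A ⟶ B) (g : B ⟶ D) (h : D ⟶ E) (k : E ⟶ F) :
    f ≫ g ≫ h ≫ k = ((f ≫ g) ≫ h) ≫ k := by simp only [Category.assoc]

lemma comp_cancel_iso {A B D E F : C} (i : E ≅ F) {f : A ⟶ B} {g : B ⟶ D} {h : D ⟶ E} {p : A ⟶ E}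
    (e : f ≫ g ≫ h ≫ i.hom = p ≫ i.hom) : f ≫ g ≫ h = p := by
  rw [← cancel_mono i.hom, ← e, Category.assoc, Category.assoc]

namespace Preoperad

variable [HasLimitsOfSize.{0, 0} C]
variable (X : Preoperad C) (V : PshR C)

lemma comultProj_reindex {S S' R T : OTree} (γ : S ⟶ S') (hγ : inner γ) (a : S' ⟶ R) (b : R ⟶ T) :
    X.comultProj V (γ ≫ a) b = X.comultProj V a b ≫ (X.presheaf.res γ hγ ⊗ₘ
      tensReindex (fun l : S'.Leaf => X.ob (R.above (a.toFun l.1)) ⊗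
        leafTens V (aboveMap b (a.toFun l.1))) (leafMap γ hγ) (leafMap_perm γ hγ)) := by
  refine Eq.trans (comult_aux₂ (X.π V b) ((X.decomp_inner_comp γ hγ a).trans
    (congrArg (fun z => X.decomp a ≫ z) (MonoidalCategory.tensorHom_def' _ _)))
    (regroupIso_inv_reindex_left V γ hγ a b (X.ob S') fun l => X.ob (R.above (a.toFun l.1)))
    (regroupIso_inv_whiskerRight V (γ ≫ a) b (X.presheaf.res γ hγ)
      fun l : S.Leaf => X.ob (R.above (a.toFun (γ.toFun l.1))))) ?_
  exact congrArg (fun z => X.comultProj V a b ≫ z) (MonoidalCategory.tensorHom_def' _ _).symm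

lemma HRes_comultProj {S R T T' : OTree} (a : S ⟶ R) (b : R ⟶ T) (β : T ⟶ T') :
    X.HRes V β ≫ X.comultProj V a b = X.comultProj V a (b ≫ β) ≫ X.ob S ◁ tensMap
      (fun l : S.Leaf => X.ob (R.above (a.toFun l.1)) ◁ leafRestrict V (aboveMap b (a.toFun l.1))
        (aboveMap β (b.toFun (a.toFun l.1)))) S.leaves :=
  comult_aux₃ (X.HRes_π V b β) _ (regroupIso_inv_restrict V a b β (X.ob S) _)

lemma HTensMap_comultProj {V W : PshR C} (φ : V ⟶ W) {S R T : OTree} (a : S ⟶ R) (b : R ⟶ T) :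
    X.HTensMap φ T ≫ X.comultProj W a b = X.comultProj V a b ≫ X.ob S ◁ tensMap
      (fun l : S.Leaf => X.ob (R.above (a.toFun l.1)) ◁ leafTensMap φ (aboveMap b (a.toFun l.1)))
        S.leaves :=
  comult_aux₃ (X.HTensMap_π φ b) _ (regroupIso_inv_map φ a b (X.ob S) _)

variable [Preadditive C] [MonoidalPreadditive C]

/-- It suffices to test on factorisations of `γ ≫ α` through saturated maps. These come from
factorisations of `α` itself, where `comultProj_reindex` gives the claim. -/
lemma comultComponent_inner {S S' T : OTree} (γ : S ⟶ S') (hγ : inner γ) (α : S' ⟶ T) :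
    X.comultComponent V (γ ≫ α) = X.comultComponent V α ≫ (X.presheaf.res γ hγ ⊗ₘ
      tensReindex (fun l : S'.Leaf => X.HObj V (T.above (α.toFun l.1))) (leafMap γ hγ)
        (leafMap_perm γ hγ)) := by
  refine X.hom_ext_of_factoring V (γ ≫ α) ?_
  rintro ⟨R, a, b, h⟩ hb
  change Saturated b at hb
  obtain ⟨a, rfl, rfl⟩ := hb.exists_lift_of_inner_comp hγ a h
  refine (X.comultComponent_π V (γ ≫ a) b).trans ((X.comultProj_reindex V γ hγ a b).trans ?_)
  refine Eq.symm (Eq.trans (tens_aux₁ (X.comultComponent V (a ≫ b)) _ _ _ _ _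
    (tensReindex_naturality (fun l : S'.Leaf => X.π V (aboveMap b (a.toFun l.1)))
      (leafMap γ hγ) (leafMap_perm γ hγ))) ?_)
  exact congrArg (fun z => z ≫ _) (X.comultComponent_π V a b)

lemma HRes_comultComponent {S T T' : OTree} (α : S ⟶ T) (β : T ⟶ T') :
    X.HRes V β ≫ X.comultComponent V α = X.comultComponent V (α ≫ β) ≫
      X.ob S ◁ tensMap (fun l : S.Leaf => X.HRes V (aboveMap β (α.toFun l.1))) S.leaves := by
  refine X.hom_ext_of_factoring V α ?_
  rintro ⟨R, a, b, rfl⟩ hb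
  refine Eq.trans ((Category.assoc _ _ _).trans ((congrArg (fun z => X.HRes V β ≫ z)
    (X.comultComponent_π V a b)).trans (X.HRes_comultProj V a b β))) (Eq.symm ?_)
  exact comp_whiskerLeft_tensMap_congr (X.comultComponent_π V a (b ≫ β))
    fun l : S.Leaf => (X.HRes_π V (aboveMap b (a.toFun l.1))
      (aboveMap β (b.toFun (a.toFun l.1)))).symm

lemma HTensMap_comultComponent {V W : PshR C} (φ : V ⟶ W) {S T : OTree} (α : S ⟶ T) :
    X.HTensMap φ T ≫ X.comultComponent W α = X.comultComponent V α ≫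
      X.ob S ◁ tensMap (fun l : S.Leaf => X.HTensMap φ (T.above (α.toFun l.1))) S.leaves := by
  refine X.hom_ext_of_factoring W α ?_
  rintro ⟨R, a, b, rfl⟩ hb
  refine Eq.trans ((Category.assoc _ _ _).trans ((congrArg (fun z => X.HTensMap φ T ≫ z)
    (X.comultComponent_π W a b)).trans (X.HTensMap_comultProj φ a b))) (Eq.symm ?_)
  exact comp_whiskerLeft_tensMap_congr (X.comultComponent_π V a b)
    fun l : S.Leaf => (X.HTensMap_π φ (aboveMap b (a.toFun l.1))).symm

/-- The comultiplication at `V` and `T`. -/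
def comultApp (T : OTree) : X.HObj V T ⟶ X.HObj (X.H.obj V) T :=
  X.lift (X.H.obj V) (fun {_} α => X.comultComponent V α) (X.comultComponent_inner V)

lemma comultApp_π {S T : OTree} (α : S ⟶ T) :
    X.comultApp V T ≫ X.π (X.H.obj V) α = X.comultComponent V α :=
  X.lift_π (X.H.obj V) (fun {_} α => X.comultComponent V α) (X.comultComponent_inner V) α

/-- The comultiplication `H_X ⟶ H_X H_X`. -/
def comult : X.H ⟶ X.H ⋙ X.H where
  app V :=
    { app T := X.comultApp V T.unop
      naturality T' T β := by
        have h : X.HRes V β.unop ≫ X.comultApp V T.unop =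
            X.comultApp V T'.unop ≫ X.HRes (X.H.obj V) β.unop := by
          refine X.HObj_ext _ fun {S} α => ?_
          rw [Category.assoc, comultApp_π, Category.assoc, HRes_π, ← Category.assoc, comultApp_π]
          exact X.HRes_comultComponent V α β.unop
        exact h }
  naturality V W φ := by
    ext T : 2
    have h : X.HTensMap φ T.unop ≫ X.comultApp W T.unop =
        X.comultApp V T.unop ≫ X.HTensMap (X.H.map φ) T.unop := by
      refine X.HObj_ext _ fun {S} α => ?_
      rw [Category.assoc, comultApp_π, Category.assoc, HTensMap_π, ← Category.assoc, comultApp_π]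
      exact X.HTensMap_comultComponent φ α
    exact h

lemma comultProj_regroup {S R T : OTree} (a : S ⟶ R) (b : R ⟶ T) :
    X.comultProj V a b ≫ leafRegroup X V a b = X.π V b ≫ X.decomp a ▷ leafTens V b := by
  rw [comultProj, Category.assoc, Category.assoc]
  refine congrArg (fun z => X.π V b ≫ z) (Eq.trans ?_ (Category.comp_id _))
  exact congrArg (fun z => X.decomp a ▷ leafTens V b ≫ z) (Iso.inv_hom_id _)

lemma isComult_comult : X.IsComult X.comult := fun V S R T α β => by
  refine Eq.trans ?_ (X.comultProj_regroup V α β)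
  exact (comp_assoc₄ _ _ _ _).trans (congrArg (fun z => z ≫ _)
    ((congrArg (fun z => z ≫ _) (X.comultApp_π V (α ≫ β))).trans (X.comultComponent_π V α β)))

/-- Since regrouping is invertible, the characterising property prescribes the projections for all
factorisations, and these determine the map. -/
lemma IsComult.app_π {δ : X.H ⟶ X.H ⋙ X.H} (h : X.IsComult δ) {S R T : OTree} (a : S ⟶ R)
    (b : R ⟶ T) : (δ.app V).app (op T) ≫ X.π (X.H.obj V) (a ≫ b) ≫
      X.ob S ◁ tensMap (fun l : S.Leaf => X.π V (aboveMap b (a.toFun l.1))) S.leaves =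
        X.comultProj V a b := by
  exact comp_cancel_iso (regroupIso V a b (X.ob S) fun l : S.Leaf => X.ob (R.above (a.toFun l.1)))
    ((h V a b).trans (X.comultProj_regroup V a b).symm)

lemma IsComult.eq {δ : X.H ⟶ X.H ⋙ X.H} (h : X.IsComult δ) : δ = X.comult := by
  ext V T : 4
  refine X.HObj_ext _ fun {S} α => X.hom_ext_of_factoring V α ?_
  rintro ⟨R, a, b, rfl⟩ hb
  exact (Category.assoc _ _ _).trans ((h.app_π X V a b).trans
    ((X.isComult_comult.app_π X V a b).symm.trans (Category.assoc _ _ _).symm))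

end Preoperad

end

/-! ### The counit laws -/

section

open OTree

variable {C : Type w} [Category.{v} C] [MonoidalCategory C] [SymmetricCategory C]

lemma comult_aux₄ {P W L Z Z' Q Q' : C} (π : P ⟶ W ⊗ L) {d : W ⟶ Z} {m : Z ⟶ Z'} {u : Z' ⟶ W}
    (h : d ≫ m ≫ u = 𝟙 W) {i : Z ⊗ L ⟶ Q} (i' : Q' ≅ Z' ⊗ L) {t : Q ⟶ Q'} {s : Q' ⟶ W ⊗ L}
    (h₁ : m ▷ L ≫ i'.inv = i ≫ t) (h₂ : i'.hom ≫ u ▷ L = s) :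
    (π ≫ d ▷ L ≫ i) ≫ t ≫ s = π := by
  rw [Category.assoc, Category.assoc, ← reassoc_of% h₁, ← h₂, Iso.inv_hom_id_assoc,
    ← comp_whiskerRight, ← comp_whiskerRight, h, id_whiskerRight, Category.comp_id]

lemma comult_aux₅ {U B L D E M : C} (π : M ⟶ B ⊗ L) (r : B ⟶ U) (s : L ⟶ D) (u : U ⟶ 𝟙_ C)
    (t : D ⟶ E) : (π ≫ (r ⊗ₘ s)) ≫ (u ⊗ₘ t) ≫ (λ_ E).hom =
      π ≫ ((r ≫ u) ▷ L ≫ 𝟙_ C ◁ (s ≫ t) ≫ (λ_ E).hom) := by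
  rw [Category.assoc, tensorHom_comp_tensorHom_assoc, MonoidalCategory.tensorHom_def,
    Category.assoc]

lemma tens_single_naturality {ι : Type*} {V W : ι → C} (f : ∀ i, V i ⟶ W i) {l : List ι} (i : ι)
    (h : l.Perm [i]) {A : C} (q : W i ⟶ A) :
    tensMap f l ≫ tensPerm W l [i] h ≫ tensSingle W i ≫ q =
      tensPerm V l [i] h ≫ tensSingle V i ≫ f i ≫ q := by
  have := leafRoot_aux f i h (f i ≫ q) q (𝟙 A) (Category.comp_id _).symm
  rwa [Category.comp_id] at this

lemma comp_assoc_right {A B D E F : C} (f : A ⟶ B) (g : B ⟶ D) (h : D ⟶ E) (k : E ⟶ F) :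
    (f ≫ g ≫ h) ≫ k = f ≫ g ≫ h ≫ k := by simp only [Category.assoc]

namespace Preoperad

variable [HasLimitsOfSize.{0, 0} C]
variable (X : Preoperad C) (V : PshR C)

/-- The subtree of `S` above `l` has a single edge, so the root inclusion of `T_l` factors through
`aboveMap α l.1` by a morphism of `A`. By invariance, the counit can be computed from the factor of
that map. -/
lemma counitApp_above {S T : OTree} (α : S ⟶ T) (l : S.Leaf) :
    X.counitApp V (rootInc (T.above (α.toFun l.1))) = X.π V (aboveMap α l.1) ≫
      (X.evalRoot (isLeaf_above_leaf l) ▷ leafTens V (aboveMap α l.1) ≫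
        𝟙_ C ◁ leafTensLeaf V α l ≫ (λ_ _).hom) := by
  rw [← X.counitApp_eq V (rootInc (S.above l.1) ≫ aboveMap α l.1), counitApp,
    X.π_inner V _ (rootInc_inner _ (isLeaf_above_leaf l))]
  exact comult_aux₅ _ _ _ _ _

variable [Preadditive C] [MonoidalPreadditive C]

/-- The counits can be read off from the factorisation of `α` through the identity of `S`. There
`decomp_id_evalRoot` removes the values of `X` at the one-edge trees. -/
lemma comultComponent_counit {S T : OTree} (α : S ⟶ T) :
    X.comultComponent V α ≫ X.ob S ◁ tensMap (fun l : S.Leaf =>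
      X.counitApp V (rootInc (T.above (α.toFun l.1)))) S.leaves = X.π V α := by
  have h := X.comultComponent_π V (𝟙 S) α
  have h1 := regroupIso_inv_whiskerLeft V (𝟙 S) α (X.ob S)
    (fun l : S.Leaf => X.evalRoot (isLeaf_above_leaf l))
  have h2 := regroupLeaves_id_left V α (X.ob S)
  have h3 := X.decomp_id_evalRoot S
  rw [whiskerLeft_comp, Category.assoc] at h3
  refine Eq.trans ?_ (comult_aux₄ (X.π V α) h3 (regroupIso V (𝟙 S) α (X.ob S) fun _ => 𝟙_ C) h1 h2)
  refine Eq.trans ?_ (congrArg (fun z => z ≫ _ ≫ _) h)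
  refine Eq.trans ?_ (Category.assoc _ _ _).symm
  refine congrArg (fun z => X.comultComponent V α ≫ z) ?_
  refine Eq.trans ?_ (congrArg (fun z => X.ob S ◁ tensMap _ S.leaves ≫ z) (whiskerLeft_comp _ _ _))
  refine Eq.trans ?_ (whiskerLeft_comp _ _ _)
  refine congrArg (fun z => X.ob S ◁ z) ?_
  refine Eq.trans ?_ (congrArg (fun z => tensMap _ S.leaves ≫ z) (tensMap_comp _ _ _))
  refine Eq.trans ?_ (tensMap_comp _ _ _)
  exact congrArg (fun z => tensMap z S.leaves) (funext fun l => X.counitApp_above V α l)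

lemma comult_map_counit : X.comult.app V ≫ X.H.map (X.counit.app V) = 𝟙 (X.H.obj V) := by
  ext T : 2
  have h : X.comultApp V T.unop ≫ X.HTensMap (X.counit.app V) T.unop = 𝟙 _ := by
    refine X.HObj_ext _ fun {S} α => ?_
    rw [Category.assoc, HTensMap_π, Category.id_comp, ← Category.assoc, comultApp_π]
    exact X.comultComponent_counit V α
  exact h

lemma comult_aux₆ {P Q Z A L U M : C} (π : P ⟶ M ⊗ L) (d : M ⟶ U ⊗ Z) (i : (U ⊗ Z) ⊗ L ⟶ U ⊗ Q)
    (u : U ⟶ 𝟙_ C) (i' : 𝟙_ C ⊗ Q ≅ (𝟙_ C ⊗ Z) ⊗ L) (t : Q ⟶ A ⊗ L) (t' : Z ⟶ A) (r : A ⟶ M)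
    (h₁ : (u ▷ Z) ▷ L ≫ i'.inv = i ≫ u ▷ Q)
    (h₂ : i'.hom ≫ (𝟙_ C ◁ t' ≫ (λ_ _).hom) ▷ L = 𝟙_ C ◁ t ≫ (λ_ _).hom)
    (h₃ : d ≫ (u ⊗ₘ t' ≫ r) ≫ (λ_ _).hom = 𝟙 _) :
    (π ≫ d ▷ L ≫ i) ≫ (u ⊗ₘ t ≫ r ▷ L) ≫ (λ_ _).hom = π := by
  have h4 : (u ⊗ₘ t ≫ r ▷ L) ≫ (λ_ _).hom = u ▷ Q ≫ (𝟙_ C ◁ t ≫ (λ_ _).hom) ≫ r ▷ L := by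
    rw [MonoidalCategory.tensorHom_def]
    simp
  have h5 : (u ⊗ₘ t' ≫ r) ≫ (λ_ _).hom = u ▷ Z ≫ (𝟙_ C ◁ t' ≫ (λ_ _).hom) ≫ r := by
    rw [MonoidalCategory.tensorHom_def]
    simp
  rw [h4, ← h₂, Category.assoc, Category.assoc, ← reassoc_of% h₁, Category.assoc,
    Iso.inv_hom_id_assoc, ← comp_whiskerRight, ← comp_whiskerRight, ← comp_whiskerRight, ← h5, h₃,
    id_whiskerRight, Category.comp_id]

lemma comult_aux₇ {P M A L D E : C} (π : P ⟶ A ⊗ L) (r : A ⟶ M) (s : L ⟶ D) (k : D ⟶ E) :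
    (π ≫ (r ⊗ₘ s)) ≫ M ◁ k = π ≫ A ◁ (s ≫ k) ≫ r ▷ E := by
  rw [Category.assoc, MonoidalCategory.tensorHom_def', whiskerLeft_comp, Category.assoc,
    Category.assoc, whisker_exchange]

lemma HRes_root_π {S T : OTree} (α : S ⟶ T) :
    X.HRes V (same_above_of_eta (rootInc S ≫ α)).hom ≫ X.π V α =
      X.π V (aboveMap α ((rootInc S).toFun etaLeaf.1)) ≫
        X.ob _ ◁ leafTensRoot V α ≫
          X.presheaf.resSame (same_above_of_eta (rootInc S)) ▷ leafTens V α := by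
  refine (X.HRes_π V α _).trans ((congrArg (fun z => z ≫ X.ob S ◁ leafRestrict V α
    (same_above_of_eta (rootInc S ≫ α)).hom) (X.π_inner V (same_above_of_eta (rootInc S)).hom
      (same_above_of_eta (rootInc S)).inner (aboveMap α ((rootInc S).toFun etaLeaf.1)))).trans ?_)
  exact comult_aux₇ _ _ _ _

/-- The factorisation `rootInc S ≫ α` computes this composite, and `decomp_rootInc` removes the
trivial factor. The counit is written at this map, which is equal to the root inclusion of `T`. -/
lemma comultComponent_counit_π {S T : OTree} (α : S ⟶ T) :
    (X.comultApp V T ≫ X.counitApp (X.H.obj V) (rootInc S ≫ α)) ≫ X.π V α = X.π V α := by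
  have h1 := regroupIso_inv_whiskerRight V (rootInc S) α X.unit.hom
    (fun l : eta.Leaf => X.ob (S.above ((rootInc S).toFun l.1)))
  have h2 := regroupLeaves_rootInc_left V α
    (fun l : eta.Leaf => X.ob (S.above ((rootInc S).toFun l.1)))
  have h3 := X.decomp_rootInc S
  rw [← Category.assoc (tensPerm _ _ _ _)] at h3
  have h4 := tens_single_naturality (fun l : eta.Leaf => X.π V (aboveMap α ((rootInc S).toFun l.1)))
    etaLeaf eta_leaves_perm (X.ob _ ◁ leafTensRoot V α ≫
      X.presheaf.resSame (same_above_of_eta (rootInc S)) ▷ leafTens V α)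
  have h5 : leafRoot (X.H.obj V) (rootInc S ≫ α) ≫ X.π V α = _ :=
    (comp_assoc_right _ _ _ _).trans ((congrArg (fun z => tensPerm _ _ _ eta_leaves_perm ≫
      tensSingle (fun l : eta.Leaf => X.HObj V (T.above (α.toFun ((rootInc S).toFun l.1)))) etaLeaf ≫
        z) (X.HRes_root_π V α)).trans (h4.symm.trans
          (congrArg (fun z => _ ≫ z) (comp_assoc_right _ _ _ _).symm)))
  have h6 : X.comultApp V T ≫ X.counitApp (X.H.obj V) (rootInc S ≫ α) =
      X.comultComponent V (rootInc S ≫ α) ≫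
        (X.unit.hom ⊗ₘ leafRoot (X.H.obj V) (rootInc S ≫ α)) ≫ (λ_ _).hom :=
    (Category.assoc _ _ _).symm.trans (congrArg (fun z => z ≫ _)
      (X.comultApp_π V (rootInc S ≫ α)))
  refine (congrArg (fun z => z ≫ X.π V α) h6).trans (Eq.trans ?_
    (comult_aux₆ (X.π V α) (X.decomp (rootInc S)) _ X.unit.hom
      (regroupIso V (rootInc S) α (𝟙_ C) _) _ _ _ h1 h2 h3))
  exact (tens_aux₃ _ _ _ _ _ _ h5.symm).symm.trans
    (congrArg (fun z => z ≫ _ ≫ _) (X.comultComponent_π V (rootInc S) α))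

lemma comult_counit_app : X.comult.app V ≫ X.counit.app (X.H.obj V) = 𝟙 (X.H.obj V) := by
  ext T : 2
  have h : X.comultApp V T.unop ≫ X.counitApp (X.H.obj V) (rootInc T.unop) = 𝟙 _ := by
    refine X.HObj_ext _ fun {S} α => ?_
    rw [Category.id_comp, ← X.counitApp_eq (X.H.obj V) (rootInc S ≫ α)]
    exact X.comultComponent_counit_π V α
  exact h

end Preoperad

end

/-! ### Coassociativity -/

section

open OTree

variable {C : Type w} [Category.{v} C] [MonoidalCategory C] [SymmetricCategory C]

lemma comp_assoc_right₃ {A B D E F G : C} (f : A ⟶ B) (g : B ⟶ D) (h : D ⟶ E) (k : E ⟶ F)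
    (m : F ⟶ G) : f ≫ (g ≫ h ≫ k) ≫ m = (f ≫ g) ≫ h ≫ k ≫ m := by simp only [Category.assoc]

lemma comp_inv_of_eq {A B D E F : C} {f : A ⟶ B} {g : B ⟶ D} (i : D ≅ E) {h : A ⟶ F} {k : F ⟶ E}
    (e : f ≫ g ≫ i.hom = h ≫ k) : f ≫ g = h ≫ k ≫ i.inv := by
  rw [← Category.assoc h, Iso.eq_comp_inv, ← e, Category.assoc]

namespace Preoperad

variable [HasLimitsOfSize.{0, 0} C]
variable (X : Preoperad C) (V : PshR C)

lemma HRes_same_π {P T : OTree} (c : P ⟶ T) (m : P.Edge) (n : (P.above m).Edge) :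
    X.HRes V (same_above_above (c.toFun m) ((aboveMap c m).toFun n)).hom ≫
        X.π V (aboveMap c ⟨n.1, (mem_above.1 n.2).1⟩) =
      X.π V (aboveMap (aboveMap c m) n) ≫
        (X.presheaf.resSame (same_above_above m n) ⊗ₘ
          leafReindex V (same_above_above m n).hom (same_above_above m n).inner
            (aboveMap (aboveMap c m) n)) ≫
        X.ob _ ◁ leafRestrict V (aboveMap c ⟨n.1, (mem_above.1 n.2).1⟩)
          (same_above_above (c.toFun m) ((aboveMap c m).toFun n)).hom := by
  refine (X.HRes_π V _ _).trans (Eq.trans (congrArg (fun z => z ≫ _)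
    (X.π_inner V (same_above_above m n).hom (same_above_above m n).inner
      (aboveMap (aboveMap c m) n))) (Category.assoc _ _ _))

lemma regroupLeaves_π {S R P T : OTree} (a : S ⟶ R) (p : R ⟶ P) (c : P ⟶ T) (A₀ : C)
    (A : S.Leaf → C) :
    A₀ ◁ tensMap (fun l : S.Leaf => A l ◁ tensMap (fun k : (R.above (a.toFun l.1)).Leaf =>
        X.π V (aboveMap (aboveMap c (p.toFun (a.toFun l.1)))
          ((aboveMap p (a.toFun l.1)).toFun k.1))) (R.above (a.toFun l.1)).leaves) S.leaves ≫
      regroupAboveLeaves V X.presheaf a p c A₀ A =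
    regroupLeaves (X.H.obj V) a (p ≫ c) A₀ A ≫
      (A₀ ⊗ tens A S.leaves) ◁ tensMap (fun m : R.Leaf => X.π V (aboveMap c (p.toFun m.1)))
        R.leaves :=
  regroup_naturality_right A₀ A (leafUp a) _ _ (leafUp_perm a)
    (fun l k => X.π V (aboveMap (aboveMap c (p.toFun (a.toFun l.1)))
          ((aboveMap p (a.toFun l.1)).toFun k.1)))
    (fun m => X.π V (aboveMap c (p.toFun m.1)))
    (fun l k => (X.HRes_same_π V c (p.toFun (a.toFun l.1))
      ((aboveMap p (a.toFun l.1)).toFun k.1)).symm)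

lemma coassoc_aux {N W L Z₁ Z₂ Z₃ Z' Q₁ Q₂ Q₃ K : C} (π : N ⟶ W ⊗ L) {d₁ : W ⟶ Z₁} {m : Z₁ ⟶ Z₂}
    {g : Z₂ ⟶ Z₃} {d₂ : W ⟶ Z'} {d₃ : Z' ⟶ Z₃} (h : d₂ ≫ d₃ = d₁ ≫ m ≫ g)
    {i₁ : Z₁ ⊗ L ⟶ Q₁} {i₂ : Q₂ ≅ Z₂ ⊗ L} {j : Q₂ ⟶ Q₃} {j' : Q₃ ⟶ Q₂} (hj : j ≫ j' = 𝟙 _)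
    (t : Q₁ ⟶ Q₂) (h₁ : m ▷ L ≫ i₂.inv = i₁ ≫ t)
    {r : Q₃ ⟶ K} {i₃ : K ≅ Z₃ ⊗ L} (h₂ : r ≫ i₃.hom = j' ≫ i₂.hom ≫ g ▷ L) :
    (π ≫ d₁ ▷ L ≫ i₁) ≫ t ≫ j ≫ r = π ≫ (d₂ ≫ d₃) ▷ L ≫ i₃.inv := by
  have h3 : r = j' ≫ i₂.hom ≫ g ▷ L ≫ i₃.inv := by
    rw [← Category.assoc, ← Category.assoc, Iso.eq_comp_inv, h₂, Category.assoc]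
  rw [h3, reassoc_of% hj, Category.assoc, Category.assoc, ← reassoc_of% h₁, Iso.inv_hom_id_assoc, h]
  simp only [comp_whiskerRight, Category.assoc]

lemma whiskerLeft_tensMap_comp {ι : Type*} (Z : C) {F G K : ι → C} (f : ∀ i, F i ⟶ G i)
    (g : ∀ i, G i ⟶ K i) (l : List ι) :
    Z ◁ tensMap (fun i => f i ≫ g i) l = Z ◁ tensMap f l ≫ Z ◁ tensMap g l := by
  rw [tensMap_comp, whiskerLeft_comp]

lemma whiskerLeft_tensMap_iso {ι : Type*} (Z : C) {F G : ι → C} (e : ∀ i, F i ≅ G i)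
    (l : List ι) : Z ◁ tensMap (fun i => (e i).inv) l ≫ Z ◁ tensMap (fun i => (e i).hom) l = 𝟙 _ := by
  rw [← whiskerLeft_tensMap_comp]
  simp only [Iso.inv_hom_id, tensMap_id, whiskerLeft_id]

variable [Preadditive C] [MonoidalPreadditive C]

/-- The factors of `X` are handled by `decomp_assoc` for `S ⟶ R ⟶ P`; those of `V` are carried along
by `regroupAboveLeaves_regroup`. -/
lemma comultComponent_comultProj {S R P T : OTree} (a : S ⟶ R) (p : R ⟶ P) (c : P ⟶ T) :
    X.comultComponent V ((a ≫ p) ≫ c) ≫ X.ob S ◁ tensMap (fun l : S.Leaf =>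
        X.comultProj V (aboveMap p (a.toFun l.1)) (aboveMap c (p.toFun (a.toFun l.1)))) S.leaves ≫
      regroupAboveLeaves V X.presheaf a p c (X.ob S)
        (fun l : S.Leaf => X.ob (R.above (a.toFun l.1))) =
    X.comultProj V p c ≫ X.decomp a ▷ _ := by
  have h := X.decomp_assoc a p
  have h0 := X.comultComponent_π V (a ≫ p) c
  have h1 := regroupIso_inv_whiskerLeft V (a ≫ p) c (X.ob S)
    (fun l : S.Leaf => X.decomp (aboveMap p (a.toFun l.1)))
  have h2 := regroupAboveLeaves_regroup V X.presheaf a p c (X.ob S)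
    (fun l : S.Leaf => X.ob (R.above (a.toFun l.1)))
  have h3 := whiskerLeft_tensMap_iso (X.ob S) (fun l : S.Leaf => regroupIso V
    (aboveMap p (a.toFun l.1)) (aboveMap c (p.toFun (a.toFun l.1)))
    (X.ob (R.above (a.toFun l.1))) (fun k : (R.above (a.toFun l.1)).Leaf => X.ob
      ((P.above (p.toFun (a.toFun l.1))).above ((aboveMap p (a.toFun l.1)).toFun k.1)))) S.leaves
  have h4 := coassoc_aux (X.π V c) h h3 _ h1 (i₂ := regroupIso V (a ≫ p) c (X.ob S) _)
    (i₃ := regroupIso V p c (X.ob S ⊗ tens (fun l : S.Leaf => X.ob (R.above (a.toFun l.1))) S.leaves)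
      (fun k : R.Leaf => X.ob (P.above (p.toFun k.1)))) h2
  have h5 := regroupIso_inv_whiskerRight V p c (X.decomp a)
    (fun k : R.Leaf => X.ob (P.above (p.toFun k.1)))
  have h6 : X.comultProj V p c ≫ X.decomp a ▷ _ = X.π V c ≫ (X.decomp p ≫ X.decomp a ▷ _) ▷ _ ≫
      (regroupIso V p c (X.ob S ⊗ tens (fun l : S.Leaf => X.ob (R.above (a.toFun l.1))) S.leaves)
      (fun k : R.Leaf => X.ob (P.above (p.toFun k.1)))).inv := by
    rw [comp_whiskerRight, Category.assoc, h5, comultProj, Category.assoc, Category.assoc]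
  refine Eq.trans ?_ (h4.trans h6.symm)
  refine Eq.trans ?_ (congrArg (fun z => z ≫ _ ≫ _ ≫ _) h0)
  refine Eq.trans ?_ (comp_assoc_right₃ _ _ _ _ _)
  refine congrArg (fun z => X.comultComponent V ((a ≫ p) ≫ c) ≫ z ≫ _) ?_
  refine (whiskerLeft_tensMap_comp _ _ _ _).trans ?_
  exact congrArg (fun z => _ ≫ z) (whiskerLeft_tensMap_comp _ _ _ _)

/-- This is the associativity axiom of a prealgebra for `H_X(V)`, with the components of `δ` as
structure maps. Tested on the factorisations of `b`, it becomes `comultComponent_comultProj`. -/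
lemma comultComponent_assoc {S R T : OTree} (a : S ⟶ R) (b : R ⟶ T) :
    X.comultComponent V (a ≫ b) ≫ X.ob S ◁ tensMap (fun l : S.Leaf =>
        X.comultComponent V (aboveMap b (a.toFun l.1))) S.leaves ≫
      regroupLeaves (X.H.obj V) a b (X.ob S) (fun l : S.Leaf => X.ob (R.above (a.toFun l.1))) =
    X.comultComponent V b ≫ X.decomp a ▷ _ := by
  refine X.hom_ext_of_factoring V b ?_
  rintro ⟨P, p, c, rfl⟩ -
  have h1 := X.comultComponent_comultProj V a p c
  have h2 := X.regroupLeaves_π V a p c (X.ob S) (fun l : S.Leaf => X.ob (R.above (a.toFun l.1)))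
  have h3 : ∀ l : S.Leaf, _ := fun l => X.comultComponent_π V (aboveMap p (a.toFun l.1))
    (aboveMap c (p.toFun (a.toFun l.1)))
  have h4 := X.comultComponent_π V p c
  have h5 : (X.comultComponent V (p ≫ c) ≫ X.decomp a ▷ _) ≫ _ ◁ tensMap (fun m : R.Leaf =>
      X.π V (aboveMap c (p.toFun m.1))) R.leaves = X.comultProj V p c ≫ X.decomp a ▷ _ := by
    rw [← h4, Category.assoc, Category.assoc]
    exact congrArg (fun z => X.comultComponent V (p ≫ c) ≫ z) (whisker_exchange _ _).symm
  refine Eq.trans ?_ (h1.trans h5.symm)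
  refine (comp_assoc_right _ _ _ _).trans ?_
  refine (congrArg (fun z => X.comultComponent V (a ≫ p ≫ c) ≫ X.ob S ◁ tensMap (fun l : S.Leaf =>
        X.comultComponent V (aboveMap (p ≫ c) (a.toFun l.1))) S.leaves ≫ z) h2.symm).trans ?_
  refine congrArg (fun z => X.comultComponent V (a ≫ p ≫ c) ≫ z) ?_
  refine (Category.assoc _ _ _).symm.trans (congrArg (fun z => z ≫ _) ?_)
  refine (whiskerLeft_tensMap_comp _ _ _ _).symm.trans ?_
  exact congrArg (fun z => X.ob S ◁ tensMap z S.leaves) (funext h3)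

/-- Both sides are tested first on the components `α` and then on the factorisations of `α`, where
the claim is `comultComponent_assoc`. -/
lemma comult_map_comult : X.comult.app V ≫ X.H.map (X.comult.app V) =
    X.comult.app V ≫ X.comult.app (X.H.obj V) := by
  ext T : 2
  have h : X.comultApp V T.unop ≫ X.HTensMap (X.comult.app V) T.unop =
      X.comultApp V T.unop ≫ X.comultApp (X.H.obj V) T.unop := by
    refine X.HObj_ext _ fun {S} α => ?_
    have h1 : (X.comultApp V T.unop ≫ X.HTensMap (X.comult.app V) T.unop) ≫
        X.π (X.H.obj (X.H.obj V)) α = X.comultComponent V α ≫ X.ob S ◁ tensMap (fun l : S.Leaf =>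
          X.comultApp V (T.unop.above (α.toFun l.1))) S.leaves := by
      refine (Category.assoc _ _ _).trans ((congrArg (fun z => X.comultApp V T.unop ≫ z)
        (X.HTensMap_π (X.comult.app V) α)).trans ((Category.assoc _ _ _).symm.trans ?_))
      exact congrArg (fun z => z ≫ _) (X.comultApp_π V α)
    have h2 : (X.comultApp V T.unop ≫ X.comultApp (X.H.obj V) T.unop) ≫
        X.π (X.H.obj (X.H.obj V)) α = X.comultApp V T.unop ≫ X.comultComponent (X.H.obj V) α := by
      exact (Category.assoc _ _ _).trans (congrArg (fun z => _ ≫ z) (X.comultApp_π (X.H.obj V) α))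
    refine h1.trans (Eq.trans ?_ h2.symm)
    refine X.hom_ext_of_factoring (X.H.obj V) α ?_
    rintro ⟨R, a, b, rfl⟩ -
    have h3 := X.comultComponent_assoc V a b
    have h4 : (X.comultApp V T.unop ≫ X.comultComponent (X.H.obj V) (a ≫ b)) ≫
        X.ob S ◁ tensMap (fun l : S.Leaf => X.π (X.H.obj V) (aboveMap b (a.toFun l.1))) S.leaves =
        X.comultComponent V b ≫ X.decomp a ▷ _ ≫ (regroupIso (X.H.obj V) a b (X.ob S)
          (fun l : S.Leaf => X.ob (R.above (a.toFun l.1)))).inv := by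
      refine (Category.assoc _ _ _).trans ((congrArg (fun z => X.comultApp V T.unop ≫ z)
        (X.comultComponent_π (X.H.obj V) a b)).trans ?_)
      exact (Category.assoc _ _ _).symm.trans (congrArg (fun z => z ≫ _) (X.comultApp_π V b))
    refine Eq.trans ?_ ((comp_inv_of_eq (regroupIso (X.H.obj V) a b (X.ob S)
          (fun l : S.Leaf => X.ob (R.above (a.toFun l.1)))) h3).trans h4.symm)
    refine (Category.assoc _ _ _).trans (congrArg (fun z => X.comultComponent V (a ≫ b) ≫ z) ?_)
    refine (whiskerLeft_tensMap_comp _ _ _ _).symm.trans ?_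
    exact congrArg (fun z => X.ob S ◁ tensMap z S.leaves)
      (funext fun l => X.comultApp_π V (aboveMap b (a.toFun l.1)))
  exact h

end Preoperad

end

/-! ### Cofree coalgebras as equalisers, for a comonad given by its equations -/

section CofreeEqualizer

variable {D : Type u} [Category.{v} D] {G G' : D ⥤ D} {δ : ∀ V, G.obj V ⟶ G.obj (G.obj V)}
  {ε : ∀ V, G.obj V ⟶ V} {φ : G ⟶ G'} {M : D} {θ : M ⟶ G'.obj M} {E : D} {i : E ⟶ G.obj M}
  {e : E ⟶ G.obj E}

/-- If `G` preserves the equaliser `i`, this lets `i ≫ δ M` factor through `G.map i`, and the factor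
`e` is the coaction on `E`. -/
lemma cofree_condition (hδ : ∀ {V W : D} (f : V ⟶ W), G.map f ≫ δ W = δ V ≫ G.map (G.map f))
    (hδδ : ∀ V, δ V ≫ G.map (δ V) = δ V ≫ δ (G.obj V))
    (w : i ≫ G.map θ = i ≫ δ M ≫ G.map (φ.app M)) :
    (i ≫ δ M) ≫ G.map (G.map θ) = (i ≫ δ M) ≫ G.map (δ M ≫ G.map (φ.app M)) := by
  rw [Category.assoc, ← hδ, reassoc_of% w, hδ, G.map_comp, Category.assoc, reassoc_of% hδδ M]

lemma cofree_counit (hε : ∀ {V W : D} (f : V ⟶ W), G.map f ≫ ε W = ε V ≫ f)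
    (hδε : ∀ V, δ V ≫ ε (G.obj V) = 𝟙 _) [Mono i] (he : e ≫ G.map i = i ≫ δ M) :
    e ≫ ε E = 𝟙 _ := by
  rw [← cancel_mono i, Category.assoc, ← hε, reassoc_of% he, hδε, Category.id_comp, Category.comp_id]

/-- After composition with `G.map (G.map i)` the identity reduces to the coassociativity of `δ`;
this is why that map has to be mono. -/
lemma cofree_coassoc (hδ : ∀ {V W : D} (f : V ⟶ W), G.map f ≫ δ W = δ V ≫ G.map (G.map f))
    (hδδ : ∀ V, δ V ≫ G.map (δ V) = δ V ≫ δ (G.obj V)) (hi : Mono (G.map (G.map i)))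
    (he : e ≫ G.map i = i ≫ δ M) : e ≫ δ E = e ≫ G.map e := by
  rw [← cancel_mono (G.map (G.map i)), Category.assoc, Category.assoc, ← hδ, reassoc_of% he,
    ← G.map_comp, he, G.map_comp, reassoc_of% he, hδδ]

lemma cofree_eq (hδε : ∀ V, δ V ≫ G.map (ε V) = 𝟙 _) (he : e ≫ G.map i = i ≫ δ M) :
    e ≫ G.map (i ≫ ε M) = i := by
  rw [G.map_comp, reassoc_of% he, hδε, Category.comp_id]

/-- Applying `ε` to the equaliser condition shows that `i ≫ ε M` respects the coactions of `G'`; it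
becomes the counit of the adjunction. -/
lemma cofree_counit_comp (hε : ∀ {V W : D} (f : V ⟶ W), G.map f ≫ ε W = ε V ≫ f)
    (hδε : ∀ V, δ V ≫ ε (G.obj V) = 𝟙 _) (hδε' : ∀ V, δ V ≫ G.map (ε V) = 𝟙 _)
    (w : i ≫ G.map θ = i ≫ δ M ≫ G.map (φ.app M)) (he : e ≫ G.map i = i ≫ δ M) :
    (i ≫ ε M) ≫ θ = (e ≫ φ.app E) ≫ G'.map (i ≫ ε M) := by
  rw [Category.assoc, Category.assoc, ← φ.naturality, reassoc_of% cofree_eq hδε' he, ← hε,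
    reassoc_of% w, hε, reassoc_of% hδε M]

variable {N : D} {η : N ⟶ G.obj N} {g : N ⟶ M}

/-- The cofree extension `η ≫ G.map g` of a map `g` lands in the equaliser because `g` is compatible
with the coactions of `G'`. -/
lemma cofree_lift_condition
    (hδ : ∀ {V W : D} (f : V ⟶ W), G.map f ≫ δ W = δ V ≫ G.map (G.map f))
    (hη : η ≫ δ N = η ≫ G.map η) (hg : g ≫ θ = (η ≫ φ.app N) ≫ G'.map g) :
    (η ≫ G.map g) ≫ G.map θ = (η ≫ G.map g) ≫ δ M ≫ G.map (φ.app M) := by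
  rw [Category.assoc, ← G.map_comp, hg, Category.assoc, Category.assoc, reassoc_of% hδ g,
    reassoc_of% hη, G.map_comp, ← φ.naturality, G.map_comp]

lemma cofree_lift_comp (hδ : ∀ {V W : D} (f : V ⟶ W), G.map f ≫ δ W = δ V ≫ G.map (G.map f))
    (hi : Mono (G.map i)) (he : e ≫ G.map i = i ≫ δ M) (hη : η ≫ δ N = η ≫ G.map η) {h : N ⟶ E}
    (hh : h ≫ i = η ≫ G.map g) : h ≫ e = η ≫ G.map h := by
  rw [← cancel_mono (G.map i), Category.assoc, he, reassoc_of% hh, hδ, Category.assoc,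
    ← G.map_comp, hh, G.map_comp, reassoc_of% hη]

lemma cofree_lift_counit (hε : ∀ {V W : D} (f : V ⟶ W), G.map f ≫ ε W = ε V ≫ f)
    (hη : η ≫ ε N = 𝟙 _) {h : N ⟶ E} (hh : h ≫ i = η ≫ G.map g) : h ≫ i ≫ ε M = g := by
  rw [reassoc_of% hh, hε, reassoc_of% hη]

/-- A map of coalgebras into `E` is recovered from its composite with the counit `i ≫ ε M`. -/
lemma cofree_lift_unique (hδε : ∀ V, δ V ≫ G.map (ε V) = 𝟙 _) (he : e ≫ G.map i = i ≫ δ M)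
    {h : N ⟶ E} (hh : h ≫ e = η ≫ G.map h) : h ≫ i = η ≫ G.map (h ≫ i ≫ ε M) := by
  rw [G.map_comp, ← reassoc_of% hh, cofree_eq hδε he]

end CofreeEqualizer

/-! ### Prealgebras as coalgebras of `H_X` -/

section

open OTree

variable {C : Type w} [Category.{v} C] [MonoidalCategory C] [SymmetricCategory C]

namespace Preoperad

variable [HasLimitsOfSize.{0, 0} C]
variable {X Y : Preoperad C}

lemma structureMap_π (M : Prealg X) {S T : OTree} (α : S ⟶ T) :
    (structureMap M).app (op T) ≫ X.π M.presheaf α = M.τ α :=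
  X.lift_π M.presheaf (fun {_} α => M.τ α) (fun γ hγ α => M.naturality_source γ hγ α) α

lemma structureMap_counit (M : Prealg X) : structureMap M ≫ X.counit.app M.presheaf = 𝟙 _ := by
  ext T : 2
  exact (Category.assoc _ _ _).symm.trans ((congrArg (fun z => z ≫ _)
    (structureMap_π M (rootInc T.unop))).trans (M.unit T.unop))

lemma structureMap_pushforward (f : X ⟶ Y) (M : Prealg X) :
    structureMap ((pushforward f).obj M) = structureMap M ≫ (Hmap f).app M.presheaf := by
  ext T : 2
  refine Y.HObj_ext _ fun {S} α => (structureMap_π ((pushforward f).obj M) α).trans ?_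
  refine Eq.symm ((Category.assoc _ _ _).trans ((congrArg (fun z => _ ≫ z)
    (HmapApp_π f M.presheaf α)).trans ((Category.assoc _ _ _).symm.trans ?_)))
  exact congrArg (fun z => z ≫ _) (structureMap_π M α)

lemma counit_aux {P A B L K U : C} (π : P ⟶ A ⊗ L) {f : A ⟶ B} {u : B ⟶ U} {u' : A ⟶ U}
    (h : f ≫ u = u') (s : L ⟶ K) : (π ≫ f ▷ L) ≫ (u ⊗ₘ s) = π ≫ (u' ⊗ₘ s) := by
  rw [← h, MonoidalCategory.tensorHom_def, MonoidalCategory.tensorHom_def, comp_whiskerRight,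
    Category.assoc, Category.assoc]

lemma Hmap_counit (f : X ⟶ Y) (V : PshR C) :
    (Hmap f).app V ≫ Y.counit.app V = X.counit.app V := by
  ext T : 2
  have h : HmapApp f V T.unop ≫ Y.counitApp V (rootInc T.unop) =
      X.counitApp V (rootInc T.unop) := by
    rw [counitApp, ← Category.assoc, HmapApp_π, ← Category.assoc, counit_aux _ f.comp_unit,
      Category.assoc, counitApp]
  exact h

variable [Preadditive C] [MonoidalPreadditive C]

lemma structureMap_comultProj (M : Prealg X) {S R T : OTree} (a : S ⟶ R) (b : R ⟶ T) :
    (structureMap M).app (op T) ≫ X.comultProj M.presheaf a b = M.τ (a ≫ b) ≫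
      X.ob S ◁ tensMap (fun l : S.Leaf => M.τ (aboveMap b (a.toFun l.1))) S.leaves := by
  refine (Category.assoc _ _ _).symm.trans ((congrArg (fun z => z ≫ _)
    (structureMap_π M b)).trans ?_)
  exact (comp_inv_of_eq (regroupIso M.presheaf a b (X.ob S)
    fun l : S.Leaf => X.ob (R.above (a.toFun l.1))) (M.assoc a b).symm).symm

/-- On the factorisation `a ≫ b` of a morphism, this is the associativity axiom of `M` for `a` and
`b`, with the regrouping inverted. -/
lemma structureMap_comult (M : Prealg X) : structureMap M ≫ X.comult.app M.presheaf =
    structureMap M ≫ X.H.map (structureMap M) := by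
  ext T : 2
  refine X.HObj_ext _ fun {S} α => ?_
  have h1 : ((structureMap M).app T ≫ X.comultApp M.presheaf T.unop) ≫ X.π _ α =
      (structureMap M).app T ≫ X.comultComponent M.presheaf α :=
    (Category.assoc _ _ _).trans (congrArg (fun z => _ ≫ z) (X.comultApp_π M.presheaf α))
  have h2 : ((structureMap M).app T ≫ X.HTensMap (structureMap M) T.unop) ≫ X.π _ α =
      M.τ α ≫ X.ob S ◁ leafTensMap (structureMap M) α :=
    (Category.assoc _ _ _).trans ((congrArg (fun z => _ ≫ z) (X.HTensMap_π (structureMap M) α)).trans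
      ((Category.assoc _ _ _).symm.trans (congrArg (fun z => z ≫ _) (structureMap_π M α))))
  refine h1.trans (Eq.trans ?_ h2.symm)
  refine X.hom_ext_of_factoring M.presheaf α ?_
  rintro ⟨R, a, b, rfl⟩ -
  refine (Category.assoc _ _ _).trans ((congrArg (fun z => (structureMap M).app T ≫ z)
    (X.comultComponent_π M.presheaf a b)).trans ((structureMap_comultProj M a b).trans ?_))
  refine Eq.symm ((Category.assoc _ _ _).trans (congrArg (fun z => M.τ (a ≫ b) ≫ z) ?_))
  refine (whiskerLeft_tensMap_comp _ _ _ _).symm.trans ?_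
  exact congrArg (fun z => X.ob S ◁ tensMap z S.leaves)
    (funext fun l => structureMap_π M (aboveMap b (a.toFun l.1)))

lemma comultApp_π_assoc (V : PshR C) {S R T : OTree} (a : S ⟶ R) (b : R ⟶ T) :
    X.comultApp V T ≫ X.π (X.H.obj V) (a ≫ b) ≫
      X.ob S ◁ tensMap (fun l : S.Leaf => X.π V (aboveMap b (a.toFun l.1))) S.leaves =
        X.comultProj V a b :=
  X.isComult_comult.app_π X V a b

end Preoperad

open Preoperad

namespace Prealg

variable [HasLimitsOfSize.{0, 0} C]
variable {X Y : Preoperad C}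

lemma Hom.comp_structureMap {M N : Prealg X} (g : M ⟶ N) :
    g.toNatTrans ≫ structureMap N = structureMap M ≫ X.H.map g.toNatTrans := by
  ext T : 2
  refine X.HObj_ext _ fun {S} α => ?_
  refine (Category.assoc _ _ _).trans ((congrArg (fun z => _ ≫ z) (structureMap_π N α)).trans
    ((g.comp_τ α).trans (Eq.symm ?_)))
  refine (Category.assoc _ _ _).trans ((congrArg (fun z => _ ≫ z)
    (X.HTensMap_π g.toNatTrans α)).trans ?_)
  exact (Category.assoc _ _ _).symm.trans (congrArg (fun z => z ≫ _) (structureMap_π M α))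

/-- A map of presheaves which commutes with the maps into `H_X` is a morphism of prealgebras. -/
def homMk {M N : Prealg X} (g : M.presheaf ⟶ N.presheaf)
    (h : g ≫ structureMap N = structureMap M ≫ X.H.map g) : M ⟶ N where
  toNatTrans := g
  comp_τ {S T} α := by
    have h1 : g.app (op T) ≫ (structureMap N).app (op T) =
        (structureMap M).app (op T) ≫ X.HTensMap g T := congrArg (fun z => z.app (op T)) h
    refine (congrArg (fun z => g.app (op T) ≫ z) (structureMap_π N α).symm).trans
      ((Category.assoc _ _ _).symm.trans ((congrArg (fun z => z ≫ _) h1).trans ?_))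
    refine (Category.assoc _ _ _).trans ((congrArg (fun z => (structureMap M).app (op T) ≫ z)
      (X.HTensMap_π g α)).trans ((Category.assoc _ _ _).symm.trans ?_))
    exact congrArg (fun z => z ≫ _) (structureMap_π M α)

variable [Preadditive C] [MonoidalPreadditive C]

/-- The prealgebra over `X` given by a coalgebra over `H_X`. -/
def ofCoalgebra (M : PshR C) (e : M ⟶ X.H.obj M) (h₁ : e ≫ X.counit.app M = 𝟙 M)
    (h₂ : e ≫ X.comult.app M = e ≫ X.H.map e) : Prealg X where
  presheaf := M
  τ {S T} α := e.app (op T) ≫ X.π M α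
  naturality_target {S T T'} α β := by
    have h : M.map β.op ≫ e.app (op T) = e.app (op T') ≫ X.HRes M β := e.naturality β.op
    refine (Category.assoc _ _ _).trans ((congrArg (fun z => e.app (op T') ≫ z)
      (X.HRes_π M α β).symm).trans ?_)
    exact (Category.assoc _ _ _).symm.trans ((congrArg (fun z => z ≫ X.π M α) h.symm).trans
      (Category.assoc _ _ _))
  naturality_source {S S' T} γ hγ α := by
    exact (congrArg (fun z => e.app (op T) ≫ z) (X.π_inner M γ hγ α)).trans
      (Category.assoc _ _ _).symm
  unit T := by
    exact (Category.assoc _ _ _).trans (congrArg (fun z => z.app (op T)) h₁)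
  assoc {S R T} α β := by
    have h : e.app (op T) ≫ X.comultApp M T = e.app (op T) ≫ X.HTensMap e T :=
      congrArg (fun z => z.app (op T)) h₂
    refine (Category.assoc _ _ _).trans ((congrArg (fun z => e.app (op T) ≫ z)
      (X.comultProj_regroup M α β).symm).trans ?_)
    refine (Category.assoc _ _ _).symm.trans (Eq.trans ?_ (Category.assoc _ _ _))
    refine congrArg (fun z => z ≫ leafRegroup X M α β) ?_
    refine (congrArg (fun z => e.app (op T) ≫ z) (X.comultApp_π_assoc M α β).symm).trans ?_
    refine (Category.assoc _ _ _).symm.trans ((congrArg (fun z => z ≫ _) h).trans ?_)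
    refine (Category.assoc _ _ _).trans (Eq.trans ?_ (Category.assoc _ _ _).symm)
    refine congrArg (fun z => e.app (op T) ≫ z) ?_
    refine (Category.assoc _ _ _).symm.trans ((congrArg (fun z => z ≫ _)
      (X.HTensMap_π e (α ≫ β))).trans ((Category.assoc _ _ _).trans ?_))
    exact congrArg (fun z => X.π M (α ≫ β) ≫ z) (whiskerLeft_tensMap_comp _ _ _ _).symm

lemma structureMap_ofCoalgebra (M : PshR C) (e : M ⟶ X.H.obj M) (h₁ : e ≫ X.counit.app M = 𝟙 M)
    (h₂ : e ≫ X.comult.app M = e ≫ X.H.map e) : structureMap (ofCoalgebra M e h₁ h₂) = e := by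
  ext T : 2
  exact X.HObj_ext _ fun {S} α => structureMap_π (ofCoalgebra M e h₁ h₂) α

end Prealg

end

/-! ### The right adjoint of `f_!` -/

section

variable {C : Type w} [Category.{v} C] [MonoidalCategory C] [SymmetricCategory C]
  [HasLimitsOfSize.{0, 0} C] [Preadditive C] [MonoidalPreadditive C]

open Preoperad

namespace Cofree

variable {X Y : Preoperad C} (f : X ⟶ Y) (M : Prealg Y)

/-- The first of the two parallel maps `H_X(M) ⟶ H_X(H_Y(M))`. -/
def fst : X.H.obj M.presheaf ⟶ X.H.obj (Y.H.obj M.presheaf) := X.H.map (structureMap M)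

/-- The second of the two parallel maps `H_X(M) ⟶ H_X(H_Y(M))`. -/
def snd : X.H.obj M.presheaf ⟶ X.H.obj (Y.H.obj M.presheaf) :=
  X.comult.app M.presheaf ≫ X.H.map ((Hmap f).app M.presheaf)

lemma fst_counit : fst (X := X) M ≫ X.H.map (Y.counit.app M.presheaf) = 𝟙 _ := by
  rw [fst, ← X.H.map_comp, structureMap_counit, X.H.map_id]

lemma snd_counit : snd f M ≫ X.H.map (Y.counit.app M.presheaf) = 𝟙 _ := by
  rw [snd, Category.assoc, ← X.H.map_comp, Hmap_counit, comult_map_counit]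

instance : IsCoreflexivePair (fst (X := X) M) (snd f M) :=
  ⟨⟨_, fst_counit M, snd_counit f M⟩⟩

/-- Coassociativity of the coaction is checked after applying `H_X` twice to the inclusion, so `H_X`
must preserve the equaliser of the image pair as well. -/
instance : IsCoreflexivePair (X.H.map (fst (X := X) M)) (X.H.map (snd f M)) :=
  ⟨⟨X.H.map (X.H.map (Y.counit.app M.presheaf)), by rw [← X.H.map_comp, fst_counit, X.H.map_id],
    by rw [← X.H.map_comp, snd_counit, X.H.map_id]⟩⟩

/-- The presheaf of the cofree prealgebra. -/
def obj : PshR C := equalizer (fst (X := X) M) (snd f M)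

/-- The inclusion of the cofree prealgebra into `H_X(M)`. -/
def inc : obj f M ⟶ X.H.obj M.presheaf := equalizer.ι _ _

instance : Mono (inc f M) := inferInstanceAs (Mono (equalizer.ι _ _))

lemma inc_condition : inc f M ≫ fst M = inc f M ≫ snd f M := equalizer.condition _ _

/-- The inclusion of the cofree prealgebra is an equaliser. -/
def isLimit : IsLimit (Fork.ofι (inc f M) (inc_condition f M)) := equalizerIsEqualizer _ _

variable (hH : ∀ (A B : PshR C) (g h : A ⟶ B), IsCoreflexivePair g h →
  PreservesLimit (parallelPair g h) X.H)

/-- The image of the inclusion of the cofree prealgebra under `H_X` is an equaliser. -/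
def isLimitMap : IsLimit (Fork.ofι (X.H.map (inc f M)) (f := X.H.map (fst M)) (g := X.H.map (snd f M))
    (by rw [← X.H.map_comp, inc_condition, X.H.map_comp])) :=
  haveI := hH _ _ (fst (X := X) M) (snd f M) inferInstance
  isLimitForkMapOfIsLimit X.H _ (isLimit f M)

include hH in
lemma mono_map : Mono (X.H.map (inc f M)) := mono_of_isLimit_fork (isLimitMap f M hH)

include hH in
lemma mono_map_map : Mono (X.H.map (X.H.map (inc f M))) :=
  haveI := hH _ _ (X.H.map (fst (X := X) M)) (X.H.map (snd f M)) inferInstance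
  mono_of_isLimit_fork (isLimitForkMapOfIsLimit X.H _ (isLimitMap f M hH))

lemma comult_naturality {V W : PshR C} (g : V ⟶ W) :
    X.H.map g ≫ X.comult.app W = X.comult.app V ≫ X.H.map (X.H.map g) := X.comult.naturality g

lemma counit_naturality {V W : PshR C} (g : V ⟶ W) :
    X.H.map g ≫ X.counit.app W = X.counit.app V ≫ g := X.counit.naturality g

include hH in
lemma exists_coaction : ∃ e : obj f M ⟶ X.H.obj (obj f M),
    e ≫ X.H.map (inc f M) = inc f M ≫ X.comult.app M.presheaf :=
  ⟨Fork.IsLimit.lift (isLimitMap f M hH) (inc f M ≫ X.comult.app M.presheaf)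
    (cofree_condition comult_naturality (fun V => X.comult_map_comult V) (inc_condition f M)),
    Fork.IsLimit.lift_ι _⟩

/-- The coaction of `H_X` on the cofree prealgebra. -/
def coaction : obj f M ⟶ X.H.obj (obj f M) := (exists_coaction f M hH).choose

lemma coaction_map : coaction f M hH ≫ X.H.map (inc f M) = inc f M ≫ X.comult.app M.presheaf :=
  (exists_coaction f M hH).choose_spec

/-- The cofree prealgebra over `X` on a prealgebra over `Y`. -/
def prealg : Prealg X :=
  Prealg.ofCoalgebra (obj f M) (coaction f M hH)
    (cofree_counit counit_naturality (fun V => X.comult_counit_app V) (coaction_map f M hH))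
    (cofree_coassoc comult_naturality (fun V => X.comult_map_comult V) (mono_map_map f M hH)
      (coaction_map f M hH))

lemma structureMap_prealg : structureMap (prealg f M hH) = coaction f M hH :=
  Prealg.structureMap_ofCoalgebra _ _ _ _

/-- The presheaf map from the cofree prealgebra to `M`. -/
def proj : obj f M ⟶ M.presheaf := inc f M ≫ X.counit.app M.presheaf

/-- This identifies the map `i` of the theorem with the inclusion of the equaliser. It follows from
the counit law for the inner `H_X`. -/
lemma structureMap_proj : structureMap (prealg f M hH) ≫ X.H.map (proj f M) = inc f M :=
  (congrArg (fun z => z ≫ X.H.map (proj f M)) (structureMap_prealg f M hH)).trans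
    (cofree_eq (fun V => X.comult_map_counit V) (coaction_map f M hH))

/-- The counit of the cofree prealgebra. -/
def counit : (pushforward f).obj (prealg f M hH) ⟶ M :=
  Prealg.homMk (proj f M)
    ((cofree_counit_comp (φ := Hmap f) counit_naturality (fun V => X.comult_counit_app V) (fun V => X.comult_map_counit V)
      (inc_condition f M) (coaction_map f M hH)).trans
      (congrArg (fun z => z ≫ Y.H.map (proj f M))
        ((congrArg (fun z => z ≫ _) (structureMap_prealg f M hH).symm).trans
          (structureMap_pushforward f (prealg f M hH)).symm)))

lemma exists_lift {N : Prealg X} (g : (pushforward f).obj N ⟶ M) :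
    ∃ h : N.presheaf ⟶ obj f M, h ≫ inc f M = structureMap N ≫ X.H.map g.toNatTrans :=
  ⟨Fork.IsLimit.lift (isLimit f M) (structureMap N ≫ X.H.map g.toNatTrans)
    (cofree_lift_condition (φ := Hmap f) comult_naturality (structureMap_comult N)
      ((Prealg.Hom.comp_structureMap g).trans
        (congrArg (fun z => z ≫ _) (structureMap_pushforward f N)))),
    Fork.IsLimit.lift_ι _⟩

/-- The morphism to the cofree prealgebra which corresponds to a morphism to `M`. -/
def lift {N : Prealg X} (g : (pushforward f).obj N ⟶ M) : N ⟶ prealg f M hH :=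
  Prealg.homMk (exists_lift f M g).choose
    ((congrArg (fun z => _ ≫ z) (structureMap_prealg f M hH)).trans
      (cofree_lift_comp comult_naturality (mono_map f M hH) (coaction_map f M hH)
        (structureMap_comult N) (exists_lift f M g).choose_spec))

lemma lift_inc {N : Prealg X} (g : (pushforward f).obj N ⟶ M) :
    (lift f M hH g).toNatTrans ≫ inc f M = structureMap N ≫ X.H.map g.toNatTrans :=
  (exists_lift f M g).choose_spec

/-- The universal property of the cofree prealgebra. -/
def homEquiv (N : Prealg X) : ((pushforward f).obj N ⟶ M) ≃ (N ⟶ prealg f M hH) where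
  toFun g := lift f M hH g
  invFun h := (pushforward f).map h ≫ counit f M hH
  left_inv g := Prealg.Hom.ext
    (cofree_lift_counit counit_naturality (structureMap_counit N) (lift_inc f M hH g))
  right_inv h := by
    refine Prealg.Hom.ext ((cancel_mono (inc f M)).1 ((lift_inc f M hH _).trans ?_))
    exact (cofree_lift_unique (fun V => X.comult_map_counit V) (coaction_map f M hH)
      ((congrArg (fun z => h.toNatTrans ≫ z) (structureMap_prealg f M hH).symm).trans
        (Prealg.Hom.comp_structureMap h))).symm

lemma homEquiv_naturality {N N' : Prealg X} (a : N' ⟶ N) (g : (pushforward f).obj N ⟶ M) :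
    homEquiv f M hH N' ((pushforward f).map a ≫ g) = a ≫ homEquiv f M hH N g := by
  refine Prealg.Hom.ext ((cancel_mono (inc f M)).1 ((lift_inc f M hH _).trans ?_))
  have h1 : (a.toNatTrans ≫ (lift f M hH g).toNatTrans) ≫ inc f M =
      structureMap N' ≫ X.H.map a.toNatTrans ≫ X.H.map g.toNatTrans := by
    refine (Category.assoc _ _ _).trans ((congrArg (fun z => a.toNatTrans ≫ z)
      (lift_inc f M hH g)).trans ?_)
    exact (Category.assoc _ _ _).symm.trans ((congrArg (fun z => z ≫ X.H.map g.toNatTrans)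
      (Prealg.Hom.comp_structureMap a)).trans (Category.assoc _ _ _))
  exact Eq.trans (congrArg (fun z => structureMap N' ≫ z) (X.H.map_comp _ _)) h1.symm

end Cofree

/-- The right adjoint of `f_!`, for a preoperad `X` such that `H_X` preserves coreflexive
equalisers. -/
def pullback {X Y : Preoperad C} (f : X ⟶ Y) (hH : ∀ (A B : PshR C) (g h : A ⟶ B),
    IsCoreflexivePair g h → PreservesLimit (parallelPair g h) X.H) : Prealg Y ⥤ Prealg X :=
  Adjunction.rightAdjointOfEquiv (fun N M => Cofree.homEquiv f M hH N)
    fun _ _ M a g => Cofree.homEquiv_naturality f M hH a g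

/-- The adjunction of `f_!` and its right adjoint. -/
def pushforwardAdjunction {X Y : Preoperad C} (f : X ⟶ Y) (hH : ∀ (A B : PshR C) (g h : A ⟶ B),
    IsCoreflexivePair g h → PreservesLimit (parallelPair g h) X.H) :
    pushforward f ⊣ pullback f hH :=
  Adjunction.adjunctionOfEquivRight (fun N M => Cofree.homEquiv f M hH N)
    fun _ _ M a g => Cofree.homEquiv_naturality f M hH a g

lemma pushforwardAdjunction_counit {X Y : Preoperad C} (f : X ⟶ Y)
    (hH : ∀ (A B : PshR C) (g h : A ⟶ B), IsCoreflexivePair g h →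
      PreservesLimit (parallelPair g h) X.H) (M : Prealg Y) :
    ((pushforwardAdjunction f hH).counit.app M).toNatTrans = Cofree.proj f M := by
  have h : (pushforwardAdjunction f hH).counit.app M = Cofree.counit f M hH :=
    (Adjunction.adjunctionOfEquivRight_counit_app _ _ _).trans
      (((congrArg (fun z => z ≫ Cofree.counit f M hH) ((pushforward f).map_id _)).trans
        (Category.id_comp _)))
  rw [h]
  rfl

/-- The adjunction of `f_!` and `f^*`, and the description of `f^*` as an equaliser, for a
preoperad `X` such that `H_X` preserves coreflexive equalisers. -/
theorem exists_pushforward_adjunction {X Y : Preoperad C} (f : X ⟶ Y)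
    (hH : ∀ (A B : PshR C) (g h : A ⟶ B), IsCoreflexivePair g h →
      PreservesLimit (parallelPair g h) X.H) :
    ∃ (fstar : Prealg Y ⥤ Prealg X) (adj : pushforward f ⊣ fstar), ∀ M : Prealg Y,
        let p : X.H.obj M.presheaf ⟶ X.H.obj (Y.H.obj M.presheaf) := X.H.map (structureMap M)
        let q : X.H.obj M.presheaf ⟶ X.H.obj (Y.H.obj M.presheaf) :=
          X.comult.app M.presheaf ≫ X.H.map ((Hmap f).app M.presheaf)
        let r : X.H.obj (Y.H.obj M.presheaf) ⟶ X.H.obj M.presheaf :=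
          X.H.map (Y.counit.app M.presheaf)
        let i : (fstar.obj M).presheaf ⟶ X.H.obj M.presheaf :=
          structureMap (fstar.obj M) ≫ X.H.map (adj.counit.app M).toNatTrans
        p ≫ r = 𝟙 _ ∧ q ≫ r = 𝟙 _ ∧
          ∃ w : i ≫ p = i ≫ q, Nonempty (IsLimit (Fork.ofι i w)) := by
  refine ⟨pullback f hH, pushforwardAdjunction f hH, fun M => ?_⟩
  intro p q r i
  refine ⟨Cofree.fst_counit M, Cofree.snd_counit f M, ?_⟩
  have hi : i = Cofree.inc f M :=
    (congrArg (fun z => structureMap (Cofree.prealg f M hH) ≫ X.H.map z)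
      (pushforwardAdjunction_counit f hH M)).trans (Cofree.structureMap_proj f M hH)
  clear_value i
  subst hi
  exact ⟨Cofree.inc_condition f M, ⟨Cofree.isLimit f M⟩⟩

end

/-! ### Equalisers as a property of maps -/

section IsEqualizer

variable {C : Type w} [Category.{v} C]

/-- The map `e` is an equaliser of `p` and `q`. -/
structure IsEqualizer {E A B : C} (e : E ⟶ A) (p q : A ⟶ B) : Prop where
  condition : e ≫ p = e ≫ q
  mono : Mono e
  exists_lift {P : C} (x : P ⟶ A) (h : x ≫ p = x ≫ q) : ∃ y, y ≫ e = x

namespace IsEqualizer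

variable {E A B E' A' B' : C} {e : E ⟶ A} {p q : A ⟶ B}

lemma of_isLimit {w : e ≫ p = e ≫ q} (h : IsLimit (Fork.ofι e w)) : IsEqualizer e p q where
  condition := w
  mono := mono_of_isLimit_fork h
  exists_lift x hx := ⟨Fork.IsLimit.lift h x hx, Fork.IsLimit.lift_ι h⟩

/-- An equaliser as a limit. -/
def isLimit (h : IsEqualizer e p q) : IsLimit (Fork.ofι e h.condition) :=
  haveI := h.mono
  Fork.IsLimit.mk _ (fun s => (h.exists_lift s.ι s.condition).choose)
    (fun s => (h.exists_lift s.ι s.condition).choose_spec)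
    fun s _ hm => (cancel_mono e).1 (hm.trans (h.exists_lift s.ι s.condition).choose_spec.symm)

lemma map {D : Type*} [Category* D] (h : IsEqualizer e p q) (F : C ⥤ D)
    [PreservesLimit (parallelPair p q) F] : IsEqualizer (F.map e) (F.map p) (F.map q) :=
  of_isLimit (isLimitForkMapOfIsLimit F _ h.isLimit)

lemma of_iso (h : IsEqualizer e p q) (i : E' ≅ E) (j : A' ≅ A) (k : B' ≅ B) {e' : E' ⟶ A'}
    {p' q' : A' ⟶ B'} (he : e' ≫ j.hom = i.hom ≫ e) (hp : p' ≫ k.hom = j.hom ≫ p)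
    (hq : q' ≫ k.hom = j.hom ≫ q) : IsEqualizer e' p' q' := by
  have := h.mono
  refine ⟨?_, ?_, fun x hx => ?_⟩
  · rw [← cancel_mono k.hom, Category.assoc, Category.assoc, hp, hq, reassoc_of% he,
      reassoc_of% he, h.condition]
  · have h1 : Mono (i.hom ≫ e) := mono_comp _ _
    rw [← he] at h1
    exact mono_of_mono e' j.hom
  · obtain ⟨y, hy⟩ := h.exists_lift (x ≫ j.hom) (by
      rw [Category.assoc, Category.assoc, ← hp, ← hq, reassoc_of% hx])
    exact ⟨y ≫ i.inv, by
      rw [← cancel_mono j.hom, Category.assoc, Category.assoc, he, Iso.inv_hom_id_assoc, hy]⟩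

lemma preservesLimit {D : Type*} [Category* D] {F : C ⥤ D} (h : IsEqualizer e p q)
    (h' : IsEqualizer (F.map e) (F.map p) (F.map q)) : PreservesLimit (parallelPair p q) F :=
  preservesLimit_of_preserves_limit_cone h.isLimit
    ((isLimitMapConeForkEquiv F h.condition).symm h'.isLimit)

end IsEqualizer

end IsEqualizer

/-! ### Tensor products of coreflexive equalisers -/

section Tensor

variable {C : Type w} [Category.{v} C] [MonoidalCategory C]

/-- Tensor products preserve equalisers. -/
class TensorExact (C : Type w) [Category.{v} C] [MonoidalCategory C] : Prop where
  whiskerLeft (Z : C) {E A B : C} {e : E ⟶ A} {p q : A ⟶ B} (h : IsEqualizer e p q) :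
    IsEqualizer (Z ◁ e) (Z ◁ p) (Z ◁ q)

namespace IsEqualizer

variable [TensorExact C] {E A B E' A' B' : C} {e : E ⟶ A} {p q : A ⟶ B} {e' : E' ⟶ A'}
  {p' q' : A' ⟶ B'}

lemma whiskerLeft (h : IsEqualizer e p q) (Z : C) : IsEqualizer (Z ◁ e) (Z ◁ p) (Z ◁ q) :=
  TensorExact.whiskerLeft Z h

variable [SymmetricCategory C]

lemma whiskerRight (h : IsEqualizer e p q) (Z : C) : IsEqualizer (e ▷ Z) (p ▷ Z) (q ▷ Z) :=
  (h.whiskerLeft Z).of_iso (β_ _ _) (β_ _ _) (β_ _ _) (by simp) (by simp) (by simp)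

/-- The tensor product of coreflexive equalisers is an equaliser. -/
lemma tensor (h : IsEqualizer e p q) (h' : IsEqualizer e' p' q') {r : B ⟶ A} {r' : B' ⟶ A'}
    (hp : p ≫ r = 𝟙 A) (hq : q ≫ r = 𝟙 A) (hp' : p' ≫ r' = 𝟙 A') (hq' : q' ≫ r' = 𝟙 A') :
    IsEqualizer (e ⊗ₘ e') (p ⊗ₘ p') (q ⊗ₘ q') := by
  have m := (h.whiskerRight E').mono
  have m1 := (h.whiskerRight B').mono
  have m' := (h'.whiskerLeft A).mono
  refine ⟨?_, ?_, fun x hx => ?_⟩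
  · rw [tensorHom_comp_tensorHom, tensorHom_comp_tensorHom, h.condition, h'.condition]
  · rw [MonoidalCategory.tensorHom_def]
    exact mono_comp _ _
  -- The retraction `r'` removes `p'` and `q'` from the equation satisfied by `x`, and `r` removes
  -- `p` and `q` below. This is where coreflexivity enters; for general pairs the two conditions
  -- cannot be separated.
  · have h1 : x ≫ p ▷ A' = x ≫ q ▷ A' := by
      have := congrArg (fun z => z ≫ B ◁ r') hx
      simpa only [Category.assoc, MonoidalCategory.tensorHom_def, ← whiskerLeft_comp, hp', hq',
        whiskerLeft_id, Category.comp_id] using this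
    have h2 : x ≫ A ◁ p' = x ≫ A ◁ q' := by
      have := congrArg (fun z => z ≫ r ▷ B') hx
      simpa only [Category.assoc, MonoidalCategory.tensorHom_def', ← comp_whiskerRight, hp, hq,
        id_whiskerRight, Category.comp_id] using this
    obtain ⟨y, rfl⟩ := (h.whiskerRight A').exists_lift x h1
    -- Having factored through `e` in the first variable, `x` still equalises the second pair, as `e
    -- ▷ B'` is mono.
    have h3 : y ≫ E ◁ p' = y ≫ E ◁ q' := by
      rw [← cancel_mono (e ▷ B'), Category.assoc, Category.assoc, whisker_exchange,
        whisker_exchange, ← Category.assoc, h2, Category.assoc]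
    obtain ⟨z, rfl⟩ := (h'.whiskerLeft E).exists_lift y h3
    exact ⟨z, by rw [Category.assoc, MonoidalCategory.tensorHom_def']⟩

lemma tensMap {ι : Type*} {E A B : ι → C} {e : ∀ i, E i ⟶ A i} {p q : ∀ i, A i ⟶ B i}
    {r : ∀ i, B i ⟶ A i} (h : ∀ i, IsEqualizer (e i) (p i) (q i)) (hp : ∀ i, p i ≫ r i = 𝟙 _)
    (hq : ∀ i, q i ≫ r i = 𝟙 _) :
    (l : List ι) → IsEqualizer (_root_.tensMap e l) (_root_.tensMap p l) (_root_.tensMap q l)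
  | [] => ⟨rfl, inferInstanceAs (Mono (𝟙 (𝟙_ C))), fun x _ => ⟨x, Category.comp_id x⟩⟩
  | i :: l => (h i).tensor (tensMap h hp hq l) (hp i) (hq i)
      (r' := _root_.tensMap r l)
      (by rw [← tensMap_comp]; simp only [hp, tensMap_id])
      (by rw [← tensMap_comp]; simp only [hq, tensMap_id])

end IsEqualizer

end Tensor

/-! ### `H_X` preserves coreflexive equalisers -/

section Presheaves

variable {C : Type w} [Category.{v} C] [MonoidalCategory C] [SymmetricCategory C]
  [HasLimitsOfSize.{0, 0} C]

lemma IsEqualizer.app {E A B : PshR C} {e : E ⟶ A} {p q : A ⟶ B} (h : IsEqualizer e p q)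
    (T : OTreeᵒᵖ) : IsEqualizer (e.app T) (p.app T) (q.app T) :=
  h.map ((evaluation OTreeᵒᵖ C).obj T)

lemma IsEqualizer.of_app {E A B : PshR C} {e : E ⟶ A} {p q : A ⟶ B}
    (h : ∀ T, IsEqualizer (e.app T) (p.app T) (q.app T)) : IsEqualizer e p q where
  condition := NatTrans.ext (funext fun T => (h T).condition)
  mono := haveI := fun T => (h T).mono; NatTrans.mono_of_mono_app e
  exists_lift {P} x hx := by
    choose y hy using fun T => (h T).exists_lift (x.app T) (congrArg (fun z => z.app T) hx)
    refine ⟨⟨y, fun T T' β => ?_⟩, NatTrans.ext (funext hy)⟩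
    have := (h T').mono
    rw [← cancel_mono (e.app T'), Category.assoc, Category.assoc, hy, e.naturality,
      reassoc_of% hy T, x.naturality]

variable [TensorExact C]

namespace Preoperad

variable (X : Preoperad C) {E A B : PshR C} {e : E ⟶ A} {p q : A ⟶ B} {r : B ⟶ A}

lemma isEqualizer_factor (h : IsEqualizer e p q) (hp : p ≫ r = 𝟙 A) (hq : q ≫ r = 𝟙 A)
    {S T : OTree} (α : S ⟶ T) : IsEqualizer (X.ob S ◁ leafTensMap e α) (X.ob S ◁ leafTensMap p α)
      (X.ob S ◁ leafTensMap q α) := by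
  refine (IsEqualizer.tensMap (r := fun l : S.Leaf => r.app (op (T.above (α.toFun l.1))))
    (fun l => h.app _) (fun l => ?_) (fun l => ?_) S.leaves).whiskerLeft _
  · exact congrArg (fun z => z.app (op (T.above (α.toFun l.1)))) hp
  · exact congrArg (fun z => z.app (op (T.above (α.toFun l.1)))) hq

/-- Each factor `X(S) ⊗ ⨂_l V(T_l)` preserves the equaliser, and `H_X(V)(T)` is a limit of such
factors. Lifts are found factor by factor; they form an invariant family because `e` induces
monomorphisms on the factors. -/
lemma isEqualizer_HTensMap (h : IsEqualizer e p q) (hp : p ≫ r = 𝟙 A) (hq : q ≫ r = 𝟙 A)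
    (T : OTree) : IsEqualizer (X.HTensMap e T) (X.HTensMap p T) (X.HTensMap q T) where
  condition := by rw [← HTensMap_comp, ← HTensMap_comp, h.condition]
  mono := ⟨fun x y hxy => X.HObj_ext E fun {S} α => by
    have := (X.isEqualizer_factor h hp hq α).mono
    rw [← cancel_mono (X.ob S ◁ leafTensMap e α), Category.assoc, Category.assoc, ← HTensMap_π,
      reassoc_of% hxy]⟩
  exists_lift {P} x hx := by
    have key : ∀ {S : OTree} (α : S ⟶ T), ∃ y, y ≫ X.ob S ◁ leafTensMap e α = x ≫ X.π A α := by
      intro S α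
      refine (X.isEqualizer_factor h hp hq α).exists_lift _ ?_
      rw [Category.assoc, Category.assoc, ← HTensMap_π, ← HTensMap_π, reassoc_of% hx]
    choose y hy using @key
    have inv : ∀ {S S' : OTree} (γ : S ⟶ S') (hγ : OTree.inner γ) (α : S' ⟶ T),
        y (γ ≫ α) = y α ≫ (X.presheaf.res γ hγ ⊗ₘ leafReindex E γ hγ α) := by
      intro S S' γ hγ α
      have := (X.isEqualizer_factor h hp hq (γ ≫ α)).mono
      rw [← cancel_mono (X.ob S ◁ leafTensMap e (γ ≫ α)), hy, X.π_inner, ← Category.assoc, ← hy α]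
      exact (tens_aux₁ _ _ _ _ _ _ (leafReindex_naturality e γ hγ α)).symm
    refine ⟨X.lift E y inv, X.HObj_ext A fun {S} α => ?_⟩
    rw [Category.assoc, HTensMap_π, ← Category.assoc, lift_π, hy]

/-- The functor `H_X` preserves coreflexive equalisers. -/
lemma preservesLimit_of_isCoreflexivePair (p q : A ⟶ B) [IsCoreflexivePair p q] :
    PreservesLimit (parallelPair p q) X.H := by
  have h : IsEqualizer (equalizer.ι p q) p q := IsEqualizer.of_isLimit (equalizerIsEqualizer p q)
  exact h.preservesLimit (IsEqualizer.of_app fun T => X.isEqualizer_HTensMap h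
    (left_comp_retraction p q) (right_comp_retraction p q) T.unop)

end Preoperad

end Presheaves

/-! ### Degreewise splittings and the tensor product -/

section Graded

open GradedObject GradedObject.Monoidal

variable {C : Type*} [Category C] [MonoidalCategory C] [Preadditive C] [MonoidalPreadditive C]
  [∀ (X₁ X₂ : GradedObject ℤ C), GradedObject.HasTensor X₁ X₂]

namespace Koszul

lemma whiskerLeft_add (Z : GradedObject ℤ C) {X Y : GradedObject ℤ C} (f g : X ⟶ Y) (n : ℤ) :
    GradedObject.Monoidal.whiskerLeft Z (fun i => f i + g i : X ⟶ Y) n =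
      GradedObject.Monoidal.whiskerLeft Z f n + GradedObject.Monoidal.whiskerLeft Z g n := by
  ext i j h
  simp [GradedObject.Monoidal.whiskerLeft]

lemma whiskerLeft_zero (Z X Y : GradedObject ℤ C) (n : ℤ) :
    GradedObject.Monoidal.whiskerLeft Z (fun _ => 0 : X ⟶ Y) n = 0 := by
  ext i j h
  simp [GradedObject.Monoidal.whiskerLeft]

lemma whiskerRight_add (Z : GradedObject ℤ C) {X Y : GradedObject ℤ C} (f g : X ⟶ Y) (n : ℤ) :
    GradedObject.Monoidal.whiskerRight (fun i => f i + g i : X ⟶ Y) Z n =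
      GradedObject.Monoidal.whiskerRight f Z n + GradedObject.Monoidal.whiskerRight g Z n := by
  ext i j h
  simp [GradedObject.Monoidal.whiskerRight]

lemma whiskerRight_zero (Z X Y : GradedObject ℤ C) (n : ℤ) :
    GradedObject.Monoidal.whiskerRight (fun _ => 0 : X ⟶ Y) Z n = 0 := by
  ext i j h
  simp [GradedObject.Monoidal.whiskerRight]

lemma whiskerLeft_comp (Z : GradedObject ℤ C) {X Y W : GradedObject ℤ C} (f : X ⟶ Y) (g : Y ⟶ W)
    (n : ℤ) : GradedObject.Monoidal.whiskerLeft Z (f ≫ g) n =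
      GradedObject.Monoidal.whiskerLeft Z f n ≫ GradedObject.Monoidal.whiskerLeft Z g n := by
  ext i j h
  simp [GradedObject.Monoidal.whiskerLeft]

lemma whiskerLeft_id (Z X : GradedObject ℤ C) (n : ℤ) :
    GradedObject.Monoidal.whiskerLeft Z (𝟙 X) n = 𝟙 _ := by
  ext i j h
  simp [GradedObject.Monoidal.whiskerLeft]

/-- The splitting maps are maps of graded objects only. Tensoring graded objects is functorial and
additive, so the identities survive. -/
lemma whiskerLeft_splitting (Z : GradedObject ℤ C) {E A B : GradedObject ℤ C} {e : E ⟶ A}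
    {d : A ⟶ B} {s : A ⟶ E} {t : B ⟶ A} (hs : ∀ n, e n ≫ s n = 𝟙 _)
    (ht : ∀ n, s n ≫ e n + d n ≫ t n = 𝟙 _) (n : ℤ) :
    GradedObject.Monoidal.whiskerLeft Z e n ≫ GradedObject.Monoidal.whiskerLeft Z s n = 𝟙 _ ∧
      GradedObject.Monoidal.whiskerLeft Z s n ≫ GradedObject.Monoidal.whiskerLeft Z e n +
        GradedObject.Monoidal.whiskerLeft Z d n ≫ GradedObject.Monoidal.whiskerLeft Z t n = 𝟙 _ := by
  have h : (fun n => (s ≫ e) n + (d ≫ t) n : A ⟶ A) = 𝟙 A := funext ht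
  constructor
  · rw [← whiskerLeft_comp, show e ≫ s = 𝟙 E from funext hs, whiskerLeft_id]
  · rw [← whiskerLeft_comp, ← whiskerLeft_comp, ← whiskerLeft_add, h, whiskerLeft_id]

end Koszul

end Graded

/-- A degreewise split equaliser of complexes is an equaliser. -/
lemma IsEqualizer.of_splitting {V ι : Type*} [Category* V] [Preadditive V] {c : ComplexShape ι}
    {E A B : HomologicalComplex V c} {e : E ⟶ A} {p q : A ⟶ B} (w : e ≫ p = e ≫ q)
    (s : ∀ n, A.X n ⟶ E.X n) (t : ∀ n, B.X n ⟶ A.X n) (hs : ∀ n, e.f n ≫ s n = 𝟙 _)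
    (ht : ∀ n, s n ≫ e.f n + (p - q).f n ≫ t n = 𝟙 _) : IsEqualizer e p q := by
  have he : ∀ n, Mono (e.f n) := fun n => mono_of_mono_fac (hs n)
  refine ⟨w, HomologicalComplex.mono_of_mono_f _ he, fun {P} x hx => ?_⟩
  have h : ∀ n, (x.f n ≫ s n) ≫ e.f n = x.f n := fun n => by
    have h1 : x.f n ≫ (p - q).f n = 0 := by
      rw [← HomologicalComplex.comp_f, Preadditive.comp_sub, hx, sub_self]
      rfl
    have h2 := congrArg (fun z => x.f n ≫ z) (ht n)
    simpa only [Preadditive.comp_add, reassoc_of% h1, zero_comp, add_zero, Category.comp_id,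
      Category.assoc] using h2
  -- The maps `s n` need not commute with the differentials, but the lifts do, since `e` is mono in
  -- each degree.
  refine ⟨⟨fun n => x.f n ≫ s n, fun i j _ => ?_⟩, HomologicalComplex.hom_ext _ _ h⟩
  rw [← cancel_mono (e.f j), Category.assoc, Category.assoc (P.d i j), h j, ← e.comm,
    ← Category.assoc, h i, x.comm]

/-! ### Splitting equalisers of vector spaces -/

section LinearAlgebra

variable {k : Type u} [Field k]

/-- Over a field, `d` has a linear section on its range, and this extends to all of `W`. -/
lemma LinearMap.exists_comp_comp_eq_self {V W : Type*} [AddCommGroup V] [Module k V]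
    [AddCommGroup W] [Module k W] (d : V →ₗ[k] W) : ∃ u : W →ₗ[k] V, d ∘ₗ u ∘ₗ d = d := by
  obtain ⟨s, hs⟩ := d.rangeRestrict.exists_rightInverse_of_surjective d.range_rangeRestrict
  obtain ⟨u, hu⟩ := LinearMap.exists_extend s
  refine ⟨u, LinearMap.ext fun x => ?_⟩
  have h1 : u (d x) = s (d.rangeRestrict x) := LinearMap.congr_fun hu (d.rangeRestrict x)
  have h2 := congrArg Subtype.val (LinearMap.congr_fun hs (d.rangeRestrict x))
  change d (u (d x)) = d x
  rw [h1]
  exact h2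

/-- Equalisers of vector spaces are split. -/
lemma IsEqualizer.exists_splitting {E A B : ModuleCat.{u} k} {e : E ⟶ A} {p q : A ⟶ B}
    (h : IsEqualizer e p q) : ∃ (s : A ⟶ E) (t : B ⟶ A), e ≫ s = 𝟙 E ∧
      s ≫ e + (p - q) ≫ t = 𝟙 A := by
  obtain ⟨u, hu⟩ := LinearMap.exists_comp_comp_eq_self (p - q).hom
  have hu' : (p - q) ≫ ModuleCat.ofHom u ≫ (p - q) = p - q := ModuleCat.hom_ext hu
  -- With `d = p - q`, the endomorphism `1 - d ≫ u` composed with `d` is zero because `d ≫ u ≫ d =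
  -- d`. So it factors through `e`, and the factor is the retraction.
  obtain ⟨s, hs⟩ := h.exists_lift (𝟙 A - (p - q) ≫ ModuleCat.ofHom u) (by
    rw [← sub_eq_zero, ← Preadditive.comp_sub, Preadditive.sub_comp, Category.id_comp,
      Category.assoc, hu', sub_self])
  have := h.mono
  refine ⟨s, ModuleCat.ofHom u, ?_, by rw [hs, sub_add_cancel]⟩
  rw [← cancel_mono e, Category.assoc, hs, Preadditive.comp_sub, Preadditive.comp_sub_assoc,
    h.condition, sub_self, zero_comp, sub_zero, Category.id_comp, Category.comp_id]

end LinearAlgebra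

/-! ### Chain complexes over a field -/

namespace Ch

variable {k : Type u} [Field k]

instance : MonoidalPreadditive (Ch k) where
  whiskerLeft_zero := by
    intro Z K L
    ext1 n
    exact Koszul.whiskerLeft_zero Z.X K.X L.X n
  zero_whiskerRight := by
    intro Z K L
    ext1 n
    exact Koszul.whiskerRight_zero Z.X K.X L.X n
  whiskerLeft_add := by
    intro Z K L f g
    ext1 n
    exact Koszul.whiskerLeft_add Z.X f.f g.f n
  add_whiskerRight := by
    intro Z K L f g
    ext1 n
    exact Koszul.whiskerRight_add Z.X f.f g.f n

/-- An equaliser of complexes is an equaliser in each degree, and there it splits. The splitting is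
kept by the tensor product with `Z`, and a degreewise split fork is an equaliser of complexes. -/
instance : TensorExact (Ch k) where
  whiskerLeft Z {E A B e p q} h := by
    have h' : ∀ n, IsEqualizer (e.f n) (p.f n) (q.f n) := fun n =>
      h.map (HomologicalComplex.eval _ _ n)
    choose s t hs ht using fun n => (h' n).exists_splitting
    have hd : Z ◁ (p - q) = Z ◁ p - Z ◁ q := ((tensoringLeft (Ch k)).obj Z).map_sub
    refine IsEqualizer.of_splitting (by
        rw [← MonoidalCategory.whiskerLeft_comp, ← MonoidalCategory.whiskerLeft_comp, h.condition])
      (fun n => GradedObject.Monoidal.whiskerLeft Z.X s n)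
      (fun n => GradedObject.Monoidal.whiskerLeft Z.X t n)
      (fun n => (Koszul.whiskerLeft_splitting Z.X hs ht n).1) (fun n => ?_)
    rw [← hd]
    exact (Koszul.whiskerLeft_splitting Z.X hs ht n).2

end Ch

/-! ### The proposition -/

theorem mainTheorem8 {k : Type u} [Field k] {X X' : Preoperad (Ch k)} (f : X ⟶ X') :
    (∀ (A B : PshR (Ch k)) (g h : A ⟶ B), IsCoreflexivePair g h →
      PreservesLimit (parallelPair g h) X.H) ∧
    ∃ δ : X.H ⟶ X.H ⋙ X.H, (X.IsComult δ ∧ ∀ δ' : X.H ⟶ X.H ⋙ X.H, X.IsComult δ' → δ' = δ) ∧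
      ∃ (fstar : Prealg X' ⥤ Prealg X) (adj : pushforward f ⊣ fstar), ∀ M' : Prealg X',
        let p : X.H.obj M'.presheaf ⟶ X.H.obj (X'.H.obj M'.presheaf) :=
          X.H.map (Preoperad.structureMap M')
        let q : X.H.obj M'.presheaf ⟶ X.H.obj (X'.H.obj M'.presheaf) :=
          δ.app M'.presheaf ≫ X.H.map ((Preoperad.Hmap f).app M'.presheaf)
        let r : X.H.obj (X'.H.obj M'.presheaf) ⟶ X.H.obj M'.presheaf :=
          X.H.map (X'.counit.app M'.presheaf)
        let i : (fstar.obj M').presheaf ⟶ X.H.obj M'.presheaf :=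
          Preoperad.structureMap (fstar.obj M') ≫ X.H.map (adj.counit.app M').toNatTrans
        p ≫ r = 𝟙 _ ∧ q ≫ r = 𝟙 _ ∧
          ∃ w : i ≫ p = i ≫ q, Nonempty (IsLimit (Fork.ofι i w)) := by
  have hH : ∀ (A B : PshR (Ch k)) (g h : A ⟶ B), IsCoreflexivePair g h →
      PreservesLimit (parallelPair g h) X.H := fun A B g h _ =>
    X.preservesLimit_of_isCoreflexivePair g h
  exact ⟨hH, X.comult, ⟨X.isComult_comult, fun δ' h => h.eq X⟩, exists_pushforward_adjunction f hH⟩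

end
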